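/- **Setting.** Let $n\ge 1$, let $\Omega\subset\mathbb R^n$ be a bounded domain (non-empty, open, connected) with Lipschitz boundary, and let $Y=\,]0,1[^n$. For $\varepsilon>0$ put $$\widetilde\Omega_{\varepsilon,3}=\{x\in\mathbb R^n: \operatorname{dist}(x,\Omega)<3\sqrt n\,\varepsilon\},\qquad \widehat\Omega_{\varepsilon,3}=\{x\in\mathbb R^n:\operatorname{dist}(x,\partial\Omega)<3\sqrt n\,\varepsilon\}.$$ For $x\in\mathbb R^n$ let $[x]\in\mathbb Z^n$ be its componentwise integer part. For a function $v$ on $\widetilde\Omega_{\varepsilon,3}$ the unfolding operator is $$\mathcal T_\varepsilon(v)(x,y)=v\bigl(\varepsilon[x/\varepsilon]+\varepsilon y\bigr),\qquad x\in\Omega,\ y\in Y.$$ For $0<s<1$, $H^s(\Omega)$ is the Hilbert space of all $u\in L^2(\Omega)$ with $$\|u\|_{s,\Omega}^2=\int_\Omega |u|^2+\int_{\Omega\times\Omega}\frac{|u(x)-u(x')|^2}{|x-x'|^{n+2s}}\,dx\,dx'<\infty ,$$ $(H^s(\Omega))'$ is its dual, and $f\in L^2(\Omega)$ is identified with the functional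 $\psi\mapsto\int_\Omega f\psi$. $H^1_{per}(Y;L^2(\Omega))$ is the space of all $v\in H^1(Y;L^2(\Omega))$ whose traces on opposite faces of $Y$ agree, with the norm of $H^1(Y;L^2(\Omega))$. **Theorem 2.6.** (a) *Extensions.* There are constants $C_0$ and $\varepsilon_0>0$, depending only on $\Omega$, such that for every $\varepsilon>0$ there is a continuous linear extension operator $\mathcal P_\varepsilon:H^1(\Omega)\to H^1(\widetilde\Omega_{\varepsilon,3})$ with $$\|\nabla\mathcal P_\varepsilon\phi\|_{L^2(\widetilde\Omega_{\varepsilon,3})}\le C_0\|\nabla\phi\|_{L^2(\Omega)}\qquad\text{for all }\phi\in H^1(\Omega),$$ and such that, if $\varepsilon\le\varepsilon_0$, for all $\phi\in H^1(\Omega)$, $$\|\nabla\mathcal P_\varepsilon\phi\|_{L^2(\widetilde\Omega_{\varepsilon,3}\setminus\Omega)}\le C_0\|\nabla\phi\|_{L^2(\Omega\cap\widehat\Omega_{\varepsilon,3})},\qquad \|\mathcal P_\varepsilon\phi\|_{L^2(\widetilde\Omega_{\varepsilon,3})}\le C_0\bigl(\|\phi\|_{L^2(\Omega)}+\varepsilon\|\nabla\phi\|_{L^2(\Omega\cap\widehat\Omega_{\varepsilon,3})}\bigr).$$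 (b) *Estimate.* For every $C_0$ there are a constant $C_1$, depending only on $\Omega$ and $C_0$, and constants $C(s)$, $0<s<1$, depending only on $\Omega$, $C_0$ and $s$, such that the following holds. Let $\varepsilon>0$ and $\phi\in H^1(\Omega)$, and let $\phi$ be extended to a function of $H^1(\widetilde\Omega_{\varepsilon,3})$, still denoted $\phi$, with $\|\nabla\phi\|_{L^2(\widetilde\Omega_{\varepsilon,3})}\le C_0\|\nabla\phi\|_{L^2(\Omega)}$. Then there is $\widehat\phi_\varepsilon\in H^1_{per}(Y;L^2(\Omega))$ with $$\|\widehat\phi_\varepsilon\|_{H^1(Y;L^2(\Omega))}\le C_1\|\nabla\phi\|_{[L^2(\Omega)]^n}$$ and such that, for every $s\in\,]0,1[$, $\mathcal T_\varepsilon(\nabla\phi)-\nabla\phi-\nabla_y\widehat\phi_\varepsilon$ belongs to $[L^2(Y;(H^s(\Omega))')]^n$ and $$\bigl\|\mathcal T_\varepsilon(\nabla\phi)-\nabla\phi-\nabla_y\widehat\phi_\varepsilon\bigr\|_{[L^2(Y;(H^s(\Omega))')]^n}\le C(s)\,\varepsilon^s\|\nabla\phi\|_{[L^2(\Omega)]^n}+C(s)\,\varepsilon^{s/2}\|\nabla\phi\|_{[L^2(\widehat\Omega_{\varepsilon,3})]^n}.$$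 -/

import Mathlib

open MeasureTheory
open scoped ContDiff ENNReal

noncomputable section

namespace Unfolding

/-- The space `ℝⁿ` with its Euclidean structure. -/
abbrev E (n : ℕ) : Type := EuclideanSpace ℝ (Fin n)

/-- The `i`-th vector of the canonical basis of `ℝⁿ`. -/
abbrev basisVec {n : ℕ} (i : Fin n) : E n := EuclideanSpace.single i 1

/-- The `i`-th partial derivative of a function on `ℝⁿ`. -/
def partialDeriv {n : ℕ} (ψ : E n → ℝ) (i : Fin n) (x : E n) : ℝ :=
  fderiv ℝ ψ x (basisVec i)

/-- `Ω` has a Lipschitz boundary: near each boundary point, in suitable orthonormal coordinates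
`(x', x_ν)` with `x_ν = ⟪x, ν⟫` and `x' = x - x_ν ν`, the set `Ω` is the part strictly above the
graph of a Lipschitz function of `x'`. -/
def HasLipschitzBoundary {n : ℕ} (Ω : Set (E n)) : Prop :=
  ∀ x₀ ∈ frontier Ω, ∃ r > (0 : ℝ), ∃ ν : E n, ‖ν‖ = 1 ∧ ∃ (K : NNReal) (γ : E n → ℝ),
    LipschitzWith K γ ∧
      ∀ x ∈ Metric.ball x₀ r, x ∈ Ω ↔ γ (x - inner ℝ x ν • ν) < inner ℝ x ν

/-- `L²(U)`, real valued. -/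
abbrev L2 {n : ℕ} (U : Set (E n)) : Type := Lp ℝ 2 (volume.restrict U)

/-- `[L²(U)]ⁿ`, the Euclidean norm being used pointwise. -/
abbrev L2Vec {n : ℕ} (U : Set (E n)) : Type := Lp (E n) 2 (volume.restrict U)

/-- The `i`-th component of a field in `[L²(U)]ⁿ`. -/
def comp {n : ℕ} {U : Set (E n)} (g : L2Vec U) (i : Fin n) : L2 U :=
  (EuclideanSpace.proj i : E n →L[ℝ] ℝ).compLp g

/-! ### The Sobolev space `H¹(U)` -/

/-- `g` is the weak (distributional) gradient of `u` in the open set `U`. -/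
def IsWeakGrad {n : ℕ} (U : Set (E n)) (u : L2 U) (g : L2Vec U) : Prop :=
  ∀ (i : Fin n) (ψ : E n → ℝ), ContDiff ℝ ∞ ψ → HasCompactSupport ψ → tsupport ψ ⊆ U →
    ∫ x in U, u x * partialDeriv ψ i x = - ∫ x in U, g x i * ψ x

theorem memLp_coord {n : ℕ} {U : Set (E n)} (g : L2Vec U) (i : Fin n) :
    MemLp (fun x => g x i) 2 (volume.restrict U) :=
  (Lp.memLp g).continuousLinearMap_comp (EuclideanSpace.proj i : E n →L[ℝ] ℝ)

theorem continuous_partialDeriv {n : ℕ} {ψ : E n → ℝ} (h : ContDiff ℝ ∞ ψ) (i : Fin n) :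
    Continuous (partialDeriv ψ i) :=
  (h.continuous_fderiv (by simp)).clm_apply continuous_const

theorem memLp_test {n : ℕ} {U : Set (E n)} {ψ : E n → ℝ} (h : ContDiff ℝ ∞ ψ)
    (hc : HasCompactSupport ψ) : MemLp ψ 2 (volume.restrict U) :=
  h.continuous.memLp_of_hasCompactSupport hc

theorem memLp_partialDeriv {n : ℕ} {U : Set (E n)} {ψ : E n → ℝ} (h : ContDiff ℝ ∞ ψ)
    (hc : HasCompactSupport ψ) (i : Fin n) :
    MemLp (partialDeriv ψ i) 2 (volume.restrict U) :=
  (continuous_partialDeriv h i).memLp_of_hasCompactSupport (hc.fderiv_apply ℝ _)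

/-- The space `H¹(U)`: pairs `(u, ∇u)` where `u ∈ L²(U)` has the weak gradient `∇u ∈ [L²(U)]ⁿ`,
with the norm `(‖u‖² + ‖∇u‖²)^(1/2)`. -/
def H1 {n : ℕ} (U : Set (E n)) : Submodule ℝ (WithLp 2 (L2 U × L2Vec U)) where
  carrier := {p | IsWeakGrad U p.fst p.snd}
  zero_mem' := by
    intro i ψ _ _ _
    have h1 : ∫ x in U, (0 : L2 U) x * partialDeriv ψ i x = 0 := by
      rw [integral_congr_ae (g := fun _ => (0 : ℝ)), integral_zero]
      filter_upwards [Lp.coeFn_zero ℝ 2 (volume.restrict U)] with x hx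
      simp only [hx, Pi.zero_apply, zero_mul]
    have h2 : ∫ x in U, (0 : L2Vec U) x i * ψ x = 0 := by
      rw [integral_congr_ae (g := fun _ => (0 : ℝ)), integral_zero]
      filter_upwards [Lp.coeFn_zero (E n) 2 (volume.restrict U)] with x hx
      simp only [hx, Pi.zero_apply, PiLp.zero_apply, zero_mul]
    simp only [WithLp.zero_fst, WithLp.zero_snd, h1, h2, neg_zero]
  add_mem' := by
    intro p q hp hq i ψ h hc hs
    have e1 : ∫ x in U, (p + q).fst x * partialDeriv ψ i x
        = (∫ x in U, p.fst x * partialDeriv ψ i x)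
          + ∫ x in U, q.fst x * partialDeriv ψ i x := by
      refine (integral_congr_ae ?_).trans (integral_add
        ((Lp.memLp p.fst).integrable_mul (memLp_partialDeriv h hc i))
        ((Lp.memLp q.fst).integrable_mul (memLp_partialDeriv h hc i)))
      filter_upwards [Lp.coeFn_add p.fst q.fst] with x hx
      simp only [WithLp.add_fst, hx, Pi.add_apply, add_mul]
    have e2 : ∫ x in U, (p + q).snd x i * ψ x
        = (∫ x in U, p.snd x i * ψ x) + ∫ x in U, q.snd x i * ψ x := by
      refine (integral_congr_ae ?_).trans (integral_add
        ((memLp_coord p.snd i).integrable_mul (memLp_test h hc))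
        ((memLp_coord q.snd i).integrable_mul (memLp_test h hc)))
      filter_upwards [Lp.coeFn_add p.snd q.snd] with x hx
      simp only [WithLp.add_snd, hx, Pi.add_apply, PiLp.add_apply, add_mul]
    rw [e1, e2, hp i ψ h hc hs, hq i ψ h hc hs]
    ring
  smul_mem' := by
    intro c p hp i ψ h hc hs
    have e1 : ∫ x in U, (c • p).fst x * partialDeriv ψ i x
        = c * ∫ x in U, p.fst x * partialDeriv ψ i x := by
      rw [← integral_const_mul]
      refine integral_congr_ae ?_
      filter_upwards [Lp.coeFn_smul c p.fst] with x hx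
      simp only [WithLp.smul_fst, hx, Pi.smul_apply, smul_eq_mul,
        mul_assoc]
    have e2 : ∫ x in U, (c • p).snd x i * ψ x = c * ∫ x in U, p.snd x i * ψ x := by
      rw [← integral_const_mul]
      refine integral_congr_ae ?_
      filter_upwards [Lp.coeFn_smul c p.snd] with x hx
      simp only [WithLp.smul_snd, hx, Pi.smul_apply, PiLp.smul_apply, smul_eq_mul,
        mul_assoc]
    rw [e1, e2, hp i ψ h hc hs]
    ring

/-- The `L²` function underlying an element of `H¹(U)`. -/
def h1Val {n : ℕ} {U : Set (E n)} (φ : H1 U) : L2 U := (φ : WithLp 2 (L2 U × L2Vec U)).fst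

/-- The weak gradient of an element of `H¹(U)`. -/
def h1Grad {n : ℕ} {U : Set (E n)} (φ : H1 U) : L2Vec U :=
  (φ : WithLp 2 (L2 U × L2Vec U)).snd

/-- The norm in `[L²(S)]ⁿ` of (the restriction to `S` of) a field `g`. -/
def l2NormOn {n : ℕ} (S : Set (E n)) (g : E n → E n) : ℝ :=
  (eLpNorm g 2 (volume.restrict S)).toReal

/-! ### The fractional Sobolev space `H^s(U)` and its dual -/

/-- The difference quotient `(u(x) - u(x')) / |x - x'|^(n/2 + s)`, whose square is the integrand of
the Gagliardo seminorm. -/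
def slopeQuot {n : ℕ} (s : ℝ) (u : E n → ℝ) (z : E n × E n) : ℝ :=
  (u z.1 - u z.2) / ‖z.1 - z.2‖ ^ ((n : ℝ) / 2 + s)

/-- The space `H^s(U)`: the functions `u ∈ L²(U)` whose difference quotient is in `L²(U × U)`.
An element is stored with its difference quotient, so that the inner product is
`∫ u v + ∬ (u(x) - u(x'))(v(x) - v(x')) / |x - x'|^(n + 2s)`. -/
def Hs {n : ℕ} (s : ℝ) (U : Set (E n)) :
    Submodule ℝ
      (WithLp 2 (L2 U × Lp ℝ 2 ((volume.restrict U).prod (volume.restrict U)))) where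
  carrier := {p | ⇑p.snd =ᵐ[(volume.restrict U).prod (volume.restrict U)] slopeQuot s p.fst}
  zero_mem' := by
    have h1 := Measure.quasiMeasurePreserving_fst (μ := volume.restrict U)
      (ν := volume.restrict U) |>.ae (Lp.coeFn_zero ℝ 2 (volume.restrict U))
    have h2 := Measure.quasiMeasurePreserving_snd (μ := volume.restrict U)
      (ν := volume.restrict U) |>.ae (Lp.coeFn_zero ℝ 2 (volume.restrict U))
    filter_upwards [h1, h2,
      Lp.coeFn_zero ℝ 2 ((volume.restrict U).prod (volume.restrict U))] with z a b c
    simp only [WithLp.zero_fst, WithLp.zero_snd, slopeQuot, a, b, c, Pi.zero_apply, sub_zero,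
      zero_div]
  add_mem' := by
    intro p q hp hq
    change ⇑(p + q).snd =ᵐ[_] slopeQuot s (p + q).fst
    have h1 := Measure.quasiMeasurePreserving_fst (μ := volume.restrict U)
      (ν := volume.restrict U) |>.ae (Lp.coeFn_add p.fst q.fst)
    have h2 := Measure.quasiMeasurePreserving_snd (μ := volume.restrict U)
      (ν := volume.restrict U) |>.ae (Lp.coeFn_add p.fst q.fst)
    filter_upwards [h1, h2, Lp.coeFn_add p.snd q.snd, hp, hq] with z a b c d e
    simp only [WithLp.add_fst, WithLp.add_snd, slopeQuot, a, b, c, d, e, Pi.add_apply]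
    ring
  smul_mem' := by
    intro r p hp
    change ⇑(r • p).snd =ᵐ[_] slopeQuot s (r • p).fst
    have h1 := Measure.quasiMeasurePreserving_fst (μ := volume.restrict U)
      (ν := volume.restrict U) |>.ae (Lp.coeFn_smul r p.fst)
    have h2 := Measure.quasiMeasurePreserving_snd (μ := volume.restrict U)
      (ν := volume.restrict U) |>.ae (Lp.coeFn_smul r p.fst)
    filter_upwards [h1, h2, Lp.coeFn_smul r p.snd, hp] with z a b c d
    simp only [WithLp.smul_fst, WithLp.smul_snd, slopeQuot, a, b, c, d, Pi.smul_apply,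
      smul_eq_mul]
    ring

/-- The dual space `(H^s(U))'`, with the dual norm. -/
abbrev HsDual {n : ℕ} (s : ℝ) (U : Set (E n)) : Type := StrongDual ℝ (Hs s U)

/-- The canonical embedding of `L²(U)` into `(H^s(U))'`: `f` acts by `ψ ↦ ∫_U f ψ`. -/
def toHsDual {n : ℕ} (s : ℝ) {U : Set (E n)} (f : L2 U) : HsDual s U :=
  (innerSL ℝ f).comp
    ((WithLp.fstL 2 ℝ (L2 U) (Lp ℝ 2 ((volume.restrict U).prod (volume.restrict U)))).comp
      (Hs s U).subtypeL)

/-! ### The space `H¹_per(Y; L²(Ω))` -/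

/-- The reference cell `Y = ]0,1[ⁿ`. -/
def cell (n : ℕ) : Set (E n) := {y | ∀ i, y i ∈ Set.Ioo (0 : ℝ) 1}

/-- `L²(Y; L²(Ω))`. -/
abbrev L2Y {n : ℕ} (Ω : Set (E n)) : Type := Lp (L2 Ω) 2 (volume.restrict (cell n))

/-- `[L²(Y; L²(Ω))]ⁿ`. -/
abbrev L2YVec {n : ℕ} (Ω : Set (E n)) : Type :=
  Lp (PiLp 2 fun _ : Fin n => L2 Ω) 2 (volume.restrict (cell n))

/-- A function on `ℝⁿ` with period `1` in each variable. -/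
def IsPeriodic {n : ℕ} (ψ : E n → ℝ) : Prop := ∀ (i : Fin n) (y : E n), ψ (y + basisVec i) = ψ y

/-- `G` is the weak gradient on the torus of `v`. Since the test functions are the smooth
`Y`-periodic functions, this says both that `G` is the distributional gradient of `v` in `Y` (the
test functions supported in `Y`) and that the traces of `v` on opposite faces of `Y` agree. -/
def IsPerWeakGrad {n : ℕ} (Ω : Set (E n)) (v : L2Y Ω) (G : L2YVec Ω) : Prop :=
  ∀ (i : Fin n) (ψ : E n → ℝ), ContDiff ℝ ∞ ψ → IsPeriodic ψ →
    ∫ y in cell n, partialDeriv ψ i y • v y = - ∫ y in cell n, ψ y • G y i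

theorem cell_subset (n : ℕ) : cell n ⊆ Metric.closedBall (0 : E n) (Real.sqrt n) := by
  intro y hy
  rw [mem_closedBall_zero_iff, EuclideanSpace.norm_eq]
  apply Real.sqrt_le_sqrt
  calc ∑ i, ‖y i‖ ^ 2 ≤ ∑ _i : Fin n, (1 : ℝ) := by
        refine Finset.sum_le_sum fun i _ => ?_
        have h := hy i
        rw [Real.norm_eq_abs, sq_abs]
        nlinarith [h.1, h.2]
    _ = n := by simp

instance instFiniteCell (n : ℕ) : IsFiniteMeasure (volume.restrict (cell n)) :=
  ⟨by
    rw [Measure.restrict_apply_univ]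
    exact (measure_mono (cell_subset n)).trans_lt
      (isCompact_closedBall (0 : E n) (Real.sqrt n)).measure_lt_top⟩

theorem integrable_smul_cell {n : ℕ} {F : Type*} [NormedAddCommGroup F] [NormedSpace ℝ F]
    {ψ : E n → ℝ} (hψ : Continuous ψ) {v : E n → F}
    (hv : MemLp v 2 (volume.restrict (cell n))) :
    Integrable (fun y => ψ y • v y) (volume.restrict (cell n)) := by
  obtain ⟨C, hC⟩ := (isCompact_closedBall (0 : E n) (Real.sqrt n)).exists_bound_of_continuousOn
    hψ.continuousOn
  refine (hv.integrable (by norm_num)).bdd_smul C hψ.aestronglyMeasurable ?_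
  have hm : MeasurableSet (cell n) := by
    have : cell n = ⋂ i, {y : E n | y i ∈ Set.Ioo (0 : ℝ) 1} := by
      ext y; simp [cell]
    rw [this]
    exact MeasurableSet.iInter fun i =>
      ((EuclideanSpace.proj i : E n →L[ℝ] ℝ).continuous.measurable measurableSet_Ioo)
  filter_upwards [ae_restrict_mem hm] with y hy
  exact hC y (cell_subset n hy)

theorem memLp_coordY {n : ℕ} {Ω : Set (E n)} (G : L2YVec Ω) (i : Fin n) :
    MemLp (fun y => G y i) 2 (volume.restrict (cell n)) :=
  (Lp.memLp G).continuousLinearMap_comp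
    (PiLp.proj 2 (fun _ : Fin n => L2 Ω) i : (PiLp 2 fun _ : Fin n => L2 Ω) →L[ℝ] L2 Ω)

/-- The space `H¹_per(Y; L²(Ω))`: pairs `(v, ∇_y v)`, with the norm
`(‖v‖² + ‖∇_y v‖²)^(1/2)` of `H¹(Y; L²(Ω))`. -/
def H1per {n : ℕ} (Ω : Set (E n)) : Submodule ℝ (WithLp 2 (L2Y Ω × L2YVec Ω)) where
  carrier := {p | IsPerWeakGrad Ω p.fst p.snd}
  zero_mem' := by
    intro i ψ _ _
    have h1 : ∫ y in cell n, partialDeriv ψ i y • (0 : L2Y Ω) y = 0 := by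
      rw [integral_congr_ae (g := fun _ => (0 : L2 Ω)), integral_zero]
      filter_upwards [Lp.coeFn_zero (L2 Ω) 2 (volume.restrict (cell n))] with y hy
      simp only [hy, Pi.zero_apply, smul_zero]
    have h2 : ∫ y in cell n, ψ y • (0 : L2YVec Ω) y i = 0 := by
      rw [integral_congr_ae (g := fun _ => (0 : L2 Ω)), integral_zero]
      filter_upwards [Lp.coeFn_zero (PiLp 2 fun _ : Fin n => L2 Ω) 2
        (volume.restrict (cell n))] with y hy
      simp only [hy, Pi.zero_apply, PiLp.zero_apply, smul_zero]
    simp only [WithLp.zero_fst, WithLp.zero_snd, h1, h2, neg_zero]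
  add_mem' := by
    intro p q hp hq i ψ h hs
    have e1 : ∫ y in cell n, partialDeriv ψ i y • (p + q).fst y
        = (∫ y in cell n, partialDeriv ψ i y • p.fst y)
          + ∫ y in cell n, partialDeriv ψ i y • q.fst y := by
      rw [← integral_add
        (integrable_smul_cell (continuous_partialDeriv h i) (Lp.memLp p.fst))
        (integrable_smul_cell (continuous_partialDeriv h i) (Lp.memLp q.fst))]
      refine integral_congr_ae ?_
      filter_upwards [Lp.coeFn_add p.fst q.fst] with y hy
      simp only [WithLp.add_fst, hy, Pi.add_apply, smul_add]
    have e2 : ∫ y in cell n, ψ y • (p + q).snd y i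
        = (∫ y in cell n, ψ y • p.snd y i) + ∫ y in cell n, ψ y • q.snd y i := by
      rw [← integral_add
        (integrable_smul_cell h.continuous (memLp_coordY p.snd i))
        (integrable_smul_cell h.continuous (memLp_coordY q.snd i))]
      refine integral_congr_ae ?_
      filter_upwards [Lp.coeFn_add p.snd q.snd] with y hy
      simp only [WithLp.add_snd, hy, Pi.add_apply, PiLp.add_apply, smul_add]
    rw [e1, e2, hp i ψ h hs, hq i ψ h hs]
    abel
  smul_mem' := by
    intro c p hp i ψ h hs
    have e1 : ∫ y in cell n, partialDeriv ψ i y • (c • p).fst y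
        = c • ∫ y in cell n, partialDeriv ψ i y • p.fst y := by
      rw [← integral_smul]
      refine integral_congr_ae ?_
      filter_upwards [Lp.coeFn_smul c p.fst] with y hy
      simp [hy, smul_comm c]
    have e2 : ∫ y in cell n, ψ y • (c • p).snd y i = c • ∫ y in cell n, ψ y • p.snd y i := by
      rw [← integral_smul]
      refine integral_congr_ae ?_
      filter_upwards [Lp.coeFn_smul c p.snd] with y hy
      simp [hy, smul_comm c]
    rw [e1, e2, hp i ψ h hs, smul_neg]

/-- The gradient `∇_y v` of an element `v` of `H¹_per(Y; L²(Ω))`. -/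
def perGrad {n : ℕ} {Ω : Set (E n)} (v : H1per Ω) : L2YVec Ω :=
  (v : WithLp 2 (L2Y Ω × L2YVec Ω)).snd

/-! ### Neighbourhoods, extensions, and the unfolding operator -/

/-- The neighbourhood `{x | dist(x, Ω) < k √n ε}` of `Ω`. -/
def outerNbhd {n : ℕ} (Ω : Set (E n)) (ε : ℝ) (k : ℕ) : Set (E n) :=
  {x | Metric.infDist x Ω < k * Real.sqrt n * ε}

/-- The neighbourhood `{x | dist(x, ∂Ω) < k √n ε}` of the boundary of `Ω`. -/
def boundaryLayer {n : ℕ} (Ω : Set (E n)) (ε : ℝ) (k : ℕ) : Set (E n) :=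
  {x | Metric.infDist x (frontier Ω) < k * Real.sqrt n * ε}

/-- `φ'` is an extension of `φ` to `V ⊇ Ω`. -/
def IsExtension {n : ℕ} {Ω V : Set (E n)} (φ : H1 Ω) (φ' : H1 V) : Prop :=
  ⇑(h1Val φ') =ᵐ[volume.restrict Ω] h1Val φ

/-- The integer part `[x] ∈ ℤⁿ`, for which `x - [x]` is in `Y` for almost every `x`. -/
def intPart {n : ℕ} (x : E n) : E n := WithLp.toLp 2 fun i => (⌊x i⌋ : ℝ)

/-- The unfolding operator `T_ε(v)(x, y) = v(ε [x/ε] + ε y)`. -/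
def unfold {n : ℕ} (ε : ℝ) (v : E n → ℝ) (x y : E n) : ℝ :=
  v (ε • intPart (ε⁻¹ • x) + ε • y)

/-- `T_ε(v)(·, y)` is a step function, hence is in `L²(Ω)` when `Ω` is bounded. -/
theorem memLp_unfold {n : ℕ} {Ω : Set (E n)} (hΩ : Bornology.IsBounded Ω) (ε : ℝ)
    (v : E n → ℝ) (y : E n) :
    MemLp (fun x => unfold ε v x y) 2 (volume.restrict Ω) := by
  obtain ⟨R, hR⟩ := hΩ.subset_closedBall (0 : E n)
  have hfin : IsFiniteMeasure (volume.restrict (Metric.closedBall (0 : E n) R)) :=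
    ⟨by
      rw [Measure.restrict_apply_univ]
      exact (isCompact_closedBall (0 : E n) R).measure_lt_top⟩
  refine MemLp.mono_measure (Measure.restrict_mono hR le_rfl) ?_
  let fl : E n → (Fin n → ℤ) := fun x i => ⌊(ε⁻¹ • x) i⌋
  have hfl : Measurable fl := by
    refine measurable_pi_lambda _ fun i => Int.measurable_floor.comp ?_
    exact (((EuclideanSpace.proj i : E n →L[ℝ] ℝ).continuous).comp
      (continuous_const_smul ε⁻¹)).measurable
  let w : (Fin n → ℤ) → ℝ := fun k => v (ε • WithLp.toLp 2 (fun i => (k i : ℝ)) + ε • y)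
  have hw : Measurable w := measurable_of_countable w
  have heq : (fun x => unfold ε v x y) = w ∘ fl := rfl
  rw [heq]
  set M : ℤ := ⌈|ε⁻¹| * R⌉ + 1
  obtain ⟨C, hC⟩ := (Set.Finite.image (fun k => ‖w k‖)
    (Set.finite_Icc (fun _ : Fin n => -M) (fun _ => M))).bddAbove
  refine MemLp.of_bound (hw.comp hfl).aestronglyMeasurable C ?_
  filter_upwards [ae_restrict_mem Metric.isClosed_closedBall.measurableSet] with x hx
  refine hC ⟨fl x, ?_, rfl⟩
  have hb : ∀ i, |(ε⁻¹ • x) i| ≤ |ε⁻¹| * R := by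
    intro i
    have h1 : ‖x i‖ ≤ ‖x‖ := PiLp.norm_apply_le x i
    rw [mem_closedBall_zero_iff] at hx
    rw [PiLp.smul_apply, smul_eq_mul, abs_mul]
    exact mul_le_mul_of_nonneg_left ((Real.norm_eq_abs (x i) ▸ h1).trans hx) (abs_nonneg _)
  have hM : |ε⁻¹| * R ≤ (M : ℝ) - 1 := by
    have := Int.le_ceil (|ε⁻¹| * R)
    simp only [M, Int.cast_add, Int.cast_one]
    linarith
  refine ⟨fun i => ?_, fun i => ?_⟩
  · refine Int.le_floor.2 ?_
    have := (abs_le.1 (hb i)).1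
    push_cast
    linarith
  · have h2 : (⌊(ε⁻¹ • x) i⌋ : ℝ) ≤ (M : ℝ) := by
      have := (abs_le.1 (hb i)).2
      have := Int.floor_le ((ε⁻¹ • x) i)
      linarith
    exact_mod_cast h2

/-- `T_ε(v)(·, y)` as an element of `L²(Ω)`. -/
def unfoldL2 {n : ℕ} {Ω : Set (E n)} (hΩ : Bornology.IsBounded Ω) (ε : ℝ) (v : E n → ℝ)
    (y : E n) : L2 Ω :=
  (memLp_unfold hΩ ε v y).toLp

/-- The map `y ↦ T_ε(∇φ')(·, y) - ∇φ - ∇_y v(y)`, with values in `[(H^s(Ω))']ⁿ`, where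
`φ ∈ H¹(Ω)`, where `φ'` is its extension to a neighbourhood `V` of `Ω`, and where
`v ∈ H¹_per(Y; L²(Ω))`. -/
def residual {n : ℕ} {Ω V : Set (E n)} (hΩ : Bornology.IsBounded Ω) (s ε : ℝ) (φ : H1 Ω)
    (φ' : H1 V) (v : H1per Ω) (y : E n) : PiLp 2 fun _ : Fin n => HsDual s Ω :=
  WithLp.toLp 2 fun i =>
    toHsDual s (unfoldL2 hΩ ε (fun x => h1Grad φ' x i) y - comp (h1Grad φ) i - perGrad v y i)

end Unfolding

end

/-! Extensions. The Lipschitz condition yields a smooth field η of uniform inner cones: x + t(η(z) +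
w) lies in Ω for x in the closure of Ω, z within ρ of x, 0 < t < ρ and |w| < ρ
(`exists_isConeField`). Following η from an exterior point until it reaches the boundary, and then
slightly further, defines a reflection Φ which is Lipschitz, fixes the closure of Ω, and shrinks
distances between exterior points by at most a fixed factor (`IsConeField.exists_isReflection`).
Hence u ∘ Φ extends u across the boundary with control of values and gradient. The overshoot is
tuned so that the outer layer of width δ is sent into the inner layer of width δ, which localises
the bounds. The global extension is m + χ (u ∘ Φ - m), with m the mean of u and χ a cutoff; the
Poincaré inequality absorbs the term in ∇χ, so the gradient bound involves ∇u only. For small ε one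
has χ = 1 on the whole neighbourhood, and the extension is simply u ∘ Φ.

Estimate. Write g = ∇φ on the neighbourhood, B_k(y) = g(ε(k + y)), a field on Y, and 1_k for the
indicator of the cell of index k. Then T_ε(g)(·, y) is the sum over k of B_k(y) 1_k. In [L²(Y)]ⁿ
each B_k splits into its projection onto the closed space of periodic gradients, its mean value, and
a remainder, its defect. The projections have potentials w_k; the sum of the w_k ⊗ 1_k is the
corrector, the same for every s (`exists_corrector`). The residual is the sum of the defects times
1_k, plus the difference between the cellwise averages of g and g itself (`residual_ae_eq`).

Both terms are paired with ψ in H^s(Ω). The averages produce integrals of g (ψ - mean of ψ) over the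
cells. For the defects, the crucial fact is that on the 3ⁿ cells of a cube a gradient satisfies
|defect(B_0)|² ≤ C Σ_q |B_q - B_0|² (`exists_norm_defect_le`): a gradient that does not change from
cell to cell is a constant plus a periodic gradient, which has no defect. The defect being linear,
this bound also holds for linear combinations of translated families. The dual of H^s is a Hilbert
space, so its norm on the span of the 1_k is a finite sum of squares of linear forms, and the bound
passes to dual-valued sums (`lintegral_defect_le_of_shift`). What remains is Σ_k (B_{k+q} - B_k)
1_k, and summation by parts transfers the difference to the integrals of ψ over neighbouring cells.

Both terms are thus controlled by the oscillation of ψ, extended by zero, between nearby cells. If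
the cube of side 3ε lies in Ω, the Gagliardo seminorm gives ε^s. Otherwise the cube lies in the
boundary layer, where the L² norm of ψ is O(ε^{s/2}) (`IsConeField.exists_layer_estimate`) and only
the norm of g on the layer enters. That layer estimate comes from packing many disjoint inward
translates of the layer into a thicker one, and iterating over scales. -/

namespace Unfolding

/-! ### Inner cones of Lipschitz domains -/

section Geometry

open Metric Filter Topology

variable {n : ℕ} {Ω : Set (E n)}

/-- A point is at most as far from the frontier as from any point on the other side. -/
theorem infDist_frontier_le_dist {x y : E n} (h : x ∈ Ω ↔ y ∉ Ω) :
    infDist x (frontier Ω) ≤ dist x y := by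
  have key : ∀ {a b : E n}, a ∈ Ω → b ∉ Ω → ∃ p ∈ frontier Ω, p ∈ segment ℝ a b := by
    intro a b ha hb
    let f : unitInterval → E n := fun t => AffineMap.lineMap a b (t : ℝ)
    have hf : Continuous f := AffineMap.lineMap_continuous.comp continuous_subtype_val
    have h1 : (f ⁻¹' Ω).Nonempty := ⟨0, by simpa [f] using ha⟩
    have h2 : f ⁻¹' Ω ≠ Set.univ := by
      intro h
      have : (1 : unitInterval) ∈ f ⁻¹' Ω := h ▸ Set.mem_univ _
      exact hb (by simpa [f] using this)
    obtain ⟨t, ht⟩ := nonempty_frontier_iff.2 ⟨h1, h2⟩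
    refine ⟨f t, hf.frontier_preimage_subset _ ht, ?_⟩
    rw [segment_eq_image_lineMap]
    exact ⟨t, t.2, rfl⟩
  have hseg : ∃ p ∈ frontier Ω, p ∈ segment ℝ x y := by
    by_cases hx : x ∈ Ω
    · exact key hx (h.1 hx)
    · have hy : y ∈ Ω := by by_contra hy; exact hx (h.2 hy)
      obtain ⟨p, hp, hs⟩ := key hy hx
      exact ⟨p, hp, segment_symm ℝ y x ▸ hs⟩
  obtain ⟨p, hp, hs⟩ := hseg
  refine (infDist_le_dist_of_mem hp).trans ?_
  have := dist_add_dist_of_mem_segment hs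
  linarith [dist_nonneg (x := p) (y := y)]

/-- `v` points into `Ω` near `x₀`, uniformly for small perturbations. -/
def ConeDirection (Ω : Set (E n)) (x₀ v : E n) : Prop :=
  ∃ r > (0 : ℝ), ∀ x ∈ Ω, dist x x₀ < r → ∀ t : ℝ, 0 < t → t < r → ∀ w : E n, ‖w‖ < r →
    x + t • (v + w) ∈ Ω

/-- Move first by ta along v₁ + w, then by tb along v₂ + w; since a + b = 1, the total displacement
is t(a v₁ + b v₂ + w). The radius is small enough for the intermediate point to stay within r₂ of
x₀. Convexity is what allows local directions to be glued by a partition of unity. -/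
theorem convex_coneDirection (Ω : Set (E n)) (x₀ : E n) :
    Convex ℝ {v | ConeDirection Ω x₀ v} := by
  rintro v₁ ⟨r₁, hr₁, h₁⟩ v₂ ⟨r₂, hr₂, h₂⟩ a b ha hb hab
  rcases ha.eq_or_lt with rfl | ha
  · obtain rfl : b = 1 := by linarith
    simpa using ⟨r₂, hr₂, h₂⟩
  rcases hb.eq_or_lt with rfl | hb
  · obtain rfl : a = 1 := by linarith
    simpa using ⟨r₁, hr₁, h₁⟩
  have hden : 0 < ‖v₁‖ + 2 := by positivity
  refine ⟨min (min r₁ r₂) (min 1 (r₂ / (‖v₁‖ + 2))), by positivity, ?_⟩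
  intro x hx hd t ht htr w hw
  simp only [lt_min_iff] at hd htr hw
  obtain ⟨⟨hd1, hd2⟩, hd3, hd4⟩ := hd
  obtain ⟨⟨ht1, ht2⟩, ht3, ht4⟩ := htr
  obtain ⟨⟨hw1, hw2⟩, hw3, hw4⟩ := hw
  have e : x + t • (a • v₁ + b • v₂ + w) = (x + (t * a) • (v₁ + w)) + (t * b) • (v₂ + w) := by
    have hb' : b = 1 - a := by linarith
    subst hb'
    module
  rw [e]
  have hta : t * a ≤ t := mul_le_of_le_one_right ht.le (by linarith)
  have htb : t * b ≤ t := mul_le_of_le_one_right ht.le (by linarith)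
  refine h₂ _ (h₁ x hx hd1 _ (by positivity) (by linarith) w hw1) ?_ _ (by positivity)
    (by linarith) w hw2
  have h3 : dist (x + (t * a) • (v₁ + w)) x ≤ t * (‖v₁‖ + 1) := by
    rw [dist_eq_norm, add_sub_cancel_left, norm_smul, Real.norm_eq_abs,
      abs_of_pos (by positivity)]
    have : ‖v₁ + w‖ ≤ ‖v₁‖ + 1 := (norm_add_le _ _).trans (by linarith)
    gcongr
  have h4 := dist_triangle (x + (t * a) • (v₁ + w)) x x₀
  rw [lt_div_iff₀ hden] at hd4 ht4
  rw [lt_div_iff₀ hden] at *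
  have h5 : dist x x₀ < r₂ / (‖v₁‖ + 2) := by rw [lt_div_iff₀ hden]; exact hd4
  have h6 : t < r₂ / (‖v₁‖ + 2) := by rw [lt_div_iff₀ hden]; exact ht4
  have h7 : r₂ / (‖v₁‖ + 2) * (‖v₁‖ + 2) = r₂ := by field_simp
  nlinarith [norm_nonneg v₁]

theorem ConeDirection.eventually {x₀ v : E n} (h : ConeDirection Ω x₀ v) :
    ∀ᶠ y in 𝓝 x₀, ConeDirection Ω y v := by
  obtain ⟨r, hr, h⟩ := h
  filter_upwards [ball_mem_nhds x₀ (half_pos hr)] with y hy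
  refine ⟨r / 2, half_pos hr, fun x hx hd t ht htr w hw => h x hx ?_ t ht (by linarith) w
    (by linarith)⟩
  have := dist_triangle x y x₀
  rw [mem_ball] at hy
  linarith

/-- At a boundary point ν works: a step t(ν + w) raises the height by at least t(1 - |w|), and the
graph by at most 2Kt|w|, so |w|(2K + 1) < 1 suffices. At an interior point the zero vector works,
and at an exterior point the condition is void. -/
theorem exists_coneDirection (hΩo : IsOpen Ω) (hΩl : HasLipschitzBoundary Ω) (x₀ : E n) :
    ∃ v, ConeDirection Ω x₀ v := by
  by_cases hf : x₀ ∈ frontier Ω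
  · obtain ⟨R, hR, ν, hν, K, γ, hγ, hb⟩ := hΩl x₀ hf
    set δ : ℝ := 1 / (2 * K + 1) with hδ
    have hδ0 : 0 < δ := by positivity
    have hδ1 : δ ≤ 1 := by
      rw [hδ, div_le_one (by positivity)]
      have := K.2
      simp
    refine ⟨ν, min δ (min 1 (R / 4)), by positivity, ?_⟩
    intro x hx hd t ht htr w hw
    simp only [lt_min_iff] at hd htr hw
    have hxb : x ∈ ball x₀ R := by rw [mem_ball]; linarith
    have hyb : x + t • (ν + w) ∈ ball x₀ R := by
      rw [mem_ball]
      have h1 : dist (x + t • (ν + w)) x ≤ t * 2 := by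
        rw [dist_eq_norm, add_sub_cancel_left, norm_smul, Real.norm_eq_abs, abs_of_pos ht]
        have : ‖ν + w‖ ≤ 2 := (norm_add_le _ _).trans (by linarith)
        gcongr
      have := dist_triangle (x + t • (ν + w)) x x₀
      linarith
    rw [hb _ hyb]
    have hx' := (hb x hxb).1 hx
    have hνν : inner ℝ ν ν = (1 : ℝ) := by rw [real_inner_self_eq_norm_sq, hν]; norm_num
    have e1 : inner ℝ (x + t • (ν + w)) ν = inner ℝ x ν + t * (1 + inner ℝ w ν) := by
      rw [inner_add_left, real_inner_smul_left, inner_add_left, hνν]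
    have hwν : |inner ℝ w ν| ≤ ‖w‖ := by
      simpa [hν] using abs_real_inner_le_norm w ν
    have e2 : x + t • (ν + w) - inner ℝ (x + t • (ν + w)) ν • ν
        = (x - inner ℝ x ν • ν) + t • (w - inner ℝ w ν • ν) := by
      rw [e1]; module
    have h2 : ‖t • (w - inner ℝ w ν • ν)‖ ≤ t * (2 * ‖w‖) := by
      rw [norm_smul, Real.norm_eq_abs, abs_of_pos ht]
      gcongr
      refine (norm_sub_le _ _).trans ?_
      rw [norm_smul, hν, Real.norm_eq_abs]
      linarith
    have h3 := hγ.dist_le_mul (x + t • (ν + w) - inner ℝ (x + t • (ν + w)) ν • ν)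
      (x - inner ℝ x ν • ν)
    rw [Real.dist_eq, dist_eq_norm, e2, add_sub_cancel_left] at h3
    rw [e2, e1]
    have h4 := (abs_le.1 h3).2
    have h5 : (K : ℝ) * ‖t • (w - inner ℝ w ν • ν)‖ ≤ K * (t * (2 * ‖w‖)) := by gcongr
    have h6 := (abs_le.1 hwν).1
    have h7 : ‖w‖ * (2 * K + 1) < 1 := by
      have := hw.1
      rwa [hδ, lt_div_iff₀ (by positivity)] at this
    have h8 : t * (‖w‖ * (2 * K + 1)) < t * 1 := by gcongr
    have h9 : t * (- ‖w‖) ≤ t * inner ℝ w ν := by gcongr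
    nlinarith
  by_cases hx : x₀ ∈ Ω
  · obtain ⟨R, hR, hb⟩ := Metric.isOpen_iff.1 hΩo x₀ hx
    refine ⟨0, min 1 (R / 2), by positivity, ?_⟩
    intro x hx hd t ht htr w hw
    simp only [lt_min_iff] at hd htr hw
    apply hb
    have h1 : dist (x + t • (0 + w)) x ≤ 1 * (R / 2) := by
      rw [dist_eq_norm, add_sub_cancel_left, norm_smul, Real.norm_eq_abs, abs_of_pos ht, zero_add]
      exact mul_le_mul htr.1.le hw.2.le (norm_nonneg _) zero_le_one
    have := dist_triangle (x + t • (0 + w)) x x₀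
    rw [mem_ball]; linarith
  · have hc : x₀ ∉ closure Ω := fun h => hf ⟨h, by rwa [hΩo.interior_eq]⟩
    obtain ⟨R, hR, hb⟩ := Metric.isOpen_iff.1 isClosed_closure.isOpen_compl x₀ hc
    exact ⟨0, R, hR, fun x hx hd => absurd (subset_closure hx) (hb hd)⟩

/-- A smooth compactly supported field `η`, of uniform inner cones of aperture `ρ` for `Ω`. -/
structure IsConeField (Ω : Set (E n)) (η : E n → E n) (ρ : ℝ) : Prop where
  contDiff : ContDiff ℝ ∞ η
  hasCompactSupport : HasCompactSupport η
  pos : 0 < ρ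
  le_one : ρ ≤ 1
  mem : ∀ x ∈ closure Ω, ∀ z, dist z x < ρ → ∀ t : ℝ, 0 < t → t < ρ → ∀ w : E n, ‖w‖ < ρ →
    x + t • (η z + w) ∈ Ω

-- Each cone direction remains valid near its base point and the admissible directions form convex
-- sets, so a smooth partition of unity selects one globally. Compactness of the closed
-- 1-neighbourhood of Ω makes the radii uniform, and a cutoff equal to 1 there gives compact
-- support.
open scoped Manifold in
theorem exists_isConeField (hΩo : IsOpen Ω) (hΩb : Bornology.IsBounded Ω)
    (hΩl : HasLipschitzBoundary Ω) : ∃ η ρ, IsConeField Ω η ρ := by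
  obtain ⟨g, hg⟩ := exists_contMDiffMap_forall_mem_convex_of_local_const (n := (⊤ : ℕ∞))
    (F := E n) 𝓘(ℝ, E n)
    (fun x => convex_coneDirection Ω x) (fun x =>
      let ⟨v, hv⟩ := exists_coneDirection hΩo hΩl x
      ⟨v, hv.eventually⟩)
  have hgs : ContDiff ℝ ∞ g := g.contMDiff.contDiff
  have hK : IsCompact (cthickening 1 Ω) :=
    isCompact_of_isClosed_isBounded isClosed_cthickening hΩb.cthickening
  have huni : ∃ r > (0 : ℝ), ∀ z ∈ cthickening 1 Ω, ∀ x ∈ Ω, dist x z < r → ∀ t : ℝ, 0 < t →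
      t < r → ∀ w : E n, ‖w‖ < r → x + t • (g z + w) ∈ Ω := by
    refine hK.induction_on (p := fun S => ∃ r > (0 : ℝ), ∀ z ∈ S, ∀ x ∈ Ω, dist x z < r →
      ∀ t : ℝ, 0 < t → t < r → ∀ w : E n, ‖w‖ < r → x + t • (g z + w) ∈ Ω) ?_ ?_ ?_ ?_
    · exact ⟨1, one_pos, by simp⟩
    · rintro S T hST ⟨r, hr, h⟩
      exact ⟨r, hr, fun z hz => h z (hST hz)⟩
    · rintro S T ⟨r, hr, h⟩ ⟨r', hr', h'⟩
      refine ⟨min r r', by positivity, fun z hz x hx hd t ht htr w hw => ?_⟩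
      simp only [lt_min_iff] at hd htr hw
      rcases hz with hz | hz
      · exact h z hz x hx hd.1 t ht htr.1 w hw.1
      · exact h' z hz x hx hd.2 t ht htr.2 w hw.2
    · intro z₀ _
      obtain ⟨r, hr, h⟩ := hg z₀
      have hc : {z | dist (g z) (g z₀) < r / 2} ∈ 𝓝 z₀ :=
        hgs.continuous.continuousAt (ball_mem_nhds _ (half_pos hr))
      refine ⟨_, mem_nhdsWithin_of_mem_nhds (inter_mem hc (ball_mem_nhds z₀ (half_pos hr))),
        r / 2, half_pos hr, ?_⟩
      rintro z ⟨hz1, hz2⟩ x hx hd t ht htr w hw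
      rw [mem_ball] at hz2
      have := h x hx (by linarith [dist_triangle x z z₀]) t ht (by linarith) ((g z - g z₀) + w) ?_
      · convert this using 3; abel
      · refine (norm_add_le _ _).trans_lt ?_
        rw [Set.mem_ofPred_eq, dist_eq_norm] at hz1
        linarith
  obtain ⟨r, hr, h⟩ := huni
  obtain ⟨R, hR⟩ := hK.isBounded.subset_closedBall (0 : E n)
  let χ : ContDiffBump (0 : E n) := ⟨max R 1, max R 1 + 1, by positivity, by linarith⟩
  have hχ : ∀ z ∈ cthickening 1 Ω, χ z = 1 := fun z hz =>
    χ.one_of_mem_closedBall (closedBall_subset_closedBall (le_max_left _ _) (hR hz))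
  refine ⟨fun z => χ z • g z, min (r / 2) 1, χ.contDiff.smul hgs,
    χ.hasCompactSupport.smul_right, by positivity, min_le_right _ _, ?_⟩
  intro x hx z hz t ht htr w hw
  simp only [lt_min_iff] at hz htr hw
  have hzK : z ∈ cthickening 1 Ω := by
    rw [← cthickening_closure]
    exact mem_cthickening_of_dist_le z x 1 (closure Ω) hx hz.2.le
  rw [hχ z hzK, one_smul]
  -- A point of the closure is replaced by a nearby x' in Ω. The error becomes the perturbation
  -- t⁻¹(x - x') of the direction, hence the tolerance t r / 2.
  obtain ⟨x', hx', hxx⟩ := Metric.mem_closure_iff.1 hx (min (r / 2) (t * (r / 2))) (by positivity)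
  rw [lt_min_iff] at hxx
  have hd : dist x' z < r := by
    have := dist_triangle x' x z
    rw [dist_comm x' x, dist_comm x z] at this
    linarith
  have := h z hzK x' hx' hd t ht (by linarith) (w + t⁻¹ • (x - x')) ?_
  · convert this using 1
    rw [← add_assoc, smul_add t _ (t⁻¹ • _), smul_inv_smul₀ ht.ne']
    abel
  · refine (norm_add_le _ _).trans_lt ?_
    rw [norm_smul, ← dist_eq_norm, norm_inv, Real.norm_eq_abs, abs_of_pos ht]
    have : t⁻¹ * dist x x' < r / 2 := by
      rw [inv_mul_lt_iff₀ ht]; exact hxx.2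
    linarith

/-- Near x₀ the translates of the frontier by distinct small multiples of η(x₀) are disjoint: if
aη(x₀) + x = bη(x₀) + y with a < b, then x = y + (b - a)η(x₀) would be in Ω. Infinitely many
disjoint translates by vectors of a bounded set force measure zero. -/
theorem IsConeField.volume_frontier {η : E n → E n} {ρ : ℝ} (h : IsConeField Ω η ρ)
    (hΩo : IsOpen Ω) : volume (frontier Ω) = 0 := by
  refine measure_null_of_locally_null _ fun x₀ hx₀ => ?_
  refine ⟨frontier Ω ∩ ball x₀ ρ, inter_mem_nhdsWithin _ (ball_mem_nhds _ h.pos), ?_⟩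
  have hρ := h.pos
  let c : ℕ → ℝ := fun k => ρ / (k + 2)
  have hc0 : ∀ k, 0 < c k := fun k => by positivity
  have hc1 : ∀ k, c k < ρ := fun k => by
    refine div_lt_self hρ ?_
    have : (0 : ℝ) ≤ k := k.cast_nonneg
    linarith
  refine Measure.addHaar_eq_zero_of_disjoint_translates volume (fun k => c k • η x₀) ?_ ?_
    (isClosed_frontier.measurableSet.inter measurableSet_ball)
  · refine (Metric.isBounded_closedBall (x := (0 : E n)) (r := ρ * ‖η x₀‖)).subset ?_
    rintro _ ⟨k, rfl⟩
    rw [mem_closedBall_zero_iff, norm_smul, Real.norm_eq_abs, abs_of_pos (hc0 k)]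
    exact mul_le_mul_of_nonneg_right (hc1 k).le (norm_nonneg _)
  · have key : ∀ {a b : ℝ}, 0 < a → b < ρ → a < b → ∀ x ∈ frontier Ω ∩ ball x₀ ρ,
        ∀ y ∈ frontier Ω ∩ ball x₀ ρ, a • η x₀ + x ≠ b • η x₀ + y := by
      intro a b ha hb hab x hx y hy he
      have h1 := h.mem y hy.1.1 x₀ (by rw [dist_comm]; exact hy.2) (b - a) (by linarith)
        (by linarith) 0 (by simpa using hρ)
      have h2 : y + (b - a) • (η x₀ + 0) = x := by
        rw [add_zero, sub_smul]
        have : x = b • η x₀ + y - a • η x₀ := by rw [← he]; abel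
        rw [this]; abel
      rw [h2] at h1
      exact hx.1.2 (by rwa [hΩo.interior_eq])
    have hinj : Function.Injective c := by
      intro i j hij
      simp only [c] at hij
      rw [div_eq_div_iff (by positivity) (by positivity)] at hij
      have := mul_left_cancel₀ hρ.ne' hij
      have : (j : ℝ) = i := by linarith
      exact_mod_cast this.symm
    intro i j hij
    rw [Function.onFun, Set.disjoint_left]
    rintro _ ⟨_, rfl, x, hx, rfl⟩ ⟨_, rfl, y, hy, he⟩
    rcases lt_trichotomy (c i) (c j) with hlt | heq | hlt
    · exact key (hc0 i) (hc1 j) hlt x hx y hy he.symm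
    · exact hij (hinj heq)
    · exact key (hc0 j) (hc1 i) hlt y hy x hx he

end Geometry

/-! ### Mollification and interior approximation -/

section Mollification

open Metric Filter Topology

theorem sq_eLpNorm_two {α F : Type*} [MeasurableSpace α] [ENorm F] (f : α → F)
    (μ : Measure α) : eLpNorm f 2 μ ^ 2 = ∫⁻ x, ‖f x‖ₑ ^ 2 ∂μ := by
  have h := eLpNorm_nnreal_pow_eq_lintegral (f := f) (μ := μ) (p := 2) two_ne_zero
  simpa using h

theorem eLpNorm_two_le_iff {α F : Type*} [MeasurableSpace α] [ENorm F] {f : α → F}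
    {μ : Measure α} {c : ℝ≥0∞} : eLpNorm f 2 μ ≤ c ↔ ∫⁻ x, ‖f x‖ₑ ^ 2 ∂μ ≤ c ^ 2 := by
  rw [← sq_eLpNorm_two]
  exact (ENNReal.pow_right_strictMono two_ne_zero).le_iff_le.symm

/-- The Cauchy-Schwarz inequality `(∫ g)² ≤ ν(X) ∫ g²`. -/
theorem sq_lintegral_le {α : Type*} [MeasurableSpace α] (ν : Measure α) {g : α → ℝ≥0∞}
    (hg : AEMeasurable g ν) : (∫⁻ x, g x ∂ν) ^ 2 ≤ ν Set.univ * ∫⁻ x, g x ^ 2 ∂ν := by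
  have h := ENNReal.lintegral_mul_le_Lp_mul_Lq ν Real.HolderConjugate.two_two
    (f := fun _ => 1) aemeasurable_const hg
  simp only [Pi.mul_apply, one_mul, ENNReal.one_rpow, lintegral_const] at h
  refine (pow_le_pow_left' h 2).trans_eq ?_
  rw [mul_pow, ← ENNReal.rpow_natCast, ← ENNReal.rpow_natCast, ← ENNReal.rpow_mul,
    ← ENNReal.rpow_mul]
  norm_num

variable {n : ℕ}

theorem fact_two_ne_top : Fact ((2 : ℝ≥0∞) ≠ ⊤) := ⟨by simp⟩

attribute [local instance] fact_two_ne_top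

theorem exists_translation_le {F : Type*} [NormedAddCommGroup F] {f : E n → F}
    (hf : MemLp f 2 volume) {τ : ℝ≥0∞} (hτ : τ ≠ 0) :
    ∃ δ > (0 : ℝ), ∀ z : E n, ‖z‖ ≤ δ → ∫⁻ x, ‖f (x - z) - f x‖ₑ ^ 2 ≤ τ := by
  have hcont : Continuous fun z : E n => DomAddAct.mk z +ᵥ hf.toLp f := by fun_prop
  have ht : Tendsto (fun z : E n => ‖(DomAddAct.mk (-z) +ᵥ hf.toLp f) - hf.toLp f‖ₑ ^ 2)
      (𝓝 0) (𝓝 0) := by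
    have h1 : Continuous
        fun z : E n => ‖(DomAddAct.mk (-z) +ᵥ hf.toLp f) - hf.toLp f‖ₑ ^ 2 :=
      (ENNReal.continuous_pow 2).comp
        (continuous_enorm.comp ((hcont.comp continuous_neg).sub continuous_const))
    have h2 := h1.tendsto 0
    have h3 : (DomAddAct.mk (-(0 : E n)) +ᵥ hf.toLp f) = hf.toLp f := by
      rw [neg_zero, DomAddAct.mk_zero, zero_vadd]
    simpa [h3] using h2
  obtain ⟨δ, hδ, h⟩ := Metric.eventually_nhds_iff.1 (ht.eventually (ge_mem_nhds hτ.bot_lt))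
  refine ⟨δ / 2, half_pos hδ, fun z hz => ?_⟩
  have h4 := h (y := z) (by rw [dist_zero_right]; linarith)
  rw [DomAddAct.mk_vadd_toLp, ← MemLp.toLp_sub, Lp.enorm_def, sq_eLpNorm_two] at h4
  refine le_of_eq_of_le (lintegral_congr_ae ?_) h4
  filter_upwards [MemLp.coeFn_toLp ((hf.comp_measurePreserving
    (measurePreserving_vadd (-z) volume)).sub hf)] with x hx
  refine Eq.trans ?_ (congrArg (fun a => ‖a‖ₑ ^ 2) hx.symm)
  simp [sub_eq_neg_add]

/-- Mollification converges in `L²`. -/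
theorem exists_mollification_le {F : Type*} [NormedAddCommGroup F] [NormedSpace ℝ F]
    [CompleteSpace F] {f : E n → F} (hfm : StronglyMeasurable f)
    (hf : MemLp f 2 volume) {τ : ℝ≥0∞} (hτ : τ ≠ 0) :
    ∃ δ > (0 : ℝ), ∀ φ : ContDiffBump (0 : E n), φ.rOut ≤ δ →
      eLpNorm (convolution (φ.normed volume) f (ContinuousLinearMap.lsmul ℝ ℝ) volume - f) 2
        volume ≤ τ := by
  obtain ⟨δ, hδ, h⟩ := exists_translation_le hf (pow_ne_zero 2 hτ)
  refine ⟨δ, hδ, fun φ hφ => ?_⟩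
  rw [eLpNorm_two_le_iff]
  set ρ := φ.normed volume with hρ
  have hρ0 : ∀ z, 0 ≤ ρ z := fun z => φ.nonneg_normed z
  have hρm : Measurable fun z => ENNReal.ofReal (ρ z) :=
    (φ.continuous_normed.measurable).ennreal_ofReal
  have hρ1 : ∫⁻ z, ENNReal.ofReal (ρ z) = 1 := by
    rw [← ofReal_integral_eq_lintegral_ofReal φ.integrable_normed
      (Eventually.of_forall hρ0), φ.integral_normed, ENNReal.ofReal_one]
  -- The kernel is read as a probability measure; Cauchy-Schwarz against it bounds the squared error
  -- by an average of squared translation errors.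
  set ν := volume.withDensity fun z => ENNReal.ofReal (ρ z) with hν
  have hν1 : ν Set.univ = 1 := by
    rw [hν, withDensity_apply _ MeasurableSet.univ, Measure.restrict_univ, hρ1]
  have hdiff : StronglyMeasurable (Function.uncurry fun x z : E n => f (x - z) - f x) :=
    (hfm.comp_measurable (measurable_fst.sub measurable_snd)).sub
      (hfm.comp_measurable measurable_fst)
  have hpt : ∀ x, ‖(convolution ρ f (ContinuousLinearMap.lsmul ℝ ℝ) volume - f) x‖ₑ ^ 2
      ≤ ∫⁻ z, ENNReal.ofReal (ρ z) * ‖f (x - z) - f x‖ₑ ^ 2 := by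
    intro x
    have hint : Integrable (fun z => ρ z • f (x - z)) volume :=
      φ.hasCompactSupport_normed.convolutionExists_left (ContinuousLinearMap.lsmul ℝ ℝ)
        φ.continuous_normed (hf.locallyIntegrable (by norm_num)) x
    have e : (convolution ρ f (ContinuousLinearMap.lsmul ℝ ℝ) volume - f) x
        = ∫ z, ρ z • (f (x - z) - f x) := by
      have e2 : f x = ∫ z, ρ z • f x := by
        rw [integral_smul_const, φ.integral_normed, one_smul]
      rw [Pi.sub_apply, convolution_def]
      simp only [ContinuousLinearMap.lsmul_apply, smul_sub]
      rw [integral_sub hint (φ.integrable_normed.smul_const _), ← e2]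
    have hm : Measurable fun z => ‖f (x - z) - f x‖ₑ :=
      (hdiff.comp_measurable measurable_prodMk_left).enorm
    have h1 : ‖(convolution ρ f (ContinuousLinearMap.lsmul ℝ ℝ) volume - f) x‖ₑ
        ≤ ∫⁻ z, ‖f (x - z) - f x‖ₑ ∂ν := by
      rw [e, hν, lintegral_withDensity_eq_lintegral_mul _ hρm hm]
      refine (enorm_integral_le_lintegral_enorm _).trans_eq (lintegral_congr fun z => ?_)
      rw [enorm_smul, Real.enorm_of_nonneg (hρ0 z)]
      rfl
    calc _ ≤ (∫⁻ z, ‖f (x - z) - f x‖ₑ ∂ν) ^ 2 := pow_le_pow_left' h1 2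
      _ ≤ ν Set.univ * ∫⁻ z, ‖f (x - z) - f x‖ₑ ^ 2 ∂ν := sq_lintegral_le ν hm.aemeasurable
      _ = _ := by
        rw [hν1, one_mul, hν, lintegral_withDensity_eq_lintegral_mul _ hρm (hm.pow_const 2)]
        rfl
  calc _ ≤ ∫⁻ x, ∫⁻ z, ENNReal.ofReal (ρ z) * ‖f (x - z) - f x‖ₑ ^ 2 :=
        lintegral_mono hpt
    _ = ∫⁻ z, ∫⁻ x, ENNReal.ofReal (ρ z) * ‖f (x - z) - f x‖ₑ ^ 2 := by
        refine lintegral_lintegral_swap (Measurable.aemeasurable ?_)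
        exact (hρm.comp measurable_snd).mul (hdiff.enorm.pow_const 2)
    _ ≤ ∫⁻ z, ENNReal.ofReal (ρ z) * τ ^ 2 := by
        refine lintegral_mono fun z => ?_
        rw [lintegral_const_mul]
        · by_cases hz : ρ z = 0
          · simp [hz]
          · gcongr
            refine h z ?_
            have : z ∈ Function.support ρ := hz
            rw [hρ, φ.support_normed_eq, mem_ball_zero_iff] at this
            linarith
        · exact (hdiff.comp_measurable measurable_prodMk_right).enorm.pow_const 2
    _ = τ ^ 2 := by rw [lintegral_mul_const _ hρm, hρ1, one_mul]

theorem gradient_apply (ψ : E n → ℝ) (x : E n) (i : Fin n) :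
    gradient ψ x i = partialDeriv ψ i x := by
  rw [partialDeriv, ← inner_gradient_left (𝕜 := ℝ), EuclideanSpace.inner_single_right]
  simp

theorem continuous_gradient {ψ : E n → ℝ} (h : ContDiff ℝ ∞ ψ) : Continuous (gradient ψ) :=
  (InnerProductSpace.toDual ℝ (E n)).symm.continuous.comp (h.continuous_fderiv (by simp))

theorem hasCompactSupport_gradient {ψ : E n → ℝ} (h : HasCompactSupport ψ) :
    HasCompactSupport (gradient ψ) :=
  (h.fderiv ℝ).comp_left (map_zero (InnerProductSpace.toDual ℝ (E n)).symm)

theorem strongly_measurable_indicator_coe {F : Type*} [NormedAddCommGroup F] {U : Set (E n)}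
    (hU : MeasurableSet U) (f : Lp F 2 (volume.restrict U)) :
    StronglyMeasurable (U.indicator f) ∧ MemLp (U.indicator f) 2 volume :=
  ⟨(Lp.stronglyMeasurable f).indicator hU, (memLp_indicator_iff_restrict hU).2 (Lp.memLp f)⟩

/-- On a compact subset of `U`, an element of `H¹(U)` is approximated by smooth functions. -/
theorem exists_smooth_approx_on_compact {U K : Set (E n)} (hU : IsOpen U)
    (hUb : Bornology.IsBounded U) (hK : IsCompact K) (hKU : K ⊆ U) (p : H1 U) {τ : ℝ≥0∞}
    (hτ : τ ≠ 0) :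
    ∃ ψ : E n → ℝ, ContDiff ℝ ∞ ψ ∧ HasCompactSupport ψ ∧
      eLpNorm (ψ - ⇑(h1Val p)) 2 (volume.restrict K) ≤ τ ∧
      eLpNorm (gradient ψ - ⇑(h1Grad p)) 2 (volume.restrict K) ≤ τ := by
  obtain ⟨hu, hu2⟩ := strongly_measurable_indicator_coe hU.measurableSet (h1Val p)
  obtain ⟨hg, hg2⟩ := strongly_measurable_indicator_coe hU.measurableSet (h1Grad p)
  set u := U.indicator (h1Val p) with hu_def
  set g := U.indicator (h1Grad p) with hg_def
  obtain ⟨δ₁, hδ₁, h₁⟩ := exists_mollification_le hu hu2 hτ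
  obtain ⟨δ₂, hδ₂, h₂⟩ := exists_mollification_le hg hg2 hτ
  obtain ⟨δ₃, hδ₃, h₃⟩ := hK.exists_cthickening_subset_open hU hKU
  set δ := min δ₁ (min δ₂ δ₃) with hδ
  have hδ0 : 0 < δ := by positivity
  let φ : ContDiffBump (0 : E n) := ⟨δ / 2, δ, by positivity, by linarith⟩
  set ρ := φ.normed volume with hρ
  have hul : LocallyIntegrable u volume := hu2.locallyIntegrable (by norm_num)
  have hgl : LocallyIntegrable g volume := hg2.locallyIntegrable (by norm_num)
  have hρs : ContDiff ℝ ∞ ρ := φ.contDiff_normed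
  have hρc : HasCompactSupport ρ := φ.hasCompactSupport_normed
  have huc : HasCompactSupport u :=
    HasCompactSupport.of_support_subset_isCompact
      (isCompact_of_isClosed_isBounded isClosed_closure hUb.closure)
      ((Set.support_indicator_subset).trans subset_closure)
  -- For x in K the kernel centred at x is supported in U, hence is an admissible test function;
  -- testing with it shows that the mollified weak gradient is the gradient of the mollification.
  have hgrad : ∀ x ∈ K, gradient (convolution ρ u (ContinuousLinearMap.lsmul ℝ ℝ) volume) x
      = convolution ρ g (ContinuousLinearMap.lsmul ℝ ℝ) volume x := by
    intro x hx
    have hball : closedBall x δ ⊆ U := by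
      refine (closedBall_subset_cthickening hx δ).trans ((cthickening_mono ?_ K).trans h₃)
      exact (min_le_right _ _).trans (min_le_right _ _)
    ext i
    rw [gradient_apply, partialDeriv,
      (hρc.hasFDerivAt_convolution_left (ContinuousLinearMap.lsmul ℝ ℝ)
        (hρs.of_le (by simp)) hul x).fderiv]
    have hi1 : Integrable (fun t => (ContinuousLinearMap.precompL (E n)
        (ContinuousLinearMap.lsmul ℝ ℝ : ℝ →L[ℝ] ℝ →L[ℝ] ℝ) (fderiv ℝ ρ t)) (u (x - t)))
        volume :=
      (hρc.fderiv ℝ).convolutionExists_left (ContinuousLinearMap.precompL (E n)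
        (ContinuousLinearMap.lsmul ℝ ℝ : ℝ →L[ℝ] ℝ →L[ℝ] ℝ))
        (hρs.continuous_fderiv (by simp)) hul x
    have hi2 : Integrable (fun t => ρ t • g (x - t)) volume :=
      hρc.convolutionExists_left (ContinuousLinearMap.lsmul ℝ ℝ) hρs.continuous hgl x
    have e1 : (convolution (fderiv ℝ ρ) u (ContinuousLinearMap.precompL (E n)
        (ContinuousLinearMap.lsmul ℝ ℝ : ℝ →L[ℝ] ℝ →L[ℝ] ℝ)) volume x) (basisVec i)
        = ∫ t, fderiv ℝ ρ t (basisVec i) * u (x - t) := by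
      rw [convolution_def, ContinuousLinearMap.integral_apply hi1]
      rfl
    have e2 : convolution ρ g (ContinuousLinearMap.lsmul ℝ ℝ) volume x i
        = ∫ t, ρ t * g (x - t) i := by
      rw [convolution_def]
      exact ((EuclideanSpace.proj i : E n →L[ℝ] ℝ).integral_comp_comm hi2).symm
    rw [e1, e2]
    rw [← integral_sub_left_eq_self (fun t => fderiv ℝ ρ t (basisVec i) * u (x - t)) volume x,
      ← integral_sub_left_eq_self (fun t => ρ t * g (x - t) i) volume x]
    simp only [sub_sub_cancel]
    let χ : E n → ℝ := fun y => ρ (x - y)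
    have hχs : ContDiff ℝ ∞ χ := hρs.comp (contDiff_const.sub contDiff_id)
    have hχsupp : tsupport χ ⊆ closedBall x δ := by
      refine closure_minimal ?_ isClosed_closedBall
      intro y hy
      have hy' : x - y ∈ Function.support ρ := hy
      rw [hρ, φ.support_normed_eq, mem_ball_zero_iff] at hy'
      rw [mem_closedBall, dist_comm, dist_eq_norm]
      exact hy'.le
    have hχc : HasCompactSupport χ :=
      (isCompact_closedBall x δ).of_isClosed_subset (isClosed_tsupport χ) hχsupp
    have hw := p.2 i χ hχs hχc (hχsupp.trans hball)
    have hd : ∀ y, partialDeriv χ i y = - fderiv ℝ ρ (x - y) (basisVec i) := by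
      intro y
      have := ((hρs.differentiable (by simp)) (x - y)).hasFDerivAt.comp y
        ((hasFDerivAt_const x y).sub (hasFDerivAt_id y))
      rw [partialDeriv, show χ = ρ ∘ (fun y => x - y) from rfl]
      erw [this.fderiv]
      simp
    have e3 : ∫ y, fderiv ℝ ρ (x - y) (basisVec i) * u y
        = - ∫ y in U, h1Val p y * partialDeriv χ i y := by
      rw [← integral_neg, ← integral_indicator hU.measurableSet]
      refine integral_congr_ae (Eventually.of_forall fun y => ?_)
      by_cases hy : y ∈ U
      · simp [hu_def, hy, hd, mul_comm]
      · simp [hu_def, hy]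
    have e4 : ∫ y, ρ (x - y) * g y i = ∫ y in U, h1Grad p y i * χ y := by
      rw [← integral_indicator hU.measurableSet]
      refine integral_congr_ae (Eventually.of_forall fun y => ?_)
      by_cases hy : y ∈ U
      · simp [hg_def, hy, χ, mul_comm]
      · simp [hg_def, hy]
    rw [e3, e4]
    exact neg_eq_iff_eq_neg.2 hw
  refine ⟨convolution ρ u (ContinuousLinearMap.lsmul ℝ ℝ) volume,
    hρc.contDiff_convolution_left _ hρs hul, hρc.convolution _ huc, ?_, ?_⟩
  · refine le_trans (le_of_eq (eLpNorm_congr_ae ?_))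
      ((eLpNorm_mono_measure _ Measure.restrict_le_self).trans (h₁ φ (min_le_left _ _)))
    filter_upwards [ae_restrict_mem hK.measurableSet] with x hx
    simp [hu_def, hKU hx, hρ]
  · refine le_trans (le_of_eq (eLpNorm_congr_ae ?_))
      ((eLpNorm_mono_measure _ Measure.restrict_le_self).trans
        (h₂ φ ((min_le_right _ _).trans (min_le_left _ _))))
    filter_upwards [ae_restrict_mem hK.measurableSet] with x hx
    simp only [Pi.sub_apply, hgrad x hx]
    simp [hg_def, hKU hx, hρ]

end Mollification

/-! ### Poincaré inequalities -/

section Poincare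

open Metric Filter Topology

variable {n : ℕ}

theorem enorm_add_sq_le {F : Type*} [NormedAddCommGroup F] (a b : F) :
    ‖a + b‖ₑ ^ 2 ≤ 2 * ‖a‖ₑ ^ 2 + 2 * ‖b‖ₑ ^ 2 := by
  have h2 : (2 : ℝ≥0∞) = ENNReal.ofReal 2 := by simp
  simp only [← ofReal_norm]
  rw [h2, ← ENNReal.ofReal_pow (norm_nonneg _), ← ENNReal.ofReal_pow (norm_nonneg _),
    ← ENNReal.ofReal_pow (norm_nonneg _), ← ENNReal.ofReal_mul zero_le_two,
    ← ENNReal.ofReal_mul zero_le_two, ← ENNReal.ofReal_add (by positivity) (by positivity)]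
  refine ENNReal.ofReal_le_ofReal ?_
  nlinarith [norm_add_le a b, norm_nonneg (a + b), sq_nonneg (‖a‖ - ‖b‖), norm_nonneg a,
    norm_nonneg b]

theorem lintegral_add_sq_le {α F : Type*} [MeasurableSpace α] [NormedAddCommGroup F]
    {μ : Measure α} (f g : α → F) (hf : AEMeasurable (fun x => ‖f x‖ₑ) μ) :
    ∫⁻ x, ‖f x + g x‖ₑ ^ 2 ∂μ ≤ 2 * ∫⁻ x, ‖f x‖ₑ ^ 2 ∂μ + 2 * ∫⁻ x, ‖g x‖ₑ ^ 2 ∂μ := by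
  rw [← lintegral_const_mul' _ _ (by simp), ← lintegral_const_mul' _ _ (by simp),
    ← lintegral_add_left' ((hf.pow_const 2).const_mul 2)]
  exact lintegral_mono fun x => enorm_add_sq_le _ _

theorem lintegral_biUnion_finset_le {α ι : Type*} [MeasurableSpace α] (μ : Measure α)
    (s : Finset ι) (A : ι → Set α) (f : α → ℝ≥0∞) :
    ∫⁻ x in ⋃ i ∈ s, A i, f x ∂μ ≤ ∑ i ∈ s, ∫⁻ x in A i, f x ∂μ := by
  classical
  induction s using Finset.induction_on with
  | empty => simp
  | insert i s hi ih =>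
    rw [Finset.set_biUnion_insert, Finset.sum_insert hi]
    exact (lintegral_union_le _ _ _).trans (by gcongr)

theorem lintegral_sub_average_le {α : Type*} [MeasurableSpace α] {μ : Measure α}
    [IsFiniteMeasure μ] (hμ : μ Set.univ ≠ 0) {u : α → ℝ} (hu : Integrable u μ) :
    ∫⁻ x, ‖u x - ⨍ y, u y ∂μ‖ₑ ^ 2 ∂μ
      ≤ (μ Set.univ)⁻¹ * ∫⁻ x, ∫⁻ y, ‖u x - u y‖ₑ ^ 2 ∂μ ∂μ := by
  have hμ' : μ Set.univ ≠ ⊤ := measure_ne_top μ _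
  rw [← lintegral_const_mul' _ _ (by simp [hμ])]
  refine lintegral_mono fun x => ?_
  have e : u x - ⨍ y, u y ∂μ = ⨍ y, (u x - u y) ∂μ := by
    rw [average_eq, average_eq, integral_sub (integrable_const _) hu, smul_sub, integral_const,
      smul_smul, inv_mul_cancel₀, one_smul]
    simp [Measure.real, ENNReal.toReal_eq_zero_iff, hμ, hμ']
  rw [e, average]
  have h1 := enorm_integral_le_lintegral_enorm (μ := (μ Set.univ)⁻¹ • μ) (fun y => u x - u y)
  rw [lintegral_smul_measure, smul_eq_mul] at h1
  have hm : AEMeasurable (fun y => ‖u x - u y‖ₑ) μ :=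
    (aestronglyMeasurable_const.sub hu.1).enorm
  calc _ ≤ ((μ Set.univ)⁻¹ * ∫⁻ y, ‖u x - u y‖ₑ ∂μ) ^ 2 := pow_le_pow_left' h1 2
    _ = (μ Set.univ)⁻¹ ^ 2 * (∫⁻ y, ‖u x - u y‖ₑ ∂μ) ^ 2 := mul_pow _ _ _
    _ ≤ (μ Set.univ)⁻¹ ^ 2 * (μ Set.univ * ∫⁻ y, ‖u x - u y‖ₑ ^ 2 ∂μ) := by
        gcongr
        exact sq_lintegral_le μ hm
    _ = _ := by
        rw [pow_two, mul_assoc, ← mul_assoc _ (μ Set.univ), ENNReal.inv_mul_cancel hμ hμ', one_mul]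

/-- The average is, up to a factor, the best constant approximation in `L²`. -/
theorem lintegral_sub_average_le_sub_const {α : Type*} [MeasurableSpace α] {μ : Measure α}
    [IsFiniteMeasure μ] {u : α → ℝ} (hu : Integrable u μ) (c : ℝ) :
    ∫⁻ x, ‖u x - ⨍ y, u y ∂μ‖ₑ ^ 2 ∂μ ≤ 4 * ∫⁻ x, ‖u x - c‖ₑ ^ 2 ∂μ := by
  rcases eq_or_ne (μ Set.univ) 0 with hμ | hμ
  · rw [Measure.measure_univ_eq_zero.1 hμ]; simp
  have hμ' : μ Set.univ ≠ ⊤ := measure_ne_top μ _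
  have hm : AEMeasurable (fun y => ‖u y - c‖ₑ) μ :=
    (hu.1.sub aestronglyMeasurable_const).enorm
  have hm2 : AEMeasurable (fun y => ‖-(u y - c)‖ₑ) μ := by
    simpa only [enorm_neg] using hm
  refine (lintegral_sub_average_le hμ hu).trans ?_
  calc _ ≤ (μ Set.univ)⁻¹ * (∫⁻ x, (2 * (∫⁻ y, ‖u y - c‖ₑ ^ 2 ∂μ)
          + 2 * (‖u x - c‖ₑ ^ 2 * μ Set.univ)) ∂μ) := by
        gcongr with x
        have h := lintegral_add_sq_le (μ := μ) (fun y => -(u y - c)) (fun _ => u x - c) hm2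
        simp only [enorm_neg, lintegral_const] at h
        refine le_trans (le_of_eq (lintegral_congr fun y => ?_)) h
        congr 2; ring
    _ = 4 * ∫⁻ x, ‖u x - c‖ₑ ^ 2 ∂μ := by
        rw [lintegral_add_left measurable_const, lintegral_const,
          lintegral_const_mul' _ _ (by simp), lintegral_mul_const' _ _ hμ']
        calc _ = (μ Set.univ)⁻¹ * μ Set.univ * (4 * ∫⁻ x, ‖u x - c‖ₑ ^ 2 ∂μ) := by ring
          _ = _ := by rw [ENNReal.inv_mul_cancel hμ hμ', one_mul]

/-- Affine change of variables with Jacobian factor t⁻ⁿ, at most 2ⁿ because t is at least 1/2. -/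
theorem lintegral_comp_smul_le {F : E n → ℝ≥0∞} (hF : Measurable F) {B : Set (E n)}
    (hB : MeasurableSet B) (c : E n) {t : ℝ} (ht : 1 / 2 ≤ t) (h : ∀ y ∈ B, c + t • y ∈ B) :
    ∫⁻ y in B, F (c + t • y) ≤ 2 ^ n * ∫⁻ y in B, F y := by
  have ht0 : 0 < t := by linarith
  have hFB : Measurable (B.indicator F) := hF.indicator hB
  calc ∫⁻ y in B, F (c + t • y) ≤ ∫⁻ y, B.indicator F (c + t • y) := by
        rw [← lintegral_indicator hB]
        refine lintegral_mono fun y => ?_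
        by_cases hy : y ∈ B
        · simp [hy, h y hy]
        · simp [hy]
    _ = ∫⁻ y, B.indicator F (c + y) ∂(Measure.map (fun y : E n => t • y) volume) := by
        exact (lintegral_map (hFB.comp (measurable_const_add c)) (measurable_const_smul t)).symm
    _ = ENNReal.ofReal |(t ^ n)⁻¹| * ∫⁻ y in B, F y := by
        rw [Measure.map_addHaar_smul _ ht0.ne', lintegral_smul_measure,
          lintegral_add_left_eq_self (B.indicator F) c, lintegral_indicator hB]
        simp
    _ ≤ 2 ^ n * ∫⁻ y in B, F y := by
        gcongr
        rw [abs_of_pos (by positivity), ← inv_pow]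
        have h2 : (2 : ℝ≥0∞) ^ n = ENNReal.ofReal (2 ^ n) := by
          rw [ENNReal.ofReal_pow zero_le_two]; simp
        rw [h2]
        refine ENNReal.ofReal_le_ofReal (pow_le_pow_left₀ (by positivity) ?_ n)
        rw [inv_le_comm₀ ht0 two_pos]
        linarith

theorem enorm_sub_sq_le_lintegral {p : E n → ℝ} (hp : ContDiff ℝ ∞ p) {D : ℝ} {x y : E n}
    (hxy : dist x y ≤ D) :
    ‖p x - p y‖ₑ ^ 2 ≤ ENNReal.ofReal D ^ 2 *
      ∫⁻ t in Set.Ioc (0 : ℝ) 1, ‖gradient p (x + t • (y - x))‖ₑ ^ 2 := by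
  have hline : Continuous fun t : ℝ => x + t • (y - x) := by fun_prop
  have hg : Continuous fun t : ℝ => gradient p (x + t • (y - x)) :=
    (continuous_gradient hp).comp hline
  have hder : ∀ t : ℝ, HasDerivAt (fun t : ℝ => p (x + t • (y - x)))
      (inner ℝ (gradient p (x + t • (y - x))) (y - x)) t := by
    intro t
    rw [inner_gradient_left]
    have h1 : HasDerivAt (fun t : ℝ => x + t • (y - x)) (y - x) t := by
      simpa using ((hasDerivAt_id t).smul_const (y - x)).const_add x
    exact ((hp.differentiable (by simp)) _).hasFDerivAt.comp_hasDerivAt t h1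
  have hint := intervalIntegral.integral_eq_sub_of_hasDerivAt (a := 0) (b := 1)
    (fun t _ => hder t) ((hg.inner continuous_const).intervalIntegrable _ _)
  simp only [one_smul, zero_smul, add_zero, add_sub_cancel] at hint
  rw [← enorm_neg, neg_sub, ← hint, intervalIntegral.integral_of_le zero_le_one]
  have hm : AEMeasurable (fun t : ℝ => ENNReal.ofReal D * ‖gradient p (x + t • (y - x))‖ₑ)
      (volume.restrict (Set.Ioc (0 : ℝ) 1)) := (hg.enorm.measurable.const_mul _).aemeasurable
  calc _ ≤ (∫⁻ t in Set.Ioc (0 : ℝ) 1,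
            ENNReal.ofReal D * ‖gradient p (x + t • (y - x))‖ₑ) ^ 2 := by
        refine pow_le_pow_left' ((enorm_integral_le_lintegral_enorm _).trans
          (lintegral_mono fun t => ?_)) 2
        rw [mul_comm, ← ofReal_norm, ← ofReal_norm, ← ENNReal.ofReal_mul (norm_nonneg _)]
        refine ENNReal.ofReal_le_ofReal ((norm_inner_le_norm _ _).trans ?_)
        gcongr
        rwa [← dist_eq_norm, dist_comm]
    _ ≤ _ := by
        refine (sq_lintegral_le _ hm).trans_eq ?_
        rw [Measure.restrict_apply_univ, Real.volume_Ioc]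
        simp only [sub_zero, ENNReal.ofReal_one, one_mul, mul_pow]
        rw [lintegral_const_mul' _ _ (by simp)]

theorem lintegral_lintegral_lintegral_swap {α β γ : Type*} [MeasurableSpace α]
    [MeasurableSpace β] [MeasurableSpace γ] {μ : Measure α} {ν : Measure β} {κ : Measure γ}
    [SFinite μ] [SFinite ν] [SFinite κ] {f : α → β → γ → ℝ≥0∞}
    (hf : Measurable fun q : (α × β) × γ => f q.1.1 q.1.2 q.2) :
    ∫⁻ x, ∫⁻ y, ∫⁻ t, f x y t ∂κ ∂ν ∂μ = ∫⁻ t, ∫⁻ x, ∫⁻ y, f x y t ∂ν ∂μ ∂κ := by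
  have h3 : Measurable fun q : (α × γ) × β => f q.1.1 q.2 q.1.2 :=
    hf.comp ((measurable_fst.fst.prodMk measurable_snd).prodMk measurable_fst.snd)
  have s2 : ∫⁻ x, ∫⁻ t, ∫⁻ y, f x y t ∂ν ∂κ ∂μ = ∫⁻ t, ∫⁻ x, ∫⁻ y, f x y t ∂ν ∂μ ∂κ :=
    lintegral_lintegral_swap (f := fun x t => ∫⁻ y, f x y t ∂ν)
      h3.lintegral_prod_right'.aemeasurable
  rw [← s2]
  refine lintegral_congr fun x => lintegral_lintegral_swap (f := f x) ?_
  exact (hf.comp ((measurable_const.prodMk measurable_fst).prodMk measurable_snd)).aemeasurable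

/-- The Poincaré inequality on a convex set, for the double integral of differences. -/
theorem lintegral_lintegral_sub_sq_le {p : E n → ℝ} (hp : ContDiff ℝ ∞ p) {B : Set (E n)}
    (hB : MeasurableSet B) (hc : Convex ℝ B) {D : ℝ} (hD : ∀ x ∈ B, ∀ y ∈ B, dist x y ≤ D) :
    ∫⁻ x in B, ∫⁻ y in B, ‖p x - p y‖ₑ ^ 2
      ≤ ENNReal.ofReal D ^ 2 * (2 ^ n * (∫⁻ x in B, ‖gradient p x‖ₑ ^ 2) * volume B) := by
  have hg := continuous_gradient hp
  let F : E n → ℝ≥0∞ := fun x => ‖gradient p x‖ₑ ^ 2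
  have hF : Measurable F := hg.measurable.enorm.pow_const 2
  have hF3 : Measurable fun q : (E n × E n) × ℝ => F (q.1.1 + q.2 • (q.1.2 - q.1.1)) :=
    hF.comp (by fun_prop : Continuous
      fun q : (E n × E n) × ℝ => q.1.1 + q.2 • (q.1.2 - q.1.1)).measurable
  have hI : ∀ t ∈ Set.Ioc (0 : ℝ) 1, ∫⁻ x in B, ∫⁻ y in B, F (x + t • (y - x))
      ≤ 2 ^ n * (∫⁻ x in B, F x) * volume B := by
    intro t ht
    have hconst : ∀ {f : E n → ℝ≥0∞} {c : ℝ≥0∞}, (∀ x ∈ B, f x ≤ c) →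
        ∫⁻ x in B, f x ≤ c * volume B := fun h =>
      (setLIntegral_mono' hB h).trans_eq (setLIntegral_const B _)
    -- At x + t(y - x) the change of variables is made in y when t ≥ 1/2 and in x when t ≤ 1/2, so
    -- that the factor never exceeds 2ⁿ.
    rcases le_total (1 / 2) t with h2 | h2
    · refine hconst fun x hx => ?_
      have e : ∀ y, x + t • (y - x) = (1 - t) • x + t • y := fun y => by module
      simp only [e]
      exact lintegral_comp_smul_le hF hB _ h2 fun y hy =>
        hc hx hy (by linarith [ht.2]) ht.1.le (by ring)
    · rw [lintegral_lintegral_swap]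
      · refine hconst fun y hy => ?_
        have e : ∀ x, x + t • (y - x) = t • y + (1 - t) • x := fun y => by module
        simp only [e]
        exact lintegral_comp_smul_le hF hB _ (by linarith) fun x hx =>
          hc hy hx ht.1.le (by linarith [ht.2]) (by ring)
      · exact (hF3.comp (measurable_id.prodMk measurable_const)).aemeasurable
  calc _ ≤ ∫⁻ x in B, ∫⁻ y in B, ENNReal.ofReal D ^ 2 *
          ∫⁻ t in Set.Ioc (0 : ℝ) 1, F (x + t • (y - x)) :=
        setLIntegral_mono' hB fun x hx => setLIntegral_mono' hB fun y hy =>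
          enorm_sub_sq_le_lintegral hp (hD x hx y hy)
    _ = ENNReal.ofReal D ^ 2 * ∫⁻ x in B, ∫⁻ y in B,
          ∫⁻ t in Set.Ioc (0 : ℝ) 1, F (x + t • (y - x)) := by
        rw [← lintegral_const_mul' _ _ (by simp)]
        refine lintegral_congr fun x => ?_
        rw [lintegral_const_mul' _ _ (by simp)]
    _ = ENNReal.ofReal D ^ 2 * ∫⁻ t in Set.Ioc (0 : ℝ) 1, ∫⁻ x in B, ∫⁻ y in B,
          F (x + t • (y - x)) := by
        congr 1
        exact lintegral_lintegral_lintegral_swap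
          (f := fun (x y : E n) (t : ℝ) => F (x + t • (y - x))) hF3
    _ ≤ ENNReal.ofReal D ^ 2 * ∫⁻ t in Set.Ioc (0 : ℝ) 1,
          (2 ^ n * (∫⁻ x in B, F x) * volume B) := by
        gcongr 1
        exact setLIntegral_mono' measurableSet_Ioc hI
    _ = _ := by
        rw [setLIntegral_const, Real.volume_Ioc]
        simp [F]

/-- The Poincaré inequality on a convex set. -/
theorem lintegral_sub_average_le_gradient {p : E n → ℝ} (hp : ContDiff ℝ ∞ p) {B : Set (E n)}
    (hB : MeasurableSet B) (hc : Convex ℝ B) {D : ℝ} (hD : ∀ x ∈ B, ∀ y ∈ B, dist x y ≤ D)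
    (h0 : volume B ≠ 0) :
    ∫⁻ x in B, ‖p x - ⨍ y in B, p y‖ₑ ^ 2
      ≤ ENNReal.ofReal D ^ 2 * 2 ^ n * ∫⁻ x in B, ‖gradient p x‖ₑ ^ 2 := by
  have hbdd : Bornology.IsBounded B := Metric.isBounded_iff.2 ⟨D, fun x hx y hy => hD x hx y hy⟩
  have hfin : volume B ≠ ⊤ := hbdd.measure_lt_top.ne
  have : IsFiniteMeasure (volume.restrict B) := ⟨by simpa using hfin.lt_top⟩
  have hint : Integrable p (volume.restrict B) :=
    (hp.continuous.locallyIntegrable.integrableOn_isCompact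
      (isCompact_of_isClosed_isBounded isClosed_closure hbdd.closure)).mono_set subset_closure
  have h1 := lintegral_sub_average_le (μ := volume.restrict B) (by simpa using h0) hint
  refine h1.trans ?_
  rw [Measure.restrict_apply_univ]
  calc _ ≤ (volume B)⁻¹ * (ENNReal.ofReal D ^ 2 *
        (2 ^ n * (∫⁻ x in B, ‖gradient p x‖ₑ ^ 2) * volume B)) := by
        gcongr
        exact lintegral_lintegral_sub_sq_le hp hB hc hD
    _ = (volume B)⁻¹ * volume B * (ENNReal.ofReal D ^ 2 * 2 ^ n *
          ∫⁻ x in B, ‖gradient p x‖ₑ ^ 2) := by ring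
    _ = _ := by rw [ENNReal.inv_mul_cancel h0 hfin, one_mul]

/-- The Poincaré inequality on a bounded connected open set, the gradient being taken on a
neighbourhood. -/
theorem exists_poincare_thickening {Ω : Set (E n)} (hΩc : IsConnected Ω)
    (hΩb : Bornology.IsBounded Ω) {δ : ℝ} (hδ : 0 < δ) :
    ∃ C : NNReal, ∀ ψ : E n → ℝ, ContDiff ℝ ∞ ψ → ∃ m : ℝ,
      ∫⁻ x in Ω, ‖ψ x - m‖ₑ ^ 2
        ≤ C * ∫⁻ x in cthickening δ Ω, ‖gradient ψ x‖ₑ ^ 2 := by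
  obtain ⟨x₀, hx₀⟩ := hΩc.nonempty
  set G : (E n → ℝ) → ℝ≥0∞ := fun ψ => ∫⁻ x in cthickening δ Ω, ‖gradient ψ x‖ₑ ^ 2 with hG
  -- All balls are compared with the one mean over the ball about x₀. Connectedness carries this
  -- property along chains of overlapping balls, and finitely many balls cover Ω.
  let Good : E n → Prop := fun x => ∃ C : NNReal, ∀ ψ : E n → ℝ, ContDiff ℝ ∞ ψ →
    ∫⁻ z in ball x δ, ‖ψ z - ⨍ y in ball x₀ δ, ψ y‖ₑ ^ 2 ≤ C * G ψ
  obtain ⟨CP, hCP⟩ : ∃ CP : NNReal, ∀ x ∈ Ω, ∀ ψ : E n → ℝ, ContDiff ℝ ∞ ψ →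
      ∫⁻ z in ball x δ, ‖ψ z - ⨍ y in ball x δ, ψ y‖ₑ ^ 2 ≤ CP * G ψ := by
    refine ⟨(2 * δ).toNNReal ^ 2 * 2 ^ n, fun x hx ψ hψ => ?_⟩
    refine (lintegral_sub_average_le_gradient hψ measurableSet_ball (convex_ball x δ)
      (D := 2 * δ) ?_ (measure_ball_pos volume x hδ).ne').trans ?_
    · intro a ha b hb
      rw [mem_ball] at ha hb
      linarith [dist_triangle_right a b x]
    · push_cast
      rw [ENNReal.ofReal]
      gcongr
      refine lintegral_mono_set ?_
      exact (ball_subset_closedBall).trans (closedBall_subset_cthickening hx δ)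
  have step : ∀ x ∈ Ω, ∀ y ∈ Ω, dist x y ≤ δ / 2 → Good x → Good y := by
    rintro x hx y hy hxy ⟨C, hC⟩
    set V := volume (ball y (δ / 2)) with hV
    have hV0 : V ≠ 0 := (measure_ball_pos volume y (half_pos hδ)).ne'
    have hVt : V ≠ ⊤ := measure_ball_lt_top.ne
    set W := volume (ball y δ) with hW
    have hWt : W ≠ ⊤ := measure_ball_lt_top.ne
    refine ⟨2 * CP + 2 * ((V⁻¹ * W).toNNReal * (2 * CP + 2 * C)), fun ψ hψ => ?_⟩
    set m₀ := ⨍ y in ball x₀ δ, ψ y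
    set m := ⨍ z in ball y δ, ψ z
    have hsub1 : ball y (δ / 2) ⊆ ball y δ := ball_subset_ball (by linarith)
    have hsub2 : ball y (δ / 2) ⊆ ball x δ := ball_subset_ball' (by
      rw [dist_comm]; linarith)
    have hm1 : ∀ (c : ℝ) (S : Set (E n)), AEMeasurable (fun z => ‖ψ z - c‖ₑ)
        (volume.restrict S) := fun c S =>
      ((hψ.continuous.sub continuous_const).enorm.measurable).aemeasurable
    -- The two constants are compared on the ball of radius δ/2 about y, which lies in both balls of
    -- radius δ.
    have hmm : ‖m - m₀‖ₑ ^ 2 * V ≤ 2 * (CP * G ψ) + 2 * (C * G ψ) := by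
      rw [hV, ← setLIntegral_const]
      have h := lintegral_add_sq_le (μ := volume.restrict (ball y (δ / 2)))
        (fun z => -(ψ z - m)) (fun z => ψ z - m₀) (by simpa only [enorm_neg] using hm1 m _)
      simp only [enorm_neg] at h
      refine le_trans (le_of_eq (lintegral_congr fun z => ?_)) (h.trans ?_)
      · congr 2; ring
      · gcongr
        · exact (lintegral_mono_set hsub1).trans (hCP y hy ψ hψ)
        · exact (lintegral_mono_set hsub2).trans (hC ψ hψ)
    have hmm' : ‖m - m₀‖ₑ ^ 2 * W ≤ (V⁻¹ * W) * ((2 * CP + 2 * C) * G ψ) := by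
      calc ‖m - m₀‖ₑ ^ 2 * W = V⁻¹ * V * (‖m - m₀‖ₑ ^ 2 * W) := by
            rw [ENNReal.inv_mul_cancel hV0 hVt, one_mul]
        _ = V⁻¹ * W * (‖m - m₀‖ₑ ^ 2 * V) := by ring
        _ ≤ V⁻¹ * W * (2 * (CP * G ψ) + 2 * (C * G ψ)) := by gcongr
        _ = _ := by ring
    have h := lintegral_add_sq_le (μ := volume.restrict (ball y δ))
      (fun z => ψ z - m) (fun _ => m - m₀) (hm1 m _)
    simp only [sub_add_sub_cancel, setLIntegral_const] at h
    refine h.trans ?_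
    calc _ ≤ 2 * (CP * G ψ) + 2 * ((V⁻¹ * W) * ((2 * CP + 2 * C) * G ψ)) := by
          gcongr
          exact hCP y hy ψ hψ
      _ = _ := by
          push_cast
          rw [ENNReal.coe_toNNReal (ENNReal.mul_ne_top (ENNReal.inv_ne_top.2 hV0) hWt)]
          ring
  have hall : ∀ x ∈ Ω, Good x := by
    have hind : ∀ x ∈ Ω, Good x₀ ↔ Good x := fun x hx =>
      hΩc.isPreconnected.induction₂ (fun x y => Good x ↔ Good y) (fun x hx => by
      filter_upwards [self_mem_nhdsWithin,
        mem_nhdsWithin_of_mem_nhds (closedBall_mem_nhds x (half_pos hδ))] with y hy hd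
      rw [mem_closedBall] at hd
      exact ⟨step x hx y hy (by rwa [dist_comm]), step y hy x hx hd⟩)
      (fun x y z _ _ _ h1 h2 => h1.trans h2) (fun x y _ _ h => h.symm) hx₀ hx
    exact fun x hx => (hind x hx).1 ⟨CP, hCP x₀ hx₀⟩
  choose! C hC using hall
  obtain ⟨t, htΩ, htf, hcov⟩ := Metric.finite_approx_of_totallyBounded 
    ((isCompact_of_isClosed_isBounded isClosed_closure hΩb.closure).totallyBounded.subset
      subset_closure) δ hδ
  refine ⟨∑ x ∈ htf.toFinset, C x, fun ψ hψ => ⟨⨍ y in ball x₀ δ, ψ y, ?_⟩⟩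
  calc _ ≤ ∫⁻ x in ⋃ y ∈ htf.toFinset, ball y δ, ‖ψ x - ⨍ y in ball x₀ δ, ψ y‖ₑ ^ 2 :=
        lintegral_mono_set (by simpa using hcov)
    _ ≤ ∑ y ∈ htf.toFinset, ∫⁻ x in ball y δ, ‖ψ x - ⨍ y in ball x₀ δ, ψ y‖ₑ ^ 2 :=
        lintegral_biUnion_finset_le _ _ _ _
    _ ≤ ∑ y ∈ htf.toFinset, C y * G ψ :=
        Finset.sum_le_sum fun y hy => hC y (htΩ (by simpa using hy)) ψ hψ
    _ = _ := by rw [← Finset.sum_mul]; push_cast; rfl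

end Poincare

/-! ### The Lipschitz reflection across the boundary -/

section Reflection

open Metric Filter Topology

variable {n : ℕ} {Ω : Set (E n)}

/-- A map which does not contract distances by more than `K` on `S` satisfies
`|S| ≤ Kⁿ |f(S)|`. -/
theorem volume_le_of_dist_le_mul {f : E n → E n} {S A : Set (E n)} {K : NNReal}
    (h : ∀ x ∈ S, ∀ y ∈ S, dist x y ≤ K * dist (f x) (f y)) (hA : Set.MapsTo f S A) :
    volume S ≤ (K : ℝ≥0∞) ^ n * volume A := by
  -- The Hausdorff measure behaves well under maps bounded below, without injective derivatives or a
  -- change of variables formula. Lebesgue measure is a multiple of it, so the constant carries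
  -- over.
  set μ : Measure (E n) := Measure.hausdorffMeasure (n : ℝ) with hμ
  have hS : μ S ≤ (K : ℝ≥0∞) ^ n * μ A := by
    let g : S → E n := fun x => f x
    have hg : AntilipschitzWith K g :=
      AntilipschitzWith.of_le_mul_dist fun x y => h x x.2 y y.2
    have h1 := hg.le_hausdorffMeasure_image (d := n) n.cast_nonneg Set.univ
    have h2 := (isometry_subtype_coe (s := S)).hausdorffMeasure_image (d := n)
      (Or.inl n.cast_nonneg) Set.univ
    rw [Set.image_univ, Subtype.range_coe] at h2
    rw [hμ, h2]
    refine h1.trans ?_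
    rw [ENNReal.rpow_natCast]
    gcongr
    rintro _ ⟨x, -, rfl⟩
    exact hA x.2
  have e := Measure.isAddLeftInvariant_eq_smul (volume : Measure (E n)) μ
  rw [e, Measure.smul_apply, Measure.smul_apply, ENNReal.smul_def, smul_eq_mul, ENNReal.smul_def,
    smul_eq_mul, mul_left_comm]
  gcongr

theorem map_restrict_le {f : E n → E n} (hf : Measurable f) {S T : Set (E n)} {K : NNReal}
    (h : ∀ x ∈ S, ∀ y ∈ S, dist x y ≤ K * dist (f x) (f y))
    (hST : Set.MapsTo f S T) :
    Measure.map f (volume.restrict S) ≤ (K : ℝ≥0∞) ^ n • volume.restrict T := by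
  refine Measure.le_iff.2 fun A hA => ?_
  rw [Measure.map_apply hf hA, Measure.restrict_apply (hf hA), Measure.smul_apply, smul_eq_mul,
    Measure.restrict_apply hA]
  exact volume_le_of_dist_le_mul (fun x hx y hy => h x hx.2 y hy.2)
    fun x hx => ⟨hx.1, hST hx.2⟩

theorem lintegral_comp_le_of_dist_le_mul {f : E n → E n} (hf : Measurable f) {S T : Set (E n)}
    {K : NNReal}
    (h : ∀ x ∈ S, ∀ y ∈ S, dist x y ≤ K * dist (f x) (f y)) (hST : Set.MapsTo f S T)
    {F : E n → ℝ≥0∞} (hF : Measurable F) :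
    ∫⁻ x in S, F (f x) ≤ (K : ℝ≥0∞) ^ n * ∫⁻ x in T, F x := by
  rw [← lintegral_map hF hf, ← smul_eq_mul, ← lintegral_smul_measure]
  exact lintegral_mono' (map_restrict_le hf h hST) le_rfl

variable {η : E n → E n} {ρ : ℝ}

theorem IsConeField.exists_bounds (h : IsConeField Ω η ρ) :
    ∃ M L : ℝ, 1 ≤ M ∧ 0 ≤ L ∧ (∀ x, ‖η x‖ ≤ M) ∧ (∀ x y, ‖η x - η y‖ ≤ L * dist x y) ∧
      ∀ x, ‖fderiv ℝ η x‖ ≤ L := by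
  obtain ⟨M, hM⟩ := h.hasCompactSupport.exists_bound_of_continuous h.contDiff.continuous
  obtain ⟨L, hL⟩ := h.contDiff.lipschitzWith_of_hasCompactSupport h.hasCompactSupport (by simp)
  refine ⟨max M 1, L, le_max_right _ _, L.2, fun x => (hM x).trans (le_max_left _ _),
    fun x y => ?_, fun x => norm_fderiv_le_of_lipschitz ℝ hL⟩
  rw [← dist_eq_norm]
  exact hL.dist_le_mul x y

/-- A Lipschitz retraction of a neighbourhood of `Ω` onto `Ω`, which reflects the exterior of `Ω`
into `Ω` without increasing the distance to the boundary. -/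
structure IsReflection (Ω : Set (E n)) (Φ : E n → E n) (L K : NNReal) (d : ℝ) : Prop where
  pos : 0 < d
  lipschitz : LipschitzWith L Φ
  eq_self : ∀ x ∈ closure Ω, Φ x = x
  mem : ∀ x, x ∉ closure Ω → infDist x Ω < d → Φ x ∈ Ω
  infDist_le : ∀ x, x ∉ closure Ω → infDist x Ω < d → infDist (Φ x) (frontier Ω) ≤ infDist x Ω
  dist_le : ∀ x, x ∉ closure Ω → infDist x Ω < d → ∀ y, y ∉ closure Ω → infDist y Ω < d →
    dist x y ≤ K * dist (Φ x) (Φ y)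

-- Let h(x) be the infimum of the t ≥ 0 with x + tη(x) in Ω, and put Φ(x) = x + (1 + c)h(x)η(x). The
-- point x + h(x)η(x) is on the boundary when x is exterior, and the extra c h(x)η(x) enters Ω. The
-- cone property makes h Lipschitz. If Φ(x) and Φ(z) were much closer together than x and z, then
-- h(x) and h(z) would differ by at least a multiple of the distance of x and z. Say h(x) is the
-- smaller; pushing the boundary point of z slightly inward would reach a point x + tη(x) of Ω with
-- t < h(x), contradicting the definition of h(x).
set_option maxHeartbeats 1600000 in
theorem IsConeField.exists_isReflection (hη : IsConeField Ω η ρ) (hΩo : IsOpen Ω)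
    (hne : Ω.Nonempty) : ∃ Φ L K d, IsReflection Ω Φ L K d := by
  obtain ⟨M, L, hM1, hL0, hM, hL, -⟩ := hη.exists_bounds
  have hρ := hη.pos
  have hρ1 := hη.le_one
  -- H will bound h. It makes HM, HML, HL and H all at most ρ/32, so that displacements by hη and
  -- variations of hη are negligible in the cone conditions.
  set H : ℝ := ρ / (32 * M * (L + 1)) with hH
  have hden : 0 < 32 * M * (L + 1) := by positivity
  have hH0 : 0 < H := by positivity
  have hHe : H * (32 * M * (L + 1)) = ρ := by rw [hH]; field_simp
  have hHM : 32 * (H * M) ≤ ρ := by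
    have : 0 ≤ H * M * L := by positivity
    nlinarith
  have hHML : 32 * (H * M * L) ≤ ρ := by
    have : 0 ≤ H * M := by positivity
    nlinarith
  have hHL : 32 * (H * L) ≤ ρ := by
    have : H * L ≤ H * L * M := le_mul_of_one_le_right (by positivity) hM1
    nlinarith
  have hHρ : 32 * H ≤ ρ := by
    have : H ≤ H * M := le_mul_of_one_le_right hH0.le hM1
    linarith
  -- A point at distance less than tρ from Ω, with t < ρ, satisfies x + tη(x) ∈ Ω. Hence h ≤ H on
  -- the d-neighbourhood.
  set d : ℝ := ρ * H with hd
  have hd0 : 0 < d := by positivity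
  have hdρ : 32 * d ≤ ρ := by nlinarith
  let S : E n → Set ℝ := fun x => {t | 0 ≤ t ∧ x + t • η x ∈ Ω}
  let h : E n → ℝ := fun x => sInf (S x)
  have hbdd : ∀ x, BddBelow (S x) := fun x => ⟨0, fun t ht => ht.1⟩
  have hS : ∀ x t, infDist x Ω < t * ρ → t < ρ → t ∈ S x := by
    intro x t ht1 ht2
    have ht0 : 0 < t := pos_of_mul_pos_left (infDist_nonneg.trans_lt ht1) hρ.le
    obtain ⟨p, hp, hxp⟩ := (infDist_lt_iff hne).1 ht1
    refine ⟨ht0.le, ?_⟩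
    have := hη.mem p (subset_closure hp) x (by nlinarith) t ht0 ht2 (t⁻¹ • (x - p)) ?_
    · rw [smul_add, smul_inv_smul₀ ht0.ne'] at this
      convert this using 1; abel
    · rw [norm_smul, norm_inv, Real.norm_eq_abs, abs_of_pos ht0, inv_mul_lt_iff₀ ht0,
        ← dist_eq_norm]
      exact hxp
  have hh0 : ∀ x, 0 ≤ h x := fun x => Real.sInf_nonneg fun t ht => ht.1
  have hhd : ∀ x, infDist x Ω < d → h x * ρ ≤ infDist x Ω := by
    intro x hx
    by_contra! hlt
    obtain ⟨b, hb1, hb2⟩ := exists_between hlt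
    obtain ⟨b', hb1', hb2'⟩ := exists_between (lt_min hb1 hx)
    rw [lt_min_iff] at hb2'
    have hmem := hS x (b' / ρ) (by rwa [div_mul_cancel₀ _ hρ.ne']) (by
      rw [div_lt_iff₀ hρ]; nlinarith)
    have := csInf_le (hbdd x) hmem
    have h3 : h x * ρ ≤ b' := by rw [← le_div_iff₀ hρ]; exact this
    linarith
  have hhH : ∀ x, infDist x Ω < d → h x ≤ H := by
    intro x hx
    have := hhd x hx
    by_contra! hlt
    nlinarith
  have hSne : ∀ x, infDist x Ω < d → (S x).Nonempty := fun x hx =>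
    ⟨H, hS x H (by rw [mul_comm]; exact hx) (by linarith)⟩
  have hcl : ∀ x, infDist x Ω < d → x + h x • η x ∈ closure Ω := by
    intro x hx
    have h1 := csInf_mem_closure (hSne x hx) (hbdd x)
    exact map_mem_closure (f := fun t : ℝ => x + t • η x) (by fun_prop) h1 fun t ht => ht.2
  have hstep : ∀ x z, infDist x Ω < d → infDist z Ω < d → h z ≤ h x + 2 / ρ * dist x z := by
    intro x z hx hz
    -- For points at least d/2 apart the bound is trivial, since h ≤ H = d/ρ.
    rcases le_or_gt d (2 * dist x z) with hD | hD
    · have h1 : H ≤ 2 / ρ * dist x z := by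
        rw [div_mul_eq_mul_div, le_div_iff₀ hρ]; linarith
      linarith [hhH z hz, hh0 x]
    rcases eq_or_ne x z with rfl | hne'
    · simp
    have hD0 : 0 < dist x z := dist_pos.2 hne'
    -- Starting at the boundary point over x, a step of length t in direction η(z) reaches z + (h(x)
    -- + t)η(z). The perturbation needed has norm less than ρ because tρ = 2|x - z| exceeds |z - x|
    -- + HL|x - z|.
    set t := 2 / ρ * dist x z with ht
    have ht0 : 0 < t := by positivity
    have htρ : t * ρ = 2 * dist x z := by rw [ht]; field_simp
    have htlt : t < ρ := by nlinarith
    refine csInf_le (hbdd z) ⟨by linarith [hh0 x], ?_⟩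
    have hz1 : dist z (x + h x • η x) < ρ := by
      have h1 : dist x (x + h x • η x) ≤ H * M := by
        rw [dist_self_add_right, norm_smul, Real.norm_eq_abs, abs_of_nonneg (hh0 x)]
        exact mul_le_mul (hhH x hx) (hM x) (norm_nonneg _) hH0.le
      have := dist_triangle z x (x + h x • η x)
      rw [dist_comm z x] at this
      linarith
    have := hη.mem _ (hcl x hx) z hz1 t ht0 htlt
      (t⁻¹ • (z + h x • η z - (x + h x • η x))) ?_
    · rw [smul_add, smul_inv_smul₀ ht0.ne'] at this
      convert this using 1; module
    · rw [norm_smul, norm_inv, Real.norm_eq_abs, abs_of_pos ht0, inv_mul_lt_iff₀ ht0]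
      have e : z + h x • η z - (x + h x • η x) = (z - x) + h x • (η z - η x) := by module
      rw [e]
      have h1 : ‖h x • (η z - η x)‖ ≤ H * (L * dist x z) := by
        rw [norm_smul, Real.norm_eq_abs, abs_of_nonneg (hh0 x), dist_comm]
        exact mul_le_mul (hhH x hx) (hL z x) (norm_nonneg _) hH0.le
      have h2 : ‖z - x‖ = dist x z := by rw [dist_comm, dist_eq_norm]
      have := norm_add_le (z - x) (h x • (η z - η x))
      nlinarith
  have habs : ∀ x z, infDist x Ω < d → infDist z Ω < d → |h x - h z| ≤ 2 / ρ * dist x z := by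
    intro x z hx hz
    rw [abs_le]
    have h1 := hstep x z hx hz
    have h2 := hstep z x hz hx
    rw [dist_comm] at h2
    constructor <;> linarith
  -- With this c the overshoot c h |η| is at most hρ, hence at most the distance to Ω: the distance
  -- to the boundary does not increase.
  set c : ℝ := ρ / M with hc
  have hM0 : 0 < M := by linarith
  have hc0 : 0 < c := by positivity
  have hcM : c * M = ρ := by rw [hc]; field_simp
  have hc1 : c ≤ 1 := by rw [hc, div_le_one hM0]; linarith
  let Φ₀ : E n → E n := fun x => x + ((1 + c) * h x) • η x
  set L' : ℝ := 1 + 2 * (2 / ρ * M + L) with hL'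
  have hL'0 : 0 ≤ L' := by positivity
  have hlip : LipschitzOnWith L'.toNNReal Φ₀ {x | infDist x Ω < d} := by
    refine LipschitzOnWith.of_dist_le_mul fun x hx z hz => ?_
    rw [Real.coe_toNNReal _ hL'0, dist_eq_norm]
    have e : Φ₀ x - Φ₀ z = (x - z) + ((1 + c) * (h x - h z)) • η x
        + ((1 + c) * h z) • (η x - η z) := by
      simp only [Φ₀]; module
    rw [e]
    refine (norm_add₃_le).trans ?_
    have h1 : ‖((1 + c) * (h x - h z)) • η x‖ ≤ (2 * (2 / ρ * dist x z)) * M := by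
      rw [norm_smul, Real.norm_eq_abs, abs_mul, abs_of_pos (by linarith : 0 < 1 + c)]
      exact mul_le_mul (mul_le_mul (by linarith) (habs x z hx hz) (abs_nonneg _) zero_le_two)
        (hM x) (norm_nonneg _) (by positivity)
    have h2 : ‖((1 + c) * h z) • (η x - η z)‖ ≤ 2 * (L * dist x z) := by
      rw [norm_smul, Real.norm_eq_abs, abs_of_nonneg (mul_nonneg (by linarith) (hh0 z))]
      refine mul_le_mul ?_ (hL x z) (norm_nonneg _) zero_le_two
      have := hhH z hz
      have := hh0 z
      nlinarith
    rw [← dist_eq_norm]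
    calc _ ≤ dist x z + 2 * (2 / ρ * dist x z) * M + 2 * (L * dist x z) := by gcongr
      _ = L' * dist x z := by rw [hL']; ring
  -- The formula is Lipschitz on the d-neighbourhood only; the values of the extension elsewhere are
  -- irrelevant.
  obtain ⟨Φ, hΦ, hEq⟩ := hlip.extend_finite_dimension
  have hΦe : ∀ x, infDist x Ω < d → Φ x = x + ((1 + c) * h x) • η x := fun x hx => (hEq hx).symm
  have hpos : ∀ x, x ∉ closure Ω → infDist x Ω < d → 0 < h x := by
    intro x hx hxd
    refine (hh0 x).lt_of_ne fun h0 => hx ?_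
    have := hcl x hxd
    rwa [← h0, zero_smul, add_zero] at this
  have hmemΩ : ∀ x, x ∉ closure Ω → infDist x Ω < d → Φ x ∈ Ω := by
    intro x hx hxd
    have hp := hpos x hx hxd
    have hHx := hhH x hxd
    have := hη.mem _ (hcl x hxd) x ?_ (c * h x) (by positivity) (by nlinarith) 0 (by simpa)
    · rw [hΦe x hxd]
      convert this using 1; module
    · rw [dist_self_add_right, norm_smul, Real.norm_eq_abs, abs_of_pos hp]
      have := mul_le_mul hHx (hM x) (norm_nonneg _) hH0.le
      linarith
  refine ⟨Φ, _, (32 * M / (c * ρ)).toNNReal, d, hd0, hΦ, ?_, hmemΩ, ?_, ?_⟩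
  · intro x hx
    have h0 : infDist x Ω = 0 := (mem_closure_iff_infDist_zero hne).1 hx
    have h1 : infDist x Ω < d := by rw [h0]; exact hd0
    have h2 := hhd x h1
    have h3 : h x = 0 := le_antisymm (by rw [h0] at h2; nlinarith [hh0 x]) (hh0 x)
    rw [hΦe x h1, h3]; simp
  · intro x hx hxd
    have hp := hpos x hx hxd
    have hfr : x + h x • η x ∈ frontier Ω := by
      refine ⟨hcl x hxd, fun hint => ?_⟩
      rw [hΩo.interior_eq] at hint
      have hcont : Continuous fun t : ℝ => x + t • η x := by fun_prop
      -- If the endpoint were already in the open set Ω, a slightly smaller t would do, against the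
      -- infimum.
      have hev : ∀ᶠ t in 𝓝 (h x), x + t • η x ∈ Ω ∧ 0 < t :=
        ((hcont.continuousAt).eventually (hΩo.mem_nhds hint)).and (lt_mem_nhds hp)
      obtain ⟨t, htlt, ht1, ht2⟩ := hev.exists_lt
      exact absurd (csInf_le (hbdd x) ⟨ht2.le, ht1⟩) (not_le.2 htlt)
    refine (infDist_le_dist_of_mem hfr).trans ?_
    have e : Φ x - (x + h x • η x) = (c * h x) • η x := by rw [hΦe x hxd]; module
    rw [dist_eq_norm, e, norm_smul, Real.norm_eq_abs, abs_of_pos (by positivity)]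
    calc c * h x * ‖η x‖ ≤ c * h x * M := by gcongr; exact hM x
      _ = h x * ρ := by rw [← hcM]; ring
      _ ≤ _ := hhd x hxd
  · have key : ∀ x, x ∉ closure Ω → infDist x Ω < d → ∀ z, z ∉ closure Ω → infDist z Ω < d →
        h x ≤ h z → c * ρ * dist x z ≤ 32 * M * dist (Φ x) (Φ z) := by
      intro x hx hxd z hz hzd hxz
      by_contra! hlt
      set Δ := h z - h x with hΔ
      have hΔ0 : 0 ≤ Δ := by linarith
      set D := dist x z with hD
      have hD0 : 0 ≤ D := dist_nonneg
      set e := dist (Φ x) (Φ z) with he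
      have he0 : 0 ≤ e := dist_nonneg
      have hxH := hhH x hxd
      have hzH := hhH z hzd
      have hx0 := hh0 x
      have hΔH : Δ ≤ H := by linarith
      have hL1 : ‖η x - η z‖ ≤ L * D := hL x z
      have hL2 : ‖η z - η x‖ ≤ L * D := by rw [← norm_neg, neg_sub]; exact hL1
      have hDle : D ≤ e + 2 * Δ * M + 2 * H * (L * D) := by
        have e1 : x - z = (Φ x - Φ z) + ((1 + c) * Δ) • η z
            - ((1 + c) * h x) • (η x - η z) := by
          rw [hΦe x hxd, hΦe z hzd, hΔ]; module
        have h1 : ‖((1 + c) * Δ) • η z‖ ≤ 2 * Δ * M := by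
          rw [norm_smul, Real.norm_eq_abs, abs_of_nonneg (by positivity)]
          exact mul_le_mul (by nlinarith) (hM z) (norm_nonneg _) (by positivity)
        have h2 : ‖((1 + c) * h x) • (η x - η z)‖ ≤ 2 * H * (L * D) := by
          rw [norm_smul, Real.norm_eq_abs, abs_of_nonneg (by positivity)]
          exact mul_le_mul (by nlinarith) hL1 (norm_nonneg _) (by positivity)
        have h3 : D = ‖x - z‖ := dist_eq_norm x z
        have h4 : e = ‖Φ x - Φ z‖ := dist_eq_norm _ _
        have h5 := norm_sub_le ((Φ x - Φ z) + ((1 + c) * Δ) • η z)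
          (((1 + c) * h x) • (η x - η z))
        have h6 := norm_add_le (Φ x - Φ z) (((1 + c) * Δ) • η z)
        rw [← e1] at h5
        linarith
      have he4 : 4 * e ≤ D := by
        have : c * ρ ≤ 1 := by nlinarith
        have : c * ρ * D ≤ 1 * D := by gcongr
        have : e ≤ M * e := le_mul_of_one_le_left he0 hM1
        linarith
      have hHLD : 4 * (2 * H * (L * D)) ≤ D := by
        have : 32 * (H * L) * D ≤ 1 * D := by gcongr; linarith
        linarith
      have hDΔ : D ≤ 4 * M * Δ := by linarith
      have hDpos : 0 < D := by
        refine hD0.lt_of_ne fun h0 => ?_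
        rw [← h0] at hlt
        have : 0 ≤ 32 * M * e := by positivity
        linarith
      have hΔpos : 0 < Δ := by
        by_contra! h0
        have : 4 * M * Δ ≤ 0 := mul_nonpos_of_nonneg_of_nonpos (by positivity) h0
        linarith
      -- In Φ(x) - Φ(z) the overshoots differ by cΔ; advancing only half of it along η(x) from the
      -- boundary point of z lands exactly on x + (h(x) - T)η(x).
      set T := c * Δ / 2 with hT
      have hT0 : 0 < T := by positivity
      have hTH : T ≤ H := by rw [hT]; nlinarith
      have hmem := hη.mem _ (hcl z hzd) x ?_ T hT0 (by linarith)
        (T⁻¹ • ((Φ x - Φ z) + (c * h z) • (η z - η x))) ?_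
      · have e2 : z + h z • η z + T • (η x + T⁻¹ • ((Φ x - Φ z) + (c * h z) • (η z - η x)))
            = x + (h x - T) • η x := by
          rw [smul_add T, smul_inv_smul₀ hT0.ne', hΦe x hxd, hΦe z hzd, hT, hΔ]
          module
        rw [e2] at hmem
        rcases le_or_gt 0 (h x - T) with hk | hk
        · have := csInf_le (hbdd x) (a := h x - T) ⟨hk, hmem⟩
          change h x ≤ _ at this
          linarith
        · have h3 := hη.mem _ (subset_closure hmem) x ?_ (T - h x) (by linarith) (by linarith) 0
            (by simpa)
          · refine hx (subset_closure ?_)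
            convert h3 using 1; module
          · rw [dist_self_add_right, norm_smul, Real.norm_eq_abs, abs_of_neg hk]
            have : -(h x - T) * ‖η x‖ ≤ H * M :=
              mul_le_mul (by linarith) (hM x) (norm_nonneg _) hH0.le
            linarith
      · have h1 : dist z (z + h z • η z) ≤ H * M := by
          rw [dist_self_add_right, norm_smul, Real.norm_eq_abs, abs_of_nonneg (hh0 z)]
          exact mul_le_mul hzH (hM z) (norm_nonneg _) hH0.le
        have h2 := dist_triangle x z (z + h z • η z)
        have h3 : M * Δ ≤ M * H := by gcongr
        nlinarith
      · rw [norm_smul, norm_inv, Real.norm_eq_abs, abs_of_pos hT0, inv_mul_lt_iff₀ hT0]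
        have h1 : ‖(c * h z) • (η z - η x)‖ ≤ c * H * (L * D) := by
          rw [norm_smul, Real.norm_eq_abs, abs_of_nonneg (mul_nonneg hc0.le (hh0 z))]
          exact mul_le_mul (by gcongr) hL2 (norm_nonneg _) (by positivity)
        have h2 := norm_add_le (Φ x - Φ z) ((c * h z) • (η z - η x))
        rw [← dist_eq_norm (Φ x)] at h2
        change _ ≤ e + _ at h2
        have h3 : 32 * M * (c * H * (L * D)) ≤ c * ρ * D := by
          have : 32 * (H * M * L) * (c * D) ≤ ρ * (c * D) := by gcongr
          nlinarith
        have h4 : c * ρ * D ≤ c * ρ * (4 * M * Δ) := by gcongr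
        have h5 : 32 * M * (e + c * H * (L * D)) < 32 * M * (T * ρ) := by
          have e3 : 32 * M * (T * ρ) = 4 * (c * ρ * (4 * M * Δ)) := by rw [hT]; ring
          have : 0 < c * ρ * D := by positivity
          rw [e3]
          nlinarith
        have h6 := lt_of_mul_lt_mul_left h5 (by positivity)
        linarith
    have hfin : ∀ a b : ℝ, c * ρ * a ≤ 32 * M * b → a ≤ (32 * M / (c * ρ)).toNNReal * b := by
      intro a b hab
      rw [Real.coe_toNNReal _ (by positivity), div_mul_eq_mul_div, le_div_iff₀ (by positivity)]
      linarith
    intro x hx hxd z hz hzd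
    rcases le_total (h x) (h z) with hle | hle
    · exact hfin _ _ (key x hx hxd z hz hzd hle)
    · rw [dist_comm x, dist_comm (Φ x)]
      exact hfin _ _ (key z hz hzd x hx hxd hle)

end Reflection

/-! ### Density of smooth functions in H¹(Ω) -/

section Density

open Metric Filter Topology

variable {n : ℕ} {Ω : Set (E n)} {η : E n → E n} {ρ : ℝ}

theorem exists_smooth_approx_on_compact' {U K : Set (E n)} (hU : IsOpen U)
    (hUb : Bornology.IsBounded U) (hK : IsCompact K) (hKU : K ⊆ U) (p : H1 U) {τ : ℝ≥0∞}
    (hτ : τ ≠ 0) :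
    ∃ ψ : E n → ℝ, ContDiff ℝ ∞ ψ ∧ HasCompactSupport ψ ∧
      ∫⁻ x in K, ‖ψ x - h1Val p x‖ₑ ^ 2 ≤ τ ∧
      ∫⁻ x in K, ‖gradient ψ x - h1Grad p x‖ₑ ^ 2 ≤ τ := by
  obtain ⟨ψ, h1, h2, h3, h4⟩ := exists_smooth_approx_on_compact hU hUb hK hKU p
    (τ := min τ 1) (by simp [hτ])
  have h5 : min τ 1 ^ 2 ≤ τ := by
    rw [pow_two]
    exact (mul_le_mul' (min_le_left τ 1) (min_le_right τ 1)).trans_eq (mul_one τ)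
  exact ⟨ψ, h1, h2, (eLpNorm_two_le_iff.1 h3).trans h5, (eLpNorm_two_le_iff.1 h4).trans h5⟩

theorem exists_pos_sq_mul_le {a τ : ℝ≥0∞} (ha : a ≠ ⊤) (hτ : τ ≠ 0) :
    ∃ κ > (0 : ℝ), κ ≤ 1 ∧ ENNReal.ofReal κ ^ 2 * a ≤ τ := by
  obtain ⟨k, hk, hlt⟩ := ENNReal.exists_nnreal_pos_mul_lt ha hτ
  have hk' : (0 : ℝ) < NNReal.sqrt k := by exact_mod_cast NNReal.sqrt_pos.2 hk
  refine ⟨min (NNReal.sqrt k : ℝ) 1, lt_min hk' one_pos, min_le_right _ _, ?_⟩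
  refine le_trans ?_ hlt.le
  gcongr
  refine (pow_le_pow_left' (ENNReal.ofReal_le_ofReal (min_le_left _ _)) 2).trans_eq ?_
  rw [ENNReal.ofReal_coe_nnreal, ← ENNReal.coe_pow, NNReal.sq_sqrt]

theorem IsConeField.mapsTo_shift (h : IsConeField Ω η ρ) {t : ℝ} (ht : 0 < t) (htρ : t < ρ) :
    Set.MapsTo (fun x => x + t • η x) (closure Ω) Ω := by
  intro x hx
  simpa using h.mem x hx x (by simpa using h.pos) t ht htρ 0 (by simpa using h.pos)

theorem IsConeField.dist_le_shift {L : ℝ} (hL : ∀ x y, ‖η x - η y‖ ≤ L * dist x y) {t : ℝ}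
    (ht : 0 < t) (htL : t * L ≤ 1 / 2) (x y : E n) :
    dist x y ≤ (2 : NNReal) * dist (x + t • η x) (y + t • η y) := by
  have e : x - y = ((x + t • η x) - (y + t • η y)) - t • (η x - η y) := by module
  have h1 : ‖t • (η x - η y)‖ ≤ 1 / 2 * dist x y := by
    rw [norm_smul, Real.norm_eq_abs, abs_of_pos ht]
    have := mul_le_mul_of_nonneg_left (hL x y) ht.le
    have := mul_le_mul_of_nonneg_right htL (dist_nonneg (x := x) (y := y))
    linarith
  have h2 := norm_sub_le ((x + t • η x) - (y + t • η y)) (t • (η x - η y))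
  rw [← e, ← dist_eq_norm, ← dist_eq_norm] at h2
  push_cast
  linarith

/-- The inward shifts are continuous at `0` in `L²(Ω)`. -/
theorem IsConeField.exists_shift_le (h : IsConeField Ω η ρ)
    (hΩb : Bornology.IsBounded Ω) {F : Type*} [NormedAddCommGroup F] [NormedSpace ℝ F]
    (f : Lp F 2 (volume.restrict Ω)) {τ : ℝ≥0∞} (hτ : τ ≠ 0) :
    ∃ t₀ > (0 : ℝ), ∀ t, 0 < t → t < t₀ →
      ∫⁻ x in Ω, ‖f (x + t • η x) - f x‖ₑ ^ 2 ≤ τ := by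
  obtain ⟨M, L, hM1, hL0, hM, hL, -⟩ := h.exists_bounds
  obtain ⟨k, hk, hklt⟩ := ENNReal.exists_nnreal_pos_mul_lt
    (a := 2 * 2 ^ n + 4) (by finiteness) (ENNReal.half_pos hτ).ne'
  obtain ⟨k', hk', -, hklt'⟩ := exists_pos_sq_mul_le (a := 1) (τ := k) (by simp)
    (by exact_mod_cast hk.ne')
  rw [mul_one] at hklt'
  -- A continuous ζ of compact support approximates f; shifting ζ is harmless by uniform continuity,
  -- and shifting f - ζ costs a factor 2ⁿ at most.
  obtain ⟨ζ, hζc, hζ, hζcont, -⟩ := (Lp.memLp f).exists_hasCompactSupport_eLpNorm_sub_le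
    (by simp) (ε := ENNReal.ofReal k') (by simpa using hk')
  have hζ2 : ∫⁻ x in Ω, ‖f x - ζ x‖ₑ ^ 2 ≤ k := (eLpNorm_two_le_iff.1 hζ).trans hklt'
  have hfm : StronglyMeasurable f := Lp.stronglyMeasurable f
  have hvol : volume Ω ≠ ⊤ := hΩb.measure_lt_top.ne
  obtain ⟨κ, hκ, -, hκle⟩ := exists_pos_sq_mul_le (a := 4 * volume Ω) (τ := τ / 2) (by finiteness)
    (ENNReal.half_pos hτ).ne'
  obtain ⟨δ, hδ, hu⟩ := Metric.uniformContinuous_iff.1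
    (hζc.uniformContinuous_of_continuous hζcont) κ hκ
  refine ⟨min (δ / M) (min ρ (1 / (2 * (L + 1)))), lt_min (by positivity)
    (lt_min h.pos (by positivity)), fun t ht htlt => ?_⟩
  simp only [lt_min_iff] at htlt
  obtain ⟨ht1, ht2, ht3⟩ := htlt
  rw [lt_div_iff₀ (by positivity)] at ht1 ht3
  have htL : t * L ≤ 1 / 2 := by nlinarith
  have hs : Continuous fun x => x + t • η x :=
    continuous_id.add (h.contDiff.continuous.const_smul t)
  have hm1 : Measurable fun x => ‖f x - ζ x‖ₑ :=
    (hfm.sub hζcont.stronglyMeasurable).enorm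
  have hpiece : ∀ x, ‖ζ (x + t • η x) - ζ x‖ₑ ^ 2 ≤ ENNReal.ofReal κ ^ 2 := by
    intro x
    refine pow_le_pow_left' ?_ 2
    rw [← ofReal_norm, ← dist_eq_norm]
    refine ENNReal.ofReal_le_ofReal (hu ?_).le
    rw [dist_self_add_left, norm_smul, Real.norm_eq_abs, abs_of_pos ht]
    exact (mul_le_mul_of_nonneg_left (hM x) ht.le).trans_lt ht1
  have hA : ∫⁻ x in Ω, ‖f (x + t • η x) - ζ (x + t • η x)‖ₑ ^ 2 ≤ 2 ^ n * k := by
    refine (lintegral_comp_le_of_dist_le_mul (S := Ω) (T := Ω) (K := 2) hs.measurable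
      (fun x _ y _ => IsConeField.dist_le_shift hL ht htL x y)
      ((h.mapsTo_shift ht ht2).mono_left subset_closure) (hm1.pow_const 2)).trans ?_
    push_cast
    gcongr
  have hB : ∫⁻ x in Ω, ‖(ζ (x + t • η x) - ζ x) + (ζ x - f x)‖ₑ ^ 2
      ≤ 2 * (ENNReal.ofReal κ ^ 2 * volume Ω) + 2 * k := by
    refine (lintegral_add_sq_le _ _ ?_).trans ?_
    · exact ((hζcont.comp hs).sub hζcont).enorm.measurable.aemeasurable
    · gcongr
      · exact (lintegral_mono hpiece).trans_eq (by rw [setLIntegral_const])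
      · simpa only [enorm_sub_rev] using hζ2
  have hC := lintegral_add_sq_le (μ := volume.restrict Ω)
    (fun x => f (x + t • η x) - ζ (x + t • η x))
    (fun x => (ζ (x + t • η x) - ζ x) + (ζ x - f x))
    (hm1.comp hs.measurable).aemeasurable
  calc _ ≤ _ := le_of_eq (lintegral_congr fun x => by congr 2; abel)
    _ ≤ _ := hC
    _ ≤ 2 * (2 ^ n * k) + 2 * (2 * (ENNReal.ofReal κ ^ 2 * volume Ω) + 2 * k) := by gcongr
    _ = k * (2 * 2 ^ n + 4) + ENNReal.ofReal κ ^ 2 * (4 * volume Ω) := by ring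
    _ ≤ τ / 2 + τ / 2 := add_le_add hklt.le hκle
    _ = τ := ENNReal.add_halves τ

/-- The restrictions of smooth functions are dense in `H¹(Ω)`. -/
theorem IsConeField.exists_smooth_approx (h : IsConeField Ω η ρ) (hΩo : IsOpen Ω)
    (hΩb : Bornology.IsBounded Ω) (p : H1 Ω) {τ : ℝ≥0∞} (hτ : τ ≠ 0) :
    ∃ ψ : E n → ℝ, ContDiff ℝ ∞ ψ ∧ HasCompactSupport ψ ∧
      ∫⁻ x in Ω, ‖ψ x - h1Val p x‖ₑ ^ 2 ≤ τ ∧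
      ∫⁻ x in Ω, ‖gradient ψ x - h1Grad p x‖ₑ ^ 2 ≤ τ := by
  obtain ⟨M, L, hM1, hL0, hM, hL, hLd⟩ := h.exists_bounds
  have hum : StronglyMeasurable (h1Val p) := Lp.stronglyMeasurable _
  have hgm : StronglyMeasurable (h1Grad p) := Lp.stronglyMeasurable _
  have h8 : τ / 32 ≠ 0 := (ENNReal.div_pos hτ (by finiteness)).ne'
  obtain ⟨t₁, ht₁, h₁⟩ := h.exists_shift_le hΩb (h1Val p) h8
  obtain ⟨t₂, ht₂, h₂⟩ := h.exists_shift_le hΩb (h1Grad p) h8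
  set A : ℝ≥0∞ := 2 ^ n * ∫⁻ x in Ω, ‖h1Grad p x‖ₑ ^ 2 with hA
  have hAt : A ≠ ⊤ := by
    rw [hA, ← sq_eLpNorm_two]
    have := (Lp.memLp (h1Grad p)).eLpNorm_ne_top
    finiteness
  obtain ⟨κ, hκ, hκ1, hκle⟩ := exists_pos_sq_mul_le hAt h8
  obtain ⟨t, ht0, htlt⟩ := exists_between (lt_min (lt_min ht₁ ht₂) (lt_min h.pos
    (lt_min (a := 0) (b := κ / (L + 1)) (c := 1 / (2 * (L + 1))) (by positivity)
      (by positivity))))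
  simp only [lt_min_iff] at htlt
  obtain ⟨⟨htt1, htt2⟩, htρ, ht3, ht4⟩ := htlt
  rw [lt_div_iff₀ (by positivity)] at ht3 ht4
  have htL : t * L ≤ 1 / 2 := by nlinarith
  have htκ : t * L ≤ κ := by nlinarith
  let s : E n → E n := fun x => x + t • η x
  have hss : ContDiff ℝ ∞ s := contDiff_id.add (h.contDiff.const_smul t)
  have hs : Continuous s := hss.continuous
  have hanti : ∀ x y, dist x y ≤ (2 : NNReal) * dist (s x) (s y) :=
    fun x y => IsConeField.dist_le_shift hL ht0 htL x y
  -- The inward shift s sends the closure of Ω into a compact subset of Ω, where interior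
  -- approximation applies; ψ ∘ s is then smooth up to the boundary and beyond.
  set K := s '' closure Ω with hKdef
  have hK : IsCompact K :=
    (isCompact_of_isClosed_isBounded isClosed_closure hΩb.closure).image hs
  have hKΩ : K ⊆ Ω := Set.image_subset_iff.2 (h.mapsTo_shift ht0 htρ)
  have hmaps : Set.MapsTo s Ω K := fun x hx => ⟨x, subset_closure hx, rfl⟩
  obtain ⟨ψ, hψ, hψc, hψ1, hψ2⟩ := exists_smooth_approx_on_compact' hΩo hΩb hK hKΩ p
    (τ := τ / 32 / 2 ^ n) (ENNReal.div_pos h8 (by finiteness)).ne'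
  have hgψ := continuous_gradient hψ
  have hcomp : ∀ {G : E n → ℝ≥0∞} {c : ℝ≥0∞}, Measurable G →
      ∫⁻ x in K, G x ≤ c → ∫⁻ x in Ω, G (s x) ≤ 2 ^ n * c := by
    intro G c hG hc
    refine (lintegral_comp_le_of_dist_le_mul (S := Ω) (T := K) (K := 2) hs.measurable
      (fun x _ y _ => hanti x y) hmaps hG).trans ?_
    push_cast
    gcongr
  have hcancel : (2 : ℝ≥0∞) ^ n * (τ / 32 / 2 ^ n) = τ / 32 :=
    ENNReal.mul_div_cancel (by positivity) (by finiteness)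
  have hm1 : Measurable fun x => ‖ψ x - h1Val p x‖ₑ :=
    (hψ.continuous.stronglyMeasurable.sub hum).enorm
  have hm2 : Measurable fun x => ‖gradient ψ x - h1Grad p x‖ₑ :=
    (hgψ.stronglyMeasurable.sub hgm).enorm
  have i1 := hcomp (hm1.pow_const 2) hψ1
  have i2 := hcomp (hm2.pow_const 2) hψ2
  have i3 : ∫⁻ x in Ω, ‖h1Grad p (s x)‖ₑ ^ 2 ≤ A :=
    hcomp (hgm.enorm.pow_const 2) (lintegral_mono_set hKΩ)
  rw [hcancel] at i1 i2
  have hsplit : τ / 32 * 32 = τ := ENNReal.div_mul_cancel (by simp) (by simp)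
  refine ⟨ψ ∘ s, hψ.comp hss, ?_, ?_, ?_⟩
  · have : AntilipschitzWith 2 s := AntilipschitzWith.of_le_mul_dist fun x y => hanti x y
    refine hψc.comp_isClosedEmbedding (this.isClosedEmbedding ?_)
    have hη := h.hasCompactSupport.uniformContinuous_of_continuous h.contDiff.continuous
    exact uniformContinuous_id.add (hη.const_smul t)
  · have hC := lintegral_add_sq_le (μ := volume.restrict Ω)
      (fun x => ψ (s x) - h1Val p (s x)) (fun x => h1Val p (s x) - h1Val p x)
      (hm1.comp hs.measurable).aemeasurable
    calc _ ≤ _ := le_of_eq (lintegral_congr fun x => by simp)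
      _ ≤ _ := hC
      _ ≤ 2 * (τ / 32) + 2 * (τ / 32) := by
        gcongr
        exact h₁ t ht0 htt1
      _ ≤ τ / 32 * 32 := by
        rw [← add_mul, mul_comm]
        gcongr
        norm_num
      _ = τ := hsplit
  -- The derivative of s differs from the identity by t Dη, of norm at most tL ≤ κ.
  · have hgrad : ∀ x, ‖gradient (ψ ∘ s) x - gradient ψ (s x)‖ₑ
        ≤ ENNReal.ofReal κ * ‖gradient ψ (s x)‖ₑ := by
      intro x
      rw [← ofReal_norm, ← ofReal_norm, ← ENNReal.ofReal_mul hκ.le]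
      refine ENNReal.ofReal_le_ofReal ?_
      have hd : HasFDerivAt (ψ ∘ s) ((fderiv ℝ ψ (s x)).comp
          (ContinuousLinearMap.id ℝ (E n) + t • fderiv ℝ η x)) x := by
        refine ((hψ.differentiable (by simp)) (s x)).hasFDerivAt.comp x ?_
        exact (hasFDerivAt_id x).add
          (((h.contDiff.differentiable (by simp)) x).hasFDerivAt.const_smul t)
      have e : gradient (ψ ∘ s) x - gradient ψ (s x) = (InnerProductSpace.toDual ℝ (E n)).symm
          ((fderiv ℝ ψ (s x)).comp (t • fderiv ℝ η x)) := by
        rw [gradient, gradient, ← map_sub, hd.fderiv]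
        congr 1
        ext v
        simp
      rw [e, LinearIsometryEquiv.norm_map]
      refine (ContinuousLinearMap.opNorm_comp_le _ _).trans ?_
      rw [gradient, LinearIsometryEquiv.norm_map, mul_comm, norm_smul, Real.norm_eq_abs,
        abs_of_pos ht0]
      gcongr
      exact (mul_le_mul_of_nonneg_left (hLd x) ht0.le).trans htκ
    have i4 : ∫⁻ x in Ω, ‖gradient (ψ ∘ s) x - gradient ψ (s x)‖ₑ ^ 2
        ≤ 2 * (ENNReal.ofReal κ ^ 2 * (τ / 32)) + 2 * (τ / 32) := by
      have hC := lintegral_add_sq_le (μ := volume.restrict Ω)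
        (fun x => gradient ψ (s x) - h1Grad p (s x)) (fun x => h1Grad p (s x))
        (hm2.comp hs.measurable).aemeasurable
      simp only [sub_add_cancel] at hC
      calc _ ≤ ∫⁻ x in Ω, ENNReal.ofReal κ ^ 2 * ‖gradient ψ (s x)‖ₑ ^ 2 := by
            refine lintegral_mono fun x => ?_
            rw [← mul_pow]
            exact pow_le_pow_left' (hgrad x) 2
        _ = ENNReal.ofReal κ ^ 2 * ∫⁻ x in Ω, ‖gradient ψ (s x)‖ₑ ^ 2 :=
            lintegral_const_mul' _ _ (by finiteness)
        _ ≤ ENNReal.ofReal κ ^ 2 * (2 * (τ / 32) + 2 * A) := by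
            gcongr
            exact hC.trans (by gcongr)
        _ = 2 * (ENNReal.ofReal κ ^ 2 * (τ / 32)) + 2 * (ENNReal.ofReal κ ^ 2 * A) := by ring
        _ ≤ _ := by gcongr
    have hκ2 : ENNReal.ofReal κ ^ 2 ≤ 1 := pow_le_one' (by simpa using hκ1) 2
    have hC := lintegral_add_sq_le (μ := volume.restrict Ω)
      (fun x => gradient (ψ ∘ s) x - gradient ψ (s x))
      (fun x => (gradient ψ (s x) - h1Grad p (s x)) + (h1Grad p (s x) - h1Grad p x))
      ((continuous_gradient (hψ.comp hss)).sub (hgψ.comp hs)).enorm.measurable.aemeasurable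
    have hC' := lintegral_add_sq_le (μ := volume.restrict Ω)
      (fun x => gradient ψ (s x) - h1Grad p (s x)) (fun x => h1Grad p (s x) - h1Grad p x)
      (hm2.comp hs.measurable).aemeasurable
    calc _ ≤ _ := le_of_eq (lintegral_congr fun x => by congr 2; abel)
      _ ≤ _ := hC
      _ ≤ 2 * (2 * (1 * (τ / 32)) + 2 * (τ / 32)) + 2 * (2 * (τ / 32) + 2 * (τ / 32)) := by
        gcongr
        · exact i4.trans (by gcongr)
        · exact hC'.trans (by gcongr; exact h₂ t ht0 htt2)
      _ = τ / 32 * 16 := by ring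
      _ ≤ τ / 32 * 32 := by
        gcongr
        norm_num
      _ = τ := hsplit

end Density

/-! ### Calculus of weak gradients -/

section WeakGradient

open Metric Filter Topology

variable {n : ℕ}

theorem le_of_forall_ne_zero_le_mul_add {A B a : ℝ≥0∞} (ha : a ≠ ⊤)
    (h : ∀ τ : ℝ≥0∞, τ ≠ 0 → A ≤ a * τ + B) : A ≤ B := by
  refine ENNReal.le_of_forall_pos_le_add fun ε hε _ => ?_
  obtain ⟨k, hk, hlt⟩ := ENNReal.exists_nnreal_pos_mul_lt ha
    (by exact_mod_cast hε.ne' : (ε : ℝ≥0∞) ≠ 0)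
  refine (h k (by exact_mod_cast hk.ne')).trans ?_
  rw [add_comm]
  gcongr
  rw [mul_comm]
  exact hlt.le

theorem integrable_mul_of_memLp {α : Type*} [MeasurableSpace α] {μ : Measure α} {f g : α → ℝ}
    (hf : MemLp f 2 μ) (hg : MemLp g 2 μ) : Integrable (fun x => f x * g x) μ :=
  hf.integrable_mul hg

theorem sq_enorm_integral_mul_le {α : Type*} [MeasurableSpace α] {μ : Measure α} {f g : α → ℝ}
    (hf : AEStronglyMeasurable f μ) (hg : AEStronglyMeasurable g μ) :
    ‖∫ x, f x * g x ∂μ‖ₑ ^ 2 ≤ (∫⁻ x, ‖f x‖ₑ ^ 2 ∂μ) * ∫⁻ x, ‖g x‖ₑ ^ 2 ∂μ := by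
  have h := ENNReal.lintegral_mul_le_Lp_mul_Lq μ Real.HolderConjugate.two_two hf.enorm hg.enorm
  have h1 : ‖∫ x, f x * g x ∂μ‖ₑ ≤ ∫⁻ x, ‖f x‖ₑ * ‖g x‖ₑ ∂μ :=
    (enorm_integral_le_lintegral_enorm _).trans_eq (by simp only [enorm_mul])
  refine (pow_le_pow_left' (h1.trans h) 2).trans_eq ?_
  rw [mul_pow, ← ENNReal.rpow_natCast, ← ENNReal.rpow_natCast, ← ENNReal.rpow_mul,
    ← ENNReal.rpow_mul]
  norm_num

/-- `G` is the weak gradient of `u` in `U`, for functions rather than classes. -/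
def WeakGrad (U : Set (E n)) (u : E n → ℝ) (G : E n → E n) : Prop :=
  ∀ (i : Fin n) (ψ : E n → ℝ), ContDiff ℝ ∞ ψ → HasCompactSupport ψ → tsupport ψ ⊆ U →
    ∫ x in U, u x * partialDeriv ψ i x = - ∫ x in U, G x i * ψ x

theorem memLp_apply {U : Set (E n)} {G : E n → E n} (hG : MemLp G 2 (volume.restrict U))
    (i : Fin n) : MemLp (fun x => G x i) 2 (volume.restrict U) :=
  hG.continuousLinearMap_comp (EuclideanSpace.proj i : E n →L[ℝ] ℝ)

theorem partialDeriv_eq_zero_of_notMem {ψ : E n → ℝ} {x : E n} (hx : x ∉ tsupport ψ)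
    (i : Fin n) : partialDeriv ψ i x = 0 := by
  rw [partialDeriv, fderiv_of_notMem_tsupport ℝ hx]; rfl

theorem WeakGrad.iff_integral {U : Set (E n)} {u : E n → ℝ} {G : E n → E n} :
    WeakGrad U u G ↔ ∀ (i : Fin n) (ψ : E n → ℝ), ContDiff ℝ ∞ ψ → HasCompactSupport ψ →
      tsupport ψ ⊆ U → ∫ x, u x * partialDeriv ψ i x = - ∫ x, G x i * ψ x := by
  have key : ∀ (i : Fin n) (ψ : E n → ℝ), tsupport ψ ⊆ U →
      (∫ x in U, u x * partialDeriv ψ i x) = (∫ x, u x * partialDeriv ψ i x) ∧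
      (∫ x in U, G x i * ψ x) = ∫ x, G x i * ψ x := by
    intro i ψ hs
    constructor <;> refine setIntegral_eq_integral_of_forall_compl_eq_zero fun x hx => ?_
    · rw [partialDeriv_eq_zero_of_notMem fun h => hx (hs h), mul_zero]
    · rw [image_eq_zero_of_notMem_tsupport fun h => hx (hs h), mul_zero]
  refine forall₂_congr fun i ψ => ⟨fun h h1 h2 h3 => ?_, fun h h1 h2 h3 => ?_⟩
  · rw [← (key i ψ h3).1, ← (key i ψ h3).2]; exact h h1 h2 h3
  · rw [(key i ψ h3).1, (key i ψ h3).2]; exact h h1 h2 h3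

theorem WeakGrad.mono {U V : Set (E n)} (hVU : V ⊆ U) {u : E n → ℝ} {G : E n → E n}
    (h : WeakGrad U u G) : WeakGrad V u G := by
  rw [WeakGrad.iff_integral] at *
  exact fun i ψ h1 h2 h3 => h i ψ h1 h2 (h3.trans hVU)

/-- Weak gradients pass to limits in `L²`. -/
theorem WeakGrad.of_approx {U : Set (E n)} {u : E n → ℝ} {G : E n → E n}
    (hu : MemLp u 2 (volume.restrict U)) (hG : MemLp G 2 (volume.restrict U))
    (h : ∀ τ : ℝ≥0∞, τ ≠ 0 → ∃ (v : E n → ℝ) (w : E n → E n),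
      MemLp v 2 (volume.restrict U) ∧ MemLp w 2 (volume.restrict U) ∧ WeakGrad U v w ∧
      ∫⁻ x in U, ‖v x - u x‖ₑ ^ 2 ≤ τ ∧ ∫⁻ x in U, ‖w x - G x‖ₑ ^ 2 ≤ τ) :
    WeakGrad U u G := by
  intro i ψ h1 h2 h3
  have m1 := memLp_partialDeriv (U := U) h1 h2 i
  have m2 := memLp_test (U := U) h1 h2
  set a := ∫⁻ x in U, ‖partialDeriv ψ i x‖ₑ ^ 2 with ha
  set b := ∫⁻ x in U, ‖ψ x‖ₑ ^ 2 with hb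
  have hat : a ≠ ⊤ := by
    rw [ha, ← sq_eLpNorm_two]; exact ENNReal.pow_ne_top m1.eLpNorm_ne_top
  have hbt : b ≠ ⊤ := by
    rw [hb, ← sq_eLpNorm_two]; exact ENNReal.pow_ne_top m2.eLpNorm_ne_top
  have hX : ‖(∫ x in U, u x * partialDeriv ψ i x) + ∫ x in U, G x i * ψ x‖ₑ ^ 2 ≤ 0 := by
    refine le_of_forall_ne_zero_le_mul_add (a := 2 * a + 2 * b) (by finiteness) fun τ hτ => ?_
    obtain ⟨v, w, hv, hw, hvw, e1, e2⟩ := h τ hτ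
    have hGi := memLp_apply hG i
    have hwi := memLp_apply hw i
    have e : (∫ x in U, u x * partialDeriv ψ i x) + ∫ x in U, G x i * ψ x
        = -((∫ x in U, (v x - u x) * partialDeriv ψ i x)
          + ∫ x in U, (w x i - G x i) * ψ x) := by
      simp only [sub_mul]
      rw [integral_sub (integrable_mul_of_memLp hv m1) (integrable_mul_of_memLp hu m1),
        integral_sub (integrable_mul_of_memLp hwi m2) (integrable_mul_of_memLp hGi m2), hvw i ψ h1 h2 h3]
      ring
    rw [e, enorm_neg, add_zero]
    refine (enorm_add_sq_le _ _).trans ?_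
    have i1 := sq_enorm_integral_mul_le (hv.sub hu).1 m1.1
    have i2 := sq_enorm_integral_mul_le (hwi.sub hGi).1 m2.1
    have i3 : ∫⁻ x in U, ‖w x i - G x i‖ₑ ^ 2 ≤ τ := by
      refine (lintegral_mono fun x => ?_).trans e2
      refine pow_le_pow_left' ?_ 2
      rw [← ofReal_norm, ← ofReal_norm]
      exact ENNReal.ofReal_le_ofReal (PiLp.norm_apply_le (w x - G x) i)
    calc _ ≤ 2 * (τ * a) + 2 * (τ * b) := by
          gcongr
          · exact i1.trans (mul_le_mul' e1 le_rfl)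
          · exact i2.trans (mul_le_mul' i3 le_rfl)
      _ = _ := by ring
  have h0 : (∫ x in U, u x * partialDeriv ψ i x) + ∫ x in U, G x i * ψ x = 0 := by
    simpa using hX
  linarith

theorem partialDeriv_mul {χ ψ : E n → ℝ} (hχ : ContDiff ℝ ∞ χ) (hψ : ContDiff ℝ ∞ ψ)
    (i : Fin n) (x : E n) :
    partialDeriv (fun y => χ y * ψ y) i x = partialDeriv χ i x * ψ x + χ x * partialDeriv ψ i x := by
  have h := ((hχ.differentiable (by simp)) x).hasFDerivAt.mul
    ((hψ.differentiable (by simp)) x).hasFDerivAt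
  rw [partialDeriv, partialDeriv, partialDeriv,
    show (fun y => χ y * ψ y) = χ * ψ from rfl, h.fderiv]
  simp
  ring

theorem integral_partialDeriv_eq_zero {ψ : E n → ℝ} (h : ContDiff ℝ ∞ ψ)
    (hc : HasCompactSupport ψ) (i : Fin n) : ∫ x, partialDeriv ψ i x = 0 := by
  have hψ := h.lipschitzWith_of_hasCompactSupport hc (by simp)
  obtain ⟨D, hD⟩ := hψ
  have h1 := LipschitzWith.integral_lineDeriv_mul_eq (μ := (volume : Measure (E n)))
    (LipschitzWith.const (1 : ℝ)) hD hc (-basisVec i)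
  simp only [neg_neg, mul_one] at h1
  have h2 : ∀ x, lineDeriv ℝ ψ x (basisVec i) = partialDeriv ψ i x := fun x =>
    ((h.differentiable (by simp)) x).lineDeriv_eq_fderiv
  simp only [h2] at h1
  rw [← h1]
  have h3 : ∀ x : E n, lineDeriv ℝ (fun _ : E n => (1 : ℝ)) x (-basisVec i) = 0 := fun x => by
    simp [lineDeriv]
  simp [h3]

/-- The product of a cutoff function and a function with weak gradient in `U`, plus a constant. -/
theorem WeakGrad.const_add_cutoff_mul {U : Set (E n)} {w : E n → ℝ} {G : E n → E n}
    (hw : MemLp w 2 (volume.restrict U)) (hG : MemLp G 2 (volume.restrict U))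
    (h : WeakGrad U w G) {χ : E n → ℝ} (hχ : ContDiff ℝ ∞ χ) (hχc : HasCompactSupport χ)
    (hχU : tsupport χ ⊆ U) (m : ℝ) :
    WeakGrad Set.univ (fun x => m + χ x * w x) (fun x => χ x • G x + w x • gradient χ x) := by
  rw [WeakGrad.iff_integral]
  intro i ψ h1 h2 _
  have hχψ : ContDiff ℝ ∞ fun x => χ x * ψ x := hχ.mul h1
  have hχψc : HasCompactSupport fun x => χ x * ψ x := hχc.mul_right
  have hsub : tsupport (fun x => χ x * ψ x) ⊆ U := (tsupport_mul_subset_left).trans hχU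
  have hGi := memLp_apply hG i
  have hwt := h i _ hχψ hχψc hsub
  have hb : Continuous fun x => partialDeriv χ i x * ψ x :=
    (continuous_partialDeriv hχ i).mul h1.continuous
  have hbm : MemLp (fun x => partialDeriv χ i x * ψ x) 2 (volume.restrict U) :=
    hb.memLp_of_hasCompactSupport h2.mul_left
  have hdm := memLp_partialDeriv (U := U) hχψ hχψc i
  have hχm := memLp_test (U := U) hχψ hχψc
  have I1 : Integrable (fun x => χ x * w x * partialDeriv ψ i x) (volume.restrict U) := by
    refine ((integrable_mul_of_memLp hw hdm).sub (integrable_mul_of_memLp hw hbm)).congr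
      (Eventually.of_forall fun x => ?_)
    simp only [Pi.sub_apply, partialDeriv_mul hχ h1]
    ring
  have hz : ∀ x, x ∉ U → χ x = 0 := fun x hx =>
    image_eq_zero_of_notMem_tsupport fun h' => hx (hχU h')
  have hz' : ∀ x, x ∉ U → partialDeriv χ i x = 0 := fun x hx =>
    partialDeriv_eq_zero_of_notMem (fun h' => hx (hχU h')) i
  have I2 : Integrable (fun x => χ x * w x * partialDeriv ψ i x) volume := by
    refine (integrableOn_iff_integrable_of_support_subset (s := U) fun x hx => ?_).1 I1
    by_contra hxU
    exact hx (by simp [hz x hxU])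
  have I3 : Integrable (fun x => m * partialDeriv ψ i x) volume :=
    ((continuous_partialDeriv h1 i).integrable_of_hasCompactSupport
      (h2.fderiv_apply ℝ _)).const_mul m
  have e1 : ∫ x, (m + χ x * w x) * partialDeriv ψ i x
      = ∫ x in U, χ x * w x * partialDeriv ψ i x := by
    simp only [add_mul]
    rw [integral_add I3 I2, integral_const_mul, integral_partialDeriv_eq_zero h1 h2, mul_zero,
      zero_add, setIntegral_eq_integral_of_forall_compl_eq_zero]
    intro x hx
    simp [hz x hx]
  have e2 : ∫ x, (χ x • G x + w x • gradient χ x) i * ψ x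
      = ∫ x in U, (G x i * (χ x * ψ x) + w x * (partialDeriv χ i x * ψ x)) := by
    rw [← setIntegral_eq_integral_of_forall_compl_eq_zero (s := U)]
    · refine integral_congr_ae (Eventually.of_forall fun x => ?_)
      simp only [PiLp.add_apply, PiLp.smul_apply, smul_eq_mul, gradient_apply]
      ring
    · intro x hx
      simp [gradient_apply, hz x hx, hz' x hx]
  rw [e1, e2, integral_add (integrable_mul_of_memLp hGi hχm) (integrable_mul_of_memLp hw hbm)]
  have e3 : ∫ x in U, χ x * w x * partialDeriv ψ i x
      = (∫ x in U, w x * partialDeriv (fun y => χ y * ψ y) i x)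
        - ∫ x in U, w x * (partialDeriv χ i x * ψ x) := by
    rw [← integral_sub (integrable_mul_of_memLp hw hdm) (integrable_mul_of_memLp hw hbm)]
    refine integral_congr_ae (Eventually.of_forall fun x => ?_)
    simp only [partialDeriv_mul hχ h1]
    ring
  rw [e3, hwt]
  ring

/-- The chain rule for a smooth function of a Lipschitz map. -/
theorem weakGrad_comp_lipschitz {ψ : E n → ℝ} (hψ : ContDiff ℝ ∞ ψ) (hψc : HasCompactSupport ψ)
    {Φ : E n → E n} {L : NNReal} (hΦ : LipschitzWith L Φ) :
    WeakGrad Set.univ (fun x => ψ (Φ x))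
      (fun x => ContinuousLinearMap.adjoint (fderiv ℝ Φ x) (gradient ψ (Φ x))) := by
  rw [WeakGrad.iff_integral]
  intro i ξ h1 h2 _
  obtain ⟨D, hD⟩ := hψ.lipschitzWith_of_hasCompactSupport hψc (by simp)
  obtain ⟨D', hD'⟩ := h1.lipschitzWith_of_hasCompactSupport h2 (by simp)
  have h := LipschitzWith.integral_lineDeriv_mul_eq (μ := (volume : Measure (E n)))
    (hD.comp hΦ) hD' h2 (basisVec i)
  have e1 : ∫ x, lineDeriv ℝ (ψ ∘ Φ) x (basisVec i) * ξ x
      = ∫ x, ContinuousLinearMap.adjoint (fderiv ℝ Φ x) (gradient ψ (Φ x)) i * ξ x := by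
    refine integral_congr_ae ?_
    -- Rademacher's theorem: Φ is differentiable almost everywhere, so the classical chain rule
    -- identifies the line derivatives.
    filter_upwards [hΦ.ae_differentiableAt] with x hx
    have hc := ((hψ.differentiable (by simp)) (Φ x)).hasFDerivAt.comp x hx.hasFDerivAt
    rw [hc.differentiableAt.lineDeriv_eq_fderiv, hc.fderiv]
    congr 1
    have : ContinuousLinearMap.adjoint (fderiv ℝ Φ x) (gradient ψ (Φ x)) i
        = inner ℝ (ContinuousLinearMap.adjoint (fderiv ℝ Φ x) (gradient ψ (Φ x)))
          (basisVec i) := by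
      rw [EuclideanSpace.inner_single_right]; simp
    rw [this, ContinuousLinearMap.adjoint_inner_left, inner_gradient_left]
    rfl
  have e2 : ∫ x, lineDeriv ℝ ξ x (-basisVec i) * (ψ ∘ Φ) x
      = - ∫ x, ψ (Φ x) * partialDeriv ξ i x := by
    rw [← integral_neg]
    refine integral_congr_ae (Eventually.of_forall fun x => ?_)
    simp only
    rw [((h1.differentiable (by simp)) x).lineDeriv_eq_fderiv, map_neg, partialDeriv]
    simp only [Function.comp_apply]
    ring
  rw [← e1, h, e2, neg_neg]

/-- The element of `H¹(U)` defined by a function and its weak gradient. -/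
noncomputable def mkH1 {U : Set (E n)} {u : E n → ℝ} {G : E n → E n} (hu : MemLp u 2 (volume.restrict U))
    (hG : MemLp G 2 (volume.restrict U)) (h : WeakGrad U u G) : H1 U :=
  ⟨WithLp.toLp 2 (hu.toLp u, hG.toLp G), by
    intro i ψ h1 h2 h3
    have e1 : ∫ x in U, hu.toLp u x * partialDeriv ψ i x
        = ∫ x in U, u x * partialDeriv ψ i x := by
      refine integral_congr_ae ?_
      filter_upwards [hu.coeFn_toLp] with x hx
      rw [hx]
    have e2 : ∫ x in U, hG.toLp G x i * ψ x = ∫ x in U, G x i * ψ x := by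
      refine integral_congr_ae ?_
      filter_upwards [hG.coeFn_toLp] with x hx
      rw [hx]
    exact e1.trans ((h i ψ h1 h2 h3).trans (congrArg Neg.neg e2.symm))⟩

end WeakGradient

/-! ### Pulling back by the reflection -/

section Extension

open Metric Filter Topology

variable {n : ℕ} {Ω : Set (E n)} {Φ : E n → E n} {L K : NNReal} {d : ℝ}

theorem isOpen_infDist_lt (S : Set (E n)) (δ : ℝ) : IsOpen {x | infDist x S < δ} :=
  isOpen_lt (continuous_infDist_pt S) continuous_const

theorem isBounded_infDist_lt {S : Set (E n)} (hS : Bornology.IsBounded S) (hne : S.Nonempty)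
    (δ : ℝ) : Bornology.IsBounded {x | infDist x S < δ} := by
  refine (hS.thickening (δ := δ)).subset fun x hx => ?_
  obtain ⟨y, hy, hxy⟩ := (infDist_lt_iff hne).1 hx
  exact mem_thickening_iff.2 ⟨y, hy, hxy⟩

/-- Off the null frontier, Φ sends the outer layer of width δ into the inner layer of the same
width, with volume distortion at most Kⁿ. All bounds of the extension by the boundary layer of Ω
come from here. -/
theorem IsReflection.lintegral_comp_diff_le (h : IsReflection Ω Φ L K d) (hΩo : IsOpen Ω)
    (hfr : volume (frontier Ω) = 0) {δ : ℝ} (hδ : δ ≤ d) {F : E n → ℝ≥0∞} (hF : Measurable F) :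
    ∫⁻ x in {x | infDist x Ω < δ} \ Ω, F (Φ x)
      ≤ (K : ℝ≥0∞) ^ n * ∫⁻ x in Ω ∩ {x | infDist x (frontier Ω) < δ}, F x := by
  have hsub : {x | infDist x Ω < δ} \ Ω ⊆ ({x | infDist x Ω < δ} \ closure Ω) ∪ frontier Ω := by
    rintro x ⟨hx, hxΩ⟩
    by_cases hc : x ∈ closure Ω
    · exact Or.inr ⟨hc, by rwa [hΩo.interior_eq]⟩
    · exact Or.inl ⟨hx, hc⟩
  calc _ ≤ ∫⁻ x in ({x | infDist x Ω < δ} \ closure Ω) ∪ frontier Ω, F (Φ x) :=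
        lintegral_mono_set hsub
    _ ≤ (∫⁻ x in {x | infDist x Ω < δ} \ closure Ω, F (Φ x)) + ∫⁻ x in frontier Ω, F (Φ x) :=
        lintegral_union_le _ _ _
    _ = ∫⁻ x in {x | infDist x Ω < δ} \ closure Ω, F (Φ x) := by
        rw [setLIntegral_measure_zero _ _ hfr, add_zero]
    _ ≤ _ := by
        refine lintegral_comp_le_of_dist_le_mul h.lipschitz.continuous.measurable ?_ ?_ hF
        · exact fun x hx y hy => h.dist_le x hx.2 (hx.1.trans_le hδ) y hy.2 (hy.1.trans_le hδ)
        · exact fun x hx => ⟨h.mem x hx.2 (hx.1.trans_le hδ),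
            (h.infDist_le x hx.2 (hx.1.trans_le hδ)).trans_lt hx.1⟩

theorem IsReflection.lintegral_comp_le (h : IsReflection Ω Φ L K d) (hΩo : IsOpen Ω)
    (hfr : volume (frontier Ω) = 0) {F : E n → ℝ≥0∞} (hF : Measurable F) :
    ∫⁻ x in {x | infDist x Ω < d}, F (Φ x) ≤ (1 + K ^ n : NNReal) * ∫⁻ x in Ω, F x := by
  calc _ ≤ ∫⁻ x in Ω ∪ ({x | infDist x Ω < d} \ Ω), F (Φ x) :=
        lintegral_mono_set (by rw [Set.union_sdiff_self]; exact Set.subset_union_right)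
    _ ≤ (∫⁻ x in Ω, F (Φ x)) + ∫⁻ x in {x | infDist x Ω < d} \ Ω, F (Φ x) :=
        lintegral_union_le _ _ _
    _ ≤ (∫⁻ x in Ω, F x) + (K : ℝ≥0∞) ^ n * ∫⁻ x in Ω, F x := by
        refine add_le_add (le_of_eq ?_) ((h.lintegral_comp_diff_le hΩo hfr le_rfl hF).trans ?_)
        · exact setLIntegral_congr_fun hΩo.measurableSet fun x hx => by
            rw [h.eq_self x (subset_closure hx)]
        · gcongr
          exact Set.inter_subset_left
    _ = _ := by push_cast; ring

/-- The integral bound applied to indicators of null sets. It makes composition with Φ meaningful on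
classes modulo null sets, hence linear. -/
theorem IsReflection.quasiMeasurePreserving (h : IsReflection Ω Φ L K d) (hΩo : IsOpen Ω)
    (hfr : volume (frontier Ω) = 0) :
    Measure.QuasiMeasurePreserving Φ (volume.restrict {x | infDist x Ω < d})
      (volume.restrict Ω) := by
  refine ⟨h.lipschitz.continuous.measurable, Measure.AbsolutelyContinuous.mk fun A hA h0 => ?_⟩
  rw [Measure.map_apply h.lipschitz.continuous.measurable hA,
    ← lintegral_indicator_one (h.lipschitz.continuous.measurable hA)]
  have h1 := h.lintegral_comp_le hΩo hfr (F := A.indicator 1) (measurable_one.indicator hA)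
  rw [lintegral_indicator_one hA, h0, mul_zero] at h1
  exact le_antisymm h1 zero_le

/-- The pull-back of a gradient by `Φ`. -/
noncomputable def pullGrad (Φ : E n → E n) (g : E n → E n) (x : E n) : E n :=
  ContinuousLinearMap.adjoint (fderiv ℝ Φ x) (g (Φ x))

theorem enorm_pullGrad_le (hΦ : LipschitzWith L Φ) (g : E n → E n) (x : E n) :
    ‖pullGrad Φ g x‖ₑ ≤ L * ‖g (Φ x)‖ₑ := by
  have h1 : ‖pullGrad Φ g x‖ ≤ L * ‖g (Φ x)‖ := by
    refine (ContinuousLinearMap.le_opNorm _ _).trans ?_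
    rw [LinearIsometryEquiv.norm_map]
    gcongr
    exact norm_fderiv_le_of_lipschitz ℝ hΦ
  rw [← ofReal_norm, ← ofReal_norm, ← ENNReal.ofReal_coe_nnreal, ← ENNReal.ofReal_mul (NNReal.coe_nonneg L)]
  exact ENNReal.ofReal_le_ofReal h1

theorem pullGrad_sub (Φ : E n → E n) (g g' : E n → E n) (x : E n) :
    pullGrad Φ g x - pullGrad Φ g' x = pullGrad Φ (fun y => g y - g' y) x := by
  simp only [pullGrad, map_sub]

theorem stronglyMeasurable_pullGrad (hΦ : Continuous Φ) {g : E n → E n}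
    (hg : StronglyMeasurable g) : StronglyMeasurable (pullGrad Φ g) := by
  have h1 : StronglyMeasurable fun x => ContinuousLinearMap.adjoint (fderiv ℝ Φ x) :=
    (LinearIsometryEquiv.continuous _).comp_stronglyMeasurable
      (measurable_fderiv ℝ Φ).stronglyMeasurable
  exact isBoundedBilinearMap_apply.continuous.comp_stronglyMeasurable
    (h1.prodMk (hg.comp_measurable hΦ.measurable))

theorem memLp_of_lintegral_le {α β F G : Type*} [MeasurableSpace α] [MeasurableSpace β]
    [NormedAddCommGroup F] [NormedAddCommGroup G] {μ : Measure α} {ν : Measure β} {f : α → F}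
    {g : β → G} (hf : AEStronglyMeasurable f μ) (hg : MemLp g 2 ν) {C : ℝ≥0∞} (hC : C ≠ ⊤)
    (h : ∫⁻ x, ‖f x‖ₑ ^ 2 ∂μ ≤ C * ∫⁻ x, ‖g x‖ₑ ^ 2 ∂ν) : MemLp f 2 μ := by
  refine ⟨hf, ?_⟩
  have h1 : ∫⁻ x, ‖f x‖ₑ ^ 2 ∂μ ≠ ⊤ := by
    refine ne_top_of_le_ne_top ?_ h
    rw [← sq_eLpNorm_two]
    have := hg.eLpNorm_ne_top
    finiteness
  rw [← sq_eLpNorm_two] at h1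
  exact (ENNReal.pow_ne_top_iff.1 h1).resolve_right two_ne_zero |>.lt_top

theorem IsReflection.memLp_comp (h : IsReflection Ω Φ L K d) (hΩo : IsOpen Ω)
    (hfr : volume (frontier Ω) = 0) {u : E n → ℝ} (hum : StronglyMeasurable u)
    (hu : MemLp u 2 (volume.restrict Ω)) :
    MemLp (fun x => u (Φ x)) 2 (volume.restrict {x | infDist x Ω < d}) :=
  memLp_of_lintegral_le (hum.comp_measurable h.lipschitz.continuous.measurable).aestronglyMeasurable
    hu (by finiteness) (h.lintegral_comp_le hΩo hfr (hum.enorm.pow_const 2))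

theorem IsReflection.lintegral_pullGrad_le (h : IsReflection Ω Φ L K d) (hΩo : IsOpen Ω)
    (hfr : volume (frontier Ω) = 0) {g : E n → E n} (hgm : StronglyMeasurable g) :
    ∫⁻ x in {x | infDist x Ω < d}, ‖pullGrad Φ g x‖ₑ ^ 2
      ≤ (L ^ 2 * (1 + K ^ n) : NNReal) * ∫⁻ x in Ω, ‖g x‖ₑ ^ 2 := by
  calc _ ≤ ∫⁻ x in {x | infDist x Ω < d}, (L : ℝ≥0∞) ^ 2 * ‖g (Φ x)‖ₑ ^ 2 := by
        refine lintegral_mono fun x => ?_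
        rw [← mul_pow]
        exact pow_le_pow_left' (enorm_pullGrad_le h.lipschitz g x) 2
    _ = (L : ℝ≥0∞) ^ 2 * ∫⁻ x in {x | infDist x Ω < d}, ‖g (Φ x)‖ₑ ^ 2 :=
        lintegral_const_mul' _ _ (by finiteness)
    _ ≤ (L : ℝ≥0∞) ^ 2 * ((1 + K ^ n : NNReal) * ∫⁻ x in Ω, ‖g x‖ₑ ^ 2) := by
        gcongr
        exact h.lintegral_comp_le hΩo hfr (hgm.enorm.pow_const 2)
    _ = _ := by push_cast; ring

theorem IsReflection.memLp_pullGrad (h : IsReflection Ω Φ L K d) (hΩo : IsOpen Ω)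
    (hfr : volume (frontier Ω) = 0) {g : E n → E n} (hgm : StronglyMeasurable g)
    (hg : MemLp g 2 (volume.restrict Ω)) :
    MemLp (pullGrad Φ g) 2 (volume.restrict {x | infDist x Ω < d}) :=
  memLp_of_lintegral_le
    (stronglyMeasurable_pullGrad h.lipschitz.continuous hgm).aestronglyMeasurable
    hg (by finiteness) (h.lintegral_pullGrad_le hΩo hfr hgm)

/-- The chain rule holds for smooth functions; pulling back is bounded in L² for values and
gradients, so density of smooth functions in H¹(Ω) gives the general case. -/
theorem IsReflection.weakGrad {η : E n → E n} {ρ : ℝ} (hη : IsConeField Ω η ρ)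
    (h : IsReflection Ω Φ L K d) (hΩo : IsOpen Ω) (hΩb : Bornology.IsBounded Ω) (p : H1 Ω) :
    WeakGrad {x | infDist x Ω < d} (fun x => h1Val p (Φ x)) (pullGrad Φ (h1Grad p)) := by
  have hfr := hη.volume_frontier hΩo
  have hum : StronglyMeasurable (h1Val p) := Lp.stronglyMeasurable _
  have hgm : StronglyMeasurable (h1Grad p) := Lp.stronglyMeasurable _
  refine WeakGrad.of_approx (h.memLp_comp hΩo hfr hum (Lp.memLp _))
    (h.memLp_pullGrad hΩo hfr hgm (Lp.memLp _)) fun τ hτ => ?_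
  set C : NNReal := (1 + L ^ 2) * (1 + K ^ n) with hC
  have hC0 : (C : ℝ≥0∞) ≠ 0 := by
    rw [hC]
    exact_mod_cast (by positivity : (0 : NNReal) < (1 + L ^ 2) * (1 + K ^ n)).ne'
  have hCτ : (C : ℝ≥0∞) * (τ / C) = τ := ENNReal.mul_div_cancel hC0 (by simp)
  obtain ⟨ψ, hψ, hψc, h1, h2⟩ := hη.exists_smooth_approx hΩo hΩb p
    (τ := τ / C) (ENNReal.div_pos hτ (by simp)).ne'
  have hgψ := continuous_gradient hψ
  refine ⟨fun x => ψ (Φ x), pullGrad Φ (gradient ψ),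
    h.memLp_comp hΩo hfr hψ.continuous.stronglyMeasurable (memLp_test hψ hψc),
    h.memLp_pullGrad hΩo hfr hgψ.stronglyMeasurable
      (hgψ.memLp_of_hasCompactSupport (hasCompactSupport_gradient hψc)),
    (weakGrad_comp_lipschitz hψ hψc h.lipschitz).mono (Set.subset_univ _), ?_, ?_⟩
  · refine (h.lintegral_comp_le hΩo hfr (F := fun x => ‖ψ x - h1Val p x‖ₑ ^ 2)
      ((hψ.continuous.stronglyMeasurable.sub hum).enorm.pow_const 2)).trans ?_
    rw [← hCτ]
    gcongr
    rw [hC]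
    exact le_mul_of_one_le_left zero_le (by simp)
  · simp only [pullGrad_sub]
    refine (h.lintegral_pullGrad_le hΩo hfr (hgψ.stronglyMeasurable.sub hgm)).trans ?_
    rw [← hCτ]
    gcongr
    · rw [hC]
      gcongr
      simp
    · exact h2

/-- The Poincaré-Wirtinger inequality on a bounded connected Lipschitz domain. -/
theorem IsReflection.exists_poincare {η : E n → E n} {ρ : ℝ} (hη : IsConeField Ω η ρ)
    (h : IsReflection Ω Φ L K d) (hΩo : IsOpen Ω) (hΩc : IsConnected Ω)
    (hΩb : Bornology.IsBounded Ω) :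
    ∃ C : NNReal, ∀ p : H1 Ω, ∫⁻ x in Ω, ‖h1Val p x - ⨍ y in Ω, h1Val p y‖ₑ ^ 2
      ≤ C * ∫⁻ x in Ω, ‖h1Grad p x‖ₑ ^ 2 := by
  have hfr := hη.volume_frontier hΩo
  obtain ⟨C, hC⟩ := exists_poincare_thickening hΩc hΩb (half_pos h.pos)
  have : IsFiniteMeasure (volume.restrict Ω) := ⟨by simpa using hΩb.measure_lt_top⟩
  refine ⟨16 * C * (L ^ 2 * (1 + K ^ n)), fun p => ?_⟩
  have hum : StronglyMeasurable (h1Val p) := Lp.stronglyMeasurable _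
  have hgm : StronglyMeasurable (h1Grad p) := Lp.stronglyMeasurable _
  set N : Set (E n) := {x | infDist x Ω < d} with hN
  have hNo : IsOpen N := isOpen_infDist_lt Ω d
  have hmu := h.memLp_comp hΩo hfr hum (Lp.memLp _)
  have hmg := h.memLp_pullGrad hΩo hfr hgm (Lp.memLp _)
  -- The reflected function lives on a neighbourhood of the closed (d/2)-neighbourhood of Ω. It is
  -- approximated there by smooth functions, for which the Poincaré inequality with gradient on the
  -- larger set is available; the reflected gradient is controlled by that on Ω.
  let w := mkH1 hmu hmg (h.weakGrad hη hΩo hΩb p)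
  have hKN : cthickening (d / 2) Ω ⊆ N := by
    intro x hx
    rw [cthickening_eq_preimage_infEDist] at hx
    have h1 : infDist x Ω ≤ d / 2 := ENNReal.toReal_le_of_le_ofReal (half_pos h.pos).le hx
    have := h.pos
    change infDist x Ω < d
    linarith
  have hKc : IsCompact (cthickening (d / 2) Ω) :=
    isCompact_of_isClosed_isBounded isClosed_cthickening hΩb.cthickening
  have hΩN : Ω ⊆ N := (self_subset_cthickening Ω).trans hKN
  refine le_of_forall_ne_zero_le_mul_add (a := 8 + 16 * C) (by finiteness) fun τ hτ => ?_
  obtain ⟨ψ, hψ, hψc, h1, h2⟩ := exists_smooth_approx_on_compact' hNo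
    (isBounded_infDist_lt hΩb hΩc.nonempty d) hKc hKN w hτ
  obtain ⟨m, hm⟩ := hC ψ hψ
  have hgψ := continuous_gradient hψ
  have e1 : ∫⁻ x in Ω, ‖ψ x - h1Val p x‖ₑ ^ 2 ≤ τ := by
    refine le_trans (le_of_eq ?_) ((lintegral_mono_set (self_subset_cthickening (δ := d / 2) Ω)).trans h1)
    refine lintegral_congr_ae ?_
    have h3 : ∀ᵐ x ∂(volume.restrict Ω), h1Val w x = h1Val p (Φ x) :=
      ae_restrict_of_ae_restrict_of_subset hΩN hmu.coeFn_toLp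
    filter_upwards [h3, ae_restrict_mem hΩo.measurableSet] with x hx hxΩ
    rw [hx, h.eq_self x (subset_closure hxΩ)]
  have e2 : ∫⁻ x in cthickening (d / 2) Ω, ‖gradient ψ x‖ₑ ^ 2
      ≤ 2 * τ + 2 * ((L ^ 2 * (1 + K ^ n) : NNReal) * ∫⁻ x in Ω, ‖h1Grad p x‖ₑ ^ 2) := by
    have h3 := lintegral_add_sq_le (μ := volume.restrict (cthickening (d / 2) Ω))
      (fun x => gradient ψ x - h1Grad w x) (fun x => h1Grad w x)
      (hgψ.stronglyMeasurable.sub (Lp.stronglyMeasurable _)).enorm.aemeasurable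
    simp only [sub_add_cancel] at h3
    refine h3.trans ?_
    gcongr
    refine le_trans ((lintegral_mono_set hKN).trans (le_of_eq (lintegral_congr_ae ?_)))
      (h.lintegral_pullGrad_le hΩo hfr hgm)
    filter_upwards [hmg.coeFn_toLp] with x hx
    exact congrArg (fun a => ‖a‖ₑ ^ 2) hx
  have e3 := lintegral_add_sq_le (μ := volume.restrict Ω)
    (fun x => h1Val p x - ψ x) (fun x => ψ x - m)
    (hum.sub hψ.continuous.stronglyMeasurable).enorm.aemeasurable
  simp only [sub_add_sub_cancel] at e3
  refine (lintegral_sub_average_le_sub_const ((Lp.memLp (h1Val p)).integrable (by norm_num)) m).trans ?_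
  calc _ ≤ 4 * (2 * τ + 2 * (C * (2 * τ + 2 * ((L ^ 2 * (1 + K ^ n) : NNReal) *
          ∫⁻ x in Ω, ‖h1Grad p x‖ₑ ^ 2)))) := by
        gcongr
        refine e3.trans ?_
        gcongr
        · simpa only [enorm_sub_rev] using e1
        · exact hm.trans (by gcongr)
    _ = _ := by push_cast; ring

/-- A smooth cutoff function between two neighbourhoods of a bounded set. -/
theorem exists_cutoff {S : Set (E n)} (hS : Bornology.IsBounded S) (hne : S.Nonempty) {a b : ℝ}
    (hab : a < b) : ∃ χ : E n → ℝ, ContDiff ℝ ∞ χ ∧ HasCompactSupport χ ∧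
      tsupport χ ⊆ {x | infDist x S < b} ∧ ∀ x, infDist x S < a → χ x = 1 := by
  obtain ⟨c, hac, hcb⟩ := exists_between hab
  obtain ⟨c', hcc', hcb'⟩ := exists_between hcb
  have hcont := continuous_infDist_pt S
  obtain ⟨f, h0, h1, -⟩ := exists_contMDiffMap_zero_one_of_isClosed
    (modelWithCornersSelf ℝ (E n)) (n := (⊤ : ℕ∞)) (s := {x | c' ≤ infDist x S})
    (t := {x | infDist x S ≤ c}) (isClosed_le continuous_const hcont)
    (isClosed_le hcont continuous_const) (by
      rw [Set.disjoint_left]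
      intro x hx hx'
      exact absurd (hcc'.trans_le (le_trans hx hx')) (lt_irrefl _))
  have hts : tsupport f ⊆ {x | infDist x S ≤ c'} := by
    refine closure_minimal (fun x hx => ?_) (isClosed_le hcont continuous_const)
    by_contra hlt
    have hlt' : ¬ infDist x S ≤ c' := hlt
    exact hx (h0 (show c' ≤ infDist x S from (not_le.1 hlt').le))
  refine ⟨f, f.contMDiff.contDiff, ?_, fun x hx => (hts hx).trans_lt hcb',
    fun x hx => h1 (hx.le.trans hac.le)⟩
  refine HasCompactSupport.of_support_subset_isCompact (K := {x | infDist x S ≤ c'}) ?_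
    (subset_closure.trans hts)
  refine isCompact_of_isClosed_isBounded (isClosed_le hcont continuous_const) ?_
  exact (isBounded_infDist_lt hS hne b).subset fun x hx => lt_of_le_of_lt hx hcb'

end Extension

/-! ### The global extension: formula and norms -/

section ExtensionOperator

open Metric Filter Topology

variable {n : ℕ} {Ω : Set (E n)} {Φ : E n → E n} {L K : NNReal} {d : ℝ} {χ : E n → ℝ}

theorem toReal_eLpNorm_le {α β F G : Type*} [MeasurableSpace α] [MeasurableSpace β]
    [NormedAddCommGroup F] [NormedAddCommGroup G] {μ : Measure α} {ν : Measure β} {f : α → F}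
    {g : β → G} (hg : MemLp g 2 ν) {C : NNReal}
    (h : ∫⁻ x, ‖f x‖ₑ ^ 2 ∂μ ≤ C * ∫⁻ x, ‖g x‖ₑ ^ 2 ∂ν) :
    (eLpNorm f 2 μ).toReal ≤ √C * (eLpNorm g 2 ν).toReal := by
  have h1 : eLpNorm f 2 μ ≤ NNReal.sqrt C * eLpNorm g 2 ν := by
    rw [eLpNorm_two_le_iff, mul_pow, sq_eLpNorm_two, ← ENNReal.coe_pow, NNReal.sq_sqrt]
    exact h
  have h2 := ENNReal.toReal_mono (ENNReal.mul_ne_top ENNReal.coe_ne_top hg.eLpNorm_ne_top) h1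
  rwa [ENNReal.toReal_mul, ENNReal.coe_toReal, Real.coe_sqrt] at h2

/-- The extension `m + χ (u ∘ Φ - m)`. -/
noncomputable def extVal (χ : E n → ℝ) (Φ : E n → E n) (u : E n → ℝ) (m : ℝ) (x : E n) : ℝ :=
  m + χ x * (u (Φ x) - m)

/-- The gradient of the extension `m + χ (u ∘ Φ - m)`, where `g` is the gradient of `u`. -/
noncomputable def extGrad (χ : E n → ℝ) (Φ : E n → E n) (u : E n → ℝ) (g : E n → E n) (m : ℝ)
    (x : E n) : E n :=
  χ x • pullGrad Φ g x + (u (Φ x) - m) • gradient χ x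

theorem gradient_eq_zero_of_notMem {x : E n} (hx : x ∉ tsupport χ) : gradient χ x = 0 := by
  ext i
  rw [gradient_apply, partialDeriv_eq_zero_of_notMem hx]
  rfl

/-- Linearity of the extension, stated for one combination so as to serve additivity (a = b = 1) and
homogeneity (b = 0). Outside the neighbourhood χ and ∇χ vanish, so the unknown values of u ∘ Φ do
not matter. -/
theorem IsReflection.ext_ae_eq (h : IsReflection Ω Φ L K d) (hΩo : IsOpen Ω)
    (hfr : volume (frontier Ω) = 0) (hχN : tsupport χ ⊆ {x | infDist x Ω < d})
    {u u₁ u₂ : E n → ℝ} {g g₁ g₂ : E n → E n} {m m₁ m₂ a b : ℝ}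
    (hu : ∀ᵐ x ∂volume.restrict Ω, u x = a * u₁ x + b * u₂ x)
    (hg : ∀ᵐ x ∂volume.restrict Ω, g x = a • g₁ x + b • g₂ x) (hm : m = a * m₁ + b * m₂) :
    ∀ᵐ x, extVal χ Φ u m x = a * extVal χ Φ u₁ m₁ x + b * extVal χ Φ u₂ m₂ x ∧
      extGrad χ Φ u g m x = a • extGrad χ Φ u₁ g₁ m₁ x + b • extGrad χ Φ u₂ g₂ m₂ x := by
  have hq := h.quasiMeasurePreserving hΩo hfr
  have h1 := (ae_restrict_iff' (isOpen_infDist_lt Ω d).measurableSet).1 (hq.ae hu)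
  have h2 := (ae_restrict_iff' (isOpen_infDist_lt Ω d).measurableSet).1 (hq.ae hg)
  filter_upwards [h1, h2] with x h1 h2
  by_cases hx : x ∈ {x | infDist x Ω < d}
  · constructor
    · simp only [extVal, h1 hx, hm]; ring
    · simp only [extGrad, pullGrad, h1 hx, h2 hx, hm, map_add, map_smul]
      module
  · have h3 := image_eq_zero_of_notMem_tsupport fun h => hx (hχN h)
    have h4 := gradient_eq_zero_of_notMem fun h => hx (hχN h)
    constructor
    · simp only [extVal, h3, hm]; ring
    · simp only [extGrad, h3, h4]; simp

theorem IsReflection.lintegral_comp_sub_le (h : IsReflection Ω Φ L K d) (hΩo : IsOpen Ω)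
    (hfr : volume (frontier Ω) = 0) {u : E n → ℝ} (hu : StronglyMeasurable u) (m : ℝ) :
    ∫⁻ x in {x | infDist x Ω < d}, ‖u (Φ x) - m‖ₑ ^ 2
      ≤ (1 + K ^ n : NNReal) * ∫⁻ x in Ω, ‖u x - m‖ₑ ^ 2 :=
  h.lintegral_comp_le hΩo hfr (F := fun x => ‖u x - m‖ₑ ^ 2)
    ((hu.sub stronglyMeasurable_const).enorm.pow_const 2)

/-- The square of the `L²` norm of the extended gradient. -/
theorem IsReflection.lintegral_extGrad_le (h : IsReflection Ω Φ L K d) (hΩo : IsOpen Ω)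
    (hfr : volume (frontier Ω) = 0) (hχ : ContDiff ℝ ∞ χ)
    (hχN : tsupport χ ⊆ {x | infDist x Ω < d}) {c : NNReal} (hc : ∀ x, ‖χ x‖₊ ≤ c)
    (hc' : ∀ x, ‖gradient χ x‖₊ ≤ c) {u : E n → ℝ} {g : E n → E n} (hu : StronglyMeasurable u)
    (hg : StronglyMeasurable g) (m : ℝ) :
    ∫⁻ x, ‖extGrad χ Φ u g m x‖ₑ ^ 2
      ≤ 2 * ((c ^ 2 * (L ^ 2 * (1 + K ^ n)) : NNReal) * ∫⁻ x in Ω, ‖g x‖ₑ ^ 2)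
        + 2 * ((c ^ 2 * (1 + K ^ n) : NNReal) * ∫⁻ x in Ω, ‖u x - m‖ₑ ^ 2) := by
  have hN : ∫⁻ x, ‖extGrad χ Φ u g m x‖ₑ ^ 2
      = ∫⁻ x in {x | infDist x Ω < d}, ‖extGrad χ Φ u g m x‖ₑ ^ 2 := by
    refine (setLIntegral_eq_of_support_subset ?_).symm
    intro x hx
    by_contra hxN
    refine hx ?_
    have h3 := image_eq_zero_of_notMem_tsupport fun h => hxN (hχN h)
    have h4 := gradient_eq_zero_of_notMem fun h => hxN (hχN h)
    simp [extGrad, h3, h4]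
  rw [hN]
  have hpm := stronglyMeasurable_pullGrad h.lipschitz.continuous hg
  refine (lintegral_add_sq_le _ _ ?_).trans ?_
  · exact (hχ.continuous.stronglyMeasurable.smul hpm).enorm.aemeasurable
  have e1 : ∫⁻ x in {x | infDist x Ω < d}, ‖χ x • pullGrad Φ g x‖ₑ ^ 2
      ≤ (c ^ 2 * (L ^ 2 * (1 + K ^ n)) : NNReal) * ∫⁻ x in Ω, ‖g x‖ₑ ^ 2 := by
    calc _ ≤ ∫⁻ x in {x | infDist x Ω < d}, (c : ℝ≥0∞) ^ 2 * ‖pullGrad Φ g x‖ₑ ^ 2 := by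
          refine lintegral_mono fun x => ?_
          rw [← mul_pow, enorm_smul]
          gcongr
          exact_mod_cast hc x
      _ = (c : ℝ≥0∞) ^ 2 * ∫⁻ x in {x | infDist x Ω < d}, ‖pullGrad Φ g x‖ₑ ^ 2 :=
          lintegral_const_mul' _ _ (by finiteness)
      _ ≤ _ := by
          rw [ENNReal.coe_mul, ENNReal.coe_pow, mul_assoc]
          gcongr
          exact h.lintegral_pullGrad_le hΩo hfr hg
  have e2 : ∫⁻ x in {x | infDist x Ω < d}, ‖(u (Φ x) - m) • gradient χ x‖ₑ ^ 2
      ≤ (c ^ 2 * (1 + K ^ n) : NNReal) * ∫⁻ x in Ω, ‖u x - m‖ₑ ^ 2 := by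
    calc _ ≤ ∫⁻ x in {x | infDist x Ω < d}, (c : ℝ≥0∞) ^ 2 * ‖u (Φ x) - m‖ₑ ^ 2 := by
          refine lintegral_mono fun x => ?_
          rw [← mul_pow, enorm_smul, mul_comm]
          gcongr
          exact_mod_cast hc' x
      _ = (c : ℝ≥0∞) ^ 2 * ∫⁻ x in {x | infDist x Ω < d}, ‖u (Φ x) - m‖ₑ ^ 2 :=
          lintegral_const_mul' _ _ (by finiteness)
      _ ≤ _ := by
          rw [ENNReal.coe_mul, ENNReal.coe_pow, mul_assoc]
          gcongr
          exact h.lintegral_comp_sub_le hΩo hfr hu m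
  gcongr

theorem IsReflection.lintegral_extVal_le (h : IsReflection Ω Φ L K d) (hΩo : IsOpen Ω)
    (hfr : volume (frontier Ω) = 0)
    (hχN : tsupport χ ⊆ {x | infDist x Ω < d}) {c : NNReal} (hc : ∀ x, ‖χ x‖₊ ≤ c)
    {u : E n → ℝ} (hu : StronglyMeasurable u) (m : ℝ) (V : Set (E n)) :
    ∫⁻ x in V, ‖extVal χ Φ u m x‖ₑ ^ 2
      ≤ 2 * (‖m‖ₑ ^ 2 * volume V)
        + 2 * ((c ^ 2 * (1 + K ^ n) : NNReal) * ∫⁻ x in Ω, ‖u x - m‖ₑ ^ 2) := by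
  refine (lintegral_add_sq_le _ _ (by fun_prop)).trans ?_
  gcongr
  · simp
  calc ∫⁻ x in V, ‖χ x * (u (Φ x) - m)‖ₑ ^ 2 ≤ ∫⁻ x, ‖χ x * (u (Φ x) - m)‖ₑ ^ 2 :=
        setLIntegral_le_lintegral _ _
    _ = ∫⁻ x in {x | infDist x Ω < d}, ‖χ x * (u (Φ x) - m)‖ₑ ^ 2 := by
        refine (setLIntegral_eq_of_support_subset ?_).symm
        intro x hx
        by_contra hxN
        refine hx ?_
        have h3 := image_eq_zero_of_notMem_tsupport fun h => hxN (hχN h)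
        simp [h3]
    _ ≤ ∫⁻ x in {x | infDist x Ω < d}, (c : ℝ≥0∞) ^ 2 * ‖u (Φ x) - m‖ₑ ^ 2 := by
        refine lintegral_mono fun x => ?_
        rw [← mul_pow, enorm_mul]
        gcongr
        exact_mod_cast hc x
    _ = (c : ℝ≥0∞) ^ 2 * ∫⁻ x in {x | infDist x Ω < d}, ‖u (Φ x) - m‖ₑ ^ 2 :=
        lintegral_const_mul' _ _ (by finiteness)
    _ ≤ _ := by
        rw [ENNReal.coe_mul, ENNReal.coe_pow, mul_assoc]
        gcongr
        exact h.lintegral_comp_sub_le hΩo hfr hu m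

theorem IsReflection.weakGrad_ext {η : E n → E n} {ρ : ℝ} (hη : IsConeField Ω η ρ)
    (h : IsReflection Ω Φ L K d) (hΩo : IsOpen Ω) (hΩb : Bornology.IsBounded Ω)
    (hne : Ω.Nonempty) (hχ : ContDiff ℝ ∞ χ) (hχc : HasCompactSupport χ)
    (hχN : tsupport χ ⊆ {x | infDist x Ω < d}) (p : H1 Ω) (m : ℝ) :
    WeakGrad Set.univ (extVal χ Φ (h1Val p) m) (extGrad χ Φ (h1Val p) (h1Grad p) m) := by
  have hfr := hη.volume_frontier hΩo
  have hum : StronglyMeasurable (h1Val p) := Lp.stronglyMeasurable _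
  have hgm : StronglyMeasurable (h1Grad p) := Lp.stronglyMeasurable _
  have hfin : IsFiniteMeasure (volume.restrict {x | infDist x Ω < d}) :=
    ⟨by simpa using (isBounded_infDist_lt hΩb hne d).measure_lt_top⟩
  have hmu := h.memLp_comp hΩo hfr hum (Lp.memLp _)
  refine WeakGrad.const_add_cutoff_mul (hmu.sub (memLp_const m))
    (h.memLp_pullGrad hΩo hfr hgm (Lp.memLp _)) ?_ hχ hχc hχN m
  intro i ψ h1 h2 h3
  rw [← h.weakGrad hη hΩo hΩb p i ψ h1 h2 h3]
  have h0 : ∫ x in {x | infDist x Ω < d}, m * partialDeriv ψ i x = 0 := by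
    rw [setIntegral_eq_integral_of_forall_compl_eq_zero fun x hx => by
      rw [partialDeriv_eq_zero_of_notMem fun h => hx (h3 h), mul_zero],
      integral_const_mul, integral_partialDeriv_eq_zero h1 h2, mul_zero]
  have h4 := integral_sub (integrable_mul_of_memLp hmu (memLp_partialDeriv h1 h2 i))
    (integrable_mul_of_memLp (memLp_const m) (memLp_partialDeriv (U := {x | infDist x Ω < d}) h1 h2 i))
  rw [h0, sub_zero] at h4
  rw [← h4]
  refine integral_congr_ae (Eventually.of_forall fun x => ?_)
  simp only [Pi.sub_apply, sub_mul]

end ExtensionOperator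

/-! ### The extension operator -/

section ExtensionTheorem

open Metric Filter Topology

variable {n : ℕ} {Ω : Set (E n)} {Φ : E n → E n} {L K : NNReal} {d : ℝ} {χ : E n → ℝ}

theorem norm_h1_sq {U : Set (E n)} (p : H1 U) : ‖p‖ ^ 2 = ‖h1Val p‖ ^ 2 + ‖h1Grad p‖ ^ 2 :=
  WithLp.prod_norm_sq_eq_of_L2 (p : WithLp 2 (L2 U × L2Vec U))

theorem h1_ext {U : Set (E n)} {p q : H1 U} (h1 : h1Val p =ᵐ[volume.restrict U] h1Val q)
    (h2 : h1Grad p =ᵐ[volume.restrict U] h1Grad q) : p = q := by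
  refine Subtype.ext (WithLp.ofLp_injective 2 (Prod.ext ?_ ?_))
  · exact Lp.ext h1
  · exact Lp.ext h2

theorem h1Val_add {U : Set (E n)} (p q : H1 U) :
    ∀ᵐ x ∂volume.restrict U, h1Val (p + q) x = h1Val p x + h1Val q x :=
  Lp.coeFn_add (h1Val p) (h1Val q)

theorem h1Grad_add {U : Set (E n)} (p q : H1 U) :
    ∀ᵐ x ∂volume.restrict U, h1Grad (p + q) x = h1Grad p x + h1Grad q x :=
  Lp.coeFn_add (h1Grad p) (h1Grad q)

theorem h1Val_smul {U : Set (E n)} (a : ℝ) (p : H1 U) :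
    ∀ᵐ x ∂volume.restrict U, h1Val (a • p) x = a * h1Val p x :=
  Lp.coeFn_smul a (h1Val p)

theorem h1Grad_smul {U : Set (E n)} (a : ℝ) (p : H1 U) :
    ∀ᵐ x ∂volume.restrict U, h1Grad (a • p) x = a • h1Grad p x :=
  Lp.coeFn_smul a (h1Grad p)

theorem enorm_sq_average_mul_le {μ : Measure (E n)} [IsFiniteMeasure μ] {u : E n → ℝ}
    (hu : MemLp u 2 μ) :
    ‖⨍ y, u y ∂μ‖ₑ ^ 2 * μ Set.univ ≤ 10 * ∫⁻ x, ‖u x‖ₑ ^ 2 ∂μ := by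
  have hi := hu.integrable (by norm_num)
  set m := ⨍ y, u y ∂μ
  have h1 := lintegral_sub_average_le_sub_const hi 0
  simp only [sub_zero] at h1
  have h2 := lintegral_add_sq_le (μ := μ) (fun x => m - u x) u
    (aestronglyMeasurable_const.sub hu.1).enorm
  simp only [sub_add_cancel, lintegral_const] at h2
  refine h2.trans ?_
  calc _ ≤ 2 * (4 * ∫⁻ x, ‖u x‖ₑ ^ 2 ∂μ) + 2 * ∫⁻ x, ‖u x‖ₑ ^ 2 ∂μ := by
        gcongr
        simpa only [enorm_sub_rev] using h1
    _ = _ := by ring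

/-- Subtracting the mean before cutting off makes the term (u ∘ Φ - m)∇χ controllable by ∇u through
the Poincaré inequality. The gradient is estimated on all of ℝⁿ, so the constant does not depend on
V; the bound on the values may depend on V, which only affects continuity. -/
theorem IsReflection.exists_extensionOperator {η : E n → E n} {ρ : ℝ} (hη : IsConeField Ω η ρ)
    (h : IsReflection Ω Φ L K d) (hΩo : IsOpen Ω) (hΩc : IsConnected Ω)
    (hΩb : Bornology.IsBounded Ω) (hχ : ContDiff ℝ ∞ χ) (hχc : HasCompactSupport χ)
    (hχN : tsupport χ ⊆ {x | infDist x Ω < d}) :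
    ∃ C : NNReal, ∀ V : Set (E n), volume V ≠ ⊤ →
      ∃ P : H1 Ω →L[ℝ] H1 V, ∀ p : H1 Ω,
        h1Val (P p) =ᵐ[volume.restrict V] extVal χ Φ (h1Val p) (⨍ y in Ω, h1Val p y) ∧
        h1Grad (P p) =ᵐ[volume.restrict V]
          extGrad χ Φ (h1Val p) (h1Grad p) (⨍ y in Ω, h1Val p y) ∧
        ‖h1Grad (P p)‖ ≤ √C * ‖h1Grad p‖ := by
  have hfr := hη.volume_frontier hΩo
  have hfin : IsFiniteMeasure (volume.restrict Ω) := ⟨by simpa using hΩb.measure_lt_top⟩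
  have hΩ0 : volume Ω ≠ 0 := (hΩo.measure_pos volume hΩc.nonempty).ne'
  have hΩ1 : volume Ω ≠ ⊤ := hΩb.measure_lt_top.ne
  obtain ⟨CP, hCP⟩ := h.exists_poincare hη hΩo hΩc hΩb
  obtain ⟨c₁, hc₁⟩ := hχ.continuous.bounded_above_of_compact_support hχc
  obtain ⟨c₂, hc₂⟩ := (continuous_gradient hχ).bounded_above_of_compact_support
    (hasCompactSupport_gradient hχc)
  set c : NNReal := (max c₁ c₂).toNNReal
  have hc : ∀ x, ‖χ x‖₊ ≤ c := fun x =>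
    NNReal.le_toNNReal_of_coe_le ((hc₁ x).trans (le_max_left _ _))
  have hc' : ∀ x, ‖gradient χ x‖₊ ≤ c := fun x =>
    NNReal.le_toNNReal_of_coe_le ((hc₂ x).trans (le_max_right _ _))
  set CG : NNReal := 2 * (c ^ 2 * (L ^ 2 * (1 + K ^ n))) + 2 * (c ^ 2 * (1 + K ^ n) * CP) with hCG
  let m : H1 Ω → ℝ := fun p => ⨍ y in Ω, h1Val p y
  have hum : ∀ p : H1 Ω, StronglyMeasurable (h1Val p) := fun p => Lp.stronglyMeasurable _
  have hgm : ∀ p : H1 Ω, StronglyMeasurable (h1Grad p) := fun p => Lp.stronglyMeasurable _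
  have hG : ∀ p : H1 Ω, ∫⁻ x, ‖extGrad χ Φ (h1Val p) (h1Grad p) (m p) x‖ₑ ^ 2
      ≤ CG * ∫⁻ x in Ω, ‖h1Grad p x‖ₑ ^ 2 := fun p => by
    refine (h.lintegral_extGrad_le hΩo hfr hχ hχN hc hc' (hum p) (hgm p) (m p)).trans ?_
    calc _ ≤ 2 * ((c ^ 2 * (L ^ 2 * (1 + K ^ n)) : NNReal) * ∫⁻ x in Ω, ‖h1Grad p x‖ₑ ^ 2)
          + 2 * ((c ^ 2 * (1 + K ^ n) : NNReal) * (CP * ∫⁻ x in Ω, ‖h1Grad p x‖ₑ ^ 2)) := by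
          gcongr
          exact hCP p
      _ = _ := by rw [hCG]; push_cast; ring
  refine ⟨CG, fun V hV => ?_⟩
  have hfinV : IsFiniteMeasure (volume.restrict V) := ⟨by simpa using hV.lt_top⟩
  set CV : NNReal := 2 * (10 * ((volume V).toNNReal / (volume Ω).toNNReal))
    + 2 * (c ^ 2 * (1 + K ^ n) * 4) with hCV
  have hVal : ∀ p : H1 Ω, ∫⁻ x in V, ‖extVal χ Φ (h1Val p) (m p) x‖ₑ ^ 2
      ≤ CV * ∫⁻ x in Ω, ‖h1Val p x‖ₑ ^ 2 := fun p => by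
    refine (h.lintegral_extVal_le hΩo hfr hχN hc (hum p) (m p) V).trans ?_
    have h1 := enorm_sq_average_mul_le (Lp.memLp (h1Val p))
    have h2 := lintegral_sub_average_le_sub_const
      ((Lp.memLp (h1Val p)).integrable (by norm_num)) 0
    simp only [sub_zero] at h2
    rw [Measure.restrict_apply_univ] at h1
    have h3 : ‖m p‖ₑ ^ 2 ≤ (10 * ∫⁻ x in Ω, ‖h1Val p x‖ₑ ^ 2) / volume Ω :=
      (ENNReal.le_div_iff_mul_le (Or.inl hΩ0) (Or.inl hΩ1)).2 h1
    have h4 : ((CV : NNReal) : ℝ≥0∞) = 2 * (10 * (volume V / volume Ω))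
        + 2 * ((c ^ 2 * (1 + K ^ n) : NNReal) * 4) := by
      have h5 : (volume Ω).toNNReal ≠ 0 := (ENNReal.toNNReal_pos hΩ0 hΩ1).ne'
      rw [hCV]
      push_cast [ENNReal.coe_div h5]
      rw [ENNReal.coe_toNNReal hV, ENNReal.coe_toNNReal hΩ1]
    calc _ ≤ 2 * (((10 * ∫⁻ x in Ω, ‖h1Val p x‖ₑ ^ 2) / volume Ω) * volume V)
          + 2 * ((c ^ 2 * (1 + K ^ n) : NNReal) * (4 * ∫⁻ x in Ω, ‖h1Val p x‖ₑ ^ 2)) := by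
          gcongr
      _ = _ := by rw [h4]; simp only [div_eq_mul_inv]; ring
  have hwg : ∀ p : H1 Ω, WeakGrad V (extVal χ Φ (h1Val p) (m p))
      (extGrad χ Φ (h1Val p) (h1Grad p) (m p)) := fun p =>
    (h.weakGrad_ext hη hΩo hΩb hΩc.nonempty hχ hχc hχN p (m p)).mono (Set.subset_univ V)
  have hGV : ∀ p : H1 Ω, ∫⁻ x in V, ‖extGrad χ Φ (h1Val p) (h1Grad p) (m p) x‖ₑ ^ 2
      ≤ CG * ∫⁻ x in Ω, ‖h1Grad p x‖ₑ ^ 2 := fun p =>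
    (setLIntegral_le_lintegral _ _).trans (hG p)
  have hmv : ∀ p : H1 Ω, MemLp (extVal χ Φ (h1Val p) (m p)) 2 (volume.restrict V) := fun p =>
    memLp_of_lintegral_le (stronglyMeasurable_const.add (hχ.continuous.stronglyMeasurable.mul
      (((hum p).comp_measurable h.lipschitz.continuous.measurable).sub
        stronglyMeasurable_const))).aestronglyMeasurable (Lp.memLp (h1Val p))
      ENNReal.coe_ne_top (hVal p)
  have hmg : ∀ p : H1 Ω, MemLp (extGrad χ Φ (h1Val p) (h1Grad p) (m p)) 2
      (volume.restrict V) := fun p =>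
    memLp_of_lintegral_le ((hχ.continuous.stronglyMeasurable.smul
      (stronglyMeasurable_pullGrad h.lipschitz.continuous (hgm p))).add
      ((((hum p).comp_measurable h.lipschitz.continuous.measurable).sub
        stronglyMeasurable_const).smul
        (continuous_gradient hχ).stronglyMeasurable)).aestronglyMeasurable (Lp.memLp (h1Grad p))
      ENNReal.coe_ne_top (hGV p)
  have hPv : ∀ p : H1 Ω, h1Val (mkH1 (hmv p) (hmg p) (hwg p)) =ᵐ[volume.restrict V]
      extVal χ Φ (h1Val p) (m p) := fun p => (hmv p).coeFn_toLp
  have hPg : ∀ p : H1 Ω, h1Grad (mkH1 (hmv p) (hmg p) (hwg p)) =ᵐ[volume.restrict V]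
      extGrad χ Φ (h1Val p) (h1Grad p) (m p) := fun p => (hmg p).coeFn_toLp
  have hint : ∀ p : H1 Ω, Integrable (h1Val p) (volume.restrict Ω) := fun p =>
    (Lp.memLp (h1Val p)).integrable (by norm_num)
  let P : H1 Ω →ₗ[ℝ] H1 V :=
    { toFun := fun p => mkH1 (hmv p) (hmg p) (hwg p)
      map_add' := fun p q => by
        have e3 : m (p + q) = m p + m q := by
          simp only [m, setAverage_eq]
          rw [integral_congr_ae (h1Val_add p q), integral_add (hint p) (hint q), smul_add]
        have e4 := ae_restrict_of_ae (s := V) (h.ext_ae_eq hΩo hfr hχN (a := 1) (b := 1)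
          (u := h1Val (p + q)) (g := h1Grad (p + q)) (m := m (p + q))
          (m₁ := m p) (m₂ := m q) (u₁ := h1Val p) (u₂ := h1Val q) (g₁ := h1Grad p) (g₂ := h1Grad q)
          ((h1Val_add p q).mono fun x hx => by rw [hx, one_mul, one_mul])
          ((h1Grad_add p q).mono fun x hx => by rw [hx, one_smul, one_smul])
          (by rw [e3, one_mul, one_mul]))
        refine h1_ext ((hPv _).trans ?_) ((hPg _).trans ?_)
        · filter_upwards [e4, hPv p, hPv q, h1Val_add (mkH1 (hmv p) (hmg p) (hwg p))
            (mkH1 (hmv q) (hmg q) (hwg q))] with x h1 h2 h3 h4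
          rw [h4, h1.1, h2, h3, one_mul, one_mul]
        · filter_upwards [e4, hPg p, hPg q, h1Grad_add (mkH1 (hmv p) (hmg p) (hwg p))
            (mkH1 (hmv q) (hmg q) (hwg q))] with x h1 h2 h3 h4
          rw [h4, h1.2, h2, h3, one_smul, one_smul]
      map_smul' := fun a p => by
        have e3 : m (a • p) = a * m p := by
          simp only [m, setAverage_eq, smul_eq_mul]
          rw [integral_congr_ae (h1Val_smul a p), integral_const_mul, mul_left_comm]
        have e4 := ae_restrict_of_ae (s := V) (h.ext_ae_eq hΩo hfr hχN (a := a) (b := 0)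
          (u := h1Val (a • p)) (g := h1Grad (a • p)) (m := m (a • p))
          (m₁ := m p) (m₂ := m p) (u₁ := h1Val p) (u₂ := h1Val p) (g₁ := h1Grad p) (g₂ := h1Grad p)
          ((h1Val_smul a p).mono fun x hx => by rw [hx, zero_mul, add_zero])
          ((h1Grad_smul a p).mono fun x hx => by rw [hx, zero_smul, add_zero])
          (by rw [e3, zero_mul, add_zero]))
        refine h1_ext ((hPv _).trans ?_) ((hPg _).trans ?_)
        · filter_upwards [e4, hPv p, h1Val_smul a (mkH1 (hmv p) (hmg p) (hwg p))] with x h1 h2 h4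
          rw [RingHom.id_apply, h4, h1.1, h2, zero_mul, add_zero]
        · filter_upwards [e4, hPg p, h1Grad_smul a (mkH1 (hmv p) (hmg p) (hwg p))] with x h1 h2 h4
          rw [RingHom.id_apply, h4, h1.2, h2, zero_smul, add_zero] }
  have hnv : ∀ p, ‖h1Val (P p)‖ ≤ √CV * ‖h1Val p‖ := fun p => by
    rw [Lp.norm_def, Lp.norm_def]
    refine (congrArg ENNReal.toReal (eLpNorm_congr_ae (hPv p))).trans_le ?_
    exact toReal_eLpNorm_le (Lp.memLp _) (hVal p)
  have hng : ∀ p, ‖h1Grad (P p)‖ ≤ √CG * ‖h1Grad p‖ := fun p => by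
    rw [Lp.norm_def, Lp.norm_def]
    refine (congrArg ENNReal.toReal (eLpNorm_congr_ae (hPg p))).trans_le ?_
    exact toReal_eLpNorm_le (Lp.memLp _) (hGV p)
  refine ⟨P.mkContinuous √(CV + CG) fun p => ?_, fun p => ⟨hPv p, hPg p, hng p⟩⟩
  refine abs_le_of_sq_le_sq' ?_ (by positivity) |>.2
  rw [mul_pow, Real.sq_sqrt (by positivity), norm_h1_sq, norm_h1_sq]
  have h1 := pow_le_pow_left₀ (norm_nonneg _) (hnv p) 2
  have h2 := pow_le_pow_left₀ (norm_nonneg _) (hng p) 2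
  rw [mul_pow, Real.sq_sqrt NNReal.zero_le_coe] at h1 h2
  have h3 : 0 ≤ (CV : ℝ) * ‖h1Grad p‖ ^ 2 := by positivity
  have h4 : 0 ≤ (CG : ℝ) * ‖h1Val p‖ ^ 2 := by positivity
  linarith

/-- The same formula serves every ε. For small ε the neighbourhood lies where χ = 1, the mean drops
out, and the extension is u ∘ Φ with gradient bounded by the pulled-back one. The L² bound then
follows from the norm of φ alone. -/
theorem exists_extension (hn : 1 ≤ n) (hΩo : IsOpen Ω) (hΩc : IsConnected Ω) (hΩb : Bornology.IsBounded Ω)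
    (hΩl : HasLipschitzBoundary Ω) :
    ∃ C₀ : ℝ, ∃ ε₀ > (0 : ℝ), ∀ ε > (0 : ℝ), ∃ P : H1 Ω →L[ℝ] H1 (outerNbhd Ω ε 3),
      ∀ φ : H1 Ω, IsExtension φ (P φ) ∧ ‖h1Grad (P φ)‖ ≤ C₀ * ‖h1Grad φ‖ ∧
        (ε ≤ ε₀ →
          l2NormOn (outerNbhd Ω ε 3 \ Ω) (h1Grad (P φ))
            ≤ C₀ * l2NormOn (Ω ∩ boundaryLayer Ω ε 3) (h1Grad φ) ∧
          ‖h1Val (P φ)‖ ≤ C₀ * (‖h1Val φ‖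
            + ε * l2NormOn (Ω ∩ boundaryLayer Ω ε 3) (h1Grad φ))) := by
  obtain ⟨η, ρ, hη⟩ := exists_isConeField hΩo hΩb hΩl
  have hfr := hη.volume_frontier hΩo
  obtain ⟨Φ, L, K, d, h⟩ := hη.exists_isReflection hΩo hΩc.nonempty
  have hd := h.pos
  obtain ⟨χ, hχ, hχc, hχN, hχ1⟩ := exists_cutoff hΩb hΩc.nonempty (half_lt_self hd)
  obtain ⟨C, hC⟩ := h.exists_extensionOperator hη hΩo hΩc hΩb hχ hχc hχN
  set D : NNReal := C + L ^ 2 * K ^ n + (1 + K ^ n) with hD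
  -- D dominates the three squared constants needed. The threshold ensures 3√n ε ≤ d/2, so that the
  -- neighbourhood stays within the region where χ = 1.
  refine ⟨√D, d / (6 * (√n + 1)), by positivity, fun ε hε => ?_⟩
  set V := outerNbhd Ω ε 3 with hV
  have hVo : IsOpen V := isOpen_infDist_lt Ω _
  have hn0 : (0 : ℝ) < √n := Real.sqrt_pos.2 (by exact_mod_cast hn)
  have hΩV : Ω ⊆ V := fun x hx => by
    change infDist x Ω < _
    rw [infDist_zero_of_mem hx]
    positivity
  obtain ⟨P, hP⟩ := hC V (isBounded_infDist_lt hΩb hΩc.nonempty _).measure_lt_top.ne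
  have hχΩ : ∀ x ∈ Ω, χ x = 1 := fun x hx => hχ1 x (by rw [infDist_zero_of_mem hx]; linarith)
  have hroot : ∀ C' : NNReal, C' ≤ D → √(C' : ℝ) ≤ √(D : ℝ) := fun C' h =>
    Real.sqrt_le_sqrt (by exact_mod_cast h)
  refine ⟨P, fun φ => ⟨?_, (hP φ).2.2.trans ?_, fun hεε => ?_⟩⟩
  · have h1 : h1Val (P φ) =ᵐ[volume.restrict Ω] _ :=
      ae_restrict_of_ae_restrict_of_subset hΩV (hP φ).1
    refine h1.trans ?_
    filter_upwards [ae_restrict_mem hΩo.measurableSet] with x hx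
    rw [extVal, hχΩ x hx, h.eq_self x (subset_closure hx)]
    ring
  · gcongr
    rw [hD, add_assoc]
    exact le_self_add
  have hδ : ((3 : ℕ) : ℝ) * √n * ε ≤ d / 2 := by
    have h1 : ε * (6 * (√n + 1)) ≤ d := (le_div_iff₀ (by positivity)).1 hεε
    push_cast
    nlinarith
  have hVd : V ⊆ {x | infDist x Ω < d / 2} := fun x hx => lt_of_lt_of_le hx hδ
  have hχV : ∀ x ∈ V, χ x = 1 ∧ gradient χ x = 0 := by
    intro x hx
    refine ⟨hχ1 x (hVd hx), ?_⟩
    have h1 : χ =ᶠ[𝓝 x] fun _ => 1 := by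
      filter_upwards [hVo.mem_nhds hx] with y hy using hχ1 y (hVd hy)
    rw [h1.gradient_eq]
    exact gradient_const x 1
  have hval : h1Val (P φ) =ᵐ[volume.restrict V] fun x => h1Val φ (Φ x) := by
    refine (hP φ).1.trans ?_
    filter_upwards [ae_restrict_mem hVo.measurableSet] with x hx
    rw [extVal, (hχV x hx).1]
    ring
  have hgrad : h1Grad (P φ) =ᵐ[volume.restrict V] pullGrad Φ (h1Grad φ) := by
    refine (hP φ).2.1.trans ?_
    filter_upwards [ae_restrict_mem hVo.measurableSet] with x hx
    rw [extGrad, (hχV x hx).1, (hχV x hx).2, one_smul, smul_zero, add_zero]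
  have hum : StronglyMeasurable (h1Val φ) := Lp.stronglyMeasurable _
  have hgm : StronglyMeasurable (h1Grad φ) := Lp.stronglyMeasurable _
  constructor
  · refine le_trans (toReal_eLpNorm_le (C := L ^ 2 * K ^ n) ?_ ?_)
      (mul_le_mul_of_nonneg_right (hroot _ ?_) ENNReal.toReal_nonneg)
    · exact (Lp.memLp (h1Grad φ)).mono_measure (Measure.restrict_mono Set.inter_subset_left le_rfl)
    · calc _ = ∫⁻ x in V \ Ω, ‖pullGrad Φ (h1Grad φ) x‖ₑ ^ 2 := by
            refine lintegral_congr_ae ?_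
            filter_upwards [ae_restrict_of_ae_restrict_of_subset Set.sdiff_subset hgrad] with x hx
            rw [hx]
        _ ≤ ∫⁻ x in V \ Ω, (L : ℝ≥0∞) ^ 2 * ‖h1Grad φ (Φ x)‖ₑ ^ 2 := by
            refine lintegral_mono fun x => ?_
            rw [← mul_pow]
            exact pow_le_pow_left' (enorm_pullGrad_le h.lipschitz _ x) 2
        _ = (L : ℝ≥0∞) ^ 2 * ∫⁻ x in V \ Ω, ‖h1Grad φ (Φ x)‖ₑ ^ 2 :=
            lintegral_const_mul' _ _ (by finiteness)
        _ ≤ _ := by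
            rw [ENNReal.coe_mul, ENNReal.coe_pow, ENNReal.coe_pow, mul_assoc]
            gcongr
            exact h.lintegral_comp_diff_le hΩo hfr (hδ.trans (half_le_self hd.le))
              (F := fun x => ‖h1Grad φ x‖ₑ ^ 2) (hgm.enorm.pow_const 2)
    · rw [hD]
      calc L ^ 2 * K ^ n ≤ C + L ^ 2 * K ^ n := le_add_self
        _ ≤ _ := le_self_add
  · have h1 : ‖h1Val (P φ)‖ ≤ √(1 + K ^ n : NNReal) * ‖h1Val φ‖ := by
      rw [Lp.norm_def, Lp.norm_def, eLpNorm_congr_ae hval]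
      refine toReal_eLpNorm_le (Lp.memLp _) ?_
      exact (lintegral_mono_set fun x hx => (hVd hx).trans (half_lt_self hd)).trans
        (h.lintegral_comp_le hΩo hfr (F := fun x => ‖h1Val φ x‖ₑ ^ 2) (hum.enorm.pow_const 2))
    refine h1.trans ?_
    gcongr
    · exact le_add_self
    · exact le_add_of_nonneg_right (mul_nonneg hε.le ENNReal.toReal_nonneg)

end ExtensionTheorem

/-! ### The Hilbert space H^s -/

section FractionalSobolev

open Metric Filter Topology

variable {n : ℕ} {Ω : Set (E n)} {s : ℝ}

/-- The `L²` function underlying an element of `H^s(U)`. -/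
noncomputable def hsVal (p : Hs s Ω) : L2 Ω :=
  (p : WithLp 2 (L2 Ω × Lp ℝ 2 ((volume.restrict Ω).prod (volume.restrict Ω)))).fst

theorem toHsDual_apply (f : L2 Ω) (p : Hs s Ω) : toHsDual s f p = inner ℝ f (hsVal p) := rfl

theorem measurable_slopeQuot {u : E n → ℝ} (hu : Measurable u) : Measurable (slopeQuot s u) := by
  unfold slopeQuot
  fun_prop

theorem ofReal_norm_sq_eq_lintegral {α F : Type*} [MeasurableSpace α] [NormedAddCommGroup F]
    {μ : Measure α} (f : Lp F 2 μ) : ENNReal.ofReal (‖f‖ ^ 2) = ∫⁻ x, ‖f x‖ₑ ^ 2 ∂μ := by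
  rw [ENNReal.ofReal_pow (norm_nonneg _), Lp.norm_def, ENNReal.ofReal_toReal (Lp.eLpNorm_ne_top f),
    sq_eLpNorm_two]

theorem ofReal_norm_hs_sq (p : Hs s Ω) :
    ENNReal.ofReal (‖p‖ ^ 2) = (∫⁻ x in Ω, ‖hsVal p x‖ₑ ^ 2)
      + ∫⁻ x in Ω, ∫⁻ z in Ω, ‖slopeQuot s (hsVal p) (x, z)‖ₑ ^ 2 := by
  have h1 : ‖p‖ ^ 2 = ‖hsVal p‖ ^ 2 + ‖p.1.snd‖ ^ 2 := WithLp.prod_norm_sq_eq_of_L2 p.1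
  have h2 : ∫⁻ x in Ω, ∫⁻ z in Ω, ‖slopeQuot s (hsVal p) (x, z)‖ₑ ^ 2
      = ∫⁻ z, ‖p.1.snd z‖ₑ ^ 2 ∂((volume.restrict Ω).prod (volume.restrict Ω)) := by
    rw [← lintegral_prod (fun z => ‖slopeQuot s (hsVal p) z‖ₑ ^ 2)
      ((measurable_slopeQuot (Lp.stronglyMeasurable (hsVal p)).measurable).enorm.pow_const
        2).aemeasurable]
    refine lintegral_congr_ae ?_
    filter_upwards [show ⇑p.1.snd =ᵐ[_] slopeQuot s p.1.fst from p.2] with z hz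
    rw [hz]
    rfl
  rw [h1, ENNReal.ofReal_add (sq_nonneg _) (sq_nonneg _), ofReal_norm_sq_eq_lintegral,
    ofReal_norm_sq_eq_lintegral, h2]

theorem enorm_sub_sq_le_slopeQuot {u : E n → ℝ} (hs : 0 < s) {x z : E n} {r : ℝ}
    (h : ‖x - z‖ ≤ r) :
    ‖u x - u z‖ₑ ^ 2 ≤ ENNReal.ofReal (r ^ (n + 2 * s)) * ‖slopeQuot s u (x, z)‖ₑ ^ 2 := by
  rcases eq_or_ne x z with rfl | hxz
  · simp
  have h0 : 0 < ‖x - z‖ := norm_pos_iff.2 (sub_ne_zero.2 hxz)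
  have h1 : ‖u x - u z‖ ≤ r ^ ((n : ℝ) / 2 + s) * ‖slopeQuot s u (x, z)‖ := by
    have h2 : ‖u x - u z‖ = ‖x - z‖ ^ ((n : ℝ) / 2 + s) * ‖slopeQuot s u (x, z)‖ := by
      rw [slopeQuot, norm_div, Real.norm_of_nonneg (Real.rpow_nonneg (norm_nonneg _) _)]
      field_simp
    rw [h2]
    gcongr
  have h3 : r ^ (n + 2 * s) = (r ^ ((n : ℝ) / 2 + s)) ^ 2 := by
    rw [← Real.rpow_mul_natCast (h0.le.trans h)]
    congr 1
    push_cast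
    ring
  have h4 : 0 ≤ r ^ ((n : ℝ) / 2 + s) := Real.rpow_nonneg (h0.le.trans h) _
  rw [h3, ENNReal.ofReal_pow h4, ← mul_pow]
  refine pow_le_pow_left' ?_ 2
  rw [← ofReal_norm, ← ofReal_norm, ← ENNReal.ofReal_mul h4]
  exact ENNReal.ofReal_le_ofReal h1

/-- Along a subsequence both components converge almost everywhere, so the relation between function
and difference quotient passes to the limit. Completeness is needed to apply the Riesz theorem to
the dual. -/
theorem isClosed_hs (s : ℝ) (Ω : Set (E n)) :
    IsClosed (Hs s Ω : Set (WithLp 2 (L2 Ω × Lp ℝ 2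
      ((volume.restrict Ω).prod (volume.restrict Ω))))) := by
  refine isClosed_of_closure_subset fun p hp => ?_
  obtain ⟨q, hq, hqp⟩ := mem_closure_iff_seq_limit.1 hp
  have h1 : Tendsto (fun k => (q k).fst) atTop (𝓝 p.fst) :=
    ((WithLp.fstL 2 ℝ _ _).continuous.tendsto p).comp hqp
  have h2 : Tendsto (fun k => (q k).snd) atTop (𝓝 p.snd) :=
    ((WithLp.sndL 2 ℝ _ _).continuous.tendsto p).comp hqp
  obtain ⟨a, ha, ha'⟩ := (tendstoInMeasure_of_tendsto_Lp h1).exists_seq_tendsto_ae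
  obtain ⟨b, hb, hb'⟩ := (tendstoInMeasure_of_tendsto_Lp
    (h2.comp ha.tendsto_atTop)).exists_seq_tendsto_ae
  have h3 := Measure.quasiMeasurePreserving_fst (μ := volume.restrict Ω)
    (ν := volume.restrict Ω) |>.ae ha'
  have h4 := Measure.quasiMeasurePreserving_snd (μ := volume.restrict Ω)
    (ν := volume.restrict Ω) |>.ae ha'
  have h5 : ∀ᵐ z ∂(volume.restrict Ω).prod (volume.restrict Ω), ∀ k,
      (q (a (b k))).snd z = slopeQuot s (q (a (b k))).fst z :=
    ae_all_iff.2 fun k => hq (a (b k))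
  change ⇑p.snd =ᵐ[_] slopeQuot s p.fst
  filter_upwards [h3, h4, h5, hb'] with z h3 h4 h5 h6
  refine tendsto_nhds_unique h6 ?_
  have h7 := ((h3.comp hb.tendsto_atTop).sub (h4.comp hb.tendsto_atTop)).div_const
    (‖z.1 - z.2‖ ^ ((n : ℝ) / 2 + s))
  refine h7.congr fun k => ?_
  exact (h5 k).symm

instance instCompleteHs (s : ℝ) (Ω : Set (E n)) : CompleteSpace (Hs s Ω) :=
  (isClosed_hs s Ω).completeSpace_coe

/-- Coordinates for the norm on the span of finitely many vectors of an inner product space. -/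
theorem exists_sq_norm_sum_eq {X ι : Type*} [NormedAddCommGroup X] [InnerProductSpace ℝ X]
    (K : Finset ι) (x : ι → X) : ∃ (m : ℕ) (ξ : Fin m → ι → ℝ),
      ∀ c : ι → ℝ, ‖∑ k ∈ K, c k • x k‖ ^ 2 = ∑ a, (∑ k ∈ K, c k * ξ a k) ^ 2 := by
  let W := Submodule.span ℝ (x '' K)
  have hfin : FiniteDimensional ℝ W := FiniteDimensional.span_of_finite ℝ (K.finite_toSet.image x)
  let f := stdOrthonormalBasis ℝ W
  refine ⟨_, fun a k => inner ℝ (f a : X) (x k), fun c => ?_⟩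
  have hmem : ∑ k ∈ K, c k • x k ∈ W := Submodule.sum_mem _ fun k hk =>
    Submodule.smul_mem _ _ (Submodule.subset_span ⟨k, hk, rfl⟩)
  have h1 := f.sum_sq_norm_inner_right ⟨_, hmem⟩
  rw [show ‖∑ k ∈ K, c k • x k‖ = ‖(⟨_, hmem⟩ : W)‖ from rfl, ← h1]
  refine Finset.sum_congr rfl fun a _ => ?_
  rw [Submodule.coe_inner, Real.norm_eq_abs, sq_abs, inner_sum]
  simp only [real_inner_smul_right]

end FractionalSobolev

/-! ### Smallness of H^s functions in the boundary layer -/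

section Layer

open Metric Filter Topology

variable {n : ℕ} {Ω : Set (E n)} {η : E n → E n} {ρ s : ℝ}

theorem frontier_nonempty (hn : 1 ≤ n) (hne : Ω.Nonempty) (hΩb : Bornology.IsBounded Ω) :
    (frontier Ω).Nonempty := by
  have : Nonempty (Fin n) := ⟨⟨0, hn⟩⟩
  rw [nonempty_frontier_iff]
  refine ⟨hne, fun h => ?_⟩
  rw [h] at hΩb
  exact NoncompactSpace.noncompact_univ (X := E n)
    (isCompact_of_isClosed_isBounded isClosed_univ hΩb)

/-- Induction on the number of doublings needed to bring δ up to δ₁. Since a q^s ≤ 1/2, the bound at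
scale qδ returns half of the bound at scale δ; the b-term fits in the other half because δ^{2s} ≤
δ₁^s δ^s for δ < δ₁. -/
theorem le_rpow_mul_of_scaling {I : ℝ → ℝ} {N s a b q δ₁ : ℝ} (hN : 0 ≤ N) (hs : 0 < s)
    (ha : 0 ≤ a) (hb : 0 ≤ b) (hq : 2 ≤ q) (hδ₁ : 0 < δ₁) (haq : a * q ^ s ≤ 1 / 2)
    (hI : ∀ δ > 0, I δ ≤ N)
    (hstep : ∀ δ > 0, δ < δ₁ → I δ ≤ a * I (q * δ) + b * δ ^ (2 * s) * N) :
    ∀ δ > 0, I δ ≤ (δ₁ ^ (-s) + 2 * b * δ₁ ^ s) * δ ^ s * N := by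
  set A := δ₁ ^ (-s) + 2 * b * δ₁ ^ s with hA
  have hA0 : 0 ≤ A := by positivity
  have hbig : ∀ δ > 0, δ₁ ≤ δ → I δ ≤ A * δ ^ s * N := by
    intro δ hδ h
    have h1 : 1 ≤ A * δ ^ s := by
      calc (1 : ℝ) = δ₁ ^ (-s) * δ₁ ^ s := by
            rw [← Real.rpow_add hδ₁, neg_add_cancel, Real.rpow_zero]
        _ ≤ A * δ ^ s := by
            gcongr
            rw [hA]
            exact le_add_of_nonneg_right (by positivity)
    calc I δ ≤ 1 * N := by rw [one_mul]; exact hI δ hδ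
      _ ≤ _ := by gcongr
  have key : ∀ j : ℕ, ∀ δ > 0, δ₁ ≤ 2 ^ j * δ → I δ ≤ A * δ ^ s * N := by
    intro j
    induction j with
    | zero => intro δ hδ h; exact hbig δ hδ (by simpa using h)
    | succ j ih =>
      intro δ hδ h
      rcases le_or_gt δ₁ δ with h1 | h1
      · exact hbig δ hδ h1
      have hqδ : 0 < q * δ := by positivity
      have h2 : I (q * δ) ≤ A * (q * δ) ^ s * N := by
        refine ih _ hqδ (h.trans ?_)
        rw [pow_succ, mul_assoc]
        gcongr
      have h3 : δ ^ (2 * s) ≤ δ₁ ^ s * δ ^ s := by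
        rw [two_mul, Real.rpow_add hδ]
        gcongr
      have h4 : 2 * b * δ₁ ^ s ≤ A := by
        rw [hA]
        exact le_add_of_nonneg_left (by positivity)
      have hδs : 0 ≤ δ ^ s := by positivity
      calc I δ ≤ a * I (q * δ) + b * δ ^ (2 * s) * N := hstep δ hδ h1
        _ ≤ a * (A * (q * δ) ^ s * N) + b * (δ₁ ^ s * δ ^ s) * N := by gcongr
        _ = (a * q ^ s) * (A * δ ^ s * N) + 1 / 2 * ((2 * b * δ₁ ^ s) * δ ^ s * N) := by
            rw [Real.mul_rpow (by linarith) hδ.le]; ring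
        _ ≤ 1 / 2 * (A * δ ^ s * N) + 1 / 2 * (A * δ ^ s * N) := by gcongr
        _ = _ := by ring
  intro δ hδ
  obtain ⟨j, hj⟩ := pow_unbounded_of_one_lt (δ₁ / δ) (one_lt_two : (1 : ℝ) < 2)
  exact key j δ hδ ((div_lt_iff₀ hδ).1 hj).le

theorem setLIntegral_add_right (A : Set (E n)) (a : E n) (F : E n → ℝ≥0∞) :
    ∫⁻ x in A, F (x + a) = ∫⁻ y in (fun y => y - a) ⁻¹' A, F y := by
  have h := (measurePreserving_add_right (volume : Measure (E n)) a).setLIntegral_comp_preimage_emb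
    (measurableEmbedding_addRight a) F ((fun y => y - a) ⁻¹' A)
  rw [← h]
  congr 2
  ext x
  simp

/-- The translates of the layer piece A by kTδη(z) + w, for 1 ≤ k ≤ K and fixed small w, are
disjoint and stay in Ω within a thicker layer. So K times the mass of A is at most twice the mass of
that layer plus the squared differences u(x) - u(x + τ). Averaging these over w in a ball turns them
into the Gagliardo double integral. -/
theorem IsConeField.card_mul_lintegral_le (hη : IsConeField Ω η ρ) (hΩo : IsOpen Ω)
    (hfr : (frontier Ω).Nonempty) {M : ℝ} (hM : ∀ x, ‖η x‖ ≤ M) {T : ℝ}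
    (hT : T = 2 / ρ + 1) {K : ℕ} {δ : ℝ} (hδ : 0 < δ) (hKδ : K * T * δ < ρ) (z : E n)
    (hs : 0 < s) {u : E n → ℝ} (hu : Measurable u) :
    K * ∫⁻ x in Ω ∩ {x | infDist x (frontier Ω) < δ} ∩ ball z ρ, ‖u x‖ₑ ^ 2
      ≤ 2 * (∫⁻ x in Ω ∩ {x | infDist x (frontier Ω) < (K * T * (M + 1) + 1) * δ}, ‖u x‖ₑ ^ 2)
        + 2 * K * (ENNReal.ofReal (((K * T * (M + 1) + 1) * δ) ^ (n + 2 * s))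
          / volume (ball (0 : E n) (ρ * T * δ))
          * ∫⁻ x in Ω, ∫⁻ y in Ω, ‖slopeQuot s u (x, y)‖ₑ ^ 2) := by
  have hρ := hη.pos
  have hρ1 := hη.le_one
  have hT1 : 1 ≤ T := by rw [hT]; exact le_add_of_nonneg_left (by positivity)
  have hTρ : 2 ≤ T * ρ := by
    rw [hT, add_mul, div_mul_cancel₀ _ hρ.ne']
    linarith
  set A := Ω ∩ {x | infDist x (frontier Ω) < δ} ∩ ball z ρ with hA
  have hAm : MeasurableSet A :=
    ((hΩo.inter (isOpen_infDist_lt _ _)).inter isOpen_ball).measurableSet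
  set κ : ℝ := K * T * (M + 1) + 1 with hκ
  set B := ball (0 : E n) (ρ * T * δ) with hB
  have hB0 : volume B ≠ 0 := (isOpen_ball.measure_pos _ (nonempty_ball.2 (by positivity))).ne'
  have hB1 : volume B ≠ ⊤ := measure_ball_lt_top.ne
  let τ : ℕ → E n → E n := fun k w => ((k * T * δ : ℝ) • η z + w)
  have hk1 : ∀ k ∈ Finset.Icc 1 K, (1 : ℝ) ≤ k ∧ (k : ℝ) ≤ K := fun k hk => by
    rw [Finset.mem_Icc] at hk
    exact ⟨by exact_mod_cast hk.1, by exact_mod_cast hk.2⟩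
  have hτn : ∀ k ∈ Finset.Icc 1 K, ∀ w ∈ B, ‖τ k w‖ ≤ K * T * (M + 1) * δ := by
    intro k hk w hw
    obtain ⟨h1, h2⟩ := hk1 k hk
    have h3 : ‖w‖ ≤ K * T * δ := by
      rw [hB, mem_ball_zero_iff] at hw
      refine hw.le.trans ?_
      gcongr
      linarith
    calc ‖τ k w‖ ≤ ‖(k * T * δ : ℝ) • η z‖ + ‖w‖ := norm_add_le _ _
      _ ≤ K * T * δ * M + K * T * δ := by
          rw [norm_smul, Real.norm_of_nonneg (by positivity)]
          gcongr
          exact hM z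
      _ = _ := by ring
  have hmem : ∀ k ∈ Finset.Icc 1 K, ∀ w ∈ B, ∀ x ∈ A, x + τ k w ∈ Ω := by
    intro k hk w hw x hx
    obtain ⟨h1, h2⟩ := hk1 k hk
    have ht : 0 < k * T * δ := by positivity
    have h3 := hη.mem x (subset_closure hx.1.1) z (by rw [dist_comm]; exact hx.2)
      (k * T * δ) ht (lt_of_le_of_lt (by gcongr) hKδ) ((k * T * δ)⁻¹ • w) (by
        rw [norm_smul, norm_inv, Real.norm_of_nonneg ht.le, inv_mul_lt_iff₀ ht]
        rw [hB, mem_ball_zero_iff] at hw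
        refine hw.trans_le ?_
        have : ρ * T * δ ≤ k * (ρ * T * δ) := le_mul_of_one_le_left (by positivity) h1
        linarith)
    rwa [smul_add, smul_inv_smul₀ ht.ne'] at h3
  have hlay : ∀ k ∈ Finset.Icc 1 K, ∀ w ∈ B, ∀ x ∈ A,
      infDist (x + τ k w) (frontier Ω) < κ * δ := by
    intro k hk w hw x hx
    have h1 := infDist_le_infDist_add_dist (s := frontier Ω) (x := x + τ k w) (y := x)
    have h2 : dist (x + τ k w) x ≤ K * T * (M + 1) * δ := by
      rw [dist_eq_norm, add_sub_cancel_left]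
      exact hτn k hk w hw
    have h3 : infDist x (frontier Ω) < δ := hx.1.2
    rw [hκ, add_mul]
    linarith
  -- If two translates met, then x = x' + tη(z) with t ≥ Tδ. As Tρ ≥ 2, the cone from x' would
  -- contain every point within δ of x, including a frontier point, which is impossible.
  have hne : ∀ k ∈ Finset.Icc 1 K, ∀ l ∈ Finset.Icc 1 K, k < l → ∀ w, ∀ x ∈ A, ∀ x' ∈ A,
      x + τ k w ≠ x' + τ l w := by
    intro k hk l hl hkl w x hx x' hx' heq
    obtain ⟨h1, h2⟩ := hk1 k hk
    obtain ⟨h1', h2'⟩ := hk1 l hl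
    have hkl' : (1 : ℝ) ≤ l - k := by
      have : (k : ℝ) + 1 ≤ l := by exact_mod_cast hkl
      linarith
    set t : ℝ := (l - k) * T * δ with ht
    have ht0 : T * δ ≤ t := by
      rw [ht, mul_assoc]
      exact le_mul_of_one_le_left (by positivity) hkl'
    have htp : 0 < t := lt_of_lt_of_le (by positivity) ht0
    have htρ : t < ρ := by
      refine lt_of_le_of_lt ?_ hKδ
      rw [ht]
      gcongr
      linarith
    have hx1 : x = x' + t • η z := by
      have : x = x' + τ l w - τ k w := by rw [← heq]; abel
      rw [this, ht]
      simp only [τ]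
      module
    obtain ⟨p, hp, hpx⟩ := (infDist_lt_iff hfr).1 (show infDist x (frontier Ω) < δ from hx.1.2)
    have h3 := hη.mem x' (subset_closure hx'.1.1) z (by rw [dist_comm]; exact hx'.2) t htp htρ
      (t⁻¹ • (p - x)) (by
        rw [norm_smul, norm_inv, Real.norm_of_nonneg htp.le, inv_mul_lt_iff₀ htp,
          ← dist_eq_norm, dist_comm]
        refine hpx.trans_le ?_
        nlinarith)
    rw [smul_add, smul_inv_smul₀ htp.ne', ← add_assoc, ← hx1, add_sub_cancel] at h3
    rw [hΩo.frontier_eq] at hp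
    exact hp.2 h3
  set J := ∫⁻ x in Ω ∩ {x | infDist x (frontier Ω) < κ * δ}, ‖u x‖ₑ ^ 2 with hJ
  have hsum : ∀ w ∈ B, ∑ k ∈ Finset.Icc 1 K, ∫⁻ x in A, ‖u (x + τ k w)‖ₑ ^ 2 ≤ J := by
    intro w hw
    have h1 : ∀ k, ∫⁻ x in A, ‖u (x + τ k w)‖ₑ ^ 2
        = ∫⁻ y in (fun y => y - τ k w) ⁻¹' A, ‖u y‖ₑ ^ 2 := fun k =>
      setLIntegral_add_right A (τ k w) fun y => ‖u y‖ₑ ^ 2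
    simp only [h1]
    rw [← lintegral_biUnion_finset]
    · refine lintegral_mono_set (Set.iUnion₂_subset fun k hk y hy => ?_)
      have h2 := hmem k hk w hw _ hy
      have h3 := hlay k hk w hw _ hy
      rw [sub_add_cancel] at h2 h3
      exact ⟨h2, h3⟩
    · intro k hk l hl hkl
      rw [Function.onFun, Set.disjoint_left]
      intro y hy hy'
      rcases lt_or_gt_of_ne hkl with h | h
      · exact hne k hk l hl h w _ hy _ hy' (by rw [sub_add_cancel, sub_add_cancel])
      · exact hne l hl k hk h w _ hy' _ hy (by rw [sub_add_cancel, sub_add_cancel])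
    · exact fun k _ => (measurable_id.sub_const _) hAm
  have hw : ∀ w ∈ B, K * ∫⁻ x in A, ‖u x‖ₑ ^ 2
      ≤ 2 * J + ∑ k ∈ Finset.Icc 1 K, 2 * ∫⁻ x in A, ‖u x - u (x + τ k w)‖ₑ ^ 2 := by
    intro w hw
    calc K * ∫⁻ x in A, ‖u x‖ₑ ^ 2 = ∑ k ∈ Finset.Icc 1 K, ∫⁻ x in A, ‖u x‖ₑ ^ 2 := by simp
      _ ≤ ∑ k ∈ Finset.Icc 1 K, (2 * (∫⁻ x in A, ‖u (x + τ k w)‖ₑ ^ 2)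
          + 2 * ∫⁻ x in A, ‖u x - u (x + τ k w)‖ₑ ^ 2) := by
          refine Finset.sum_le_sum fun k _ => ?_
          have h1 := lintegral_add_sq_le (μ := volume.restrict A) (fun x => u (x + τ k w))
            (fun x => u x - u (x + τ k w)) (by fun_prop)
          simpa only [add_sub_cancel] using h1
      _ = 2 * (∑ k ∈ Finset.Icc 1 K, ∫⁻ x in A, ‖u (x + τ k w)‖ₑ ^ 2)
          + ∑ k ∈ Finset.Icc 1 K, 2 * ∫⁻ x in A, ‖u x - u (x + τ k w)‖ₑ ^ 2 := by
          rw [Finset.sum_add_distrib, Finset.mul_sum]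
      _ ≤ _ := by
          gcongr
          exact hsum w hw
  set W := ∫⁻ x in Ω, ∫⁻ y in Ω, ‖slopeQuot s u (x, y)‖ₑ ^ 2 with hW
  have hdiff : ∀ k ∈ Finset.Icc 1 K, ∫⁻ w in B, ∫⁻ x in A, ‖u x - u (x + τ k w)‖ₑ ^ 2
      ≤ ENNReal.ofReal ((κ * δ) ^ (n + 2 * s)) * W := by
    intro k hk
    rw [lintegral_lintegral_swap (by
      simp only [τ]
      fun_prop)]
    rw [hW, ← lintegral_const_mul' _ _ ENNReal.ofReal_ne_top]
    refine (setLIntegral_mono' hAm fun x hx => ?_).trans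
      (lintegral_mono_set (Set.inter_subset_left.trans Set.inter_subset_left))
    calc ∫⁻ w in B, ‖u x - u (x + τ k w)‖ₑ ^ 2
        ≤ ∫⁻ w in B, Ω.indicator (fun y => ENNReal.ofReal ((κ * δ) ^ (n + 2 * s))
            * ‖slopeQuot s u (x, y)‖ₑ ^ 2) (w + (x + (k * T * δ : ℝ) • η z)) := by
          refine setLIntegral_mono' measurableSet_ball fun w hw => ?_
          have h1 : w + (x + (k * T * δ : ℝ) • η z) = x + τ k w := by
            simp only [τ]
            abel
          rw [h1, Set.indicator_of_mem (hmem k hk w hw x hx)]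
          refine enorm_sub_sq_le_slopeQuot hs ?_
          rw [sub_add_cancel_left, norm_neg]
          refine (hτn k hk w hw).trans ?_
          rw [hκ]
          gcongr
          exact (lt_add_one _).le
      _ ≤ ∫⁻ w, Ω.indicator (fun y => ENNReal.ofReal ((κ * δ) ^ (n + 2 * s))
            * ‖slopeQuot s u (x, y)‖ₑ ^ 2) (w + (x + (k * T * δ : ℝ) • η z)) :=
          setLIntegral_le_lintegral _ _
      _ = _ := by
          rw [lintegral_add_right_eq_self (fun w => Ω.indicator (fun y =>
            ENNReal.ofReal ((κ * δ) ^ (n + 2 * s)) * ‖slopeQuot s u (x, y)‖ₑ ^ 2) w),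
            lintegral_indicator hΩo.measurableSet, lintegral_const_mul' _ _ ENNReal.ofReal_ne_top]
  -- The inequality is integrated over w in B and then divided by the volume of B.
  have hall := setLIntegral_mono' (μ := volume) (measurableSet_ball (x := (0 : E n))) hw
  rw [setLIntegral_const, lintegral_add_left' aemeasurable_const, setLIntegral_const,
    lintegral_finsetSum' _ fun k _ => by
      refine AEMeasurable.const_mul ?_ _
      refine (Measurable.lintegral_prod_right ?_).aemeasurable
      simp only [τ]
      fun_prop] at hall
  have hall' := (ENNReal.le_div_iff_mul_le (Or.inl hB0) (Or.inl hB1)).2 hall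
  refine hall'.trans ?_
  rw [ENNReal.add_div, ENNReal.mul_div_cancel_right hB0 hB1]
  gcongr
  calc (∑ k ∈ Finset.Icc 1 K, ∫⁻ w in B, 2 * ∫⁻ x in A, ‖u x - u (x + τ k w)‖ₑ ^ 2) / volume B
      ≤ (∑ k ∈ Finset.Icc 1 K, 2 * (ENNReal.ofReal ((κ * δ) ^ (n + 2 * s)) * W)) / volume B := by
        gcongr with k hk
        rw [lintegral_const_mul' _ _ (by simp)]
        gcongr
        exact hdiff k hk
    _ = _ := by
        simp only [Finset.sum_const, Nat.card_Icc, add_tsub_cancel_right, nsmul_eq_mul,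
          div_eq_mul_inv]
        ring

theorem ofReal_div_volume_ball {a b δ t : ℝ} (ha : 0 ≤ a) (hb : 0 < b) (hδ : 0 < δ) :
    ENNReal.ofReal ((a * δ) ^ (n + t)) / volume (ball (0 : E n) (b * δ))
      = ENNReal.ofReal (a ^ (n + t) / (b ^ n * (volume (ball (0 : E n) 1)).toReal) * δ ^ t) := by
  have h1 : volume (ball (0 : E n) 1) ≠ ⊤ := measure_ball_lt_top.ne
  have h0 : 0 < (volume (ball (0 : E n) 1)).toReal :=
    ENNReal.toReal_pos (isOpen_ball.measure_pos _ (nonempty_ball.2 one_pos)).ne' h1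
  rw [Measure.addHaar_ball_of_pos _ _ (by positivity), finrank_euclideanSpace_fin,
    ← ENNReal.ofReal_toReal h1, ← ENNReal.ofReal_mul (by positivity),
    ← ENNReal.ofReal_div_of_pos (by positivity), ENNReal.toReal_ofReal h0.le]
  congr 1
  rw [Real.mul_rpow ha hδ.le, Real.rpow_add hδ, Real.rpow_natCast, mul_pow]
  field_simp

theorem ofReal_natCast_mul_add {K : ℕ} (hK : K ≠ 0) {a b c : ℝ} (ha : 0 ≤ a) (hb : 0 ≤ b)
    (hc : 0 ≤ c) : 2 * ENNReal.ofReal a + 2 * K * (ENNReal.ofReal b * ENNReal.ofReal c)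
      = K * ENNReal.ofReal (2 / K * a + 2 * b * c) := by
  rw [← ENNReal.ofReal_natCast K, ← ENNReal.ofReal_ofNat 2, ← ENNReal.ofReal_mul (by positivity),
    ← ENNReal.ofReal_mul (by positivity), ← ENNReal.ofReal_mul (by positivity),
    ← ENNReal.ofReal_mul (by positivity), ← ENNReal.ofReal_mul (by positivity),
    ← ENNReal.ofReal_add (by positivity) (by positivity)]
  congr 1
  field_simp

set_option maxHeartbeats 1000000 in
/-- Functions of `H^s(Ω)` are small in a thin layer along the boundary. -/
theorem IsConeField.exists_layer_estimate (hη : IsConeField Ω η ρ) (hΩo : IsOpen Ω)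
    (hΩb : Bornology.IsBounded Ω) (hfr : (frontier Ω).Nonempty) (hs : s ∈ Set.Ioo (0 : ℝ) 1) :
    ∃ C : ℝ, 0 ≤ C ∧ ∀ δ > 0, ∀ p : Hs s Ω,
      ∫⁻ x in Ω ∩ {x | infDist x (frontier Ω) < δ}, ‖hsVal p x‖ₑ ^ 2
        ≤ ENNReal.ofReal (C * δ ^ s * ‖p‖ ^ 2) := by
  obtain ⟨M, -, hM1, -, hM, -⟩ := hη.exists_bounds
  have hρ := hη.pos
  set T : ℝ := 2 / ρ + 1 with hT
  have hT1 : 1 ≤ T := le_add_of_nonneg_left (by positivity)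
  have hFc : IsCompact (frontier Ω) :=
    isCompact_of_isClosed_isBounded isClosed_frontier (hΩb.closure.subset frontier_subset_closure)
  -- Half radii leave room: a point within ρ/2 of the frontier is in one of the balls of radius ρ.
  obtain ⟨t, ht, htc⟩ := hFc.elim_nhds_subcover (fun z => ball z (ρ / 2))
    fun z _ => ball_mem_nhds z (half_pos hρ)
  set c : ℝ := T * (M + 1) + 1 with hc
  have hc1 : 1 ≤ c := le_add_of_nonneg_left (by positivity)
  -- The scaling lemma is used with factor a = 2·card/K and ratio κ ≤ Kc, so aκ^s ≤ 1/2 follows from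
  -- 4·card·c^s K^{s-1} ≤ 1, which large K satisfy because s < 1.
  obtain ⟨K, hK1, hK⟩ : ∃ K : ℕ, 1 ≤ K ∧ 4 * t.card * c ^ s * (K : ℝ) ^ (s - 1) ≤ 1 := by
    have h1 : Tendsto (fun K : ℕ => 4 * t.card * c ^ s * (K : ℝ) ^ (-(1 - s))) atTop
        (𝓝 (4 * t.card * c ^ s * 0)) :=
      ((tendsto_rpow_neg_atTop (by linarith [hs.2])).comp tendsto_natCast_atTop_atTop).const_mul _
    rw [mul_zero] at h1
    obtain ⟨K, h2, h3⟩ := ((h1.eventually (gt_mem_nhds one_pos)).and (eventually_ge_atTop 1)).exists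
    exact ⟨K, h3, by rw [neg_sub] at h2; exact h2.le⟩
  have hK0 : (1 : ℝ) ≤ K := by exact_mod_cast hK1
  set κ : ℝ := K * T * (M + 1) + 1 with hκ
  have hκ2 : 2 ≤ κ := by
    have : 1 * 1 * (1 : ℝ) ≤ K * T * (M + 1) := by gcongr; linarith
    linarith
  have hκc : κ ≤ K * c := by
    rw [hκ, hc]
    nlinarith
  set D : ℝ := κ ^ (n + 2 * s) / ((ρ * T) ^ n * (volume (ball (0 : E n) 1)).toReal) with hD
  have hD0 : 0 ≤ D := by positivity
  -- Below ρ/2 the layer is covered by the balls; below ρ/(KT) all K translates have length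
  -- parameter less than ρ.
  set δ₁ : ℝ := min (ρ / 2) (ρ / (K * T)) with hδ₁
  have hδ₁0 : 0 < δ₁ := by positivity
  clear_value δ₁ D
  refine ⟨δ₁ ^ (-s) + 2 * (t.card * (2 * D)) * δ₁ ^ s, by positivity, fun δ hδ p => ?_⟩
  let I : ℝ → ℝ := fun δ =>
    (∫⁻ x in Ω ∩ {x | infDist x (frontier Ω) < δ}, ‖hsVal p x‖ₑ ^ 2).toReal
  have hp := ofReal_norm_hs_sq p
  have hIle : ∀ δ, ∫⁻ x in Ω ∩ {x | infDist x (frontier Ω) < δ}, ‖hsVal p x‖ₑ ^ 2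
      ≤ ENNReal.ofReal (‖p‖ ^ 2) := fun δ => by
    rw [hp]
    exact (lintegral_mono_set Set.inter_subset_left).trans le_self_add
  have hIfin : ∀ δ, ∫⁻ x in Ω ∩ {x | infDist x (frontier Ω) < δ}, ‖hsVal p x‖ₑ ^ 2 ≠ ⊤ :=
    fun δ => ne_top_of_le_ne_top ENNReal.ofReal_ne_top (hIle δ)
  have hIof : ∀ δ, ENNReal.ofReal (I δ)
      = ∫⁻ x in Ω ∩ {x | infDist x (frontier Ω) < δ}, ‖hsVal p x‖ₑ ^ 2 := fun δ =>
    ENNReal.ofReal_toReal (hIfin δ)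
  have hI0 : ∀ δ, 0 ≤ I δ := fun δ => ENNReal.toReal_nonneg
  have hmain : ∀ δ > 0, I δ ≤ (δ₁ ^ (-s) + 2 * (t.card * (2 * D)) * δ₁ ^ s) * δ ^ s * ‖p‖ ^ 2 := by
    refine le_rpow_mul_of_scaling (q := κ) (a := t.card * (2 / K)) (sq_nonneg _) hs.1
      (by positivity) (by positivity) hκ2 hδ₁0 ?_
      (fun δ _ => ENNReal.toReal_le_of_le_ofReal (sq_nonneg _) (hIle δ)) ?_
    · have h1 : κ ^ s ≤ K ^ s * c ^ s := by
        rw [← Real.mul_rpow (by positivity) (by positivity)]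
        exact Real.rpow_le_rpow (by positivity) hκc hs.1.le
      rw [Real.rpow_sub_one (by positivity)] at hK
      calc t.card * (2 / K) * κ ^ s ≤ t.card * (2 / K) * (K ^ s * c ^ s) := by gcongr
        _ = 1 / 2 * (4 * t.card * c ^ s * (K ^ s / K)) := by ring
        _ ≤ _ := by linarith
    · intro δ hδ hδδ
      rw [hδ₁] at hδδ
      have h1 : δ < ρ / 2 := hδδ.trans_le (min_le_left _ _)
      have h2 : K * T * δ < ρ := by
        have := hδδ.trans_le (min_le_right _ _)
        rwa [lt_div_iff₀ (by positivity), mul_comm] at this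
      have h3 : ∀ z, ∫⁻ x in Ω ∩ {x | infDist x (frontier Ω) < δ} ∩ ball z ρ, ‖hsVal p x‖ₑ ^ 2
          ≤ ENNReal.ofReal (2 / K * I (κ * δ) + 2 * D * δ ^ (2 * s) * ‖p‖ ^ 2) := by
        intro z
        have h4 := hη.card_mul_lintegral_le hΩo hfr hM hT hδ h2 z hs.1
          (Lp.stronglyMeasurable (hsVal p)).measurable
        rw [ofReal_div_volume_ball (by positivity) (by positivity) hδ, ← hκ, ← hD] at h4
        have h5 : ∫⁻ x in Ω, ∫⁻ z in Ω, ‖slopeQuot s (hsVal p) (x, z)‖ₑ ^ 2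
            ≤ ENNReal.ofReal (‖p‖ ^ 2) := by rw [hp]; exact le_add_self
        have h6 : (K : ℝ≥0∞) * ∫⁻ x in Ω ∩ {x | infDist x (frontier Ω) < δ} ∩ ball z ρ,
            ‖hsVal p x‖ₑ ^ 2 ≤ K * ENNReal.ofReal
              (2 / K * I (κ * δ) + 2 * D * δ ^ (2 * s) * ‖p‖ ^ 2) := by
          refine h4.trans ?_
          rw [← hIof]
          calc _ ≤ 2 * ENNReal.ofReal (I (κ * δ)) + 2 * K * (ENNReal.ofReal (D * δ ^ (2 * s))
                * ENNReal.ofReal (‖p‖ ^ 2)) := by gcongr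
            _ = _ := by
              rw [ofReal_natCast_mul_add (by omega) (hI0 _) (by positivity) (sq_nonneg _)]
              congr 3
              ring
        exact (ENNReal.mul_le_mul_iff_right (by exact_mod_cast (by omega : K ≠ 0)) (by simp)).1 h6
      refine ENNReal.toReal_le_of_le_ofReal
        (add_nonneg (mul_nonneg (by positivity) (hI0 _)) (by positivity)) ?_
      calc _ ≤ ∫⁻ x in ⋃ z ∈ t, Ω ∩ {x | infDist x (frontier Ω) < δ} ∩ ball z ρ,
            ‖hsVal p x‖ₑ ^ 2 := by
            refine lintegral_mono_set fun x hx => ?_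
            obtain ⟨y, hy, hxy⟩ := (infDist_lt_iff hfr).1 hx.2
            obtain ⟨z, hz, hyz⟩ := Set.mem_iUnion₂.1 (htc hy)
            refine Set.mem_iUnion₂.2 ⟨z, hz, hx, ?_⟩
            rw [mem_ball] at hyz ⊢
            linarith [dist_triangle x y z]
        _ ≤ ∑ z ∈ t, ∫⁻ x in Ω ∩ {x | infDist x (frontier Ω) < δ} ∩ ball z ρ,
            ‖hsVal p x‖ₑ ^ 2 := lintegral_biUnion_finset_le _ _ _ _
        _ ≤ ∑ z ∈ t, ENNReal.ofReal (2 / K * I (κ * δ) + 2 * D * δ ^ (2 * s) * ‖p‖ ^ 2) :=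
            Finset.sum_le_sum fun z _ => h3 z
        _ = _ := by
            rw [Finset.sum_const, nsmul_eq_mul, ← ENNReal.ofReal_natCast,
              ← ENNReal.ofReal_mul (by positivity)]
            congr 1
            ring
  rw [← hIof]
  exact ENNReal.ofReal_le_ofReal (hmain δ hδ)

end Layer

/-! ### Lattice cells -/

section Cells

open Metric Filter Topology

variable {n : ℕ} {Ω : Set (E n)} {ε : ℝ}

/-- The point of `ℤⁿ ⊆ ℝⁿ` with given coordinates. -/
noncomputable def intVec (k : Fin n → ℤ) : E n := WithLp.toLp 2 fun i => (k i : ℝ)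

/-- The cell `ε (k + [0,1[ⁿ)`. -/
def floorCell (ε : ℝ) (k : Fin n → ℤ) : Set (E n) := {x | (fun i => ⌊(ε⁻¹ • x) i⌋) = k}

/-- The point `ε (k + y)`. -/
noncomputable def cellPt (ε : ℝ) (k : Fin n → ℤ) (y : E n) : E n := ε • (intVec k + y)

theorem intVec_apply (k : Fin n → ℤ) (i : Fin n) : intVec k i = (k i : ℝ) := rfl

theorem intVec_add (k q : Fin n → ℤ) : intVec (k + q) = intVec k + intVec q := by
  ext i
  simp [intVec_apply]

theorem cellPt_apply (ε : ℝ) (k : Fin n → ℤ) (y : E n) (i : Fin n) :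
    cellPt ε k y i = ε * (k i + y i) := rfl

theorem continuous_cellPt (ε : ℝ) (k : Fin n → ℤ) : Continuous (cellPt ε k) := by
  unfold cellPt
  fun_prop

theorem mem_floorCell (hε : 0 < ε) {k : Fin n → ℤ} {x : E n} :
    x ∈ floorCell ε k ↔ ∀ i, ε * k i ≤ x i ∧ x i < ε * (k i + 1) := by
  rw [floorCell, Set.mem_ofPred_eq, funext_iff]
  refine forall_congr' fun i => ?_
  rw [Int.floor_eq_iff, PiLp.smul_apply, smul_eq_mul, le_inv_mul_iff₀ hε, inv_mul_lt_iff₀ hε]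

theorem measurableSet_floorCell (ε : ℝ) (k : Fin n → ℤ) : MeasurableSet (floorCell ε k) := by
  have h : Measurable fun (x : E n) (i : Fin n) => ⌊(ε⁻¹ • x) i⌋ := by
    refine measurable_pi_lambda _ fun i => Int.measurable_floor.comp ?_
    exact ((EuclideanSpace.proj i : E n →L[ℝ] ℝ).continuous.comp
      (continuous_const_smul ε⁻¹)).measurable
  exact h (measurableSet_singleton k)

theorem disjoint_floorCell (ε : ℝ) {k l : Fin n → ℤ} (h : k ≠ l) :
    Disjoint (floorCell ε k) (floorCell ε l) :=
  Set.disjoint_left.2 fun _ hx hy => h (hx.symm.trans hy)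

theorem cellPt_mem_floorCell (hε : 0 < ε) {k : Fin n → ℤ} {y : E n} :
    cellPt ε k y ∈ floorCell ε k ↔ y ∈ floorCell 1 (0 : Fin n → ℤ) := by
  rw [mem_floorCell hε, mem_floorCell one_pos]
  refine forall_congr' fun i => ?_
  rw [cellPt_apply, mul_le_mul_iff_right₀ hε, mul_lt_mul_iff_right₀ hε]
  simp

theorem measurableSet_cell (n : ℕ) : MeasurableSet (cell n) := by
  have : cell n = ⋂ i, {y : E n | y i ∈ Set.Ioo (0 : ℝ) 1} := by
    ext y; simp [cell]
  rw [this]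
  exact MeasurableSet.iInter fun i =>
    ((EuclideanSpace.proj i : E n →L[ℝ] ℝ).continuous.measurable measurableSet_Ioo)

theorem cell_ae_eq (n : ℕ) : (cell n : Set (E n)) =ᵐ[volume] floorCell 1 (0 : Fin n → ℤ) := by
  have h0 : ∀ i : Fin n, volume {y : E n | y i = 0} = 0 := by
    intro i
    have h1 := Measure.addHaar_submodule (volume : Measure (E n))
      (LinearMap.ker (EuclideanSpace.proj i : E n →L[ℝ] ℝ).toLinearMap) (by
        intro h
        have h2 : (basisVec i : E n) ∈
            LinearMap.ker (EuclideanSpace.proj i : E n →L[ℝ] ℝ).toLinearMap := by rw [h]; trivial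
        simp at h2)
    refine (congrArg volume ?_).trans h1
    ext y
    simp
  have h1 : ∀ᵐ y : E n, ∀ i, y i ≠ 0 := ae_all_iff.2 fun i => by
    rw [ae_iff]
    simpa using h0 i
  filter_upwards [h1] with y hy
  refine propext ⟨fun h => (mem_floorCell one_pos).2 fun i => ?_, fun h i => ?_⟩
  · have := h i
    simp only [Pi.zero_apply, Int.cast_zero, mul_zero, zero_add, mul_one]
    exact ⟨this.1.le, this.2⟩
  · have := (mem_floorCell one_pos).1 h i
    simp only [Pi.zero_apply, Int.cast_zero, mul_zero, zero_add, mul_one] at this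
    exact ⟨lt_of_le_of_ne this.1 (hy i).symm, this.2⟩

theorem measurableEmbedding_cellPt (hε : 0 < ε) (k : Fin n → ℤ) :
    MeasurableEmbedding (cellPt ε k) :=
  (measurableEmbedding_const_smul₀ hε.ne').comp (measurableEmbedding_addLeft (intVec k))

theorem map_cellPt (hε : 0 < ε) (k : Fin n → ℤ) :
    Measure.map (cellPt ε k) (volume.restrict (cell n))
      = ENNReal.ofReal (ε ^ n)⁻¹ • volume.restrict (floorCell ε k) := by
  have h1 : cellPt ε k ⁻¹' floorCell ε k = floorCell 1 (0 : Fin n → ℤ) := by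
    ext y
    exact cellPt_mem_floorCell hε
  have h2 : Measure.map (cellPt ε k) (volume : Measure (E n))
      = ENNReal.ofReal (ε ^ n)⁻¹ • volume := by
    have h3 : cellPt ε k = (fun x => ε • x) ∘ (fun y => intVec k + y) := rfl
    rw [h3, ← Measure.map_map (measurable_const_smul ε) (measurable_const_add _),
      map_add_left_eq_self, Measure.map_addHaar_smul _ hε.ne', finrank_euclideanSpace_fin,
      abs_of_pos (by positivity)]
  rw [Measure.restrict_congr_set (cell_ae_eq n), ← h1,
    ← (measurableEmbedding_cellPt hε k).restrict_map, h2, Measure.restrict_smul]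

theorem lintegral_cellPt (hε : 0 < ε) (k : Fin n → ℤ) (F : E n → ℝ≥0∞) :
    ENNReal.ofReal (ε ^ n) * ∫⁻ y in cell n, F (cellPt ε k y) = ∫⁻ x in floorCell ε k, F x := by
  rw [← (measurableEmbedding_cellPt hε k).lintegral_map, map_cellPt hε, lintegral_smul_measure,
    smul_eq_mul, ← mul_assoc, ← ENNReal.ofReal_mul (by positivity),
    mul_inv_cancel₀ (by positivity), ENNReal.ofReal_one, one_mul]

theorem integral_cellPt {F : Type*} [NormedAddCommGroup F] [NormedSpace ℝ F] (hε : 0 < ε)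
    (k : Fin n → ℤ) (f : E n → F) :
    ε ^ n • ∫ y in cell n, f (cellPt ε k y) = ∫ x in floorCell ε k, f x := by
  rw [← (measurableEmbedding_cellPt hε k).integral_map, map_cellPt hε, integral_smul_measure,
    ENNReal.toReal_ofReal (by positivity), smul_inv_smul₀ (by positivity)]

theorem quasiMeasurePreserving_cellPt (hε : 0 < ε) (k : Fin n → ℤ) :
    Measure.QuasiMeasurePreserving (cellPt ε k) (volume.restrict (cell n))
      (volume.restrict (floorCell ε k)) :=
  ⟨(continuous_cellPt ε k).measurable, by
    rw [map_cellPt hε]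
    exact Measure.smul_absolutelyContinuous⟩

theorem memLp_comp_cellPt {F : Type*} [NormedAddCommGroup F] (hε : 0 < ε) (k : Fin n → ℤ)
    {f : E n → F} (hf : MemLp f 2 (volume.restrict (floorCell ε k))) :
    MemLp (fun y => f (cellPt ε k y)) 2 (volume.restrict (cell n)) := by
  have h1 : MemLp f 2 (Measure.map (cellPt ε k) (volume.restrict (cell n))) := by
    rw [map_cellPt hε]
    exact hf.smul_measure ENNReal.ofReal_ne_top
  exact h1.comp_of_map (continuous_cellPt ε k).aemeasurable

theorem volume_cell (n : ℕ) : volume (cell n) = 1 := by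
  have h : (cell n : Set (E n))
      = (MeasurableEquiv.toLp 2 (Fin n → ℝ)).symm ⁻¹' (Set.univ.pi fun _ => Set.Ioo 0 1) := by
    ext y
    simp [cell]
  rw [h, (EuclideanSpace.volume_preserving_symm_measurableEquiv_toLp (Fin n)).measure_preimage
    (MeasurableSet.univ_pi fun _ => measurableSet_Ioo).nullMeasurableSet, Real.volume_pi_Ioo]
  simp

theorem volume_floorCell (hε : 0 < ε) (k : Fin n → ℤ) :
    volume (floorCell ε k) = ENNReal.ofReal (ε ^ n) := by
  have h := lintegral_cellPt hε k fun _ => 1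
  simpa [volume_cell] using h.symm

theorem dist_lt_of_forall_abs_sub_lt (hn : 1 ≤ n) {x z : E n} {r : ℝ}
    (h : ∀ i, |x i - z i| < r) : dist x z < √n * r := by
  have hr : 0 ≤ r := (abs_nonneg _).trans (h ⟨0, hn⟩).le
  rw [EuclideanSpace.dist_eq, ← Real.sqrt_sq hr, ← Real.sqrt_mul (Nat.cast_nonneg n)]
  refine Real.sqrt_lt_sqrt (Finset.sum_nonneg fun i _ => sq_nonneg _) ?_
  have : Nonempty (Fin n) := ⟨⟨0, hn⟩⟩
  calc ∑ i, dist (x i) (z i) ^ 2 < ∑ _i : Fin n, r ^ 2 := by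
        refine Finset.sum_lt_sum_of_nonempty Finset.univ_nonempty fun i _ => ?_
        rw [Real.dist_eq]
        exact pow_lt_pow_left₀ (h i) (abs_nonneg _) two_ne_zero
    _ = _ := by simp

/-- The box `ε (k + [0,3[ⁿ)`. -/
def cellBox (ε : ℝ) (k : Fin n → ℤ) : Set (E n) :=
  {x | ∀ i, ε * k i ≤ x i ∧ x i < ε * (k i + 3)}

theorem floorCell_subset_cellBox (hε : 0 < ε) (k : Fin n → ℤ) {q : Fin n → ℤ}
    (hq : q ∈ Finset.Icc (0 : Fin n → ℤ) 2) : floorCell ε (k + q) ⊆ cellBox ε k := by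
  intro x hx i
  have h1 := (mem_floorCell hε).1 hx i
  rw [Finset.mem_Icc] at hq
  have h2 : (0 : ℝ) ≤ q i := by exact_mod_cast hq.1 i
  have h3 : (q i : ℝ) ≤ 2 := by exact_mod_cast hq.2 i
  simp only [Pi.add_apply, Int.cast_add] at h1
  constructor
  · exact le_trans (by gcongr; linarith) h1.1
  · exact h1.2.trans_le (by gcongr ε * ?_; linarith)

/-- The cube of 3ⁿ cells has diameter 3√n ε, not attained since it is half-open: this is the width
of the neighbourhoods of Ω and of its boundary. -/
theorem dist_lt_of_mem_cellBox (hn : 1 ≤ n) {k : Fin n → ℤ} {x z : E n}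
    (hx : x ∈ cellBox ε k) (hz : z ∈ cellBox ε k) : dist x z < (3 : ℕ) * √n * ε := by
  rw [show ((3 : ℕ) : ℝ) * √n * ε = √n * (3 * ε) by push_cast; ring]
  refine dist_lt_of_forall_abs_sub_lt hn fun i => abs_sub_lt_iff.2 ⟨?_, ?_⟩
  · linarith [(hx i).2, (hz i).1]
  · linarith [(hz i).2, (hx i).1]

/-- The closed box `ε (k + [0,3]ⁿ)`. -/
def closedCellBox (ε : ℝ) (k : Fin n → ℤ) : Set (E n) :=
  {x | ∀ i, ε * k i ≤ x i ∧ x i ≤ ε * (k i + 3)}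

theorem cellBox_subset_closedCellBox (ε : ℝ) (k : Fin n → ℤ) :
    cellBox ε k ⊆ closedCellBox ε k := fun _ hx i => ⟨(hx i).1, (hx i).2.le⟩

theorem isCompact_closedCellBox (ε : ℝ) (k : Fin n → ℤ) : IsCompact (closedCellBox ε k) := by
  have h : closedCellBox ε k = (EuclideanSpace.equiv (Fin n) ℝ).toHomeomorph ⁻¹'
      (Set.univ.pi fun i => Set.Icc (ε * k i) (ε * (k i + 3))) := by
    ext x
    exact ⟨fun hx i _ => hx i, fun hx i => hx i trivial⟩
  rw [h]
  exact (Homeomorph.isCompact_preimage _).2 (isCompact_univ_pi fun _ => isCompact_Icc)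

/-- A point of Ω in the cell is first moved slightly along the diagonal, staying in Ω and in the
cell. All coordinate distances to points of the closed box then become strictly less than 3ε. The
closed box is needed for approximation on compact sets. -/
theorem closedCellBox_subset_outerNbhd (hn : 1 ≤ n) (hΩo : IsOpen Ω) (hε : 0 < ε)
    {k : Fin n → ℤ} (hk : (floorCell ε k ∩ Ω).Nonempty) :
    closedCellBox ε k ⊆ outerNbhd Ω ε 3 := by
  obtain ⟨z, hz, hzΩ⟩ := hk
  have hz' := (mem_floorCell hε).1 hz
  let w : ℝ → E n := fun t => z + t • WithLp.toLp 2 fun _ => (1 : ℝ)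
  have hw : ∀ t i, w t i = z i + t := fun t i => by simp [w]
  have hcont : Continuous w := by fun_prop
  have h1 : ∀ᶠ t in 𝓝[>] (0 : ℝ), w t ∈ Ω := by
    refine (hcont.tendsto' 0 z (by simp [w])).mono_left nhdsWithin_le_nhds |>.eventually
      (hΩo.mem_nhds hzΩ)
  have h2 : ∀ᶠ t in 𝓝[>] (0 : ℝ), ∀ i, w t i < ε * (k i + 1) := by
    refine eventually_all.2 fun i => ?_
    have h3 : Tendsto (fun t => w t i) (𝓝[>] 0) (𝓝 (z i)) := by
      simp only [hw]
      have : Tendsto (fun t : ℝ => z i + t) (𝓝 0) (𝓝 (z i + 0)) :=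
        tendsto_const_nhds.add tendsto_id
      rw [add_zero] at this
      exact this.mono_left nhdsWithin_le_nhds
    exact h3.eventually (gt_mem_nhds (hz' i).2)
  obtain ⟨t, ht1, ht2, ht0⟩ := (h1.and (h2.and self_mem_nhdsWithin)).exists
  intro x hx
  refine (infDist_le_dist_of_mem ht1).trans_lt ?_
  rw [show ((3 : ℕ) : ℝ) * √n * ε = √n * (3 * ε) by push_cast; ring]
  refine dist_lt_of_forall_abs_sub_lt hn fun i => ?_
  have h3 := hx i
  have h4 := ht2 i
  have h5 := hz' i
  have h6 : (0 : ℝ) < t := ht0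
  rw [hw] at h4 ⊢
  rw [abs_sub_lt_iff]
  constructor <;> nlinarith

theorem finite_setOf_floorCell_inter (hΩb : Bornology.IsBounded Ω) (ε : ℝ) :
    {k : Fin n → ℤ | (floorCell ε k ∩ Ω).Nonempty}.Finite := by
  obtain ⟨R, hR⟩ := hΩb.exists_norm_le
  set M : ℤ := ⌈|ε⁻¹| * R⌉ + 1
  refine (Set.finite_Icc (fun _ : Fin n => -M) fun _ => M).subset ?_
  rintro k ⟨x, hx, hxΩ⟩
  have hM : |ε⁻¹| * R ≤ (M : ℝ) - 1 := by
    have := Int.le_ceil (|ε⁻¹| * R)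
    simp only [M, Int.cast_add, Int.cast_one]
    linarith
  have hb : ∀ i, |(ε⁻¹ • x) i| ≤ |ε⁻¹| * R := by
    intro i
    have h1 : ‖x i‖ ≤ ‖x‖ := PiLp.norm_apply_le x i
    rw [PiLp.smul_apply, smul_eq_mul, abs_mul]
    exact mul_le_mul_of_nonneg_left (h1.trans (hR x hxΩ)) (abs_nonneg _)
  have hk : ∀ i, ⌊(ε⁻¹ • x) i⌋ = k i := congrFun hx
  refine ⟨fun i => ?_, fun i => ?_⟩
  · rw [← hk i]
    refine Int.le_floor.2 ?_
    have := (abs_le.1 (hb i)).1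
    push_cast
    linarith
  · have h2 : (k i : ℝ) ≤ (M : ℝ) := by
      rw [← hk i]
      have := (abs_le.1 (hb i)).2
      have := Int.floor_le ((ε⁻¹ • x) i)
      linarith
    exact_mod_cast h2

end Cells

/-! ### Periodisation on the unit cell -/

section Periodic

open Metric Filter Topology

variable {n : ℕ}

/-- The vertex of the unit cube with given set of nonzero coordinates. -/
def vertex (A : Finset (Fin n)) (i : Fin n) : ℤ := if i ∈ A then 1 else 0

theorem intVec_vertex_empty : intVec (vertex (∅ : Finset (Fin n))) = 0 := by
  ext i
  simp [intVec_apply, vertex]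

theorem intVec_vertex_insert {A : Finset (Fin n)} {i : Fin n} (hi : i ∉ A) :
    intVec (vertex (insert i A)) = intVec (vertex A) + basisVec i := by
  ext j
  rcases eq_or_ne j i with rfl | h
  · simp [intVec_apply, vertex, hi]
  · simp [intVec_apply, vertex, h]

theorem vertex_mem_Icc (A : Finset (Fin n)) : vertex A ∈ Finset.Icc (0 : Fin n → ℤ) 2 := by
  rw [Finset.mem_Icc]
  constructor <;> intro i <;> simp only [vertex] <;> split_ifs <;> simp

theorem IsPeriodic.add_vertex {ψ : E n → ℝ} (h : IsPeriodic ψ) (A : Finset (Fin n)) (y : E n) :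
    ψ (y + intVec (vertex A)) = ψ y := by
  induction A using Finset.induction_on with
  | empty => rw [intVec_vertex_empty, add_zero]
  | insert i A hi ih => rw [intVec_vertex_insert hi, ← add_assoc, h, ih]

theorem partialDeriv_comp_add (ψ : E n → ℝ) (a : E n) (i : Fin n) (y : E n) :
    partialDeriv (fun y => ψ (y + a)) i y = partialDeriv ψ i (y + a) := by
  rw [partialDeriv, partialDeriv, fderiv_comp_add_right]

theorem IsPeriodic.partialDeriv {ψ : E n → ℝ} (h : IsPeriodic ψ) (i : Fin n) :
    IsPeriodic (partialDeriv ψ i) := fun j y => by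
  rw [← partialDeriv_comp_add]
  congr 1
  exact funext fun y => h j y

/-- The sum of the translates of `f` by the vertices of the unit cube. -/
noncomputable def vertexSum (f : E n → ℝ) (y : E n) : ℝ :=
  ∑ A : Finset (Fin n), f (y + intVec (vertex A))

theorem contDiff_vertexSum {f : E n → ℝ} (hf : ContDiff ℝ ∞ f) : ContDiff ℝ ∞ (vertexSum f) :=
  ContDiff.sum fun _ _ => hf.comp (contDiff_id.add contDiff_const)

theorem partialDeriv_vertexSum {f : E n → ℝ} (hf : ContDiff ℝ ∞ f) (i : Fin n) (y : E n) :
    partialDeriv (vertexSum f) i y = vertexSum (partialDeriv f i) y := by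
  have hd : ∀ A ∈ (Finset.univ : Finset (Finset (Fin n))),
      DifferentiableAt ℝ (fun y => f (y + intVec (vertex A))) y := fun A _ =>
    ((hf.comp (contDiff_id.add contDiff_const)).differentiable (by simp)) y
  have h := fderiv_fun_sum hd
  rw [partialDeriv, show vertexSum f = fun y => ∑ A : Finset (Fin n), f (y + intVec (vertex A))
    from rfl, h, sum_apply]
  exact Finset.sum_congr rfl fun A _ => partialDeriv_comp_add f _ i y

/-- A one-dimensional bump function whose integer translates sum up to one. -/
noncomputable def bump (t : ℝ) : ℝ :=
  Real.smoothTransition (2 * t) - Real.smoothTransition (2 * (t - 1))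

theorem contDiff_bump : ContDiff ℝ ∞ bump :=
  (Real.smoothTransition.contDiff.comp (contDiff_const.mul contDiff_id)).sub
    (Real.smoothTransition.contDiff.comp (contDiff_const.mul (contDiff_id.sub contDiff_const)))

theorem bump_eq_zero {t : ℝ} (h : t ∉ Set.Icc (0 : ℝ) (3 / 2)) : bump t = 0 := by
  rw [Set.mem_Icc, not_and_or, not_le, not_le] at h
  rcases h with h | h
  · rw [bump, Real.smoothTransition.zero_of_nonpos (by linarith),
      Real.smoothTransition.zero_of_nonpos (by linarith), sub_zero]
  · rw [bump, Real.smoothTransition.one_of_one_le (by linarith),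
      Real.smoothTransition.one_of_one_le (by linarith), sub_self]

theorem bump_add_bump {t : ℝ} (h0 : 0 ≤ t) (h1 : t ≤ 1) : bump t + bump (t + 1) = 1 := by
  rw [bump, bump, Real.smoothTransition.one_of_one_le (x := 2 * (t + 1)) (by linarith),
    Real.smoothTransition.zero_of_nonpos (x := 2 * (t - 1)) (by linarith), add_sub_cancel_right]
  ring

/-- A smooth function supported in the cube `[0,2[ⁿ`, whose integer translates sum up to one. -/
noncomputable def cubeBump (y : E n) : ℝ := ∏ i, bump (y i)

theorem contDiff_cubeBump : ContDiff ℝ ∞ (cubeBump : E n → ℝ) :=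
  contDiff_prod fun i _ => contDiff_bump.comp (EuclideanSpace.proj i : E n →L[ℝ] ℝ).contDiff

/-- Expanding the product of the sums bump(y_i + 1) + bump(y_i) = 1 over subsets of coordinates
gives the sum over the vertices. -/
theorem vertexSum_cubeBump {y : E n} (hy : y ∈ cell n) : vertexSum cubeBump y = 1 := by
  classical
  have h1 : ∏ i : Fin n, (bump (y i + 1) + bump (y i)) = 1 :=
    Finset.prod_eq_one fun i _ => by
      rw [add_comm]
      exact bump_add_bump (hy i).1.le (hy i).2.le
  rw [Fintype.prod_add] at h1
  rw [← h1]
  refine Finset.sum_congr rfl fun A _ => ?_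
  rw [cubeBump, ← Finset.prod_mul_prod_compl A]
  congr 1
  · refine Finset.prod_congr rfl fun i hi => ?_
    simp [intVec_apply, vertex, hi]
  · refine Finset.prod_congr rfl fun i hi => ?_
    rw [Finset.mem_compl] at hi
    simp [intVec_apply, vertex, hi]

theorem isOpen_cell (n : ℕ) : IsOpen (cell n) := by
  have : cell n = ⋂ i, {y : E n | y i ∈ Set.Ioo (0 : ℝ) 1} := by
    ext y; simp [cell]
  rw [this]
  exact isOpen_iInter_of_finite fun i =>
    isOpen_Ioo.preimage (EuclideanSpace.proj i : E n →L[ℝ] ℝ).continuous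

theorem vertexSum_partialDeriv_cubeBump {y : E n} (hy : y ∈ cell n) (i : Fin n) :
    vertexSum (partialDeriv cubeBump i) y = 0 := by
  rw [← partialDeriv_vertexSum contDiff_cubeBump, partialDeriv]
  have h : vertexSum (cubeBump : E n → ℝ) =ᶠ[𝓝 y] fun _ => 1 := by
    filter_upwards [(isOpen_cell n).mem_nhds hy] with z hz using vertexSum_cubeBump hz
  rw [h.fderiv_eq]
  simp

theorem tsupport_cubeBump_subset :
    tsupport (cubeBump : E n → ℝ) ⊆ {y | ∀ i, y i ∈ Set.Icc (0 : ℝ) (3 / 2)} := by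
  have hcl : IsClosed {y : E n | ∀ i, y i ∈ Set.Icc (0 : ℝ) (3 / 2)} := by
    have : {y : E n | ∀ i, y i ∈ Set.Icc (0 : ℝ) (3 / 2)}
        = ⋂ i, {y : E n | y i ∈ Set.Icc (0 : ℝ) (3 / 2)} := by ext y; simp
    rw [this]
    exact isClosed_iInter fun i =>
      isClosed_Icc.preimage (EuclideanSpace.proj i : E n →L[ℝ] ℝ).continuous
  refine closure_minimal (fun y hy i => ?_) hcl
  by_contra h
  exact hy (Finset.prod_eq_zero (Finset.mem_univ i) (bump_eq_zero h))

theorem hasCompactSupport_cubeBump : HasCompactSupport (cubeBump : E n → ℝ) := by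
  refine HasCompactSupport.of_support_subset_isCompact (isCompact_closedCellBox 1 0)
    ((subset_tsupport _).trans (tsupport_cubeBump_subset.trans fun y hy i => ?_))
  have := hy i
  simp only [Pi.zero_apply, Int.cast_zero, mul_zero, zero_add, one_mul]
  exact ⟨this.1, by linarith [this.2]⟩

theorem mem_floorCell_vertex {y : E n} (hy : ∀ i, y i ∈ Set.Ico (0 : ℝ) 2) :
    ∃ A, y ∈ floorCell 1 (vertex A) := by
  classical
  refine ⟨Finset.univ.filter fun i => 1 ≤ y i, (mem_floorCell one_pos).2 fun i => ?_⟩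
  have := hy i
  simp only [vertex, Finset.mem_filter, Finset.mem_univ, true_and, one_mul]
  split_ifs with h
  · push_cast
    exact ⟨h, by linarith [this.2]⟩
  · push_cast
    exact ⟨this.1, by linarith⟩

theorem vertex_injective : Function.Injective (vertex : Finset (Fin n) → Fin n → ℤ) := by
  intro A B h
  ext i
  have := congrFun h i
  simp only [vertex] at this
  split_ifs at this with h1 h2 h2 <;> simp_all

theorem cellPt_one (k : Fin n → ℤ) (y : E n) : cellPt 1 k y = y + intVec k := by
  rw [cellPt, one_smul, add_comm]

/-- The cells at the vertices tile [0,2[ⁿ, which contains the support of f. -/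
theorem integral_vertexSum {f : E n → ℝ} (hf : Continuous f)
    (h0 : ∀ y, ¬ (∀ i, y i ∈ Set.Icc (0 : ℝ) (3 / 2)) → f y = 0) (hc : HasCompactSupport f) :
    ∫ y in cell n, vertexSum f y = ∫ y, f y := by
  have hi : Integrable f := hf.integrable_of_hasCompactSupport hc
  have h1 : ∀ A : Finset (Fin n), ∫ y in cell n, f (y + intVec (vertex A))
      = ∫ y in floorCell 1 (vertex A), f y := fun A => by
    rw [← integral_cellPt one_pos, one_pow, one_smul]
    simp only [cellPt_one]
  have h2 : ∫ y in ⋃ A ∈ (Finset.univ : Finset (Finset (Fin n))), floorCell 1 (vertex A), f y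
      = ∫ y, f y := by
    refine setIntegral_eq_integral_of_forall_compl_eq_zero fun y hy => h0 y fun h => hy ?_
    obtain ⟨A, hA⟩ := mem_floorCell_vertex (y := y) fun i => ⟨(h i).1, by linarith [(h i).2]⟩
    exact Set.mem_iUnion₂.2 ⟨A, Finset.mem_univ A, hA⟩
  rw [← h2, integral_biUnion_finset _ (fun A _ => measurableSet_floorCell 1 _)
    (fun A _ B _ hAB => disjoint_floorCell 1 (vertex_injective.ne hAB))
    fun A _ => hi.integrableOn]
  simp only [vertexSum, ← h1]
  refine integral_finsetSum _ fun A _ => ?_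
  exact ((hf.comp (continuous_id.add continuous_const)).integrable_of_hasCompactSupport
    (hc.comp_homeomorph (Homeomorph.addRight _))).integrableOn

/-- `p` is smooth, and its gradient is its weak gradient on the torus. -/
def PerGrad (p : E n → ℝ) : Prop :=
  ContDiff ℝ ∞ p ∧ ∀ (i : Fin n) (ψ : E n → ℝ), ContDiff ℝ ∞ ψ → IsPeriodic ψ →
    ∫ y in cell n, partialDeriv ψ i y * p y = - ∫ y in cell n, ψ y * partialDeriv p i y

theorem integrable_cell_of_continuous {f : E n → ℝ} (hf : Continuous f) :
    Integrable f (volume.restrict (cell n)) :=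
  (hf.continuousOn.integrableOn_compact
    (isCompact_closedBall (0 : E n) (Real.sqrt n))).mono_set (cell_subset n)

/-- On Y the vertex sum S f of f = θu, with θ the bump `cubeBump`, is the restriction of the
periodisation of f. For periodic ψ the sum ∂ψ·Sf + ψ·∂(Sf) equals S(∂(ψf)), whose integral over Y is
the integral of ∂(ψf) over ℝⁿ, that is 0. -/
theorem perGrad_vertexSum {u : E n → ℝ} (hu : ContDiff ℝ ∞ u) :
    PerGrad (vertexSum fun y => cubeBump y * u y) := by
  set f : E n → ℝ := fun y => cubeBump y * u y with hf
  have hfs : ContDiff ℝ ∞ f := contDiff_cubeBump.mul hu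
  have hfc : HasCompactSupport f := hasCompactSupport_cubeBump.mul_right
  refine ⟨contDiff_vertexSum hfs, fun i ψ hψ hper => ?_⟩
  have hψf : ContDiff ℝ ∞ fun y => ψ y * f y := hψ.mul hfs
  have hψfc : HasCompactSupport fun y => ψ y * f y := hfc.mul_left
  have hsupp : tsupport (fun y => ψ y * f y) ⊆ {y | ∀ i, y i ∈ Set.Icc (0 : ℝ) (3 / 2)} :=
    (tsupport_mul_subset_right.trans tsupport_mul_subset_left).trans tsupport_cubeBump_subset
  have h1 := integral_vertexSum (continuous_partialDeriv hψf i)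
    (fun y hy => partialDeriv_eq_zero_of_notMem (fun h => hy (hsupp h)) i)
    (hψfc.fderiv_apply ℝ _)
  rw [integral_partialDeriv_eq_zero hψf hψfc] at h1
  have i1 : Integrable (fun y => partialDeriv ψ i y * vertexSum f y) (volume.restrict (cell n)) :=
    integrable_cell_of_continuous ((continuous_partialDeriv hψ i).mul
      (contDiff_vertexSum hfs).continuous)
  have i2 : Integrable (fun y => ψ y * partialDeriv (vertexSum f) i y)
      (volume.restrict (cell n)) :=
    integrable_cell_of_continuous (hψ.continuous.mul
      (continuous_partialDeriv (contDiff_vertexSum hfs) i))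
  rw [eq_neg_iff_add_eq_zero, ← integral_add i1 i2, ← h1]
  refine integral_congr_ae (Eventually.of_forall fun y => ?_)
  simp only [partialDeriv_vertexSum hfs, vertexSum, Finset.mul_sum, partialDeriv_mul hψ hfs,
    Finset.sum_add_distrib, hper.add_vertex, (hper.partialDeriv i).add_vertex]

/-- The preceding integration by parts with u = 1, for which the vertex sum is identically 1 on Y.
-/
theorem IsPeriodic.integral_partialDeriv_eq_zero {ψ : E n → ℝ} (hψ : ContDiff ℝ ∞ ψ)
    (h : IsPeriodic ψ) (i : Fin n) : ∫ y in cell n, Unfolding.partialDeriv ψ i y = 0 := by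
  have h1 := (perGrad_vertexSum (contDiff_const (c := (1 : ℝ)))).2 i ψ hψ h
  simp only [mul_one] at h1
  rw [setIntegral_congr_fun (g := Unfolding.partialDeriv ψ i) (measurableSet_cell n) fun y hy => by
    change Unfolding.partialDeriv ψ i y * vertexSum cubeBump y = _
    rw [vertexSum_cubeBump hy, mul_one]] at h1
  rw [h1, setIntegral_congr_fun (g := fun _ => (0 : ℝ)) (measurableSet_cell n) fun y hy => by
    change ψ y * Unfolding.partialDeriv (vertexSum cubeBump) i y = 0
    rw [partialDeriv_vertexSum contDiff_cubeBump, vertexSum_partialDeriv_cubeBump hy, mul_zero]]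
  simp

end Periodic

/-! ### Gradients with small oscillation between cells -/

section PeriodicApproximation

open Metric Filter Topology

variable {n : ℕ}

theorem enorm_sum_sq_le {ι F : Type*} [NormedAddCommGroup F] (s : Finset ι) (f : ι → F) :
    ‖∑ i ∈ s, f i‖ₑ ^ 2 ≤ s.card * ∑ i ∈ s, ‖f i‖ₑ ^ 2 := by
  have h1 : ‖∑ i ∈ s, f i‖₊ ^ 2 ≤ s.card * ∑ i ∈ s, ‖f i‖₊ ^ 2 :=
    (pow_le_pow_left' (nnnorm_sum_le s f) 2).trans sq_sum_le_card_mul_sum_sq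
  simp only [enorm_eq_nnnorm]
  exact_mod_cast h1

theorem gradient_sub_inner {ψ : E n → ℝ} (hψ : ContDiff ℝ ∞ ψ) (c : E n) (i : Fin n) (y : E n) :
    partialDeriv (fun y => ψ y - inner ℝ c y) i y = partialDeriv ψ i y - c i := by
  have h := ((hψ.differentiable (by simp)) y).hasFDerivAt.sub (innerSL ℝ c).hasFDerivAt
  rw [partialDeriv, show (fun y => ψ y - inner ℝ c y) = ψ - ⇑(innerSL ℝ c) from rfl, h.fderiv,
    sub_apply, innerSL_apply_apply, EuclideanSpace.inner_single_right]
  simp [partialDeriv]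

theorem contDiff_sub_inner {ψ : E n → ℝ} (hψ : ContDiff ℝ ∞ ψ) (c : E n) :
    ContDiff ℝ ∞ fun y => ψ y - inner ℝ c y :=
  hψ.sub (contDiff_const.inner ℝ contDiff_id)

theorem partialDeriv_sub {f g : E n → ℝ} (hf : ContDiff ℝ ∞ f) (hg : ContDiff ℝ ∞ g) (i : Fin n)
    (y : E n) : partialDeriv (fun y => f y - g y) i y = partialDeriv f i y - partialDeriv g i y := by
  rw [partialDeriv, fderiv_fun_sub ((hf.differentiable (by simp)) y)
    ((hg.differentiable (by simp)) y)]
  rfl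

/-- The difference of two values of the gradient at points that differ by an integer vector. -/
noncomputable def gradShift (ψ : E n → ℝ) (q : Fin n → ℤ) (y : E n) : E n :=
  gradient ψ (y + intVec q) - gradient ψ y

/-- Let u = ψ - c·y and let θ_A be the translates of the bump. Since Σθ_A = 1 and Σ∇θ_A = 0 on Y,
one may write ∇u = Σ(θ_A ∇u + u ∇θ_A); subtracting the gradient of the periodisation leaves only
differences of u and of ∇ψ between a point and its translates. -/
theorem gradient_sub_vertexSum {ψ : E n → ℝ} (hψ : ContDiff ℝ ∞ ψ) (c : E n) {y : E n}
    (hy : y ∈ cell n) :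
    gradient ψ y - c - gradient (vertexSum fun y => cubeBump y * (ψ y - inner ℝ c y)) y
      = -∑ A : Finset (Fin n),
        (((ψ (y + intVec (vertex A)) - inner ℝ c (y + intVec (vertex A))) - (ψ y - inner ℝ c y))
          • gradient cubeBump (y + intVec (vertex A))
          + cubeBump (y + intVec (vertex A)) • gradShift ψ (vertex A) y) := by
  ext i
  have h1 := vertexSum_partialDeriv_cubeBump hy i
  have h2 := vertexSum_cubeBump hy
  have hu := contDiff_sub_inner hψ c
  simp only [vertexSum] at h1 h2
  simp only [PiLp.sub_apply, PiLp.neg_apply, PiLp.add_apply, PiLp.smul_apply, smul_eq_mul,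
    gradShift, gradient_apply, WithLp.ofLp_sum, Finset.sum_apply,
    partialDeriv_vertexSum (contDiff_cubeBump.mul hu), vertexSum,
    partialDeriv_mul contDiff_cubeBump hu, gradient_sub_inner hψ c]
  have e : partialDeriv ψ i y - c i
      = (∑ A : Finset (Fin n), cubeBump (y + intVec (vertex A))) * (partialDeriv ψ i y - c i)
        + (∑ A : Finset (Fin n), partialDeriv cubeBump i (y + intVec (vertex A)))
          * (ψ y - inner ℝ c y) := by rw [h1, h2]; ring
  rw [e, Finset.sum_mul, Finset.sum_mul, ← Finset.sum_add_distrib, ← Finset.sum_sub_distrib,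
    ← Finset.sum_neg_distrib]
  exact Finset.sum_congr rfl fun A _ => by ring

/-- The sum of the squares of the norms of the differences of the gradient between cells. -/
noncomputable def gradOsc (ψ : E n → ℝ) : ℝ≥0∞ :=
  ∑ q ∈ Finset.Icc (0 : Fin n → ℤ) 2, ∫⁻ y in cell n, ‖gradShift ψ q y‖ₑ ^ 2

theorem lintegral_gradShift_le (ψ : E n → ℝ) {q : Fin n → ℤ}
    (hq : q ∈ Finset.Icc (0 : Fin n → ℤ) 2) :
    ∫⁻ y in cell n, ‖gradShift ψ q y‖ₑ ^ 2 ≤ gradOsc ψ :=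
  Finset.single_le_sum (f := fun q => ∫⁻ y in cell n, ‖gradShift ψ q y‖ₑ ^ 2)
    (fun _ _ => zero_le) hq

/-- The cube `[0,2[ⁿ`. -/
def cube (n : ℕ) : Set (E n) := {y | ∀ i, y i ∈ Set.Ico (0 : ℝ) 2}

theorem cube_eq : cube n = ⋃ A ∈ (Finset.univ : Finset (Finset (Fin n))),
    floorCell 1 (vertex A) := by
  ext y
  constructor
  · intro hy
    obtain ⟨A, hA⟩ := mem_floorCell_vertex hy
    exact Set.mem_iUnion₂.2 ⟨A, Finset.mem_univ A, hA⟩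
  · intro hy i
    obtain ⟨A, -, hA⟩ := Set.mem_iUnion₂.1 hy
    have := (mem_floorCell one_pos).1 hA i
    simp only [vertex, one_mul] at this
    split_ifs at this
    · push_cast at this
      exact ⟨by linarith [this.1], by linarith [this.2]⟩
    · push_cast at this
      exact ⟨this.1, by linarith [this.2]⟩

theorem measurableSet_cube (n : ℕ) : MeasurableSet (cube n) := by
  rw [cube_eq]
  exact Finset.measurableSet_biUnion _ fun A _ => measurableSet_floorCell 1 _

theorem lintegral_floorCell_one (k : Fin n → ℤ) (F : E n → ℝ≥0∞) :
    ∫⁻ y in floorCell 1 k, F y = ∫⁻ y in cell n, F (y + intVec k) := by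
  rw [← lintegral_cellPt one_pos, one_pow, ENNReal.ofReal_one, one_mul]
  simp only [cellPt_one]

theorem continuous_gradShift {ψ : E n → ℝ} (hψ : ContDiff ℝ ∞ ψ) (q : Fin n → ℤ) :
    Continuous (gradShift ψ q) :=
  ((continuous_gradient hψ).comp (continuous_id.add continuous_const)).sub
    (continuous_gradient hψ)

/-- The Poincaré inequality for the increment ψ(· + e_i) - ψ, whose gradient on the cell at a vertex
A is the difference of the gradient shifts by A + e_i and by A. This is why shifts with entries up
to 2 are needed. Working on [0,2[ⁿ provides one mean increment valid at all the vertices. -/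
theorem exists_lintegral_sub_average_cube_le (n : ℕ) : ∃ C : NNReal, ∀ ψ : E n → ℝ,
    ContDiff ℝ ∞ ψ → ∀ i : Fin n,
      ∫⁻ y in cube n, ‖(ψ (y + basisVec i) - ψ y)
        - ⨍ z in cube n, (ψ (z + basisVec i) - ψ z)‖ₑ ^ 2 ≤ C * gradOsc ψ := by
  classical
  refine ⟨(√n * 2).toNNReal ^ 2 * 2 ^ n * (4 * 2 ^ n), fun ψ hψ i => ?_⟩
  have hD : ContDiff ℝ ∞ fun y => ψ (y + basisVec i) - ψ y :=
    (hψ.comp (contDiff_id.add contDiff_const)).sub hψ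
  have hconv : Convex ℝ (cube n) := by
    have : cube n = ⋂ i, (EuclideanSpace.proj i : E n →L[ℝ] ℝ) ⁻¹' Set.Ico (0 : ℝ) 2 := by
      ext y; simp [cube]
    rw [this]
    exact convex_iInter fun i => (convex_Ico 0 2).linear_preimage
      (EuclideanSpace.proj i : E n →L[ℝ] ℝ).toLinearMap
  have hdist : ∀ x ∈ cube n, ∀ y ∈ cube n, dist x y ≤ √n * 2 := by
    intro x hx y hy
    refine (dist_lt_of_forall_abs_sub_lt (Fin.pos i) fun j => ?_).le
    rw [abs_sub_lt_iff]
    constructor <;> linarith [(hx j).1, (hx j).2, (hy j).1, (hy j).2]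
  have h0 : volume (cube n) ≠ 0 := by
    have h1 : volume (floorCell 1 (vertex (∅ : Finset (Fin n)))) ≤ volume (cube n) := by
      refine measure_mono ?_
      rw [cube_eq]
      exact Set.subset_biUnion_of_mem (u := fun A => floorCell 1 (vertex A)) (Finset.mem_univ _)
    rw [volume_floorCell one_pos] at h1
    intro h
    rw [h] at h1
    simp at h1
  refine (lintegral_sub_average_le_gradient hD (measurableSet_cube n) hconv hdist h0).trans ?_
  have hgrad : ∀ y, gradient (fun y => ψ (y + basisVec i) - ψ y) y
      = gradient ψ (y + basisVec i) - gradient ψ y := by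
    intro y
    ext j
    have hψi : ContDiff ℝ ∞ fun y => ψ (y + basisVec i) :=
      hψ.comp (contDiff_id.add contDiff_const)
    rw [gradient_apply, PiLp.sub_apply, gradient_apply, gradient_apply, ← partialDeriv_comp_add,
      partialDeriv_sub hψi hψ]
  have hA : ∀ A : Finset (Fin n),
      ∫⁻ y in floorCell 1 (vertex A), ‖gradient (fun y => ψ (y + basisVec i) - ψ y) y‖ₑ ^ 2
        ≤ 4 * gradOsc ψ := by
    intro A
    have hmem : vertex A + Pi.single i 1 ∈ Finset.Icc (0 : Fin n → ℤ) 2 := by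
      rw [Finset.mem_Icc]
      constructor <;> intro j <;> rcases eq_or_ne j i with rfl | h <;>
        simp only [vertex, Pi.add_apply, Pi.single_eq_same] <;> split_ifs <;> simp [*]
    have hvec : intVec (vertex A + Pi.single i 1) = intVec (vertex A) + basisVec i := by
      rw [intVec_add]
      congr 1
      ext j
      rcases eq_or_ne j i with rfl | h <;> simp [intVec_apply, *]
    rw [lintegral_floorCell_one]
    calc _ = ∫⁻ y in cell n, ‖gradShift ψ (vertex A + Pi.single i 1) y
          + -gradShift ψ (vertex A) y‖ₑ ^ 2 := by
          refine lintegral_congr fun y => ?_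
          rw [hgrad, gradShift, gradShift, hvec, add_assoc]
          congr 2
          abel
      _ ≤ 2 * (∫⁻ y in cell n, ‖gradShift ψ (vertex A + Pi.single i 1) y‖ₑ ^ 2)
          + 2 * ∫⁻ y in cell n, ‖-gradShift ψ (vertex A) y‖ₑ ^ 2 :=
          lintegral_add_sq_le (gradShift ψ (vertex A + Pi.single i 1))
            (fun y => -gradShift ψ (vertex A) y) (continuous_gradShift hψ _).enorm.aemeasurable
      _ ≤ 2 * gradOsc ψ + 2 * gradOsc ψ := by
          simp only [enorm_neg]
          gcongr
          · exact lintegral_gradShift_le ψ hmem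
          · exact lintegral_gradShift_le ψ (vertex_mem_Icc A)
      _ = _ := by ring
  calc _ ≤ ENNReal.ofReal (√n * 2) ^ 2 * 2 ^ n
        * ∑ A : Finset (Fin n), 4 * gradOsc ψ := by
        gcongr
        conv_lhs => rw [cube_eq]
        exact (lintegral_biUnion_finset_le _ _ _ _).trans (Finset.sum_le_sum fun A _ => hA A)
    _ = _ := by
        rw [Finset.sum_const, Finset.card_univ, Fintype.card_finset, Fintype.card_fin,
          nsmul_eq_mul]
        push_cast
        rw [ENNReal.ofReal]
        ring

/-- Up to an affine function, a function is close to a periodic function if its gradient varies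
little between cells. -/
theorem exists_perGrad_approx (n : ℕ) : ∃ C : NNReal, ∀ ψ : E n → ℝ, ContDiff ℝ ∞ ψ →
    ∃ (c : E n) (p : E n → ℝ), PerGrad p ∧
      ∫⁻ y in cell n, ‖gradient ψ y - c - gradient p y‖ₑ ^ 2 ≤ C * gradOsc ψ := by
  classical
  obtain ⟨C, hC⟩ := exists_lintegral_sub_average_cube_le n
  obtain ⟨b₁, hb₁⟩ := contDiff_cubeBump.continuous.bounded_above_of_compact_support
    (hasCompactSupport_cubeBump (n := n))
  obtain ⟨b₂, hb₂⟩ := (continuous_gradient contDiff_cubeBump).bounded_above_of_compact_support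
    (hasCompactSupport_gradient (hasCompactSupport_cubeBump (n := n)))
  set b : NNReal := (max b₁ b₂).toNNReal
  have hb : ∀ x : E n, ‖cubeBump x‖₊ ≤ b := fun x =>
    NNReal.le_toNNReal_of_coe_le ((hb₁ x).trans (le_max_left _ _))
  have hb' : ∀ x : E n, ‖gradient cubeBump x‖₊ ≤ b := fun x =>
    NNReal.le_toNNReal_of_coe_le ((hb₂ x).trans (le_max_right _ _))
  -- The vertex A is reached from 0 by adding one basis vector at a time; each increment is close to
  -- its mean c_i, which the affine part removes.
  have hE : ∀ A : Finset (Fin n), ∃ D : NNReal, ∀ ψ : E n → ℝ, ContDiff ℝ ∞ ψ → ∀ c : E n,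
      (∀ i, c i = ⨍ z in cube n, (ψ (z + basisVec i) - ψ z)) →
      ∫⁻ y in cell n, ‖(ψ (y + intVec (vertex A)) - inner ℝ c (y + intVec (vertex A)))
        - (ψ y - inner ℝ c y)‖ₑ ^ 2 ≤ D * gradOsc ψ := by
    intro A
    induction A using Finset.induction_on with
    | empty => exact ⟨0, fun ψ _ c _ => by simp [intVec_vertex_empty]⟩
    | insert i A hi ih =>
      obtain ⟨D, hD⟩ := ih
      refine ⟨2 * D + 2 * C, fun ψ hψ c hc => ?_⟩
      have hu := (contDiff_sub_inner hψ c).continuous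
      have h1 : ∀ y : E n, (ψ (y + intVec (vertex (insert i A)))
          - inner ℝ c (y + intVec (vertex (insert i A)))) - (ψ y - inner ℝ c y)
          = ((ψ (y + intVec (vertex A)) - inner ℝ c (y + intVec (vertex A)))
            - (ψ y - inner ℝ c y)) + ((ψ (y + intVec (vertex A) + basisVec i)
              - ψ (y + intVec (vertex A))) - c i) := by
        intro y
        rw [intVec_vertex_insert hi, ← add_assoc, inner_add_right _ _ (basisVec i),
          EuclideanSpace.inner_single_right]
        simp only [conj_trivial, one_mul]
        ring
      simp only [h1]
      refine (lintegral_add_sq_le _ _ ?_).trans ?_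
      · exact ((hu.comp (continuous_id.add continuous_const)).sub hu).enorm.aemeasurable
      · push_cast
        rw [add_mul, mul_assoc, mul_assoc]
        gcongr
        · exact hD ψ hψ c hc
        · rw [← lintegral_floorCell_one (vertex A)
            fun y => ‖(ψ (y + basisVec i) - ψ y) - c i‖ₑ ^ 2, hc i]
          refine (lintegral_mono_set ?_).trans (hC ψ hψ i)
          rw [cube_eq]
          exact Set.subset_biUnion_of_mem (u := fun A => floorCell 1 (vertex A))
            (Finset.mem_univ _)
  choose D hD using hE
  refine ⟨Fintype.card (Finset (Fin n)) * ∑ A, (2 * (b ^ 2 * D A) + 2 * b ^ 2), fun ψ hψ => ?_⟩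
  -- The slope of the affine part is the vector of mean increments of ψ in the coordinate
  -- directions.
  set c : E n := WithLp.toLp 2 fun i => ⨍ z in cube n, (ψ (z + basisVec i) - ψ z) with hc
  have hu := contDiff_sub_inner hψ c
  refine ⟨c, _, perGrad_vertexSum hu, ?_⟩
  have hmeas : ∀ A : Finset (Fin n), Continuous fun y : E n =>
      ((ψ (y + intVec (vertex A)) - inner ℝ c (y + intVec (vertex A))) - (ψ y - inner ℝ c y))
        • gradient cubeBump (y + intVec (vertex A)) := fun A =>
    ((hu.continuous.comp (continuous_id.add continuous_const)).sub hu.continuous).smul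
      ((continuous_gradient contDiff_cubeBump).comp (continuous_id.add continuous_const))
  have hmeas' : ∀ A : Finset (Fin n), Continuous fun y : E n =>
      cubeBump (y + intVec (vertex A)) • gradShift ψ (vertex A) y := fun A =>
    (contDiff_cubeBump.continuous.comp (continuous_id.add continuous_const)).smul
      (continuous_gradShift hψ _)
  calc _ ≤ ∫⁻ y in cell n, Fintype.card (Finset (Fin n)) * ∑ A : Finset (Fin n),
        ‖((ψ (y + intVec (vertex A)) - inner ℝ c (y + intVec (vertex A))) - (ψ y - inner ℝ c y))
          • gradient cubeBump (y + intVec (vertex A))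
          + cubeBump (y + intVec (vertex A)) • gradShift ψ (vertex A) y‖ₑ ^ 2 := by
        refine setLIntegral_mono' (measurableSet_cell n) fun y hy => ?_
        rw [gradient_sub_vertexSum hψ c hy, enorm_neg]
        exact enorm_sum_sq_le _ _
    _ = Fintype.card (Finset (Fin n)) * ∑ A : Finset (Fin n), ∫⁻ y in cell n,
        ‖((ψ (y + intVec (vertex A)) - inner ℝ c (y + intVec (vertex A))) - (ψ y - inner ℝ c y))
          • gradient cubeBump (y + intVec (vertex A))
          + cubeBump (y + intVec (vertex A)) • gradShift ψ (vertex A) y‖ₑ ^ 2 := by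
        rw [lintegral_const_mul' _ _ (by simp), lintegral_finsetSum' _ fun A _ =>
          ((((hmeas A).measurable.add (hmeas' A).measurable :
            Measurable fun y => _ + _)).enorm.pow_const 2).aemeasurable]
    _ ≤ Fintype.card (Finset (Fin n)) * ∑ A : Finset (Fin n),
        (2 * (b ^ 2 * (D A * gradOsc ψ)) + 2 * (b ^ 2 * gradOsc ψ)) := by
        gcongr with A
        refine (lintegral_add_sq_le _ _ (hmeas A).enorm.aemeasurable).trans ?_
        gcongr
        · refine le_trans (lintegral_mono (g := fun y => (b : ℝ≥0∞) ^ 2 *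
            ‖(ψ (y + intVec (vertex A)) - inner ℝ c (y + intVec (vertex A)))
              - (ψ y - inner ℝ c y)‖ₑ ^ 2) fun y => ?_) ?_
          · beta_reduce
            rw [enorm_smul, ← mul_pow, mul_comm]
            gcongr
            exact_mod_cast hb' _
          · rw [lintegral_const_mul' _ _ (by finiteness)]
            gcongr
            exact hD A ψ hψ c fun i => rfl
        · refine le_trans (lintegral_mono (g := fun y => (b : ℝ≥0∞) ^ 2 *
            ‖gradShift ψ (vertex A) y‖ₑ ^ 2) fun y => ?_) ?_
          · beta_reduce
            rw [enorm_smul, ← mul_pow]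
            gcongr
            exact_mod_cast hb _
          · rw [lintegral_const_mul' _ _ (by finiteness)]
            gcongr
            exact lintegral_gradShift_le ψ (vertex_mem_Icc A)
    _ = _ := by
        push_cast
        rw [mul_assoc, Finset.sum_mul]
        congr 1
        refine Finset.sum_congr rfl fun A _ => ?_
        ring

end PeriodicApproximation

/-! ### The closed space of periodic gradients -/

section PeriodicGradients

open Metric Filter Topology

variable {n : ℕ}

theorem memLp_cell_of_continuous {F : Type*} [NormedAddCommGroup F] [SecondCountableTopology F]
    {f : E n → F} (hf : Continuous f) : MemLp f 2 (volume.restrict (cell n)) := by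
  obtain ⟨C, hC⟩ := (isCompact_closedBall (0 : E n) (Real.sqrt n)).exists_bound_of_continuousOn
    hf.continuousOn
  refine MemLp.of_bound hf.aestronglyMeasurable C ?_
  filter_upwards [ae_restrict_mem (measurableSet_cell n)] with y hy using hC y (cell_subset n hy)

/-- The restriction to `Y` of a continuous function. -/
noncomputable def toL2Cell {F : Type*} [NormedAddCommGroup F] [SecondCountableTopology F]
    (f : E n → F) (hf : Continuous f) : Lp F 2 (volume.restrict (cell n)) :=
  (memLp_cell_of_continuous hf).toLp f

theorem coeFn_toL2Cell {F : Type*} [NormedAddCommGroup F] [SecondCountableTopology F]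
    {f : E n → F} (hf : Continuous f) : toL2Cell f hf =ᵐ[volume.restrict (cell n)] f :=
  MemLp.coeFn_toLp _

instance instProbabilityCell (n : ℕ) : IsProbabilityMeasure (volume.restrict (cell n)) :=
  ⟨by rw [Measure.restrict_apply_univ, volume_cell]⟩

theorem inner_toL2Cell {f : E n → ℝ} (hf : Continuous f) (w : L2 (cell n)) :
    inner ℝ (toL2Cell f hf) w = ∫ y in cell n, f y * w y := by
  rw [L2.inner_def]
  refine integral_congr_ae ?_
  filter_upwards [coeFn_toL2Cell hf] with y hy
  rw [hy]
  simp [mul_comm]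

theorem continuous_smul_basisVec {f : E n → ℝ} (hf : Continuous f) (i : Fin n) :
    Continuous fun y => f y • (basisVec i : E n) := hf.smul continuous_const

theorem inner_toL2Cell_smul {f : E n → ℝ} (hf : Continuous f) (i : Fin n) (g : L2Vec (cell n)) :
    inner ℝ (toL2Cell _ (continuous_smul_basisVec hf i)) g = ∫ y in cell n, f y * g y i := by
  rw [L2.inner_def]
  refine integral_congr_ae ?_
  filter_upwards [coeFn_toL2Cell (continuous_smul_basisVec hf i)] with y hy
  rw [hy, real_inner_smul_left, EuclideanSpace.inner_single_left]
  simp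

theorem PerGrad.lin {p q : E n → ℝ} (hp : PerGrad p) (hq : PerGrad q) (a b : ℝ) :
    PerGrad fun y => a * p y + b * q y := by
  have hd : ∀ i y, partialDeriv (fun y => a * p y + b * q y) i y
      = a * partialDeriv p i y + b * partialDeriv q i y := fun i y => by
    have h := (((hp.1.differentiable (by simp)) y).hasFDerivAt.const_mul a).add
      (((hq.1.differentiable (by simp)) y).hasFDerivAt.const_mul b)
    rw [partialDeriv, show (fun y => a * p y + b * q y)
      = (fun y => a * p y) + fun y => b * q y from rfl, h.fderiv]
    rfl
  refine ⟨(contDiff_const.mul hp.1).add (contDiff_const.mul hq.1), fun i ψ hψ hper => ?_⟩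
  have i1 : ∀ {r : E n → ℝ}, Continuous r →
      Integrable (fun y => partialDeriv ψ i y * r y) (volume.restrict (cell n)) := fun hr =>
    integrable_cell_of_continuous ((continuous_partialDeriv hψ i).mul hr)
  have i2 : ∀ {r : E n → ℝ}, ContDiff ℝ ∞ r →
      Integrable (fun y => ψ y * partialDeriv r i y) (volume.restrict (cell n)) := fun hr =>
    integrable_cell_of_continuous (hψ.continuous.mul (continuous_partialDeriv hr i))
  have e1 : ∀ y, partialDeriv ψ i y * (a * p y + b * q y)
      = a * (partialDeriv ψ i y * p y) + b * (partialDeriv ψ i y * q y) := fun y => by ring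
  have e2 : ∀ y, ψ y * partialDeriv (fun y => a * p y + b * q y) i y
      = a * (ψ y * partialDeriv p i y) + b * (ψ y * partialDeriv q i y) := fun y => by
    rw [hd]; ring
  simp only [e1, e2]
  rw [integral_add ((i1 hp.1.continuous).const_mul a) ((i1 hq.1.continuous).const_mul b),
    integral_add ((i2 hp.1).const_mul a) ((i2 hq.1).const_mul b)]
  simp only [integral_const_mul]
  rw [hp.2 i ψ hψ hper, hq.2 i ψ hψ hper]
  ring

theorem perGrad_const (c : ℝ) : PerGrad fun _ : E n => c := by
  refine ⟨contDiff_const, fun i ψ hψ hper => ?_⟩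
  rw [integral_mul_const, hper.integral_partialDeriv_eq_zero hψ]
  simp [partialDeriv]

theorem gradient_lin {p q : E n → ℝ} (hp : ContDiff ℝ ∞ p) (hq : ContDiff ℝ ∞ q) (a b : ℝ)
    (y : E n) : gradient (fun y => a * p y + b * q y) y = a • gradient p y + b • gradient q y := by
  ext i
  have h := (((hp.differentiable (by simp)) y).hasFDerivAt.const_mul a).add
    (((hq.differentiable (by simp)) y).hasFDerivAt.const_mul b)
  rw [PiLp.add_apply, PiLp.smul_apply, PiLp.smul_apply, gradient_apply, gradient_apply,
    gradient_apply, partialDeriv, show (fun y => a * p y + b * q y)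
      = (fun y => a * p y) + fun y => b * q y from rfl, h.fderiv]
  rfl

theorem toL2Cell_lin {F : Type*} [NormedAddCommGroup F] [SecondCountableTopology F]
    [NormedSpace ℝ F] {f g h : E n → F} (hf : Continuous f) (hg : Continuous g)
    (hh : Continuous h) (a b : ℝ) (e : ∀ y, h y = a • f y + b • g y) :
    toL2Cell h hh = a • toL2Cell f hf + b • toL2Cell g hg := by
  refine Lp.ext ?_
  filter_upwards [coeFn_toL2Cell hf, coeFn_toL2Cell hg, coeFn_toL2Cell hh,
    Lp.coeFn_add (a • toL2Cell f hf) (b • toL2Cell g hg), Lp.coeFn_smul a (toL2Cell f hf),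
    Lp.coeFn_smul b (toL2Cell g hg)] with y h1 h2 h3 h4 h5 h6
  rw [h4, h3, Pi.add_apply, h5, h6, Pi.smul_apply, Pi.smul_apply, h1, h2, e]

/-- The pairs `(p, ∇p)` of a smooth `p` with mean value zero whose gradient is its weak gradient on
the torus. -/
noncomputable def perPairs (n : ℕ) :
    Submodule ℝ (WithLp 2 (L2 (cell n) × L2Vec (cell n))) where
  carrier := {a | ∃ (p : E n → ℝ) (hp : PerGrad p), ∫ y in cell n, p y = 0 ∧
    a = WithLp.toLp 2 (toL2Cell p hp.1.continuous, toL2Cell _ (continuous_gradient hp.1))}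
  zero_mem' := by
    refine ⟨fun _ => 0, perGrad_const 0, by simp, ?_⟩
    rw [toL2Cell_lin continuous_const continuous_const continuous_const 0 0
        (f := fun _ : E n => (0 : ℝ)) (g := fun _ => 0) (fun y => by simp),
      toL2Cell_lin continuous_const continuous_const _ 0 0 (f := fun _ : E n => (0 : E n))
        (g := fun _ => 0) (fun y => by simp)]
    simp
    rfl
  add_mem' := by
    rintro _ _ ⟨p, hp, hp0, rfl⟩ ⟨q, hq, hq0, rfl⟩
    refine ⟨fun y => 1 * p y + 1 * q y, hp.lin hq 1 1, ?_, ?_⟩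
    · rw [integral_add ((integrable_cell_of_continuous hp.1.continuous).const_mul 1)
        ((integrable_cell_of_continuous hq.1.continuous).const_mul 1), integral_const_mul,
        integral_const_mul, hp0, hq0]
      simp
    · rw [show toL2Cell (fun y => 1 * p y + 1 * q y) (hp.lin hq 1 1).1.continuous = _ from
          toL2Cell_lin hp.1.continuous hq.1.continuous _ 1 1 fun y => rfl,
        toL2Cell_lin (continuous_gradient hp.1) (continuous_gradient hq.1) _ 1 1
          (gradient_lin hp.1 hq.1 1 1)]
      simp
      rfl
  smul_mem' := by
    rintro c _ ⟨p, hp, hp0, rfl⟩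
    refine ⟨fun y => c * p y + 0 * p y, hp.lin hp c 0, ?_, ?_⟩
    · simp only [zero_mul, add_zero]
      rw [integral_const_mul, hp0, mul_zero]
    · rw [show toL2Cell (fun y => c * p y + 0 * p y) (hp.lin hp c 0).1.continuous = _ from
          toL2Cell_lin hp.1.continuous hp.1.continuous _ c 0 fun y => rfl,
        toL2Cell_lin (continuous_gradient hp.1) (continuous_gradient hp.1) _ c 0
          (gradient_lin hp.1 hp.1 c 0)]
      simp
      rfl

theorem weak_of_mem_closure_perPairs {a : WithLp 2 (L2 (cell n) × L2Vec (cell n))}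
    (ha : a ∈ (perPairs n).topologicalClosure) (i : Fin n) {ψ : E n → ℝ} (hψ : ContDiff ℝ ∞ ψ)
    (hper : IsPeriodic ψ) :
    ∫ y in cell n, partialDeriv ψ i y * a.fst y = - ∫ y in cell n, ψ y * a.snd y i := by
  rw [← inner_toL2Cell (continuous_partialDeriv hψ i), ← inner_toL2Cell_smul hψ.continuous i]
  have hcl : IsClosed {a : WithLp 2 (L2 (cell n) × L2Vec (cell n)) |
      inner ℝ (toL2Cell _ (continuous_partialDeriv hψ i)) a.fst
        = -inner ℝ (toL2Cell _ (continuous_smul_basisVec hψ.continuous i)) a.snd} :=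
    isClosed_eq (continuous_const.inner (WithLp.fstL 2 ℝ _ _).continuous)
      (continuous_const.inner (WithLp.sndL 2 ℝ _ _).continuous).neg
  refine closure_minimal ?_ hcl ha
  rintro _ ⟨p, hp, -, rfl⟩
  rw [Set.mem_ofPred_eq, inner_toL2Cell, inner_toL2Cell_smul hψ.continuous]
  rw [integral_congr_ae (g := fun y => partialDeriv ψ i y * p y), hp.2 i ψ hψ hper]
  · congr 1
    refine integral_congr_ae ?_
    filter_upwards [coeFn_toL2Cell (continuous_gradient hp.1)] with y hy
    rw [WithLp.toLp_snd, hy, gradient_apply]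
  · filter_upwards [coeFn_toL2Cell hp.1.continuous] with y hy
    rw [WithLp.toLp_fst, hy]

/-- For smooth p of mean zero this is the Poincaré inequality on the convex cell; the condition is
closed. -/
theorem exists_perPairs_poincare (n : ℕ) : ∃ C : NNReal,
    ∀ a ∈ (perPairs n).topologicalClosure, ‖a.fst‖ ≤ C * ‖a.snd‖ := by
  refine ⟨NNReal.sqrt ((√n * 1).toNNReal ^ 2 * 2 ^ n), fun a ha => ?_⟩
  have hcl : IsClosed {a : WithLp 2 (L2 (cell n) × L2Vec (cell n)) |
      ‖a.fst‖ ≤ NNReal.sqrt ((√n * 1).toNNReal ^ 2 * 2 ^ n) * ‖a.snd‖} :=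
    isClosed_le (WithLp.fstL 2 ℝ _ _).continuous.norm
      (continuous_const.mul (WithLp.sndL 2 ℝ _ _).continuous.norm)
  refine closure_minimal ?_ hcl ha
  rintro _ ⟨p, hp, hp0, rfl⟩
  rw [Set.mem_ofPred_eq, WithLp.toLp_fst, WithLp.toLp_snd, Lp.norm_def, Lp.norm_def,
    Real.coe_sqrt]
  refine toReal_eLpNorm_le (Lp.memLp _) ?_
  have hconv : Convex ℝ (cell n) := by
    have : cell n = ⋂ i, (EuclideanSpace.proj i : E n →L[ℝ] ℝ) ⁻¹' Set.Ioo (0 : ℝ) 1 := by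
      ext y; simp [cell]
    rw [this]
    exact convex_iInter fun i => (convex_Ioo 0 1).linear_preimage
      (EuclideanSpace.proj i : E n →L[ℝ] ℝ).toLinearMap
  have hdist : ∀ x ∈ cell n, ∀ y ∈ cell n, dist x y ≤ √n * 1 := by
    intro x hx y hy
    rcases Nat.eq_zero_or_pos n with rfl | hn
    · simp [Subsingleton.elim x y]
    · refine (dist_lt_of_forall_abs_sub_lt hn fun j => ?_).le
      rw [abs_sub_lt_iff]
      constructor <;> linarith [(hx j).1, (hx j).2, (hy j).1, (hy j).2]
  have h1 := lintegral_sub_average_le_gradient hp.1 (measurableSet_cell n) hconv hdist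
    (by rw [volume_cell]; exact one_ne_zero)
  rw [setAverage_eq, hp0, smul_zero] at h1
  simp only [sub_zero] at h1
  calc _ = ∫⁻ y in cell n, ‖p y‖ₑ ^ 2 := by
        refine lintegral_congr_ae ?_
        filter_upwards [coeFn_toL2Cell hp.1.continuous] with y hy
        rw [hy]
    _ ≤ _ := h1
    _ = _ := by
        push_cast
        rw [ENNReal.ofReal]
        congr 1
        refine lintegral_congr_ae ?_
        filter_upwards [coeFn_toL2Cell (continuous_gradient hp.1)] with y hy
        rw [hy]

/-- The space of the weak gradients of the functions of `H¹` of the torus. -/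
noncomputable def perGradients (n : ℕ) : Submodule ℝ (L2Vec (cell n)) :=
  (perPairs n).topologicalClosure.map
    (WithLp.sndL 2 ℝ (L2 (cell n)) (L2Vec (cell n))).toLinearMap

/-- By the Poincaré inequality the map (p, ∇p) ↦ ∇p is bounded below on a complete space, so its
range is closed. This gives access to the orthogonal projection. -/
theorem isClosed_perGradients (n : ℕ) : IsClosed (perGradients n : Set (L2Vec (cell n))) := by
  obtain ⟨C, hC⟩ := exists_perPairs_poincare n
  let S := (perPairs n).topologicalClosure
  have hcomp : CompleteSpace S := (perPairs n).isClosed_topologicalClosure.completeSpace_coe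
  let T : S →L[ℝ] L2Vec (cell n) :=
    (WithLp.sndL 2 ℝ (L2 (cell n)) (L2Vec (cell n))).comp S.subtypeL
  have hT : AntilipschitzWith (C + 1) T := by
    refine AddMonoidHomClass.antilipschitz_of_bound T fun a => ?_
    have h1 := hC a a.2
    have h2 : ‖a‖ ^ 2 = ‖a.1.fst‖ ^ 2 + ‖a.1.snd‖ ^ 2 := WithLp.prod_norm_sq_eq_of_L2 a.1
    have h3 : T a = a.1.snd := rfl
    rw [h3]
    push_cast
    refine (abs_le_of_sq_le_sq' (h2.trans_le ?_) (by positivity)).2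
    have h4 := pow_le_pow_left₀ (norm_nonneg _) h1 2
    have h5 : 0 ≤ (C : ℝ) * ‖a.1.snd‖ ^ 2 := by positivity
    nlinarith
  have h := hT.isClosed_range T.uniformContinuous
  convert h using 1
  ext f
  constructor
  · rintro ⟨a, ha, rfl⟩
    exact ⟨⟨a, ha⟩, rfl⟩
  · rintro ⟨a, rfl⟩
    exact ⟨a.1, a.2, rfl⟩

instance instCompletePerGradients (n : ℕ) : CompleteSpace (perGradients n) :=
  (isClosed_perGradients n).completeSpace_coe

/-- Every periodic gradient has a potential, that it controls. -/
theorem exists_potential (n : ℕ) : ∃ C : NNReal, ∀ f ∈ perGradients n, ∃ w : L2 (cell n),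
    ‖w‖ ≤ C * ‖f‖ ∧ ∀ (i : Fin n) (ψ : E n → ℝ), ContDiff ℝ ∞ ψ → IsPeriodic ψ →
      ∫ y in cell n, partialDeriv ψ i y * w y = - ∫ y in cell n, ψ y * f y i := by
  obtain ⟨C, hC⟩ := exists_perPairs_poincare n
  refine ⟨C, ?_⟩
  rintro f ⟨a, ha, rfl⟩
  exact ⟨a.fst, hC a ha, fun i ψ hψ hper => weak_of_mem_closure_perPairs ha i hψ hper⟩

/-- Subtracting the mean changes neither the gradient nor the periodicity. -/
theorem toL2Cell_gradient_mem {p : E n → ℝ} (hp : PerGrad p) :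
    toL2Cell _ (continuous_gradient hp.1) ∈ perGradients n := by
  set m := ∫ y in cell n, p y
  have hq := hp.lin (perGrad_const m) 1 (-1)
  refine ⟨_, (perPairs n).le_topologicalClosure ⟨_, hq, ?_, rfl⟩, ?_⟩
  · rw [integral_add ((integrable_cell_of_continuous hp.1.continuous).const_mul 1)
      (integrable_const _), integral_const_mul]
    simp [m]
  · change toL2Cell _ (continuous_gradient hq.1) = _
    rw [toL2Cell_lin (continuous_gradient hp.1) (continuous_gradient hp.1) _ 1 0 fun y => ?_]
    · simp
    · rw [gradient_lin hp.1 contDiff_const, gradient_fun_const]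
      simp

end PeriodicGradients

/-! ### The defect of a field -/

section Defect

open Metric Filter Topology

variable {n : ℕ} {ε : ℝ}

/-- The constant fields on `Y`. -/
noncomputable def constField (n : ℕ) : E n →L[ℝ] L2Vec (cell n) :=
  Lp.constL 2 (volume.restrict (cell n)) ℝ

theorem coeFn_constField (c : E n) :
    constField n c =ᵐ[volume.restrict (cell n)] fun _ => c := Lp.coeFn_const _ _ _

/-- The mean value of a field on `Y`. -/
noncomputable def meanField (n : ℕ) : L2Vec (cell n) →L[ℝ] E n :=
  ContinuousLinearMap.adjoint (constField n)

theorem integrable_l2Vec (b : L2Vec (cell n)) : Integrable b (volume.restrict (cell n)) :=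
  (Lp.memLp b).integrable (by norm_num)

theorem inner_constField (c : E n) (b : L2Vec (cell n)) :
    inner ℝ (constField n c) b = inner ℝ c (∫ y in cell n, b y) := by
  rw [L2.inner_def, ← integral_inner (integrable_l2Vec b)]
  refine integral_congr_ae ?_
  filter_upwards [coeFn_constField c] with y hy
  rw [hy]

theorem meanField_eq (b : L2Vec (cell n)) : meanField n b = ∫ y in cell n, b y := by
  refine ext_inner_left ℝ fun c => ?_
  rw [meanField, ContinuousLinearMap.adjoint_inner_right, inner_constField]

theorem meanField_constField (c : E n) : meanField n (constField n c) = c := by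
  rw [meanField_eq, integral_congr_ae (coeFn_constField c)]
  simp

theorem meanField_eq_zero_of_mem {f : L2Vec (cell n)} (hf : f ∈ perGradients n) :
    meanField n f = 0 := by
  obtain ⟨a, ha, rfl⟩ := hf
  ext i
  have h1 := weak_of_mem_closure_perPairs ha i (contDiff_const (c := (1 : ℝ)))
    (fun _ _ => rfl)
  simp only [partialDeriv, one_mul, fderiv_fun_const, Pi.zero_apply,
    zero_apply, zero_mul, integral_zero, zero_eq_neg] at h1
  rw [meanField_eq, eval_integral_piLp fun i => (integrable_l2Vec _).eval_piLp i]
  exact h1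

/-- Periodic gradients have mean zero, hence are orthogonal to the constants. -/
theorem starProjection_constField (c : E n) :
    (perGradients n).starProjection (constField n c) = 0 := by
  rw [Submodule.starProjection_apply_eq_zero_iff, Submodule.mem_orthogonal']
  intro f hf
  rw [inner_constField, ← meanField_eq, meanField_eq_zero_of_mem hf, inner_zero_right]

/-- The part of a field that is orthogonal to the periodic gradients and to the constants. -/
noncomputable def defect (n : ℕ) : L2Vec (cell n) →L[ℝ] L2Vec (cell n) :=
  ContinuousLinearMap.id ℝ _ - (perGradients n).starProjection - constField n ∘L meanField n

theorem decomposition (b : L2Vec (cell n)) :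
    b = (perGradients n).starProjection b + defect n b + constField n (meanField n b) := by
  simp only [defect, sub_apply, ContinuousLinearMap.id_apply,
    ContinuousLinearMap.comp_apply]
  abel

/-- The defect is obtained by removing the mean and then projecting onto the orthogonal complement
of the periodic gradients, two contractions. -/
theorem norm_defect_le (b : L2Vec (cell n)) : ‖defect n b‖ ≤ ‖b‖ := by
  have h1 : defect n b
      = (perGradients n)ᗮ.starProjection (b - constField n (meanField n b)) := by
    rw [Submodule.starProjection_orthogonal_val, map_sub, starProjection_constField, sub_zero]
    simp only [defect, sub_apply, ContinuousLinearMap.id_apply,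
      ContinuousLinearMap.comp_apply]
    abel
  have h2 : ‖b - constField n (meanField n b)‖ ≤ ‖b‖ := by
    refine (abs_le_of_sq_le_sq' ?_ (norm_nonneg _)).2
    have h3 : inner ℝ b (constField n (meanField n b)) = ‖meanField n b‖ ^ 2 := by
      rw [← ContinuousLinearMap.adjoint_inner_left]
      exact real_inner_self_eq_norm_sq (meanField n b)
    have h4 : ‖constField n (meanField n b)‖ ^ 2 = ‖meanField n b‖ ^ 2 := by
      rw [← real_inner_self_eq_norm_sq, inner_constField, ← meanField_eq, meanField_constField,
        real_inner_self_eq_norm_sq]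
    rw [norm_sub_sq_real, h3, h4]
    linarith [sq_nonneg ‖meanField n b‖]
  rw [h1]
  exact (Submodule.norm_starProjection_apply_le _ _).trans h2

theorem defect_constField (c : E n) : defect n (constField n c) = 0 := by
  simp only [defect, sub_apply, ContinuousLinearMap.id_apply,
    ContinuousLinearMap.comp_apply, starProjection_constField, meanField_constField]
  simp

theorem defect_of_mem {f : L2Vec (cell n)} (hf : f ∈ perGradients n) : defect n f = 0 := by
  simp only [defect, sub_apply, ContinuousLinearMap.id_apply,
    ContinuousLinearMap.comp_apply, meanField_eq_zero_of_mem hf,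
    Submodule.starProjection_eq_self_iff.2 hf]
  simp

/-- The indices of the cells of a cube of side `3`. -/
abbrev CubeIdx (n : ℕ) : Type := Finset.Icc (0 : Fin n → ℤ) 2

theorem continuous_gradient_shift {ψ : E n → ℝ} (hψ : ContDiff ℝ ∞ ψ) (q : Fin n → ℤ) :
    Continuous fun y => gradient ψ (y + intVec q) :=
  (continuous_gradient hψ).comp (continuous_id.add continuous_const)

/-- The restrictions of a smooth gradient to the cells of a cube of side `3`. -/
noncomputable def smoothFamilies (n : ℕ) : Submodule ℝ (CubeIdx n → L2Vec (cell n)) where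
  carrier := {B | ∃ (ψ : E n → ℝ) (hψ : ContDiff ℝ ∞ ψ),
    B = fun q : CubeIdx n => toL2Cell _ (continuous_gradient_shift hψ (q : Fin n → ℤ))}
  zero_mem' := by
    refine ⟨fun _ => 0, contDiff_const, ?_⟩
    funext q
    rw [toL2Cell_lin continuous_const continuous_const _ 0 0 (f := fun _ : E n => (0 : E n))
      (g := fun _ => 0) (fun y => by simp)]
    simp
  add_mem' := by
    rintro _ _ ⟨p, hp, rfl⟩ ⟨q, hq, rfl⟩
    refine ⟨fun y => 1 * p y + 1 * q y,
      (contDiff_const.mul hp).add (contDiff_const.mul hq), ?_⟩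
    funext r
    rw [toL2Cell_lin (continuous_gradient_shift hp r) (continuous_gradient_shift hq r) _ 1 1
      fun y => gradient_lin hp hq 1 1 _]
    simp
  smul_mem' := by
    rintro c _ ⟨p, hp, rfl⟩
    refine ⟨fun y => c * p y + 0 * p y,
      (contDiff_const.mul hp).add (contDiff_const.mul hp), ?_⟩
    funext r
    rw [toL2Cell_lin (continuous_gradient_shift hp r) (continuous_gradient_shift hp r) _ c 0
      fun y => gradient_lin hp hp c 0 _]
    simp

/-- The index of the first cell of a cube of side `3`. -/
def zeroIdx (n : ℕ) : CubeIdx n := ⟨0, by simp⟩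

theorem norm_sq_le_of_lintegral_le {α F : Type*} [MeasurableSpace α] [NormedAddCommGroup F]
    {μ : Measure α} {f : Lp F 2 μ} {r : ℝ} (hr : 0 ≤ r)
    (h : ∫⁻ x, ‖f x‖ₑ ^ 2 ∂μ ≤ ENNReal.ofReal r) : ‖f‖ ^ 2 ≤ r := by
  rw [← ofReal_norm_sq_eq_lintegral] at h
  exact (ENNReal.ofReal_le_ofReal_iff hr).1 h

/-- The defect annihilates constants and periodic gradients, so for a smooth gradient it sees only
the error of the best available approximation by c + ∇p, which the variation between cells controls.
Both sides are continuous, so the bound passes to the closure, which is a linear space. -/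
theorem exists_norm_defect_le (n : ℕ) : ∃ C : NNReal, ∀ B ∈ (smoothFamilies n).topologicalClosure,
    ‖defect n (B (zeroIdx n))‖ ^ 2 ≤ C * ∑ q, ‖B q - B (zeroIdx n)‖ ^ 2 := by
  obtain ⟨C, hC⟩ := exists_perGrad_approx n
  refine ⟨C, fun B hB => ?_⟩
  have hcl : IsClosed {B : CubeIdx n → L2Vec (cell n) |
      ‖defect n (B (zeroIdx n))‖ ^ 2 ≤ C * ∑ q, ‖B q - B (zeroIdx n)‖ ^ 2} := by
    refine isClosed_le (by fun_prop) ?_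
    fun_prop
  refine closure_minimal ?_ hcl hB
  rintro _ ⟨ψ, hψ, rfl⟩
  obtain ⟨c, p, hp, hcp⟩ := hC ψ hψ
  set b := toL2Cell _ (continuous_gradient_shift hψ (zeroIdx n : Fin n → ℤ)) with hb
  have h0 : intVec ((zeroIdx n : CubeIdx n) : Fin n → ℤ) = (0 : E n) := by
    ext i
    simp [zeroIdx, intVec_apply]
  have h1 : defect n b = defect n (b - constField n c - toL2Cell _ (continuous_gradient hp.1)) := by
    rw [map_sub, map_sub, defect_constField, defect_of_mem (toL2Cell_gradient_mem hp)]
    simp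
  have hbb : b =ᵐ[volume.restrict (cell n)] gradient ψ := by
    filter_upwards [coeFn_toL2Cell (continuous_gradient_shift hψ (zeroIdx n : Fin n → ℤ))] with y hy
    rw [hb, hy, h0, add_zero]
  have h2 : ∀ q : CubeIdx n, ENNReal.ofReal (‖toL2Cell _ (continuous_gradient_shift hψ q) - b‖ ^ 2)
      = ∫⁻ y in cell n, ‖gradShift ψ q y‖ₑ ^ 2 := by
    intro q
    rw [ofReal_norm_sq_eq_lintegral]
    refine lintegral_congr_ae ?_
    filter_upwards [Lp.coeFn_sub (toL2Cell _ (continuous_gradient_shift hψ q)) b, hbb,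
      coeFn_toL2Cell (continuous_gradient_shift hψ q)] with y h1 h2 h3
    rw [h1, Pi.sub_apply, h2, h3, gradShift]
  change ‖defect n b‖ ^ 2
    ≤ C * ∑ q : CubeIdx n, ‖toL2Cell _ (continuous_gradient_shift hψ (q : Fin n → ℤ)) - b‖ ^ 2
  rw [h1]
  refine (pow_le_pow_left₀ (norm_nonneg _) (norm_defect_le _) 2).trans ?_
  refine norm_sq_le_of_lintegral_le (by positivity) ?_
  rw [ENNReal.ofReal_mul C.coe_nonneg, ENNReal.ofReal_sum_of_nonneg fun _ _ => by positivity]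
  simp only [h2]
  calc _ = ∫⁻ y in cell n, ‖gradient ψ y - c - gradient p y‖ₑ ^ 2 := by
        refine lintegral_congr_ae ?_
        filter_upwards [Lp.coeFn_sub (b - constField n c) (toL2Cell _ (continuous_gradient hp.1)),
          Lp.coeFn_sub b (constField n c), hbb, coeFn_constField c,
          coeFn_toL2Cell (continuous_gradient hp.1)] with y h1 h2 h3 h4 h5
        rw [h1, Pi.sub_apply, h2, Pi.sub_apply, h3, h4, h5]
    _ ≤ C * gradOsc ψ := hcp
    _ = _ := by
        rw [gradOsc, ← Finset.sum_coe_sort]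
        congr 1
        exact (ENNReal.ofReal_coe_nnreal).symm

/-- The field `g(ε (k + ·))` on `Y`. -/
noncomputable def cellField (hε : 0 < ε) {g : E n → E n} (hg : MemLp g 2 volume)
    (k : Fin n → ℤ) : L2Vec (cell n) :=
  (memLp_comp_cellPt hε k (hg.restrict _)).toLp

theorem coeFn_cellField (hε : 0 < ε) {g : E n → E n} (hg : MemLp g 2 volume) (k : Fin n → ℤ) :
    cellField hε hg k =ᵐ[volume.restrict (cell n)] fun y => g (cellPt ε k y) :=
  MemLp.coeFn_toLp _

theorem partialDeriv_comp_cellPt {ψ : E n → ℝ} (hψ : ContDiff ℝ ∞ ψ) (hε : 0 < ε)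
    (k : Fin n → ℤ) (i : Fin n) (y : E n) :
    partialDeriv (fun y => ε⁻¹ * ψ (cellPt ε k y)) i y = partialDeriv ψ i (cellPt ε k y) := by
  have h1 : HasFDerivAt (cellPt ε k) (ε • ContinuousLinearMap.id ℝ (E n)) y :=
    ((hasFDerivAt_id y).const_add (intVec k)).const_smul ε
  have h2 := (((hψ.differentiable (by simp)) (cellPt ε k y)).hasFDerivAt.comp y h1).const_mul ε⁻¹
  rw [partialDeriv, show (fun y => ε⁻¹ * ψ (cellPt ε k y))
    = fun y => ε⁻¹ * (ψ ∘ cellPt ε k) y from rfl, h2.fderiv, partialDeriv]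
  simp [hε.ne']

theorem cellPt_add_intVec (ε : ℝ) (k q : Fin n → ℤ) (y : E n) :
    cellPt ε k (y + intVec q) = cellPt ε (k + q) y := by
  rw [cellPt, cellPt, intVec_add]
  congr 1
  abel

/-- Approximation of the H¹ function by smooth ones on the compact box, followed by rescaling to
unit cells. -/
theorem cellField_mem_closure (hε : 0 < ε) {V : Set (E n)} (hVo : IsOpen V)
    (hVb : Bornology.IsBounded V) (p : H1 V) {g : E n → E n} (hg : MemLp g 2 volume)
    (hgp : ∀ x ∈ V, g x = h1Grad p x) {k : Fin n → ℤ} (hk : closedCellBox ε k ⊆ V) :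
    (fun q : CubeIdx n => cellField hε hg (k + (q : Fin n → ℤ))) ∈ (smoothFamilies n).topologicalClosure := by
  refine Metric.mem_closure_iff.2 fun δ hδ => ?_
  -- The tolerance carries the Jacobian εⁿ of y ↦ ε(k + y). The rescaled potential is multiplied by
  -- ε⁻¹, so that its gradient at y is ∇ψ(ε(k + y)).
  obtain ⟨ψ, hψ, -, -, h2⟩ := exists_smooth_approx_on_compact' hVo hVb
    (isCompact_closedCellBox ε k) hk p (τ := ENNReal.ofReal (ε ^ n) * ENNReal.ofReal ((δ / 2) ^ 2))
    (by simp only [ne_eq, mul_eq_zero, ENNReal.ofReal_eq_zero, not_or, not_le]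
        constructor <;> positivity)
  have hψ' : ContDiff ℝ ∞ fun y => ε⁻¹ * ψ (cellPt ε k y) :=
    by
    unfold cellPt
    fun_prop
  refine ⟨_, ⟨_, hψ', rfl⟩, (dist_pi_lt_iff hδ).2 fun q => lt_of_le_of_lt ?_ (half_lt_self hδ)⟩
  rw [dist_eq_norm]
  refine (abs_le_of_sq_le_sq' (norm_sq_le_of_lintegral_le (by positivity) ?_) (by positivity)).2
  have hgrad : ∀ y, gradient (fun y => ε⁻¹ * ψ (cellPt ε k y)) (y + intVec q)
      = gradient ψ (cellPt ε (k + (q : Fin n → ℤ)) y) := by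
    intro y
    ext i
    rw [gradient_apply, gradient_apply, partialDeriv_comp_cellPt hψ hε, cellPt_add_intVec]
  have h3 : floorCell ε (k + (q : Fin n → ℤ)) ⊆ closedCellBox ε k :=
    (floorCell_subset_cellBox hε k q.2).trans (cellBox_subset_closedCellBox ε k)
  refine (ENNReal.mul_le_mul_iff_right (a := ENNReal.ofReal (ε ^ n)) (by simp; positivity)
    ENNReal.ofReal_ne_top).1 ?_
  refine le_trans (le_of_eq ?_) ((lintegral_mono_set h3).trans h2)
  rw [← lintegral_cellPt hε]
  congr 1
  have h4 : ∀ᵐ y ∂volume.restrict (cell n), cellPt ε (k + (q : Fin n → ℤ)) y ∈ floorCell ε (k + (q : Fin n → ℤ)) :=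
    (quasiMeasurePreserving_cellPt hε (k + (q : Fin n → ℤ))).ae (ae_restrict_mem (measurableSet_floorCell ε _))
  refine lintegral_congr_ae ?_
  filter_upwards [Lp.coeFn_sub (cellField hε hg (k + (q : Fin n → ℤ)))
    (toL2Cell _ (continuous_gradient_shift hψ' (q : Fin n → ℤ))), coeFn_cellField hε hg (k + (q : Fin n → ℤ)),
    coeFn_toL2Cell (continuous_gradient_shift hψ' (q : Fin n → ℤ)), h4] with y e1 e2 e3 e4
  rw [e1, Pi.sub_apply, e2, e3, hgrad, hgp _ (hk (h3 e4)), enorm_sub_rev]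

end Defect

/-! ### Oscillation between neighbouring cells -/

section CellOscillation

open Metric Filter Topology

variable {n : ℕ} {ε s : ℝ} {Ω : Set (E n)} {ψ : E n → ℝ}

/-- The oscillation of `ψ` between the cells of indices `k` and `k + q`. -/
noncomputable def cellOsc (ε : ℝ) (ψ : E n → ℝ) (q k : Fin n → ℤ) : ℝ≥0∞ :=
  ∫⁻ x in floorCell ε k, ∫⁻ z in floorCell ε (k + q), ‖ψ x - ψ z‖ₑ ^ 2

theorem sq_enorm_setIntegral_le {A : Set (E n)} {f : E n → ℝ}
    (hf : AEStronglyMeasurable f (volume.restrict A)) :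
    ‖∫ x in A, f x‖ₑ ^ 2 ≤ volume A * ∫⁻ x in A, ‖f x‖ₑ ^ 2 := by
  have h := sq_enorm_integral_mul_le (f := fun _ => (1 : ℝ)) (aestronglyMeasurable_const) hf
  simpa using h

theorem isFiniteMeasure_floorCell (hε : 0 < ε) (k : Fin n → ℤ) :
    IsFiniteMeasure (volume.restrict (floorCell ε k)) :=
  ⟨by rw [Measure.restrict_apply_univ, volume_floorCell hε]; exact ENNReal.ofReal_lt_top⟩

theorem integrable_floorCell (hε : 0 < ε) (k : Fin n → ℤ) (hψ : MemLp ψ 2 volume) :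
    Integrable ψ (volume.restrict (floorCell ε k)) :=
  have := isFiniteMeasure_floorCell hε k
  (hψ.restrict _).integrable (by norm_num)

theorem setIntegral_floorCell_const (hε : 0 < ε) (k : Fin n → ℤ) (c : ℝ) :
    ∫ _x in floorCell ε k, c = ε ^ n * c := by
  rw [setIntegral_const, Measure.real, volume_floorCell hε, ENNReal.toReal_ofReal (by positivity),
    smul_eq_mul]

theorem sq_enorm_sub_average_le (hε : 0 < ε) (hψ : MemLp ψ 2 volume) (x : E n) (l : Fin n → ℤ) :
    ‖ψ x - (ε ^ n)⁻¹ * ∫ z in floorCell ε l, ψ z‖ₑ ^ 2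
      ≤ ENNReal.ofReal (ε ^ n)⁻¹ * ∫⁻ z in floorCell ε l, ‖ψ x - ψ z‖ₑ ^ 2 := by
  have := isFiniteMeasure_floorCell hε l
  have hp : (0 : ℝ) < ε ^ n := by positivity
  have h1 : ψ x - (ε ^ n)⁻¹ * ∫ z in floorCell ε l, ψ z
      = (ε ^ n)⁻¹ * ∫ z in floorCell ε l, (ψ x - ψ z) := by
    rw [integral_sub (integrable_const _) (integrable_floorCell hε l hψ),
      setIntegral_floorCell_const hε]
    field_simp
  have h2 : ENNReal.ofReal (ε ^ n)⁻¹ * volume (floorCell ε l) = 1 := by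
    rw [volume_floorCell hε, ← ENNReal.ofReal_mul (by positivity), inv_mul_cancel₀ hp.ne',
      ENNReal.ofReal_one]
  rw [h1, enorm_mul, mul_pow, Real.enorm_of_nonneg (by positivity), sq, mul_assoc]
  refine mul_le_mul_right ?_ _
  calc _ ≤ ENNReal.ofReal (ε ^ n)⁻¹ * (volume (floorCell ε l)
        * ∫⁻ z in floorCell ε l, ‖ψ x - ψ z‖ₑ ^ 2) :=
        mul_le_mul_right (sq_enorm_setIntegral_le
          (aestronglyMeasurable_const.sub hψ.1.restrict)) _
    _ = _ := by rw [← mul_assoc, h2, one_mul]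

theorem lintegral_floorCell_sub_average_le (hε : 0 < ε) (hψ : MemLp ψ 2 volume) (q k : Fin n → ℤ) :
    ∫⁻ x in floorCell ε k, ‖ψ x - (ε ^ n)⁻¹ * ∫ z in floorCell ε (k + q), ψ z‖ₑ ^ 2
      ≤ ENNReal.ofReal (ε ^ n)⁻¹ * cellOsc ε ψ q k := by
  rw [cellOsc, ← lintegral_const_mul' _ _ ENNReal.ofReal_ne_top]
  exact lintegral_mono fun x => sq_enorm_sub_average_le hε hψ x _

theorem sq_enorm_integral_cell_sub_le (hε : 0 < ε) (hψ : MemLp ψ 2 volume) (q k : Fin n → ℤ) :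
    ‖(∫ x in floorCell ε k, ψ x) - ∫ z in floorCell ε (k + q), ψ z‖ₑ ^ 2 ≤ cellOsc ε ψ q k := by
  have := isFiniteMeasure_floorCell hε k
  have hp : (0 : ℝ) < ε ^ n := by positivity
  have h1 : (∫ x in floorCell ε k, ψ x) - ∫ z in floorCell ε (k + q), ψ z
      = ∫ x in floorCell ε k, (ψ x - (ε ^ n)⁻¹ * ∫ z in floorCell ε (k + q), ψ z) := by
    rw [integral_sub (integrable_floorCell hε k hψ) (integrable_const _),
      setIntegral_floorCell_const hε]
    field_simp
  rw [h1]
  calc _ ≤ volume (floorCell ε k) * (ENNReal.ofReal (ε ^ n)⁻¹ * cellOsc ε ψ q k) :=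
        (sq_enorm_setIntegral_le (hψ.1.restrict.sub aestronglyMeasurable_const)).trans
          (mul_le_mul_right (lintegral_floorCell_sub_average_le hε hψ q k) _)
    _ = _ := by
        rw [← mul_assoc, volume_floorCell hε, ← ENNReal.ofReal_mul (by positivity),
          mul_inv_cancel₀ hp.ne', ENNReal.ofReal_one, one_mul]

theorem sum_setLIntegral_floorCell_le (J : Finset (Fin n → ℤ)) (q : Fin n → ℤ) (F : E n → ℝ≥0∞)
    {S : Set (E n)} (hS : ∀ k ∈ J, floorCell ε (k + q) ⊆ S) :
    ∑ k ∈ J, ∫⁻ x in floorCell ε (k + q), F x ≤ ∫⁻ x in S, F x := by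
  rw [← lintegral_biUnion_finset (fun k _ l _ h => disjoint_floorCell ε (by simpa using h))
    fun k _ => measurableSet_floorCell ε _]
  exact lintegral_mono_set (Set.iUnion₂_subset hS)

/-- For pairs of cells inside Ω the differences are bounded by r^{n+2s} times the Gagliardo
integrand, and the cells are disjoint, so the double integrals add up to at most the full one. -/
theorem sum_cellOsc_le_slopeQuot (hs : 0 < s) (J : Finset (Fin n → ℤ)) (q : Fin n → ℤ)
    {u : E n → ℝ} {r : ℝ}
    (h0 : ∀ k ∈ J, floorCell ε k ⊆ Ω) (hq : ∀ k ∈ J, floorCell ε (k + q) ⊆ Ω)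
    (hr : ∀ k ∈ J, ∀ x ∈ floorCell ε k, ∀ z ∈ floorCell ε (k + q), ‖x - z‖ ≤ r) :
    ∑ k ∈ J, cellOsc ε (Ω.indicator u) q k ≤ ENNReal.ofReal (r ^ (n + 2 * s))
      * ∫⁻ x in Ω, ∫⁻ z in Ω, ‖slopeQuot s u (x, z)‖ₑ ^ 2 := by
  rw [← lintegral_const_mul' _ _ ENNReal.ofReal_ne_top]
  refine le_trans (Finset.sum_le_sum fun k hk => ?_)
    (sum_setLIntegral_floorCell_le J 0 _ (by simpa using h0))
  rw [add_zero, cellOsc]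
  refine setLIntegral_mono' (measurableSet_floorCell ε k) fun x hx => ?_
  rw [← lintegral_const_mul' _ _ ENNReal.ofReal_ne_top]
  refine le_trans ?_ (lintegral_mono_set (hq k hk))
  refine setLIntegral_mono' (measurableSet_floorCell ε _) fun z hz => ?_
  rw [Set.indicator_of_mem (h0 k hk hx), Set.indicator_of_mem (hq k hk hz)]
  exact enorm_sub_sq_le_slopeQuot hs (hr k hk x hx z hz)

theorem cellOsc_le (hε : 0 < ε) (ψ : E n → ℝ) (q k : Fin n → ℤ) :
    cellOsc ε ψ q k ≤ ENNReal.ofReal (2 * ε ^ n)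
      * ((∫⁻ x in floorCell ε k, ‖ψ x‖ₑ ^ 2) + ∫⁻ x in floorCell ε (k + q), ‖ψ x‖ₑ ^ 2) := by
  have h1 : ∀ x, ∫⁻ z in floorCell ε (k + q), ‖ψ x - ψ z‖ₑ ^ 2
      ≤ 2 * (ENNReal.ofReal (ε ^ n) * ‖ψ x‖ₑ ^ 2)
        + 2 * ∫⁻ z in floorCell ε (k + q), ‖ψ z‖ₑ ^ 2 := by
    intro x
    have h := lintegral_add_sq_le (μ := volume.restrict (floorCell ε (k + q))) (fun _ => ψ x)
      (fun z => -ψ z) aemeasurable_const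
    simp only [← sub_eq_add_neg, enorm_neg, lintegral_const, Measure.restrict_apply_univ,
      volume_floorCell hε] at h
    rwa [mul_comm (_ ^ 2)] at h
  refine (lintegral_mono h1).trans (le_of_eq ?_)
  rw [lintegral_add_right _ measurable_const, lintegral_const, Measure.restrict_apply_univ,
    volume_floorCell hε, lintegral_const_mul' _ _ (by simp),
    lintegral_const_mul' _ _ ENNReal.ofReal_ne_top, ENNReal.ofReal_mul (by norm_num),
    ENNReal.ofReal_ofNat]
  ring

/-- Near the boundary no regularity is used: the oscillation is bounded by the L² masses of both
cells, and each family of cells is disjoint. -/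
theorem sum_cellOsc_le_lintegral (hε : 0 < ε) (ψ : E n → ℝ) (J : Finset (Fin n → ℤ))
    (q : Fin n → ℤ) {L : Set (E n)} (h0 : ∀ k ∈ J, floorCell ε k ⊆ L)
    (hq : ∀ k ∈ J, floorCell ε (k + q) ⊆ L) :
    ∑ k ∈ J, cellOsc ε ψ q k ≤ ENNReal.ofReal (4 * ε ^ n) * ∫⁻ x in L, ‖ψ x‖ₑ ^ 2 := by
  refine (Finset.sum_le_sum fun k _ => cellOsc_le hε ψ q k).trans ?_
  rw [← Finset.mul_sum, Finset.sum_add_distrib]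
  have e1 := sum_setLIntegral_floorCell_le J 0 (fun x => ‖ψ x‖ₑ ^ 2) (by simpa using h0)
  have e2 := sum_setLIntegral_floorCell_le J q (fun x => ‖ψ x‖ₑ ^ 2) hq
  simp only [add_zero] at e1
  refine (mul_le_mul_right (add_le_add e1 e2) _).trans (le_of_eq ?_)
  rw [show 4 * ε ^ n = 2 * ε ^ n * 2 by ring, ENNReal.ofReal_mul (p := 2 * ε ^ n) (by positivity),
    ENNReal.ofReal_ofNat]
  ring

end CellOscillation

/-! ### Sums over cells tested against H^s -/

section DualEstimates

open Metric Filter Topology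

variable {n : ℕ} {ε s : ℝ} {Ω : Set (E n)}

theorem sq_sum_le_mul_of_le {ι : Type*} {S : Finset ι} {t w : ι → ℝ} {d : ι → ℝ≥0∞} {D : ℝ}
    (hw : ∀ k ∈ S, 0 ≤ w k) (hD : 0 ≤ D)
    (ht : ∀ k ∈ S, ENNReal.ofReal (t k ^ 2) ≤ ENNReal.ofReal (w k) * d k)
    (hd : ∑ k ∈ S, d k ≤ ENNReal.ofReal D) : (∑ k ∈ S, t k) ^ 2 ≤ (∑ k ∈ S, w k) * D := by
  have hfin : ∀ k ∈ S, d k ≠ ⊤ := fun k hk =>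
    ne_top_of_le_ne_top ENNReal.ofReal_ne_top ((Finset.single_le_sum (f := d)
      (fun _ _ => zero_le) hk).trans hd)
  have h1 : ∑ k ∈ S, (d k).toReal ≤ D := by
    rw [← ENNReal.toReal_sum hfin]
    exact ENNReal.toReal_le_of_le_ofReal hD hd
  refine (Finset.sum_sq_le_sum_mul_sum_of_sq_le_mul S hw
    (fun k _ => ENNReal.toReal_nonneg (a := d k)) fun k hk => ?_).trans
    (mul_le_mul_of_nonneg_left h1 (Finset.sum_nonneg hw))
  have h2 := ht k hk
  rw [← ENNReal.ofReal_toReal (hfin k hk), ← ENNReal.ofReal_mul (hw k hk)] at h2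
  exact (ENNReal.ofReal_le_ofReal_iff (mul_nonneg (hw k hk) ENNReal.toReal_nonneg)).1 h2

/-- The box contains points of both Ω and its complement, so each of its points has one on the other
side within the diameter of the box; the frontier is at most as far. -/
theorem subset_boundaryLayer (hn : 1 ≤ n) {k : Fin n → ℤ} (h1 : (cellBox ε k ∩ Ω).Nonempty)
    (h2 : ¬ cellBox ε k ⊆ Ω) : cellBox ε k ⊆ boundaryLayer Ω ε 3 := by
  obtain ⟨a, ha, haΩ⟩ := h1
  obtain ⟨b, hb, hbΩ⟩ := Set.not_subset.1 h2
  intro x hx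
  by_cases hxΩ : x ∈ Ω
  · exact (infDist_frontier_le_dist (y := b) (by tauto)).trans_lt (dist_lt_of_mem_cellBox hn hx hb)
  · exact (infDist_frontier_le_dist (y := a) (by tauto)).trans_lt (dist_lt_of_mem_cellBox hn hx ha)

theorem add_sq_le_of_sq_le {a b A B N e e₁ e₂ c w w' W W' : ℝ} (hA : 0 ≤ A) (hB : 0 ≤ B)
    (hN : 0 ≤ N) (he : 0 ≤ e) (he₁ : 0 ≤ e₁) (he₂ : 0 ≤ e₂) (hc : 0 ≤ c) (hW : 0 ≤ W)
    (hW' : 0 ≤ W') (h3 : w ≤ W) (h4 : w' ≤ W') (h1 : a ^ 2 ≤ w * (A * (e * e₂) * N))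
    (h2 : b ^ 2 ≤ w' * (4 * e * (c * (B * e₁) * N))) :
    (a + b) ^ 2 ≤ (2 * A + 8 * c * B) * e * (e₂ * W + e₁ * W') * N := by
  have e5 := mul_le_mul_of_nonneg_right h3 (show 0 ≤ A * (e * e₂) * N by positivity)
  have e6 := mul_le_mul_of_nonneg_right h4 (show 0 ≤ 4 * e * (c * (B * e₁) * N) by positivity)
  have c1 : 0 ≤ A * e * (e₁ * W') * N := by positivity
  have c2 : 0 ≤ c * B * e * (e₂ * W) * N := by positivity
  refine add_sq_le.trans ?_
  linarith

-- The indices split according to whether the box lies in Ω. Cauchy-Schwarz on each part gives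
-- ε^{n+2s} from the Gagliardo seminorm for the boxes inside, and εⁿ·ε^s from the layer estimate for
-- the others. In the second part the cells k + q lie in the boundary layer, so only their weights
-- are counted there.
set_option maxHeartbeats 800000 in
open Classical in
theorem sq_sum_le_of_le_cellOsc (hn : 1 ≤ n) (hΩo : IsOpen Ω) (hε : 0 < ε)
    (hs : s ∈ Set.Ioo (0 : ℝ) 1) {Cl : ℝ} (hCl : 0 ≤ Cl)
    (hlayer : ∀ δ > 0, ∀ p : Hs s Ω,
      ∫⁻ x in Ω ∩ {x | infDist x (frontier Ω) < δ}, ‖hsVal p x‖ₑ ^ 2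
        ≤ ENNReal.ofReal (Cl * δ ^ s * ‖p‖ ^ 2))
    (p : Hs s Ω) {q : Fin n → ℤ} (hq : q ∈ Finset.Icc (0 : Fin n → ℤ) 2)
    {J : Finset (Fin n → ℤ)} (hJ : ∀ k ∈ J, (cellBox ε k ∩ Ω).Nonempty)
    {t w : (Fin n → ℤ) → ℝ} (hw : ∀ k, 0 ≤ w k)
    (ht : ∀ k ∈ J, ENNReal.ofReal (t k ^ 2)
      ≤ ENNReal.ofReal (w k) * cellOsc ε (Ω.indicator (hsVal p)) q k) :
    (∑ k ∈ J, t k) ^ 2 ≤ (2 * (3 * √n) ^ (n + 2 * s) + 8 * Cl * (3 * √n) ^ s) * ε ^ n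
      * (ε ^ (2 * s) * (∑ k ∈ J, w k)
        + ε ^ s * ∑ k ∈ J with floorCell ε (k + q) ⊆ boundaryLayer Ω ε 3, w k) * ‖p‖ ^ 2 := by
  set ψ := Ω.indicator (hsVal p)
  set L := boundaryLayer Ω ε 3 with hL
  set W := ∑ k ∈ J, w k
  set W' := ∑ k ∈ J with floorCell ε (k + q) ⊆ L, w k
  set r : ℝ := (3 : ℕ) * √n * ε with hr
  have hn0 : (0 : ℝ) < √n := Real.sqrt_pos.2 (by exact_mod_cast hn)
  have hr0 : 0 < r := by positivity
  have h0 : (0 : Fin n → ℤ) ∈ Finset.Icc (0 : Fin n → ℤ) 2 := by simp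
  have hbox : ∀ k, floorCell ε k ⊆ cellBox ε k := fun k => by
    simpa using floorCell_subset_cellBox hε k h0
  let good : (Fin n → ℤ) → Prop := fun k => cellBox ε k ⊆ Ω
  have hbad : ∀ k ∈ J.filter (fun k => ¬ good k), cellBox ε k ⊆ L := fun k hk =>
    subset_boundaryLayer hn (hJ k (Finset.mem_filter.1 hk).1) (Finset.mem_filter.1 hk).2
  have hp := ofReal_norm_hs_sq p
  have e1 : (∑ k ∈ J with good k, t k) ^ 2
      ≤ (∑ k ∈ J with good k, w k) * (r ^ (n + 2 * s) * ‖p‖ ^ 2) := by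
    refine sq_sum_le_mul_of_le (d := cellOsc ε ψ q) (fun k _ => hw k) (by positivity)
      (fun k hk => ht k (Finset.mem_filter.1 hk).1) ?_
    refine (sum_cellOsc_le_slopeQuot (r := r) hs.1 _ q
      (fun k hk => (hbox k).trans (Finset.mem_filter.1 hk).2)
      (fun k hk => (floorCell_subset_cellBox hε k hq).trans (Finset.mem_filter.1 hk).2)
      fun k _ x hx z hz => ?_).trans ?_
    · rw [← dist_eq_norm]
      exact (dist_lt_of_mem_cellBox hn (hbox k hx) (floorCell_subset_cellBox hε k hq hz)).le
    · rw [ENNReal.ofReal_mul (by positivity), hp]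
      exact mul_le_mul_right le_add_self _
  have e2 : (∑ k ∈ J with ¬ good k, t k) ^ 2
      ≤ (∑ k ∈ J with ¬ good k, w k) * (4 * ε ^ n * (Cl * r ^ s * ‖p‖ ^ 2)) := by
    refine sq_sum_le_mul_of_le (d := cellOsc ε ψ q) (fun k _ => hw k) (by positivity)
      (fun k hk => ht k (Finset.mem_filter.1 hk).1) ?_
    refine (sum_cellOsc_le_lintegral hε ψ _ q (fun k hk => (hbox k).trans (hbad k hk))
      fun k hk => (floorCell_subset_cellBox hε k hq).trans (hbad k hk)).trans ?_
    rw [ENNReal.ofReal_mul (p := 4 * ε ^ n) (by positivity)]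
    refine mul_le_mul_right (le_trans (le_of_eq ?_) (hlayer r hr0 p)) _
    have h1 : ∀ x, ‖ψ x‖ₑ ^ 2 = Ω.indicator (fun x => ‖hsVal p x‖ₑ ^ 2) x := by
      intro x
      by_cases hx : x ∈ Ω <;> simp [ψ, hx]
    simp only [h1]
    rw [lintegral_indicator hΩo.measurableSet, Measure.restrict_restrict hΩo.measurableSet]
    rfl
  have e3 : ∑ k ∈ J with good k, w k ≤ W :=
    Finset.sum_le_sum_of_subset_of_nonneg (Finset.filter_subset _ _) fun k _ _ => hw k
  have e4 : ∑ k ∈ J with ¬ good k, w k ≤ W' := by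
    refine Finset.sum_le_sum_of_subset_of_nonneg (fun k hk => Finset.mem_filter.2
      ⟨(Finset.mem_filter.1 hk).1, (floorCell_subset_cellBox hε k hq).trans (hbad k hk)⟩)
      fun k _ _ => hw k
  have hW : 0 ≤ W := Finset.sum_nonneg fun k _ => hw k
  have hW' : 0 ≤ W' := Finset.sum_nonneg fun k _ => hw k
  have hr1 : r ^ (n + 2 * s) = (3 * √n) ^ (n + 2 * s) * (ε ^ n * ε ^ (2 * s)) := by
    rw [hr, Real.mul_rpow (by positivity) hε.le, Real.rpow_add hε, Real.rpow_natCast]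
    norm_num
  have hr2 : r ^ s = (3 * √n) ^ s * ε ^ s := by
    rw [hr, Real.mul_rpow (by positivity) hε.le]
    norm_num
  rw [← Finset.sum_filter_add_sum_filter_not J good t]
  rw [hr1] at e1
  rw [hr2] at e2
  exact add_sq_le_of_sq_le (by positivity) (by positivity) (by positivity) (by positivity)
    (by positivity) (by positivity) hCl hW hW' e3 e4 e1 e2

theorem sq_opNorm_le {X : Type*} [NormedAddCommGroup X] [NormedSpace ℝ X] {T : StrongDual ℝ X}
    {M : ℝ} (hM : 0 ≤ M) (h : ∀ p, T p ^ 2 ≤ M * ‖p‖ ^ 2) : ‖T‖ ^ 2 ≤ M := by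
  have h1 : ‖T‖ ≤ √M := by
    refine T.opNorm_le_bound (Real.sqrt_nonneg _) fun p => ?_
    rw [Real.norm_eq_abs]
    refine abs_le_of_sq_le_sq ?_ (by positivity)
    rw [mul_pow, Real.sq_sqrt hM]
    exact h p
  calc ‖T‖ ^ 2 ≤ √M ^ 2 := pow_le_pow_left₀ (norm_nonneg _) h1 2
    _ = M := Real.sq_sqrt hM

/-- The indicator function of a cell, in `L²(Ω)`. -/
noncomputable def cellInd (Ω : Set (E n)) (hε : 0 < ε) (k : Fin n → ℤ) : L2 Ω :=
  indicatorConstLp 2 (measurableSet_floorCell ε k)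
    (ne_top_of_le_ne_top (by rw [volume_floorCell hε]; exact ENNReal.ofReal_ne_top)
      (Measure.restrict_apply_le Ω (floorCell ε k))) (1 : ℝ)

theorem coeFn_cellInd (hε : 0 < ε) (k : Fin n → ℤ) :
    cellInd Ω hε k =ᵐ[volume.restrict Ω] (floorCell ε k).indicator fun _ => 1 :=
  indicatorConstLp_coeFn

theorem memLp_indicator_hsVal (hΩo : IsOpen Ω) (p : Hs s Ω) :
    MemLp (Ω.indicator (hsVal p)) 2 volume :=
  (memLp_indicator_iff_restrict hΩo.measurableSet).2 (Lp.memLp _)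

theorem toHsDual_cellInd (hΩo : IsOpen Ω) (hε : 0 < ε) (k : Fin n → ℤ) (p : Hs s Ω) :
    toHsDual s (cellInd Ω hε k) p = ∫ x in floorCell ε k, Ω.indicator (hsVal p) x := by
  rw [toHsDual_apply, cellInd, L2.inner_indicatorConstLp_one, integral_indicator hΩo.measurableSet,
    Measure.restrict_restrict hΩo.measurableSet,
    Measure.restrict_restrict (measurableSet_floorCell ε k), Set.inter_comm]

theorem toHsDual_cellInd_eq_zero (hΩo : IsOpen Ω) (hε : 0 < ε) {k : Fin n → ℤ}
    (hk : ¬ (floorCell ε k ∩ Ω).Nonempty) (p : Hs s Ω) :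
    toHsDual s (cellInd Ω hε k) p = 0 := by
  rw [toHsDual_cellInd hΩo, integral_indicator hΩo.measurableSet,
    Measure.restrict_restrict hΩo.measurableSet, Set.inter_comm, Set.not_nonempty_iff_eq_empty.1 hk]
  simp

end DualEstimates

/-! ### Summation by parts over the cells -/

section CellSums

open Metric Filter Topology

variable {n : ℕ} {ε s : ℝ} {Ω : Set (E n)}

/-- The indices of the cells that meet `Ω`. -/
noncomputable def cellIdx (hΩb : Bornology.IsBounded Ω) (ε : ℝ) : Finset (Fin n → ℤ) :=
  (finite_setOf_floorCell_inter hΩb ε).toFinset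

theorem mem_cellIdx {hΩb : Bornology.IsBounded Ω} {k : Fin n → ℤ} :
    k ∈ cellIdx hΩb ε ↔ (floorCell ε k ∩ Ω).Nonempty := by
  simp [cellIdx]

open Classical in
/-- The indices `k` such that the cell of index `k` or that of index `k + q` meets `Ω`. -/
noncomputable def pairIdx (hΩb : Bornology.IsBounded Ω) (ε : ℝ) (q : Fin n → ℤ) :
    Finset (Fin n → ℤ) :=
  cellIdx hΩb ε ∪ (cellIdx hΩb ε).image fun k => k - q

theorem subset_cellBox (hε : 0 < ε) (k : Fin n → ℤ) : floorCell ε k ⊆ cellBox ε k := by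
  simpa using floorCell_subset_cellBox hε k (q := 0) (by simp)

theorem cellBox_inter_nonempty_of_mem_pairIdx {hΩb : Bornology.IsBounded Ω} (hε : 0 < ε)
    {q k : Fin n → ℤ} (hq : q ∈ Finset.Icc (0 : Fin n → ℤ) 2) (hk : k ∈ pairIdx hΩb ε q) :
    (cellBox ε k ∩ Ω).Nonempty := by
  rw [pairIdx, Finset.mem_union, Finset.mem_image] at hk
  rcases hk with h | ⟨l, h, rfl⟩
  · exact (mem_cellIdx.1 h).mono (Set.inter_subset_inter_left _ (subset_cellBox hε k))
  · refine (mem_cellIdx.1 h).mono (Set.inter_subset_inter_left _ ?_)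
    simpa using floorCell_subset_cellBox hε (l - q) hq

/-- A change of index, exact because ψ vanishes off the cells meeting Ω; the index set is enlarged
so that no boundary terms appear. -/
theorem summation_by_parts (hΩb : Bornology.IsBounded Ω) (ε : ℝ) (q : Fin n → ℤ)
    (b ψ : (Fin n → ℤ) → ℝ) (hψ : ∀ k, k ∉ cellIdx hΩb ε → ψ k = 0) :
    ∑ k ∈ cellIdx hΩb ε, (b (k + q) - b k) * ψ k
      = ∑ m ∈ pairIdx hΩb ε q, b (m + q) * (ψ m - ψ (m + q)) := by
  classical
  have h1 : ∑ k ∈ cellIdx hΩb ε, b (k + q) * ψ k = ∑ m ∈ pairIdx hΩb ε q, b (m + q) * ψ m :=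
    Finset.sum_subset Finset.subset_union_left fun k _ hk => by rw [hψ k hk, mul_zero]
  have h2 : ∑ k ∈ cellIdx hΩb ε, b k * ψ k
      = ∑ m ∈ pairIdx hΩb ε q, b (m + q) * ψ (m + q) := by
    rw [← Finset.sum_image (f := fun k => b k * ψ k) (g := fun m => m + q)
      fun _ _ _ _ h => by simpa using h]
    refine Finset.sum_subset (fun k hk => ?_) fun k _ hk => by rw [hψ k hk, mul_zero]
    exact Finset.mem_image.2 ⟨k - q, Finset.mem_union_right _ (Finset.mem_image_of_mem _ hk),
      by simp⟩
  simp only [sub_mul, mul_sub, Finset.sum_sub_distrib, h1, h2]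

/-- The set of the `k` such that the cell of index `k` lies in the boundary layer. -/
def layerIdx (Ω : Set (E n)) (ε : ℝ) : Set (Fin n → ℤ) :=
  {k | floorCell ε k ⊆ boundaryLayer Ω ε 3}

open Classical in
/-- Bounds in `(H^s(Ω))'` for sums over the cells of size `ε`, with constant `C`. -/
structure CellEstimates (Ω : Set (E n)) (s C : ℝ) : Prop where
  nonneg : 0 ≤ C
  sq_sum_le : ∀ ε > (0 : ℝ), ∀ (p : Hs s Ω), ∀ q ∈ Finset.Icc (0 : Fin n → ℤ) 2,
    ∀ J : Finset (Fin n → ℤ), (∀ k ∈ J, (cellBox ε k ∩ Ω).Nonempty) →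
    ∀ t w : (Fin n → ℤ) → ℝ, (∀ k, 0 ≤ w k) →
    (∀ k ∈ J, ENNReal.ofReal (t k ^ 2)
      ≤ ENNReal.ofReal (w k) * cellOsc ε (Ω.indicator (hsVal p)) q k) →
    (∑ k ∈ J, t k) ^ 2 ≤ C * ε ^ n
      * (ε ^ (2 * s) * (∑ k ∈ J, w k) + ε ^ s * ∑ k ∈ J with k + q ∈ layerIdx Ω ε, w k) * ‖p‖ ^ 2

theorem exists_cellEstimates (hn : 1 ≤ n) (hΩo : IsOpen Ω) (hΩc : IsConnected Ω)
    (hΩb : Bornology.IsBounded Ω) (hΩl : HasLipschitzBoundary Ω) (hs : s ∈ Set.Ioo (0 : ℝ) 1) :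
    ∃ C, CellEstimates Ω s C := by
  obtain ⟨η, ρ, hη⟩ := exists_isConeField hΩo hΩb hΩl
  obtain ⟨Cl, hCl, hl⟩ := hη.exists_layer_estimate hΩo hΩb
    (frontier_nonempty hn hΩc.nonempty hΩb) hs
  exact ⟨_, by positivity, fun ε hε p q hq J hJ t w hw ht =>
    sq_sum_le_of_le_cellOsc hn hΩo hε hs hCl hl p hq hJ hw ht⟩

variable {C : ℝ}

-- Summation by parts moves the difference from the arbitrary coefficients b to the integrals of the
-- test function over the cells k and k + q, whose difference is controlled by the oscillation.
open Classical in
theorem CellEstimates.norm_sum_sub_le (hC : CellEstimates Ω s C) (hΩo : IsOpen Ω)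
    (hΩb : Bornology.IsBounded Ω) (hε : 0 < ε) {q : Fin n → ℤ}
    (hq : q ∈ Finset.Icc (0 : Fin n → ℤ) 2) (b : (Fin n → ℤ) → ℝ) :
    ‖∑ k ∈ cellIdx hΩb ε, (b (k + q) - b k) • toHsDual s (cellInd Ω hε k)‖ ^ 2
      ≤ C * ε ^ n * (ε ^ (2 * s) * (∑ k ∈ pairIdx hΩb ε q, b (k + q) ^ 2)
        + ε ^ s * ∑ k ∈ pairIdx hΩb ε q with k + q ∈ layerIdx Ω ε, b (k + q) ^ 2) := by
  have h0 := hC.nonneg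
  refine sq_opNorm_le (by positivity) fun p => ?_
  have h1 : (∑ k ∈ cellIdx hΩb ε, (b (k + q) - b k) • toHsDual s (cellInd Ω hε k)) p
      = ∑ k ∈ cellIdx hΩb ε, (b (k + q) - b k) * toHsDual s (cellInd Ω hε k) p := by
    simp
  rw [h1, summation_by_parts hΩb ε q b (fun k => toHsDual s (cellInd Ω hε k) p) fun k hk =>
    toHsDual_cellInd_eq_zero hΩo hε (fun h => hk (mem_cellIdx.2 h)) p]
  refine hC.sq_sum_le ε hε p q hq _
    (fun k hk => cellBox_inter_nonempty_of_mem_pairIdx hε hq hk) _ (fun k => b (k + q) ^ 2)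
    (fun k => sq_nonneg _) fun k _ => ?_
  rw [mul_pow, ENNReal.ofReal_mul (sq_nonneg _)]
  refine mul_le_mul_right ?_ _
  rw [toHsDual_cellInd hΩo, toHsDual_cellInd hΩo, ← sq_abs, ENNReal.ofReal_pow (abs_nonneg _),
    ← Real.enorm_eq_ofReal_abs]
  exact sq_enorm_integral_cell_sub_le hε (memLp_indicator_hsVal hΩo p) q k

theorem integral_eq_sum_floorCell (hΩb : Bornology.IsBounded Ω) (ε : ℝ) {f : E n → ℝ}
    (hf : Integrable f) (h0 : ∀ x, x ∉ Ω → f x = 0) :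
    ∫ x, f x = ∑ k ∈ cellIdx hΩb ε, ∫ x in floorCell ε k, f x := by
  rw [← integral_biUnion_finset _ (fun k _ => measurableSet_floorCell ε k)
    (fun k _ l _ h => disjoint_floorCell ε h) fun k _ => hf.integrableOn]
  refine (setIntegral_eq_integral_of_forall_compl_eq_zero fun x hx => h0 x fun hxΩ => hx ?_).symm
  refine Set.mem_iUnion₂.2 ⟨fun i => ⌊(ε⁻¹ • x) i⌋, mem_cellIdx.2 ⟨x, rfl, hxΩ⟩, rfl⟩

-- Pairing with ψ leaves the integrals of G(ψ - mean of ψ) over the cells, since the mean of G times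
-- the integral of ψ is the mean of ψ times the integral of G. This is the case q = 0 of the cell
-- estimates.
open Classical in
theorem CellEstimates.norm_sum_average_sub_le (hC : CellEstimates Ω s C) (hΩo : IsOpen Ω)
    (hΩb : Bornology.IsBounded Ω) (hε : 0 < ε) {G : E n → ℝ} (hG : MemLp G 2 volume) (g : L2 Ω)
    (hGg : G =ᵐ[volume.restrict Ω] g) {w : (Fin n → ℤ) → ℝ} (hw0 : ∀ k, 0 ≤ w k)
    (hw : ∀ k, ENNReal.ofReal (ε ^ n)⁻¹ * ∫⁻ x in floorCell ε k, ‖G x‖ₑ ^ 2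
      ≤ ENNReal.ofReal (w k)) :
    ‖∑ k ∈ cellIdx hΩb ε, ((ε ^ n)⁻¹ * ∫ x in floorCell ε k, G x) • toHsDual s (cellInd Ω hε k)
        - toHsDual s g‖ ^ 2
      ≤ C * ε ^ n * (ε ^ (2 * s) * (∑ k ∈ cellIdx hΩb ε, w k)
        + ε ^ s * ∑ k ∈ cellIdx hΩb ε with k ∈ layerIdx Ω ε, w k) := by
  have h0 := hC.nonneg
  have hw1 : ∀ S : Finset (Fin n → ℤ), 0 ≤ ∑ k ∈ S, w k := fun S =>
    Finset.sum_nonneg fun k _ => hw0 k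
  have hw2 := hw1 (cellIdx hΩb ε)
  have hw3 := hw1 ((cellIdx hΩb ε).filter (· ∈ layerIdx Ω ε))
  refine sq_opNorm_le (by positivity) fun p => ?_
  set ψ := Ω.indicator (hsVal p) with hψ
  have hψ2 : MemLp ψ 2 volume := memLp_indicator_hsVal hΩo p
  have h2 : toHsDual s g p = ∑ k ∈ cellIdx hΩb ε, ∫ x in floorCell ε k, G x * ψ x := by
    rw [← integral_eq_sum_floorCell hΩb ε (integrable_mul_of_memLp hG hψ2)
      fun x hx => by simp [hψ, hx], toHsDual_apply, L2.inner_def]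
    have h3 : ∀ x, G x * ψ x = Ω.indicator (fun x => G x * hsVal p x) x := fun x => by
      by_cases hx : x ∈ Ω <;> simp [hψ, hx]
    simp only [h3]
    rw [integral_indicator hΩo.measurableSet]
    refine integral_congr_ae ?_
    filter_upwards [hGg] with x hx
    rw [hx]
    simp [mul_comm]
  have h1 : (∑ k ∈ cellIdx hΩb ε, ((ε ^ n)⁻¹ * ∫ x in floorCell ε k, G x)
        • toHsDual s (cellInd Ω hε k) - toHsDual s g) p
      = ∑ k ∈ cellIdx hΩb ε, -∫ x in floorCell ε k,
          G x * (ψ x - (ε ^ n)⁻¹ * ∫ z in floorCell ε k, ψ z) := by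
    rw [sub_apply, h2, sum_apply, ← Finset.sum_sub_distrib]
    refine Finset.sum_congr rfl fun k _ => ?_
    have h4 : ∀ x, G x * (ψ x - (ε ^ n)⁻¹ * ∫ z in floorCell ε k, ψ z)
        = G x * ψ x - ((ε ^ n)⁻¹ * ∫ z in floorCell ε k, ψ z) * G x := fun x => by ring
    simp only [h4]
    rw [integral_sub (integrable_mul_of_memLp hG hψ2).integrableOn
      ((integrable_floorCell hε k hG).const_mul _), integral_const_mul,
      smul_apply, toHsDual_cellInd hΩo, smul_eq_mul]
    ring
  rw [h1]
  have h5 := hC.sq_sum_le ε hε p 0 (by simp) (cellIdx hΩb ε)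
    (fun k hk => (mem_cellIdx.1 hk).mono (Set.inter_subset_inter_left _ (subset_cellBox hε k)))
    (fun k => -∫ x in floorCell ε k, G x * (ψ x - (ε ^ n)⁻¹ * ∫ z in floorCell ε k, ψ z)) w hw0
    fun k _ => ?_
  · simpa only [add_zero] using h5
  · have := isFiniteMeasure_floorCell hε k
    rw [neg_sq, ← sq_abs, ENNReal.ofReal_pow (abs_nonneg _), ← Real.enorm_eq_ofReal_abs]
    refine (sq_enorm_integral_mul_le hG.1.restrict
      (hψ2.1.restrict.sub aestronglyMeasurable_const)).trans ?_
    have h6 := lintegral_floorCell_sub_average_le hε hψ2 0 k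
    rw [add_zero] at h6
    refine (mul_le_mul_right h6 _).trans ?_
    rw [← mul_assoc, mul_comm (∫⁻ x in _, _)]
    exact mul_le_mul_left (hw k) _

end CellSums

/-! ### Sums of fields tensored with cell indicators -/

section TensorSums

open Metric Filter Topology

variable {n : ℕ} {ι : Type*}

theorem coeFn_finset_sum {α F : Type*} [MeasurableSpace α] [NormedAddCommGroup F]
    {μ : Measure α} (K : Finset ι) (f : ι → Lp F 2 μ) :
    ⇑(∑ k ∈ K, f k) =ᵐ[μ] fun x => ∑ k ∈ K, f k x := by
  classical
  induction K using Finset.induction_on with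
  | empty =>
    simp only [Finset.sum_empty]
    exact Lp.coeFn_zero F 2 μ
  | insert a K ha ih =>
    rw [Finset.sum_insert ha]
    filter_upwards [Lp.coeFn_add (f a) (∑ k ∈ K, f k), ih] with x h1 h2
    rw [h1, Pi.add_apply, h2, Finset.sum_insert ha]

theorem coeFn_finset_sum_smul {α F : Type*} [MeasurableSpace α] [NormedAddCommGroup F]
    [NormedSpace ℝ F] {μ : Measure α} (K : Finset ι) (c : ι → ℝ) (f : ι → Lp F 2 μ) :
    ⇑(∑ k ∈ K, c k • f k) =ᵐ[μ] fun x => ∑ k ∈ K, c k • f k x := by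
  have h : ∀ᵐ x ∂μ, ∀ k ∈ K, (c k • f k) x = c k • f k x :=
    (Filter.eventually_all_finset K).2 fun k _ => Lp.coeFn_smul (c k) (f k)
  filter_upwards [coeFn_finset_sum K fun k => c k • f k, h] with x h1 h2
  rw [h1]
  exact Finset.sum_congr rfl h2

theorem sq_enorm_eq_ofReal {F : Type*} [SeminormedAddCommGroup F] (v : F) :
    ‖v‖ₑ ^ 2 = ENNReal.ofReal (‖v‖ ^ 2) := by
  rw [← ofReal_norm, ENNReal.ofReal_pow (norm_nonneg _)]

theorem sq_enorm_piLp {X : Type*} [SeminormedAddCommGroup X] (v : PiLp 2 fun _ : Fin n => X) :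
    ‖v‖ₑ ^ 2 = ∑ i, ‖v i‖ₑ ^ 2 := by
  rw [sq_enorm_eq_ofReal, PiLp.norm_sq_eq_of_L2,
    ENNReal.ofReal_sum_of_nonneg fun _ _ => by positivity]
  simp only [sq_enorm_eq_ofReal]

/-- If the norm on the span of the x_k is a sum of squares of linear forms ξ_a, then the norm of Σ
f_k ⊗ x_k is computed from the scalar combinations Σ_k ξ_{a,k} f_k. Quadratic bounds for linear
operators on fields thus carry over to X-valued sums with the same constant. -/
theorem lintegral_sum_sq_enorm_sum {α X : Type*} [MeasurableSpace α] {μ : Measure α}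
    [SeminormedAddCommGroup X] [NormedSpace ℝ X] (K : Finset ι) (x : ι → X) {m : ℕ}
    {ξ : Fin m → ι → ℝ} (hξ : ∀ c : ι → ℝ, ‖∑ k ∈ K, c k • x k‖ ^ 2
      = ∑ a, (∑ k ∈ K, c k * ξ a k) ^ 2) (f : ι → Lp (E n) 2 μ) :
    ∫⁻ y, ∑ i, ‖∑ k ∈ K, f k y i • x k‖ₑ ^ 2 ∂μ
      = ∑ a, ENNReal.ofReal (‖∑ k ∈ K, ξ a k • f k‖ ^ 2) := by
  simp only [ofReal_norm_sq_eq_lintegral]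
  rw [← lintegral_finsetSum' _ fun a _ =>
    (Lp.aestronglyMeasurable (∑ k ∈ K, ξ a k • f k)).enorm.pow_const 2]
  have h : ∀ᵐ y ∂μ, ∀ a ∈ (Finset.univ : Finset (Fin m)),
      (∑ k ∈ K, ξ a k • f k : Lp (E n) 2 μ) y = ∑ k ∈ K, ξ a k • f k y :=
    (Filter.eventually_all_finset _).2 fun a _ => coeFn_finset_sum_smul K (ξ a) f
  refine lintegral_congr_ae ?_
  filter_upwards [h] with y hy
  have h1 : ∀ i, ‖∑ k ∈ K, f k y i • x k‖ₑ ^ 2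
      = ∑ a, ENNReal.ofReal ((∑ k ∈ K, f k y i * ξ a k) ^ 2) := fun i => by
    rw [sq_enorm_eq_ofReal, hξ, ENNReal.ofReal_sum_of_nonneg fun _ _ => sq_nonneg _]
  simp only [h1]
  rw [Finset.sum_comm]
  refine Finset.sum_congr rfl fun a ha => ?_
  rw [hy a ha, sq_enorm_piLp]
  refine Finset.sum_congr rfl fun i _ => ?_
  rw [sq_enorm_eq_ofReal, Real.norm_eq_abs, sq_abs]
  congr 2
  simp [mul_comm]

/-- The map `a ↦ (a₁ x, …, aₙ x)`. -/
noncomputable def tensorVec (n : ℕ) {X : Type*} [NormedAddCommGroup X] [NormedSpace ℝ X] (x : X) :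
    E n →L[ℝ] PiLp 2 fun _ : Fin n => X :=
  LinearMap.toContinuousLinearMap
    { toFun := fun a => WithLp.toLp 2 fun i => a i • x
      map_add' := fun a b => by ext i; simp [add_smul]
      map_smul' := fun c a => by ext i; simp [mul_smul] }

theorem tensorVec_apply {X : Type*} [NormedAddCommGroup X] [NormedSpace ℝ X] (x : X) (a : E n)
    (i : Fin n) : tensorVec n x a i = a i • x := rfl

theorem coeFn_sum_tensorVec {α X : Type*} [MeasurableSpace α] {μ : Measure α}
    [NormedAddCommGroup X] [NormedSpace ℝ X] (K : Finset ι) (x : ι → X) (f : ι → Lp (E n) 2 μ) :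
    ⇑(∑ k ∈ K, (tensorVec n (x k)).compLp (f k))
      =ᵐ[μ] fun y => WithLp.toLp 2 fun i => ∑ k ∈ K, f k y i • x k := by
  have h : ∀ᵐ y ∂μ, ∀ k ∈ K, (tensorVec n (x k)).compLp (f k) y = tensorVec n (x k) (f k y) :=
    (Filter.eventually_all_finset K).2 fun k _ => ContinuousLinearMap.coeFn_compLp _ _
  filter_upwards [coeFn_finset_sum K fun k => (tensorVec n (x k)).compLp (f k), h] with y h1 h2
  rw [h1, Finset.sum_congr rfl h2]
  ext1 i
  simp [tensorVec_apply]

theorem coeFn_sum_toSpanSingleton {α X : Type*} [MeasurableSpace α] {μ : Measure α}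
    [NormedAddCommGroup X] [NormedSpace ℝ X] (K : Finset ι) (x : ι → X) (f : ι → Lp ℝ 2 μ) :
    ⇑(∑ k ∈ K, (ContinuousLinearMap.toSpanSingleton ℝ (x k)).compLp (f k))
      =ᵐ[μ] fun y => ∑ k ∈ K, f k y • x k := by
  have h : ∀ᵐ y ∂μ, ∀ k ∈ K, (ContinuousLinearMap.toSpanSingleton ℝ (x k)).compLp (f k) y
      = f k y • x k :=
    (Filter.eventually_all_finset K).2 fun k _ => ContinuousLinearMap.coeFn_compLp _ _
  filter_upwards [coeFn_finset_sum K fun k =>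
    (ContinuousLinearMap.toSpanSingleton ℝ (x k)).compLp (f k), h] with y h1 h2
  rw [h1, Finset.sum_congr rfl h2]

variable {Ω V : Set (E n)} {ε : ℝ}

theorem isPerWeakGrad_sum (K : Finset ι) (x : ι → L2 Ω) (w : ι → L2 (cell n))
    (f : ι → L2Vec (cell n))
    (h : ∀ k ∈ K, ∀ (i : Fin n) (ψ : E n → ℝ), ContDiff ℝ ∞ ψ → IsPeriodic ψ →
      ∫ y in cell n, partialDeriv ψ i y * w k y = - ∫ y in cell n, ψ y * f k y i) :
    IsPerWeakGrad Ω (∑ k ∈ K, (ContinuousLinearMap.toSpanSingleton ℝ (x k)).compLp (w k))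
      (∑ k ∈ K, (tensorVec n (x k)).compLp (f k)) := by
  intro i ψ hψ hper
  have e1 : ∫ y in cell n, partialDeriv ψ i y •
        (∑ k ∈ K, (ContinuousLinearMap.toSpanSingleton ℝ (x k)).compLp (w k) : L2Y Ω) y
      = ∑ k ∈ K, (∫ y in cell n, partialDeriv ψ i y * w k y) • x k := by
    have hi : ∀ k ∈ K, Integrable (fun y => (partialDeriv ψ i y * w k y) • x k)
        (volume.restrict (cell n)) := fun k _ =>
      (integrable_smul_cell (continuous_partialDeriv hψ i) (Lp.memLp (w k))).smul_const (x k)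
    rw [integral_congr_ae (g := fun y => ∑ k ∈ K, (partialDeriv ψ i y * w k y) • x k),
      integral_finsetSum _ hi]
    · exact Finset.sum_congr rfl fun k _ => integral_smul_const _ _
    · filter_upwards [coeFn_sum_toSpanSingleton K x w] with y hy
      rw [hy, Finset.smul_sum]
      simp only [mul_smul]
  have e2 : ∫ y in cell n, ψ y • (∑ k ∈ K, (tensorVec n (x k)).compLp (f k) : L2YVec Ω) y i
      = ∑ k ∈ K, (∫ y in cell n, ψ y * f k y i) • x k := by
    have hi : ∀ k ∈ K, Integrable (fun y => (ψ y * f k y i) • x k)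
        (volume.restrict (cell n)) := fun k _ =>
      (integrable_smul_cell hψ.continuous (memLp_coord (f k) i)).smul_const (x k)
    rw [integral_congr_ae (g := fun y => ∑ k ∈ K, (ψ y * f k y i) • x k),
      integral_finsetSum _ hi]
    · exact Finset.sum_congr rfl fun k _ => integral_smul_const _ _
    · filter_upwards [coeFn_sum_tensorVec K x f] with y hy
      rw [hy, PiLp.toLp_apply, Finset.smul_sum]
      simp only [mul_smul]
  rw [e1, e2, ← Finset.sum_neg_distrib]
  exact Finset.sum_congr rfl fun k hk => by rw [h k hk i ψ hψ hper, neg_smul]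

theorem sum_indicator_floorCell {F : Type*} [AddCommMonoid F] (ε : ℝ) (K : Finset (Fin n → ℤ))
    (c : (Fin n → ℤ) → F) (x : E n) [Decidable ((fun i => ⌊(ε⁻¹ • x) i⌋) ∈ K)] :
    ∑ k ∈ K, (floorCell ε k).indicator (fun _ => c k) x
      = if (fun i => ⌊(ε⁻¹ • x) i⌋) ∈ K then c fun i => ⌊(ε⁻¹ • x) i⌋ else 0 := by
  classical
  have hl : ∀ k, x ∈ floorCell ε k ↔ (fun i => ⌊(ε⁻¹ • x) i⌋) = k := fun k => Iff.rfl
  simp only [Set.indicator_apply, hl, Finset.sum_ite_eq]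
  congr

theorem smul_indicator_one (A : Set (E n)) (c : ℝ) (x : E n) :
    c • A.indicator (fun _ => (1 : ℝ)) x = A.indicator (fun _ => c) x := by
  classical
  simp [Set.indicator_apply]

theorem sq_norm_sum_cellInd_le (hε : 0 < ε) (K : Finset (Fin n → ℤ)) (c : (Fin n → ℤ) → ℝ) :
    ‖∑ k ∈ K, c k • cellInd Ω hε k‖ ^ 2 ≤ ε ^ n * ∑ k ∈ K, c k ^ 2 := by
  refine norm_sq_le_of_lintegral_le (by positivity) ?_
  have h1 : ∀ᵐ x ∂volume.restrict Ω, ∀ k ∈ K,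
      cellInd Ω hε k x = (floorCell ε k).indicator (fun _ => 1) x :=
    (Filter.eventually_all_finset K).2 fun k _ => coeFn_cellInd hε k
  have h2 : ∀ x : E n, ‖∑ k ∈ K, c k • (floorCell ε k).indicator (fun _ => (1 : ℝ)) x‖ₑ ^ 2
      ≤ ∑ k ∈ K, (floorCell ε k).indicator (fun _ => ENNReal.ofReal (c k ^ 2)) x := by
    intro x
    classical
    simp only [smul_indicator_one, sum_indicator_floorCell]
    split_ifs
    · rw [sq_enorm_eq_ofReal, Real.norm_eq_abs, sq_abs]
    · simp
  calc _ = ∫⁻ x in Ω, ‖∑ k ∈ K, c k • (floorCell ε k).indicator (fun _ => (1 : ℝ)) x‖ₑ ^ 2 := by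
        refine lintegral_congr_ae ?_
        filter_upwards [h1, coeFn_finset_sum_smul K c fun k => cellInd Ω hε k] with x h1 h2
        rw [h2, Finset.sum_congr rfl fun k hk => by rw [h1 k hk]]
    _ ≤ ∫⁻ x, ∑ k ∈ K, (floorCell ε k).indicator (fun _ => ENNReal.ofReal (c k ^ 2)) x :=
        (lintegral_mono h2).trans (lintegral_mono' Measure.restrict_le_self le_rfl)
    _ = _ := by
        rw [lintegral_finsetSum _ fun k _ =>
          measurable_const.indicator (measurableSet_floorCell ε k)]
        simp only [lintegral_indicator_const (measurableSet_floorCell ε _), volume_floorCell hε]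
        rw [← Finset.sum_mul, ← ENNReal.ofReal_sum_of_nonneg fun _ _ => sq_nonneg _,
          ← ENNReal.ofReal_mul (Finset.sum_nonneg fun _ _ => sq_nonneg _), mul_comm]

theorem unfoldL2_eq_sum (hΩo : IsOpen Ω) (hΩb : Bornology.IsBounded Ω) (hε : 0 < ε) (g : E n → ℝ) (y : E n) :
    unfoldL2 hΩb ε g y = ∑ k ∈ cellIdx hΩb ε, g (cellPt ε k y) • cellInd Ω hε k := by
  refine Lp.ext ?_
  have h1 : ∀ᵐ x ∂volume.restrict Ω, ∀ k ∈ cellIdx hΩb ε,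
      cellInd Ω hε k x = (floorCell ε k).indicator (fun _ => 1) x :=
    (Filter.eventually_all_finset _).2 fun k _ => coeFn_cellInd hε k
  classical
  filter_upwards [h1, (memLp_unfold hΩb ε g y).coeFn_toLp, ae_restrict_mem hΩo.measurableSet,
    coeFn_finset_sum_smul (cellIdx hΩb ε) (fun k => g (cellPt ε k y)) fun k => cellInd Ω hε k]
    with x h1 h2 h3 h4
  rw [h4, Finset.sum_congr rfl fun k hk => by rw [h1 k hk, smul_indicator_one],
    sum_indicator_floorCell, if_pos (mem_cellIdx.2 ⟨x, rfl, h3⟩), unfoldL2, h2, unfold, cellPt,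
    smul_add]
  rfl

/-- Test functions supported in Ω are admissible for both weak gradients, so these agree by the
fundamental lemma of the calculus of variations. -/
theorem h1Grad_ae_eq_of_isExtension (hΩo : IsOpen Ω) (hVm : MeasurableSet V) (hΩV : Ω ⊆ V)
    {φ : H1 Ω} {φ' : H1 V}
    (h : IsExtension φ φ') : h1Grad φ' =ᵐ[volume.restrict Ω] h1Grad φ := by
  have hle : volume.restrict Ω ≤ volume.restrict V := Measure.restrict_mono hΩV le_rfl
  have h1 : ∀ i, ∀ᵐ x ∂volume.restrict Ω, h1Grad φ' x i - h1Grad φ x i = 0 := by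
    intro i
    have hm1 : MemLp (fun x => h1Grad φ' x i) 2 (volume.restrict Ω) :=
      (memLp_coord (h1Grad φ') i).mono_measure hle
    have hm := hm1.sub (memLp_coord (h1Grad φ) i)
    rw [ae_restrict_iff' hΩo.measurableSet]
    refine hΩo.ae_eq_zero_of_integral_contDiff_smul_eq_zero
      ?_ fun ψ hψ hψc hψs => ?_
    · have hl : LocallyIntegrable (fun x => h1Grad φ' x i - h1Grad φ x i) (volume.restrict Ω) :=
        hm.locallyIntegrable (by norm_num)
      exact (locallyIntegrableOn_of_locallyIntegrable_restrict hl)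
    · have hz : ∀ x, x ∉ Ω → ψ x = 0 ∧ partialDeriv ψ i x = 0 := fun x hx => by
        have hx' : x ∉ tsupport ψ := fun h => hx (hψs h)
        refine ⟨image_eq_zero_of_notMem_tsupport hx', ?_⟩
        rw [partialDeriv, image_eq_zero_of_notMem_tsupport fun h => hx' (tsupport_fderiv_subset ℝ h)]
        rfl
      have e1 := φ'.2 i ψ hψ hψc (hψs.trans hΩV)
      have e2 := φ.2 i ψ hψ hψc hψs
      rw [setIntegral_eq_of_subset_of_forall_sdiff_eq_zero hVm hΩV
          (fun x hx => by rw [(hz x hx.2).2, mul_zero]),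
        setIntegral_eq_of_subset_of_forall_sdiff_eq_zero hVm hΩV
          (fun x hx => by rw [(hz x hx.2).1, mul_zero])] at e1
      have e3 : ∫ x in Ω, h1Val φ' x * partialDeriv ψ i x
          = ∫ x in Ω, h1Val φ x * partialDeriv ψ i x :=
        integral_congr_ae (h.mono fun x hx => by simp only [hx])
      have e4 : ∫ x in Ω, h1Grad φ' x i * ψ x = ∫ x in Ω, h1Grad φ x i * ψ x :=
        neg_injective (e1.symm.trans (e3.trans e2))
      rw [← setIntegral_eq_integral_of_forall_compl_eq_zero (s := Ω)
        fun x hx => by rw [(hz x hx).1, zero_smul]]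
      have e5 : ∀ x, ψ x • (h1Grad φ' x i - h1Grad φ x i)
          = h1Grad φ' x i * ψ x - h1Grad φ x i * ψ x := fun x => by
        rw [smul_eq_mul]; ring
      simp only [e5]
      rw [integral_sub (integrable_mul_of_memLp hm1 (memLp_test hψ hψc))
        (integrable_mul_of_memLp (memLp_coord (h1Grad φ) i) (memLp_test hψ hψc)), e4, sub_self]
  filter_upwards [ae_all_iff.2 h1] with x hx
  ext i
  exact sub_eq_zero.1 (hx i)

end TensorSums

/-! ### Bounds for the two parts of the residual -/

section ResidualBounds

open Metric Filter Topology

variable {n : ℕ} {ε s C Γ Λ : ℝ} {Ω V : Set (E n)} {G : E n → E n}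

/-- The Riesz isometry transfers the sum-of-squares form of the norm to the dual. -/
theorem exists_sq_norm_sum_eq_strongDual {X ι : Type*} [NormedAddCommGroup X]
    [InnerProductSpace ℝ X] [CompleteSpace X] (K : Finset ι) (x : ι → StrongDual ℝ X) :
    ∃ (m : ℕ) (ξ : Fin m → ι → ℝ),
      ∀ c : ι → ℝ, ‖∑ k ∈ K, c k • x k‖ ^ 2 = ∑ a, (∑ k ∈ K, c k * ξ a k) ^ 2 := by
  obtain ⟨m, ξ, h⟩ := exists_sq_norm_sum_eq K fun k => (InnerProductSpace.toDual ℝ X).symm (x k)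
  refine ⟨m, ξ, fun c => ?_⟩
  rw [← h c, ← (InnerProductSpace.toDual ℝ X).symm.norm_map, map_sum]
  simp

theorem ofReal_norm_cellField_sq (hε : 0 < ε) (hG : MemLp G 2 volume) (k : Fin n → ℤ) :
    ENNReal.ofReal (ε ^ n * ‖cellField hε hG k‖ ^ 2) = ∫⁻ x in floorCell ε k, ‖G x‖ₑ ^ 2 := by
  rw [ENNReal.ofReal_mul (by positivity), ofReal_norm_sq_eq_lintegral, ← lintegral_cellPt hε]
  congr 1
  exact lintegral_congr_ae ((coeFn_cellField hε hG k).mono fun y hy => by simp only [hy])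

theorem sum_norm_cellField_sq_le (hε : 0 < ε) (hG : MemLp G 2 volume) {S : Set (E n)} (hΓ : 0 ≤ Γ)
    (h : ∫⁻ x in S, ‖G x‖ₑ ^ 2 ≤ ENNReal.ofReal Γ) (J : Finset (Fin n → ℤ)) (q : Fin n → ℤ)
    (hJ : ∀ k ∈ J, floorCell ε (k + q) ⊆ S) :
    ε ^ n * ∑ k ∈ J, ‖cellField hε hG (k + q)‖ ^ 2 ≤ Γ := by
  refine (ENNReal.ofReal_le_ofReal_iff hΓ).1 ?_
  rw [Finset.mul_sum, ENNReal.ofReal_sum_of_nonneg fun _ _ => by positivity]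
  simp only [ofReal_norm_cellField_sq]
  exact (sum_setLIntegral_floorCell_le J q _ hJ).trans h

theorem meanField_cellField_apply (hε : 0 < ε) (hG : MemLp G 2 volume) (k : Fin n → ℤ)
    (i : Fin n) :
    meanField n (cellField hε hG k) i = (ε ^ n)⁻¹ * ∫ x in floorCell ε k, G x i := by
  rw [meanField_eq, eval_integral_piLp fun i => (integrable_l2Vec _).eval_piLp i,
    ← integral_cellPt hε k, smul_eq_mul, inv_mul_cancel_left₀ (by positivity)]
  exact integral_congr_ae ((coeFn_cellField hε hG k).mono fun y hy => by simp only [hy])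

/-- `Γ` and `Λ` bound the square of the `L²` norm of `G`, on `ℝⁿ` and on the boundary layer. -/
structure FieldBounds (Ω : Set (E n)) (ε : ℝ) (G : E n → E n) (Γ Λ : ℝ) : Prop where
  memLp : MemLp G 2 volume
  nonneg : 0 ≤ Γ
  nonneg_layer : 0 ≤ Λ
  le : ∫⁻ x, ‖G x‖ₑ ^ 2 ≤ ENNReal.ofReal Γ
  le_layer : ∫⁻ x in boundaryLayer Ω ε 3, ‖G x‖ₑ ^ 2 ≤ ENNReal.ofReal Λ

open Classical in
theorem FieldBounds.sum_le (hG : FieldBounds Ω ε G Γ Λ) (hε : 0 < ε) (hC : 0 ≤ C)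
    (J : Finset (Fin n → ℤ)) (q : Fin n → ℤ) :
    C * ε ^ n * (ε ^ (2 * s) * (∑ k ∈ J, ‖cellField hε hG.memLp (k + q)‖ ^ 2)
      + ε ^ s * ∑ k ∈ J with k + q ∈ layerIdx Ω ε, ‖cellField hε hG.memLp (k + q)‖ ^ 2)
      ≤ C * (ε ^ (2 * s) * Γ + ε ^ s * Λ) := by
  have h1 := sum_norm_cellField_sq_le hε hG.memLp (S := Set.univ) hG.nonneg
    (by simpa using hG.le) J q fun _ _ => Set.subset_univ _
  have h2 := sum_norm_cellField_sq_le hε hG.memLp hG.nonneg_layer hG.le_layer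
    (J.filter fun k => k + q ∈ layerIdx Ω ε) q fun k hk => (Finset.mem_filter.1 hk).2
  have h3 := mul_le_mul_of_nonneg_left h1 (show 0 ≤ C * ε ^ (2 * s) by positivity)
  have h4 := mul_le_mul_of_nonneg_left h2 (show 0 ≤ C * ε ^ s by positivity)
  linarith

theorem FieldBounds.sum_norm_average_sub_le (hG : FieldBounds Ω ε G Γ Λ)
    (hC : CellEstimates Ω s C) (hΩo : IsOpen Ω) (hΩb : Bornology.IsBounded Ω) (hε : 0 < ε)
    (g : L2Vec Ω) (hg : G =ᵐ[volume.restrict Ω] g) (i : Fin n) :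
    ‖∑ k ∈ cellIdx hΩb ε, meanField n (cellField hε hG.memLp k) i • toHsDual s (cellInd Ω hε k)
        - toHsDual s (comp g i)‖ ^ 2 ≤ C * (ε ^ (2 * s) * Γ + ε ^ s * Λ) := by
  classical
  have hGi : MemLp (fun x => G x i) 2 volume := memLp_piLp_iff.1 hG.memLp i
  have hgi : (fun x => G x i) =ᵐ[volume.restrict Ω] comp g i := by
    filter_upwards [hg, (EuclideanSpace.proj i : E n →L[ℝ] ℝ).coeFn_compLp g] with x h1 h2
    rw [comp, h2, h1]
    rfl
  have h := hC.norm_sum_average_sub_le hΩo hΩb hε hGi (comp g i) hgi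
    (w := fun k => ‖cellField hε hG.memLp k‖ ^ 2) (fun k => sq_nonneg _) fun k => by
      have h1 : ENNReal.ofReal (‖cellField hε hG.memLp k‖ ^ 2)
          = ENNReal.ofReal (ε ^ n)⁻¹ * ∫⁻ x in floorCell ε k, ‖G x‖ₑ ^ 2 := by
        rw [← ofReal_norm_cellField_sq hε hG.memLp, ← ENNReal.ofReal_mul (by positivity),
          inv_mul_cancel_left₀ (by positivity)]
      rw [h1]
      refine mul_le_mul_right (lintegral_mono fun x => pow_le_pow_left' ?_ 2) _
      exact enorm_le_iff_norm_le.2 (PiLp.norm_apply_le (G x) i)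
  simp only [← meanField_cellField_apply hε hG.memLp] at h
  refine h.trans ?_
  simpa using hG.sum_le hε hC.nonneg (cellIdx hΩb ε) 0 (s := s)

-- For almost every y and each component the shift estimate applies with the values at y as
-- coefficients; integration over Y then produces the norms of the cell fields.
set_option maxHeartbeats 800000 in
theorem FieldBounds.lintegral_shift_sub_le (hG : FieldBounds Ω ε G Γ Λ)
    (hC : CellEstimates Ω s C) (hΩo : IsOpen Ω) (hΩb : Bornology.IsBounded Ω) (hε : 0 < ε)
    {q : Fin n → ℤ} (hq : q ∈ Finset.Icc (0 : Fin n → ℤ) 2) :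
    ∫⁻ y in cell n, ∑ i, ‖∑ k ∈ cellIdx hΩb ε,
        (cellField hε hG.memLp (k + q) - cellField hε hG.memLp k) y i
          • toHsDual s (cellInd Ω hε k)‖ₑ ^ 2
      ≤ ENNReal.ofReal (C * (ε ^ (2 * s) * Γ + ε ^ s * Λ)) := by
  classical
  have hC0 := hC.nonneg
  set B := cellField hε hG.memLp with hB
  set J := pairIdx hΩb ε q
  set J' := J.filter fun k => k + q ∈ layerIdx Ω ε
  have hsub : ∀ᵐ y ∂volume.restrict (cell n), ∀ k ∈ cellIdx hΩb ε,
      (B (k + q) - B k) y = B (k + q) y - B k y :=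
    (Filter.eventually_all_finset _).2 fun k _ => Lp.coeFn_sub _ _
  have hsum : ∀ (S : Finset (Fin n → ℤ)) y, ∑ i, ENNReal.ofReal (∑ k ∈ S, B (k + q) y i ^ 2)
      = ∑ k ∈ S, ‖B (k + q) y‖ₑ ^ 2 := by
    intro S y
    simp only [sq_enorm_piLp]
    rw [Finset.sum_comm]
    refine Finset.sum_congr rfl fun i _ => ?_
    rw [ENNReal.ofReal_sum_of_nonneg fun _ _ => sq_nonneg _]
    refine Finset.sum_congr rfl fun k _ => ?_
    rw [sq_enorm_eq_ofReal, Real.norm_eq_abs, sq_abs]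
  have hint : ∀ S : Finset (Fin n → ℤ), ∫⁻ y in cell n, ∑ k ∈ S, ‖B (k + q) y‖ₑ ^ 2
      = ENNReal.ofReal (∑ k ∈ S, ‖B (k + q)‖ ^ 2) := by
    intro S
    rw [lintegral_finsetSum' _ fun k _ => (Lp.aestronglyMeasurable _).enorm.pow_const 2,
      ENNReal.ofReal_sum_of_nonneg fun _ _ => sq_nonneg _]
    simp only [ofReal_norm_sq_eq_lintegral]
  calc _ ≤ ∫⁻ y in cell n, (ENNReal.ofReal (C * ε ^ n * ε ^ (2 * s)) * ∑ k ∈ J, ‖B (k + q) y‖ₑ ^ 2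
        + ENNReal.ofReal (C * ε ^ n * ε ^ s) * ∑ k ∈ J', ‖B (k + q) y‖ₑ ^ 2) := by
        refine lintegral_mono_ae ?_
        filter_upwards [hsub] with y hy
        rw [← hsum, ← hsum, Finset.mul_sum, Finset.mul_sum, ← Finset.sum_add_distrib]
        refine Finset.sum_le_sum fun i _ => ?_
        rw [← ENNReal.ofReal_mul (by positivity), ← ENNReal.ofReal_mul (by positivity),
          ← ENNReal.ofReal_add (by positivity) (by positivity), sq_enorm_eq_ofReal]
        refine ENNReal.ofReal_le_ofReal ?_
        rw [Finset.sum_congr rfl fun k hk => by rw [hy k hk, PiLp.sub_apply]]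
        refine (hC.norm_sum_sub_le hΩo hΩb hε hq fun k => B k y i).trans (le_of_eq ?_)
        ring
    _ = ENNReal.ofReal (C * ε ^ n * (ε ^ (2 * s) * (∑ k ∈ J, ‖B (k + q)‖ ^ 2)
          + ε ^ s * ∑ k ∈ J', ‖B (k + q)‖ ^ 2)) := by
        rw [lintegral_add_left' (AEMeasurable.const_mul (Finset.aemeasurable_fun_sum _ fun k _ =>
            (Lp.aestronglyMeasurable _).enorm.pow_const 2) _),
          lintegral_const_mul' _ _ ENNReal.ofReal_ne_top,
          lintegral_const_mul' _ _ ENNReal.ofReal_ne_top, hint, hint,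
          ← ENNReal.ofReal_mul (by positivity), ← ENNReal.ofReal_mul (by positivity),
          ← ENNReal.ofReal_add (by positivity) (by positivity)]
        congr 1
        ring
    _ ≤ _ := ENNReal.ofReal_le_ofReal (hG.sum_le hε hC.nonneg J q)

/-- For each linear form ξ_a the combination Σ_k ξ_{a,k} B_{k+·} is again a limit of smooth gradient
families, so its defect is controlled by the differences Σ_k ξ_{a,k}(B_{k+q} - B_k). Summing over a
restores the norm of X. Applying the defect bound to each B_k separately would lose the cancellation
in the dual norm. -/
theorem lintegral_defect_le_of_shift {X : Type*} [SeminormedAddCommGroup X] [NormedSpace ℝ X]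
    (K : Finset (Fin n → ℤ)) (x : (Fin n → ℤ) → X) {m : ℕ} {ξ : Fin m → (Fin n → ℤ) → ℝ}
    (hξ : ∀ c : (Fin n → ℤ) → ℝ,
      ‖∑ k ∈ K, c k • x k‖ ^ 2 = ∑ a, (∑ k ∈ K, c k * ξ a k) ^ 2)
    (B : (Fin n → ℤ) → L2Vec (cell n)) {D : NNReal}
    (hD : ∀ B ∈ (smoothFamilies n).topologicalClosure,
      ‖defect n (B (zeroIdx n))‖ ^ 2 ≤ D * ∑ q, ‖B q - B (zeroIdx n)‖ ^ 2)
    (hmem : ∀ k ∈ K, (fun q : CubeIdx n => B (k + (q : Fin n → ℤ)))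
      ∈ (smoothFamilies n).topologicalClosure) {R : ℝ}
    (hR : ∀ q ∈ Finset.Icc (0 : Fin n → ℤ) 2,
      ∫⁻ y in cell n, ∑ i, ‖∑ k ∈ K, (B (k + q) - B k) y i • x k‖ₑ ^ 2 ≤ ENNReal.ofReal R) :
    ∫⁻ y in cell n, ∑ i, ‖∑ k ∈ K, defect n (B k) y i • x k‖ₑ ^ 2
      ≤ ENNReal.ofReal (D * Fintype.card (CubeIdx n) * R) := by
  rw [lintegral_sum_sq_enorm_sum K _ hξ fun k => defect n (B k)]
  have h1 : ∀ a, ‖∑ k ∈ K, ξ a k • defect n (B k)‖ ^ 2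
      ≤ D * ∑ q : CubeIdx n, ‖∑ k ∈ K, ξ a k • (B (k + (q : Fin n → ℤ)) - B k)‖ ^ 2 := by
    intro a
    have h2 := hD _ (Submodule.sum_mem _ fun k hk => Submodule.smul_mem _ (ξ a k) (hmem k hk))
    have h3 : ∀ q : CubeIdx n, (∑ k ∈ K, ξ a k • fun q : CubeIdx n => B (k + (q : Fin n → ℤ))) q
        = ∑ k ∈ K, ξ a k • B (k + (q : Fin n → ℤ)) := fun q => by simp [Finset.sum_apply]
    simp only [h3] at h2
    have h4 : ((zeroIdx n : CubeIdx n) : Fin n → ℤ) = 0 := rfl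
    simp only [h4, add_zero, map_sum, map_smul, ← Finset.sum_sub_distrib, ← smul_sub] at h2
    exact h2
  calc _ ≤ ∑ a, ENNReal.ofReal (D * ∑ q : CubeIdx n,
        ‖∑ k ∈ K, ξ a k • (B (k + (q : Fin n → ℤ)) - B k)‖ ^ 2) :=
        Finset.sum_le_sum fun a _ => ENNReal.ofReal_le_ofReal (h1 a)
    _ = D * ∑ q : CubeIdx n, ∑ a, ENNReal.ofReal
          (‖∑ k ∈ K, ξ a k • (B (k + (q : Fin n → ℤ)) - B k)‖ ^ 2) := by
        rw [Finset.sum_comm, Finset.mul_sum]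
        refine Finset.sum_congr rfl fun a _ => ?_
        rw [ENNReal.ofReal_mul D.coe_nonneg, ENNReal.ofReal_coe_nnreal,
          ENNReal.ofReal_sum_of_nonneg fun _ _ => sq_nonneg _]
    _ ≤ D * ∑ _q : CubeIdx n, ENNReal.ofReal R := by
        refine mul_le_mul_right (Finset.sum_le_sum fun q _ => ?_) _
        rw [← lintegral_sum_sq_enorm_sum K _ hξ fun k => B (k + (q : Fin n → ℤ)) - B k]
        exact hR q q.2
    _ = _ := by
        rw [Finset.sum_const, Finset.card_univ, nsmul_eq_mul, mul_assoc,
          ENNReal.ofReal_mul D.coe_nonneg, ENNReal.ofReal_coe_nnreal,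
          ENNReal.ofReal_mul (Nat.cast_nonneg _), ENNReal.ofReal_natCast]

theorem lintegral_defect_le_of_shift_strongDual {X : Type*} [NormedAddCommGroup X]
    [InnerProductSpace ℝ X] [CompleteSpace X] (K : Finset (Fin n → ℤ))
    (x : (Fin n → ℤ) → StrongDual ℝ X) (B : (Fin n → ℤ) → L2Vec (cell n)) {D : NNReal}
    (hD : ∀ B ∈ (smoothFamilies n).topologicalClosure,
      ‖defect n (B (zeroIdx n))‖ ^ 2 ≤ D * ∑ q, ‖B q - B (zeroIdx n)‖ ^ 2)
    (hmem : ∀ k ∈ K, (fun q : CubeIdx n => B (k + (q : Fin n → ℤ)))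
      ∈ (smoothFamilies n).topologicalClosure) {R : ℝ}
    (hR : ∀ q ∈ Finset.Icc (0 : Fin n → ℤ) 2,
      ∫⁻ y in cell n, ∑ i, ‖∑ k ∈ K, (B (k + q) - B k) y i • x k‖ₑ ^ 2 ≤ ENNReal.ofReal R) :
    ∫⁻ y in cell n, ∑ i, ‖∑ k ∈ K, defect n (B k) y i • x k‖ₑ ^ 2
      ≤ ENNReal.ofReal (D * Fintype.card (CubeIdx n) * R) := by
  obtain ⟨m, ξ, hξ⟩ := exists_sq_norm_sum_eq_strongDual K x
  exact lintegral_defect_le_of_shift K x hξ B hD hmem hR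

theorem FieldBounds.lintegral_defect_le (hG : FieldBounds Ω ε G Γ Λ)
    (hC : CellEstimates Ω s C) (hΩo : IsOpen Ω) (hΩb : Bornology.IsBounded Ω) (hε : 0 < ε)
    {D : NNReal} (hD : ∀ B ∈ (smoothFamilies n).topologicalClosure,
      ‖defect n (B (zeroIdx n))‖ ^ 2 ≤ D * ∑ q, ‖B q - B (zeroIdx n)‖ ^ 2)
    (hmem : ∀ k ∈ cellIdx hΩb ε, (fun q : CubeIdx n => cellField hε hG.memLp (k + (q : Fin n → ℤ)))
      ∈ (smoothFamilies n).topologicalClosure) :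
    ∫⁻ y in cell n, ∑ i, ‖∑ k ∈ cellIdx hΩb ε,
        defect n (cellField hε hG.memLp k) y i • toHsDual s (cellInd Ω hε k)‖ₑ ^ 2
      ≤ ENNReal.ofReal (D * Fintype.card (CubeIdx n) * (C * (ε ^ (2 * s) * Γ + ε ^ s * Λ))) := by
  exact lintegral_defect_le_of_shift_strongDual _ _ _ hD hmem fun q hq =>
    hG.lintegral_shift_sub_le hC hΩo hΩb hε hq

end ResidualBounds

/-! ### The corrector and the decomposition of the residual -/

section UnfoldingEstimate

open Metric Filter Topology

variable {n : ℕ} {ε s : ℝ} {Ω : Set (E n)} {ι : Type*}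

theorem lintegral_sum_sq_enorm {α F : Type*} [MeasurableSpace α] [NormedAddCommGroup F]
    {μ : Measure α} {c : ℝ} (hc : 0 ≤ c) (K : Finset ι) (f : ι → Lp F 2 μ) :
    ∫⁻ y, ENNReal.ofReal c * ∑ k ∈ K, ‖f k y‖ₑ ^ 2 ∂μ
      = ENNReal.ofReal (c * ∑ k ∈ K, ‖f k‖ ^ 2) := by
  rw [lintegral_const_mul' _ _ ENNReal.ofReal_ne_top,
    lintegral_finsetSum' _ fun k _ => (Lp.aestronglyMeasurable _).enorm.pow_const 2,
    ENNReal.ofReal_mul hc, ENNReal.ofReal_sum_of_nonneg fun _ _ => sq_nonneg _]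
  simp only [ofReal_norm_sq_eq_lintegral]

/-- The corrector is Σ w_k ⊗ 1_k, where w_k is a potential of the projection of B_k onto the
periodic gradients. The indicators have disjoint supports of measure at most εⁿ, so squared norms
add up; the constant C² + 1 counts potential and gradient. No s is involved. -/
theorem exists_corrector (n : ℕ) : ∃ C : ℝ, 0 ≤ C ∧ ∀ (Ω : Set (E n)) (ε : ℝ) (hε : 0 < ε)
    (K : Finset (Fin n → ℤ)) (B : (Fin n → ℤ) → L2Vec (cell n)), ∃ v : H1per Ω,
      ‖v‖ ^ 2 ≤ C * (ε ^ n * ∑ k ∈ K, ‖B k‖ ^ 2) ∧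
      ⇑(perGrad v) =ᵐ[volume.restrict (cell n)] fun y => WithLp.toLp 2 fun i =>
        ∑ k ∈ K, (perGradients n).starProjection (B k) y i • cellInd Ω hε k := by
  obtain ⟨C, hC⟩ := exists_potential n
  refine ⟨C ^ 2 + 1, by positivity, fun Ω ε hε K B => ?_⟩
  have hf : ∀ k, (perGradients n).starProjection (B k) ∈ perGradients n := fun k =>
    Submodule.starProjection_apply_mem _ _
  choose w hw hper using fun k => hC _ (hf k)
  set f := fun k => (perGradients n).starProjection (B k) with hfdef
  have hfB : ∀ k, ‖f k‖ ^ 2 ≤ ‖B k‖ ^ 2 := fun k =>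
    pow_le_pow_left₀ (norm_nonneg _) (Submodule.norm_starProjection_apply_le _ _) 2
  have hwB : ∀ k, ‖w k‖ ^ 2 ≤ C ^ 2 * ‖B k‖ ^ 2 := fun k => by
    refine (pow_le_pow_left₀ (norm_nonneg _) (hw k) 2).trans ?_
    rw [mul_pow]
    exact mul_le_mul_of_nonneg_left (hfB k) (by positivity)
  set a : L2Y Ω := ∑ k ∈ K,
    (ContinuousLinearMap.toSpanSingleton ℝ (cellInd Ω hε k)).compLp (w k) with ha
  set b : L2YVec Ω := ∑ k ∈ K, (tensorVec n (cellInd Ω hε k)).compLp (f k) with hb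
  have h1 : ‖a‖ ^ 2 ≤ ε ^ n * ∑ k ∈ K, ‖w k‖ ^ 2 := by
    refine norm_sq_le_of_lintegral_le (by positivity) ?_
    rw [← lintegral_sum_sq_enorm (by positivity)]
    refine lintegral_mono_ae ?_
    filter_upwards [coeFn_sum_toSpanSingleton K (cellInd Ω hε) w] with y hy
    rw [ha, hy, sq_enorm_eq_ofReal]
    refine (ENNReal.ofReal_le_ofReal (sq_norm_sum_cellInd_le hε K fun k => w k y)).trans ?_
    rw [ENNReal.ofReal_mul (by positivity), ENNReal.ofReal_sum_of_nonneg fun _ _ => sq_nonneg _]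
    simp only [sq_enorm_eq_ofReal, Real.norm_eq_abs, sq_abs, le_refl]
  have h2 : ‖b‖ ^ 2 ≤ ε ^ n * ∑ k ∈ K, ‖f k‖ ^ 2 := by
    refine norm_sq_le_of_lintegral_le (by positivity) ?_
    rw [← lintegral_sum_sq_enorm (by positivity)]
    refine lintegral_mono_ae ?_
    filter_upwards [coeFn_sum_tensorVec K (cellInd Ω hε) f] with y hy
    rw [hb, hy, sq_enorm_piLp]
    simp only [sq_enorm_piLp]
    rw [Finset.sum_comm, Finset.mul_sum]
    refine Finset.sum_le_sum fun i _ => ?_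
    rw [sq_enorm_eq_ofReal]
    refine (ENNReal.ofReal_le_ofReal (sq_norm_sum_cellInd_le hε K fun k => f k y i)).trans ?_
    rw [ENNReal.ofReal_mul (by positivity), ENNReal.ofReal_sum_of_nonneg fun _ _ => sq_nonneg _]
    simp only [sq_enorm_eq_ofReal, Real.norm_eq_abs, sq_abs, le_refl]
  refine ⟨⟨WithLp.toLp 2 (a, b), isPerWeakGrad_sum K _ w f fun k _ => hper k⟩, ?_,
    coeFn_sum_tensorVec K (cellInd Ω hε) f⟩
  have h3 : ‖(WithLp.toLp 2 (a, b) : WithLp 2 (L2Y Ω × L2YVec Ω))‖ ^ 2 = ‖a‖ ^ 2 + ‖b‖ ^ 2 :=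
    WithLp.prod_norm_sq_eq_of_L2 _
  refine h3.trans_le ((add_le_add h1 h2).trans ?_)
  rw [← mul_add, mul_left_comm]
  refine mul_le_mul_of_nonneg_left ?_ (by positivity)
  rw [add_mul, one_mul, Finset.mul_sum]
  exact add_le_add (Finset.sum_le_sum fun k _ => hwB k) (Finset.sum_le_sum fun k _ => hfB k)

theorem memLp_and_lintegral_le_of_ae_eq {X : Type*} [NormedAddCommGroup X] [NormedSpace ℝ X]
    (K : Finset ι) (x : ι → X) (f : ι → L2Vec (cell n)) (r : PiLp 2 fun _ : Fin n => X)
    {R : E n → PiLp 2 fun _ : Fin n => X}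
    (hR : ∀ᵐ y ∂volume.restrict (cell n),
      R y = (WithLp.toLp 2 fun i => ∑ k ∈ K, f k y i • x k) + r) {a b : ℝ} (ha0 : 0 ≤ a)
    (hb0 : 0 ≤ b)
    (ha : ∫⁻ y in cell n, ∑ i, ‖∑ k ∈ K, f k y i • x k‖ₑ ^ 2 ≤ ENNReal.ofReal a)
    (hb : ∀ i, ‖r i‖ ^ 2 ≤ b) :
    MemLp R 2 (volume.restrict (cell n)) ∧
      ∫⁻ y in cell n, ‖R y‖ₑ ^ 2 ≤ ENNReal.ofReal (2 * a + 2 * (n * b)) := by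
  set Q : Lp (PiLp 2 fun _ : Fin n => X) 2 (volume.restrict (cell n)) :=
    ∑ k ∈ K, (tensorVec n (x k)).compLp (f k) with hQ
  have h0 : R =ᵐ[volume.restrict (cell n)] fun y => Q y + r := by
    filter_upwards [hR, coeFn_sum_tensorVec K x f] with y h1 h2
    rw [h1, hQ, h2]
  have h1 : ∫⁻ y in cell n, ‖Q y‖ₑ ^ 2 ≤ ENNReal.ofReal a := by
    refine le_trans (le_of_eq (lintegral_congr_ae ?_)) ha
    filter_upwards [coeFn_sum_tensorVec K x f] with y hy
    rw [hQ, hy, sq_enorm_piLp]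
  have h2 : ‖r‖ₑ ^ 2 ≤ ENNReal.ofReal (n * b) := by
    rw [sq_enorm_eq_ofReal, PiLp.norm_sq_eq_of_L2]
    refine ENNReal.ofReal_le_ofReal ((Finset.sum_le_sum fun i _ => hb i).trans (le_of_eq ?_))
    simp
  refine ⟨(((Lp.memLp Q).add (memLp_const r)).ae_eq h0.symm), ?_⟩
  calc _ = ∫⁻ y in cell n, ‖Q y + r‖ₑ ^ 2 :=
        lintegral_congr_ae (h0.mono fun y hy => by simp only [hy])
    _ ≤ _ := lintegral_add_sq_le Q (fun _ => r) (Lp.aestronglyMeasurable Q).enorm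
    _ ≤ 2 * ENNReal.ofReal a + 2 * ENNReal.ofReal (n * b) := by
        refine add_le_add (mul_le_mul_right h1 _) (mul_le_mul_right ?_ _)
        rw [lintegral_const, Measure.restrict_apply_univ, volume_cell, mul_one]
        exact h2
    _ = _ := by
        rw [ENNReal.ofReal_add (by positivity) (by positivity), ENNReal.ofReal_mul (p := 2)
          (by norm_num), ENNReal.ofReal_mul (p := 2) (by norm_num), ENNReal.ofReal_ofNat]

theorem toHsDual_sum_sub_sub (K : Finset ι) (e : ι → L2 Ω) (g : L2 Ω) {c d δ m : ι → ℝ}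
    (h : ∀ k ∈ K, c k = d k + δ k + m k) :
    toHsDual s (∑ k ∈ K, c k • e k - g - ∑ k ∈ K, d k • e k)
      = ∑ k ∈ K, δ k • toHsDual s (e k) + (∑ k ∈ K, m k • toHsDual s (e k) - toHsDual s g) := by
  ext p
  have h1 : ∑ k ∈ K, c k * inner ℝ (e k) (hsVal p) = ∑ k ∈ K, d k * inner ℝ (e k) (hsVal p)
      + ∑ k ∈ K, δ k * inner ℝ (e k) (hsVal p) + ∑ k ∈ K, m k * inner ℝ (e k) (hsVal p) := by
    rw [← Finset.sum_add_distrib, ← Finset.sum_add_distrib]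
    exact Finset.sum_congr rfl fun k hk => by rw [h k hk]; ring
  simp only [toHsDual_apply, inner_sub_left, sum_inner, sum_apply,
    smul_apply, add_apply, sub_apply,
    real_inner_smul_left, smul_eq_mul, h1]
  ring

theorem boundaryLayer_subset_outerNbhd (hΩ : (frontier Ω).Nonempty) :
    boundaryLayer Ω ε 3 ⊆ outerNbhd Ω ε 3 := by
  intro x hx
  have h : infDist x Ω ≤ infDist x (frontier Ω) := by
    rw [← infDist_closure]
    exact infDist_le_infDist_of_subset frontier_subset_closure hΩ
  exact h.trans_lt hx

/-- On every cell meeting Ω the unfolded gradient is projection + defect + mean; the corrector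
cancels the projections, and the remainder that does not depend on y compares cell averages with ∇φ.
-/
theorem residual_ae_eq (hn : 1 ≤ n) (hΩo : IsOpen Ω) (hΩb : Bornology.IsBounded Ω) (hε : 0 < ε)
    (φ : H1 Ω) (φ' : H1 (outerNbhd Ω ε 3)) {G : E n → E n} (hG : MemLp G 2 volume)
    (hGφ : ∀ x ∈ outerNbhd Ω ε 3, G x = h1Grad φ' x) {v : H1per Ω}
    (hv : ⇑(perGrad v) =ᵐ[volume.restrict (cell n)] fun y => WithLp.toLp 2 fun i =>
      ∑ k ∈ cellIdx hΩb ε, (perGradients n).starProjection (cellField hε hG k) y i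
        • cellInd Ω hε k) :
    ∀ᵐ y ∂volume.restrict (cell n), residual hΩb s ε φ φ' v y
      = (WithLp.toLp 2 fun i => ∑ k ∈ cellIdx hΩb ε, defect n (cellField hε hG k) y i
          • toHsDual s (cellInd Ω hε k))
        + WithLp.toLp 2 fun i => ∑ k ∈ cellIdx hΩb ε, meanField n (cellField hε hG k) i
            • toHsDual s (cellInd Ω hε k) - toHsDual s (comp (h1Grad φ) i) := by
  have h1 : ∀ᵐ y ∂volume.restrict (cell n), ∀ k ∈ cellIdx hΩb ε,
      h1Grad φ' (cellPt ε k y) = (perGradients n).starProjection (cellField hε hG k) y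
        + defect n (cellField hε hG k) y + meanField n (cellField hε hG k) := by
    refine (Filter.eventually_all_finset _).2 fun k hk => ?_
    set b := cellField hε hG k with hb
    have h2 : ∀ᵐ y ∂volume.restrict (cell n), cellPt ε k y ∈ floorCell ε k :=
      (quasiMeasurePreserving_cellPt hε k).ae (ae_restrict_mem (measurableSet_floorCell ε k))
    have h3 : floorCell ε k ⊆ outerNbhd Ω ε 3 :=
      ((subset_cellBox hε k).trans (cellBox_subset_closedCellBox ε k)).trans
        (closedCellBox_subset_outerNbhd hn hΩo hε (mem_cellIdx.1 hk))
    have h4 := decomposition b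
    filter_upwards [h2, coeFn_cellField hε hG k, Lp.coeFn_add ((perGradients n).starProjection b
      + defect n b) (constField n (meanField n b)), Lp.coeFn_add
      ((perGradients n).starProjection b) (defect n b), coeFn_constField (meanField n b)]
      with y e1 e2 e3 e4 e5
    rw [← h4] at e3
    rw [← hGφ _ (h3 e1), ← e2, ← hb, e3, Pi.add_apply, e4, Pi.add_apply, e5]
  filter_upwards [h1, hv] with y h1 hv
  ext1 i
  rw [residual, PiLp.toLp_apply, hv, unfoldL2_eq_sum hΩo hΩb hε]
  exact toHsDual_sum_sub_sub _ _ _ fun k hk => by rw [h1 k hk]; rfl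

end UnfoldingEstimate

/-! ### The unfolding estimate -/

section Conclusion

open Metric Filter Topology

variable {n : ℕ} {ε s : ℝ} {Ω : Set (E n)}

theorem fieldBounds_indicator (hn : 1 ≤ n) (hΩne : Ω.Nonempty)
    (hΩb : Bornology.IsBounded Ω) (φ' : H1 (outerNbhd Ω ε 3)) :
    FieldBounds Ω ε ((outerNbhd Ω ε 3).indicator (h1Grad φ')) (‖h1Grad φ'‖ ^ 2)
      (l2NormOn (boundaryLayer Ω ε 3) (h1Grad φ') ^ 2) := by
  have hVm : MeasurableSet (outerNbhd Ω ε 3) := (isOpen_infDist_lt Ω _).measurableSet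
  have hLV : boundaryLayer Ω ε 3 ⊆ outerNbhd Ω ε 3 :=
    boundaryLayer_subset_outerNbhd (frontier_nonempty hn hΩne hΩb)
  have h1 : ∀ x, ‖(outerNbhd Ω ε 3).indicator (h1Grad φ') x‖ₑ ^ 2
      = (outerNbhd Ω ε 3).indicator (fun x => ‖h1Grad φ' x‖ₑ ^ 2) x := fun x => by
    by_cases hx : x ∈ outerNbhd Ω ε 3 <;> simp [hx]
  have hm : MemLp (h1Grad φ') 2 (volume.restrict (boundaryLayer Ω ε 3)) :=
    (Lp.memLp (h1Grad φ')).mono_measure (Measure.restrict_mono hLV le_rfl)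
  refine ⟨(memLp_indicator_iff_restrict hVm).2 (Lp.memLp _), sq_nonneg _, sq_nonneg _, ?_, ?_⟩
  · simp only [h1]
    rw [lintegral_indicator hVm, ofReal_norm_sq_eq_lintegral]
  · simp only [h1]
    rw [setLIntegral_indicator hVm, Set.inter_eq_right.2 hLV, l2NormOn,
      ENNReal.ofReal_pow ENNReal.toReal_nonneg, ENNReal.ofReal_toReal hm.2.ne, sq_eLpNorm_two]

theorem sqrt_mul_add_le {M a b x y : ℝ} (hM : 0 ≤ M) (ha : 0 ≤ a) (hb : 0 ≤ b) (hx : 0 ≤ x)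
    (hy : 0 ≤ y) : M * (a ^ 2 * x ^ 2 + b ^ 2 * y ^ 2) ≤ (√M * (a * x + b * y)) ^ 2 := by
  rw [mul_pow, Real.sq_sqrt hM]
  refine mul_le_mul_of_nonneg_left ?_ hM
  have : 0 ≤ a * x * (b * y) := by positivity
  nlinarith

theorem eLpNorm_two_le_of_lintegral_le {α F : Type*} [MeasurableSpace α] {μ : Measure α}
    [SeminormedAddCommGroup F] {R : α → F} (hε : 0 < ε) {A d m a b l C₀ : ℝ} (hA : 0 ≤ A)
    (hd : 0 ≤ d) (hm : 0 ≤ m) (ha : 0 ≤ a) (hb : 0 ≤ b) (hl : 0 ≤ l) (hab : a ≤ C₀ * b)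
    (h : ∫⁻ y, ‖R y‖ₑ ^ 2 ∂μ ≤ ENNReal.ofReal (2 * (d * (A * (ε ^ (2 * s) * a ^ 2 + ε ^ s * l ^ 2)))
      + 2 * (m * (A * (ε ^ (2 * s) * a ^ 2 + ε ^ s * l ^ 2))))) :
    eLpNorm R 2 μ ≤ ENNReal.ofReal
      (√(2 * (d * A) + 2 * (m * A)) * (|C₀| + 1) * ε ^ s * b
        + √(2 * (d * A) + 2 * (m * A)) * (|C₀| + 1) * ε ^ (s / 2) * l) := by
  refine eLpNorm_two_le_iff.2 (h.trans ?_)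
  rw [← ENNReal.ofReal_pow (by positivity)]
  refine ENNReal.ofReal_le_ofReal ?_
  have e1 : ε ^ (2 * s) = (ε ^ s) ^ 2 := by
    rw [← Real.rpow_natCast, ← Real.rpow_mul hε.le, Nat.cast_ofNat, mul_comm]
  have e2 : ε ^ s = (ε ^ (s / 2)) ^ 2 := by
    rw [← Real.rpow_natCast, ← Real.rpow_mul hε.le, Nat.cast_ofNat, div_mul_cancel₀ _ two_ne_zero]
  have e3 : a ≤ (|C₀| + 1) * b :=
    hab.trans (mul_le_mul_of_nonneg_right (by linarith [le_abs_self C₀]) hb)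
  have e4 : l ≤ (|C₀| + 1) * l := le_mul_of_one_le_left hl (by linarith [abs_nonneg C₀])
  calc _ = (2 * (d * A) + 2 * (m * A)) * ((ε ^ s) ^ 2 * a ^ 2 + (ε ^ (s / 2)) ^ 2 * l ^ 2) := by
        rw [← e1, ← e2]
        ring
    _ ≤ (√(2 * (d * A) + 2 * (m * A)) * (ε ^ s * a + ε ^ (s / 2) * l)) ^ 2 :=
        sqrt_mul_add_le (by positivity) (by positivity) (by positivity) ha hl
    _ ≤ (√(2 * (d * A) + 2 * (m * A)) * (ε ^ s * ((|C₀| + 1) * b)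
          + ε ^ (s / 2) * ((|C₀| + 1) * l))) ^ 2 := by
        gcongr
    _ = _ := by ring

theorem memLp_and_lintegral_le_of_ae_eq_strongDual {X ι : Type*} [NormedAddCommGroup X]
    [NormedSpace ℝ X] (K : Finset ι) (x : ι → StrongDual ℝ X) (f : ι → L2Vec (cell n))
    (r : PiLp 2 fun _ : Fin n => StrongDual ℝ X) {R : E n → PiLp 2 fun _ : Fin n => StrongDual ℝ X}
    (hR : ∀ᵐ y ∂volume.restrict (cell n),
      R y = (WithLp.toLp 2 fun i => ∑ k ∈ K, f k y i • x k) + r) {a b : ℝ} (ha0 : 0 ≤ a)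
    (hb0 : 0 ≤ b)
    (ha : ∫⁻ y in cell n, ∑ i, ‖∑ k ∈ K, f k y i • x k‖ₑ ^ 2 ≤ ENNReal.ofReal a)
    (hb : ∀ i, ‖r i‖ ^ 2 ≤ b) :
    MemLp R 2 (volume.restrict (cell n)) ∧
      ∫⁻ y in cell n, ‖R y‖ₑ ^ 2 ≤ ENNReal.ofReal (2 * a + 2 * (n * b)) :=
  memLp_and_lintegral_le_of_ae_eq K x f r hR ha0 hb0 ha hb

theorem FieldBounds.memLp_residual_and_le {G : E n → E n} {Γ Λ C : ℝ}
    (hG : FieldBounds Ω ε G Γ Λ) (hC : CellEstimates Ω s C) (hn : 1 ≤ n) (hΩo : IsOpen Ω)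
    (hΩb : Bornology.IsBounded Ω) (hε : 0 < ε) (φ : H1 Ω) (φ' : H1 (outerNbhd Ω ε 3))
    (hGφ : ∀ x ∈ outerNbhd Ω ε 3, G x = h1Grad φ' x) (hGg : G =ᵐ[volume.restrict Ω] h1Grad φ)
    {D : NNReal} (hD : ∀ B ∈ (smoothFamilies n).topologicalClosure,
      ‖defect n (B (zeroIdx n))‖ ^ 2 ≤ D * ∑ q, ‖B q - B (zeroIdx n)‖ ^ 2)
    (hmem : ∀ k ∈ cellIdx hΩb ε, (fun q : CubeIdx n => cellField hε hG.memLp (k + (q : Fin n → ℤ)))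
      ∈ (smoothFamilies n).topologicalClosure) {v : H1per Ω}
    (hv : ⇑(perGrad v) =ᵐ[volume.restrict (cell n)] fun y => WithLp.toLp 2 fun i =>
      ∑ k ∈ cellIdx hΩb ε, (perGradients n).starProjection (cellField hε hG.memLp k) y i
        • cellInd Ω hε k) :
    MemLp (residual hΩb s ε φ φ' v) 2 (volume.restrict (cell n)) ∧
      ∫⁻ y in cell n, ‖residual hΩb s ε φ φ' v y‖ₑ ^ 2
        ≤ ENNReal.ofReal (2 * (D * Fintype.card (CubeIdx n) * (C * (ε ^ (2 * s) * Γ + ε ^ s * Λ)))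
          + 2 * (n * (C * (ε ^ (2 * s) * Γ + ε ^ s * Λ)))) := by
  have h0 := hC.nonneg
  have h1 := hG.nonneg
  have h2 := hG.nonneg_layer
  exact memLp_and_lintegral_le_of_ae_eq_strongDual (X := Hs s Ω) _ _ _ _
    (residual_ae_eq (s := s) hn hΩo hΩb hε φ φ' hG.memLp hGφ hv) (by positivity) (by positivity)
    (hG.lintegral_defect_le hC hΩo hΩb hε hD hmem)
    fun i => hG.sum_norm_average_sub_le hC hΩo hΩb hε (h1Grad φ) hGg i

-- The gradient of the extension, continued by zero outside the neighbourhood, is an L² field on ℝⁿ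
-- to which the cell estimates apply. The squared bounds ε^{2s}Γ + ε^sΛ become ε^s and ε^{s/2} after
-- taking roots.
set_option maxHeartbeats 1000000 in
theorem exists_unfolding_corrector (hn : 1 ≤ n) (hΩo : IsOpen Ω) (hΩc : IsConnected Ω)
    (hΩb : Bornology.IsBounded Ω) (hΩl : HasLipschitzBoundary Ω) (C₀ : ℝ) :
    ∃ (C₁ : ℝ) (C : ℝ → ℝ), ∀ ε > (0 : ℝ), ∀ φ : H1 Ω, ∀ φ' : H1 (outerNbhd Ω ε 3),
      IsExtension φ φ' → ‖h1Grad φ'‖ ≤ C₀ * ‖h1Grad φ‖ →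
      ∃ v : H1per Ω, ‖v‖ ≤ C₁ * ‖h1Grad φ‖ ∧ ∀ s ∈ Set.Ioo (0 : ℝ) 1,
        MemLp (residual hΩb s ε φ φ' v) 2 (volume.restrict (cell n)) ∧
        eLpNorm (residual hΩb s ε φ φ' v) 2 (volume.restrict (cell n))
          ≤ ENNReal.ofReal (C s * ε ^ s * ‖h1Grad φ‖
              + C s * ε ^ (s / 2) * l2NormOn (boundaryLayer Ω ε 3) (h1Grad φ')) := by
  obtain ⟨P, hP0, hP⟩ := exists_corrector n
  obtain ⟨D, hD⟩ := exists_norm_defect_le n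
  -- A dummy value outside ]0,1[ allows the constants to be chosen as a function of s before ε and
  -- φ.
  have hA : ∀ s, ∃ A, s ∈ Set.Ioo (0 : ℝ) 1 → CellEstimates Ω s A := fun s => by
    by_cases hs : s ∈ Set.Ioo (0 : ℝ) 1
    · obtain ⟨A, hA⟩ := exists_cellEstimates hn hΩo hΩc hΩb hΩl hs
      exact ⟨A, fun _ => hA⟩
    · exact ⟨0, fun h => absurd h hs⟩
  choose A hA using hA
  let M : ℝ → ℝ := fun s => 2 * (D * Fintype.card (CubeIdx n) * A s) + 2 * (n * A s)
  -- The first constant passes from the norm of ∇φ' to that of ∇φ. In the second, |C₀| + 1 is at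
  -- least C₀ for the global term and at least 1 for the layer term.
  refine ⟨√P * C₀, fun s => √(M s) * (|C₀| + 1), fun ε hε φ φ' hext hnorm => ?_⟩
  have hVo : IsOpen (outerNbhd Ω ε 3) := isOpen_infDist_lt Ω _
  have hG := fieldBounds_indicator hn hΩc.nonempty hΩb φ'
  set G := (outerNbhd Ω ε 3).indicator (h1Grad φ') with hGdef
  have hGφ : ∀ x ∈ outerNbhd Ω ε 3, G x = h1Grad φ' x := fun x hx => Set.indicator_of_mem hx _
  have hΩV : Ω ⊆ outerNbhd Ω ε 3 := fun x hx => by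
    change infDist x Ω < _
    rw [infDist_zero_of_mem hx]
    have : (0 : ℝ) < √n := Real.sqrt_pos.2 (by exact_mod_cast hn)
    positivity
  have hGg : G =ᵐ[volume.restrict Ω] h1Grad φ := by
    filter_upwards [h1Grad_ae_eq_of_isExtension hΩo hVo.measurableSet hΩV hext,
      ae_restrict_mem hΩo.measurableSet] with x h1 h2
    rw [hGφ x (hΩV h2), h1]
  have hmem : ∀ k ∈ cellIdx hΩb ε,
      (fun q : CubeIdx n => cellField hε hG.memLp (k + (q : Fin n → ℤ)))
        ∈ (smoothFamilies n).topologicalClosure := fun k hk =>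
    cellField_mem_closure hε hVo (isBounded_infDist_lt hΩb hΩc.nonempty _) φ' hG.memLp hGφ
      (closedCellBox_subset_outerNbhd hn hΩo hε (mem_cellIdx.1 hk))
  obtain ⟨v, hv1, hv2⟩ := hP Ω ε hε (cellIdx hΩb ε) (cellField hε hG.memLp)
  refine ⟨v, ?_, fun s hs => ?_⟩
  · have h1 : ε ^ n * ∑ k ∈ cellIdx hΩb ε, ‖cellField hε hG.memLp k‖ ^ 2 ≤ ‖h1Grad φ'‖ ^ 2 := by
      simpa using sum_norm_cellField_sq_le hε hG.memLp (S := Set.univ) (sq_nonneg _)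
        (by simpa using hG.le) (cellIdx hΩb ε) 0 fun _ _ => Set.subset_univ _
    have h2 : 0 ≤ C₀ * ‖h1Grad φ‖ := (norm_nonneg _).trans hnorm
    rw [mul_assoc]
    refine (abs_le_of_sq_le_sq' ?_ (by positivity)).2
    rw [mul_pow, Real.sq_sqrt hP0]
    exact hv1.trans (mul_le_mul_of_nonneg_left
      (h1.trans (pow_le_pow_left₀ (norm_nonneg _) hnorm 2)) hP0)
  · have hC := hA s hs
    have hA0 := hC.nonneg
    have hr := hG.memLp_residual_and_le hC hn hΩo hΩb hε φ φ' hGφ hGg hD hmem hv2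
    exact ⟨hr.1, eLpNorm_two_le_of_lintegral_le hε hA0 (by positivity) (Nat.cast_nonneg n)
      (norm_nonneg _) (norm_nonneg _) ENNReal.toReal_nonneg hnorm hr.2⟩

end Conclusion

end Unfolding

theorem theorem2p6 (n : ℕ) (hn : 1 ≤ n) (Ω : Set (Unfolding.E n)) (hΩo : IsOpen Ω)
    (hΩc : IsConnected Ω) (hΩb : Bornology.IsBounded Ω)
    (hΩl : Unfolding.HasLipschitzBoundary Ω) :
    (∃ C₀ : ℝ, ∃ ε₀ > (0 : ℝ), ∀ ε > (0 : ℝ),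
      ∃ P : Unfolding.H1 Ω →L[ℝ] Unfolding.H1 (Unfolding.outerNbhd Ω ε 3),
        ∀ φ : Unfolding.H1 Ω,
          Unfolding.IsExtension φ (P φ) ∧
          ‖Unfolding.h1Grad (P φ)‖ ≤ C₀ * ‖Unfolding.h1Grad φ‖ ∧
          (ε ≤ ε₀ →
            Unfolding.l2NormOn (Unfolding.outerNbhd Ω ε 3 \ Ω) (Unfolding.h1Grad (P φ))
                ≤ C₀ * Unfolding.l2NormOn (Ω ∩ Unfolding.boundaryLayer Ω ε 3) (Unfolding.h1Grad φ) ∧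
            ‖Unfolding.h1Val (P φ)‖ ≤ C₀ * (‖Unfolding.h1Val φ‖
                + ε * Unfolding.l2NormOn (Ω ∩ Unfolding.boundaryLayer Ω ε 3) (Unfolding.h1Grad φ)))) ∧
    (∀ C₀ : ℝ, ∃ (C₁ : ℝ) (C : ℝ → ℝ), ∀ ε > (0 : ℝ), ∀ φ : Unfolding.H1 Ω,
      ∀ φ' : Unfolding.H1 (Unfolding.outerNbhd Ω ε 3),
        Unfolding.IsExtension φ φ' → ‖Unfolding.h1Grad φ'‖ ≤ C₀ * ‖Unfolding.h1Grad φ‖ →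
        ∃ v : Unfolding.H1per Ω,
          ‖v‖ ≤ C₁ * ‖Unfolding.h1Grad φ‖ ∧
          ∀ s ∈ Set.Ioo (0 : ℝ) 1,
            MemLp (Unfolding.residual hΩb s ε φ φ' v) 2 (volume.restrict (Unfolding.cell n)) ∧
            eLpNorm (Unfolding.residual hΩb s ε φ φ' v) 2 (volume.restrict (Unfolding.cell n))
              ≤ ENNReal.ofReal (C s * ε ^ s * ‖Unfolding.h1Grad φ‖
                  + C s * ε ^ (s / 2)
                    * Unfolding.l2NormOn (Unfolding.boundaryLayer Ω ε 3) (Unfolding.h1Grad φ'))) := by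
  exact ⟨Unfolding.exists_extension hn hΩo hΩc hΩb hΩl,
    fun C₀ => Unfolding.exists_unfolding_corrector hn hΩo hΩc hΩb hΩl C₀⟩
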